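/- **Setting.** Let $n\ge 0$, $\Bbbk=\mathbb C(q)$, $z=q-q^{-1}$. Everything is $\mathbb Z/2$-graded ("super") with the usual signs: $(x\otimes y)(x'\otimes y')=(-1)^{\bar y\bar x'}xx'\otimes yy'$, $(f\otimes g)(m\otimes m')=(-1)^{\bar g\bar m}f(m)\otimes g(m')$, $\mathrm{flip}(m\otimes m')=(-1)^{\bar m\bar m'}m'\otimes m$. Let $I=\{\pm1,\dots,\pm n\}$, ordered as integers, $p(i)=0$ if $i>0$ and $p(i)=1$ if $i<0$, $p(i,j)=p(i)+p(j)$, $\varphi(i,j)=\delta_{|i|,|j|}\operatorname{sgn}(j)$. Let $V$ be the superspace with basis $v_i$ ($i\in I$) of parity $p(i)$, $E_{ij}v_k=\delta_{jk}v_i$, $Jv_i=(-1)^{p(i)}v_{-i}$, and $$\Theta=\sum_{i,j}q^{\varphi(i,j)}E_{ii}\otimes E_{jj}+z\sum_{i<j}(-1)^{p(i)}(E_{ji}+E_{-j,-i})\otimes E_{ij}=\sum_{i,j}\Theta_{ij}\otimes E_{ij}.$$ $U_q=U_q(\mathfrak q_n)$ is the superalgebra generated by $u_{ij}$ ($i\le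 j$) of parity $p(i,j)$, with relations $u_{ii}u_{-i,-i}=1$ and $L^{12}L^{13}\Theta^{23}=\Theta^{23}L^{13}L^{12}$, where $L=\sum_{i\le j}u_{ij}\otimes E_{ij}$. It is a Hopf superalgebra with $\Delta(u_{ij})=\sum_k(-1)^{p(i,k)p(k,j)}u_{ik}\otimes u_{kj}$, $\varepsilon(u_{ij})=\delta_{ij}$, and antipode $S$ given by $\sum_{i\le j}S(u_{ij})\otimes E_{ij}=L^{-1}$. A homomorphism $f:M\to N$ of $U_q$-supermodules of parity $\bar f$ is a linear map of parity $\bar f$ with $f(xm)=(-1)^{\bar f\bar x}xf(m)$; let $U_q\text{-smod}$ be the resulting supercategory, monoidal through $\Delta$ and $\varepsilon$. The algebra $U_q$ acts on $V$ by $u_{ij}\mapsto\Theta_{ij}$ and on $V^*=\operatorname{Hom}_\Bbbk(V,\Bbbk)$ by $(xf)(v)=(-1)^{\bar x\bar f}f(S(x)v)$. Let $E_{ij}^*:V^*\to V^*$, $f\mapsto(-1)^{p(i,j)\bar f}f\circ E_{ij}$, let $\mathrm{ev}:V^*\otimes V\to\Bbbk$, $f\otimes v\mapsto f(v)$, and let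 $T=\mathrm{flip}\circ\Theta:V\otimes V\to V\otimes V$. For $M\in U_q\text{-smod}$ put $$T_{MV}=\mathrm{flip}\circ L:M\otimes V\to V\otimes M .$$ $\mathcal Q(z)$ is the strict monoidal supercategory generated by objects $\uparrow,\downarrow$, even morphisms $x,y:\uparrow\uparrow\to\uparrow\uparrow$ (positive and negative crossings), $r:\uparrow\downarrow\to\downarrow\uparrow$ (negative right crossing), $d:\downarrow\uparrow\to\mathbb 1$ (left cap), $c:\mathbb 1\to\uparrow\downarrow$ (left cup), and an odd morphism $t:\uparrow\to\uparrow$ (Clifford token). With $l=(d\otimes1_{\uparrow\downarrow})(1_\downarrow\otimes x\otimes1_\downarrow)(1_{\downarrow\uparrow}\otimes c)$, right cap $d'=dr$ and right cup $c'=rc$, the relations are: $xy=yx=1$; $lr=1$, $rl=1$; $(x\otimes1)(1\otimes x)(x\otimes1)=(1\otimes x)(x\otimes1)(1\otimes x)$; $x-y=z$; $t^2=-1$; $x(t\otimes1)=(1\otimes t)x$; $d'(t\otimes1)c=0$; $d'c=0$; $(1_\uparrow\otimes d)(c\otimes1_\uparrow)=1_\uparrow$; $(d\otimes1_\downarrow)(1_\downarrow\otimes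 c)=1_\downarrow$. The chirally braided supercategory $\mathcal W(z)$ is obtained from $\mathcal Q(z)$ by adjoining an object $\bullet$ (the red strand) and even morphisms $a:\bullet\uparrow\to\uparrow\bullet$, $b:\uparrow\bullet\to\bullet\uparrow$ such that, with $$a'=(1_{\downarrow\bullet}\otimes d')(1_\downarrow\otimes b\otimes1_\downarrow)(c'\otimes1_{\bullet\downarrow}):\bullet\downarrow\to\downarrow\bullet,\qquad b'=(d\otimes1_{\bullet\downarrow})(1_\downarrow\otimes a\otimes1_\downarrow)(1_{\downarrow\bullet}\otimes c):\downarrow\bullet\to\bullet\downarrow,$$ one has $ba=1$, $ab=1$, $b'a'=1$, $a'b'=1$ and $(x\otimes1_\bullet)(1_\uparrow\otimes a)(a\otimes1_\uparrow)=(1_\uparrow\otimes a)(a\otimes1_\uparrow)(1_\bullet\otimes x)$. Let $\mathcal W_1(z)$ be the full sub-supercategory of $\mathcal W(z)$ on the words in $\uparrow,\downarrow,\bullet$ with exactly one $\bullet$. Let $\mathcal{SE}nd(\mathcal C)$ be the supercategory of superfunctors $\mathcal C\to\mathcal C$ and supernatural transformations (those of parity $p$ being the families $\alpha_X$ of morphisms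 of parity $p$ with $G(f)\alpha_X=(-1)^{p\bar f}\alpha_YF(f)$ for all homogeneous $f:X\to Y$). Monoidal superfunctors to $U_q\text{-smod}$ send words to the tensor products of the images of their letters, with the canonical associativity and unit isomorphisms as structure maps. **Theorem.** 1. For every $U_q$-supermodule $M$, the map $T_{MV}$ is an (even) isomorphism of $U_q$-supermodules. For all homogeneous $f\in\operatorname{Hom}_{U_q}(M,N)$ one has $T_{NV}\circ(f\otimes1_V)=(1_V\otimes f)\circ T_{MV}$. 2. There is a unique monoidal superfunctor $\mathbf F_n:\mathcal Q(z)\to U_q\text{-smod}$ with $\mathbf F_n(\uparrow)=V$, $\mathbf F_n(\downarrow)=V^*$, $\mathbf F_n(x)=T$, $\mathbf F_n(d)=\mathrm{ev}$, $\mathbf F_n(t)=J$. For each $U_q$-supermodule $M$ it extends to a unique monoidal superfunctor $\mathbf F_n^M:\mathcal W(z)\to U_q\text{-smod}$ with $\mathbf F_n^M(\bullet)=M$ and $\mathbf F_n^M(a)=T_{MV}$. Furthermore $\mathbf F_n^M(b)=T_{MV}^{-1}$, the antipode $S$ is bijective, and $$\mathbf F_n^M(a')=\mathrm{flip}\circ\Big(\sum_{i\le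 j}S^{-1}(u_{ij})\otimes E_{ij}^*\Big),\qquad \mathbf F_n^M(b')=\Big(\sum_{i\le j}u_{ij}\otimes E_{ij}^*\Big)\circ\mathrm{flip}.$$ 3. There is a unique superfunctor $\mathcal W_1(z)\to\mathcal{SE}nd(U_q\text{-smod})$ which sends an object $X$ to the superfunctor $M\mapsto\mathbf F_n^M(X)$ (acting on morphisms by $g\mapsto1\otimes g\otimes1$, with $g$ in the position of the red letter $\bullet$) and a morphism $f:X\to Y$ to the supernatural transformation with $M$-component $\mathbf F_n^M(f)$. -/

import Mathlib

noncomputable section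

open scoped TensorProduct

namespace Isomeric

universe u v u' v'

/-- The sign `(-1)^p` for `p ∈ ℤ/2`. -/
def sg (p : ZMod 2) : ℤ := if p = 0 then 1 else -1

lemma sg_zero : sg 0 = 1 := rfl
lemma sg_one : sg 1 = -1 := rfl
lemma sg_add (p r : ZMod 2) : sg (p + r) = sg p * sg r := by revert p r; decide
lemma sg_mul_self (p : ZMod 2) : sg p * sg p = 1 := by revert p; decide

/-! ### Supercategories -/

/-- A supercategory over `k`: a category enriched in `k`-supermodules.  The morphism superspace from
`X` to `Y` is `Hom 0 X Y ⊕ Hom 1 X Y`, given through its even and odd parts; composition is bilinear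
and additive on parities.  The parity of a composite is recorded as any `s` with a proof that it is
the sum of the parities. -/
structure SuperCat (k : Type*) [CommRing k] where
  Obj : Type u
  Hom : ZMod 2 → Obj → Obj → Type v
  [grp : ∀ p X Y, AddCommGroup (Hom p X Y)]
  [mod : ∀ p X Y, Module k (Hom p X Y)]
  id : ∀ X, Hom 0 X X
  comp : ∀ {p r s : ZMod 2} {X Y Z : Obj}, p + r = s → Hom p Y Z → Hom r X Y → Hom s X Z
  add_comp : ∀ {p r s : ZMod 2} {X Y Z : Obj} (h : p + r = s) (f f' : Hom p Y Z) (g : Hom r X Y),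
    comp h (f + f') g = comp h f g + comp h f' g
  comp_add : ∀ {p r s : ZMod 2} {X Y Z : Obj} (h : p + r = s) (f : Hom p Y Z) (g g' : Hom r X Y),
    comp h f (g + g') = comp h f g + comp h f g'
  smul_comp : ∀ {p r s : ZMod 2} {X Y Z : Obj} (h : p + r = s) (c : k) (f : Hom p Y Z)
    (g : Hom r X Y), comp h (c • f) g = c • comp h f g
  comp_smul : ∀ {p r s : ZMod 2} {X Y Z : Obj} (h : p + r = s) (c : k) (f : Hom p Y Z)
    (g : Hom r X Y), comp h f (c • g) = c • comp h f g
  id_comp : ∀ {p : ZMod 2} {X Y : Obj} (h : 0 + p = p) (f : Hom p X Y), comp h (id Y) f = f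
  comp_id : ∀ {p : ZMod 2} {X Y : Obj} (h : p + 0 = p) (f : Hom p X Y), comp h f (id X) = f
  assoc : ∀ {p r s a b t : ZMod 2} {W X Y Z : Obj} (h₁ : p + r = a) (h₂ : a + s = t)
    (h₃ : r + s = b) (h₄ : p + b = t) (f : Hom p Y Z) (g : Hom r X Y) (e : Hom s W X),
    comp h₂ (comp h₁ f g) e = comp h₄ f (comp h₃ g e)

attribute [instance] SuperCat.grp SuperCat.mod

/-- A superfunctor: `k`-linear and parity preserving on morphisms. -/
@[ext]
structure Superfunctor {k : Type*} [CommRing k] (C : SuperCat.{u, v} k) (D : SuperCat.{u', v'} k)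
    where
  obj : C.Obj → D.Obj
  map : ∀ (p : ZMod 2) (X Y : C.Obj), C.Hom p X Y →ₗ[k] D.Hom p (obj X) (obj Y)
  map_id : ∀ X, map 0 X X (C.id X) = D.id (obj X)
  map_comp : ∀ {p r s : ZMod 2} {X Y Z : C.Obj} (h : p + r = s) (f : C.Hom p Y Z) (g : C.Hom r X Y),
    map s X Z (C.comp h f g) = D.comp h (map p Y Z f) (map r X Y g)


namespace SuperCat

variable {k : Type*} [CommRing k] (C : SuperCat.{u, v} k)

lemma zsmul_comp {p r s : ZMod 2} {X Y Z : C.Obj} (h : p + r = s) (m : ℤ) (f : C.Hom p Y Z)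
    (g : C.Hom r X Y) : C.comp h (m • f) g = m • C.comp h f g :=
  map_zsmul (AddMonoidHom.mk' (fun f => C.comp h f g) (fun a b => C.add_comp h a b g)) m f

lemma comp_zsmul {p r s : ZMod 2} {X Y Z : C.Obj} (h : p + r = s) (m : ℤ) (f : C.Hom p Y Z)
    (g : C.Hom r X Y) : C.comp h f (m • g) = m • C.comp h f g :=
  map_zsmul (AddMonoidHom.mk' (fun g => C.comp h f g) (fun a b => C.comp_add h f a b)) m g

lemma comp_zero {p r s : ZMod 2} {X Y Z : C.Obj} (h : p + r = s) (f : C.Hom p Y Z) :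
    C.comp h f (0 : C.Hom r X Y) = 0 := by
  simpa using C.comp_smul h 0 f (0 : C.Hom r X Y)

lemma zero_comp {p r s : ZMod 2} {X Y Z : C.Obj} (h : p + r = s) (g : C.Hom r X Y) :
    C.comp h (0 : C.Hom p Y Z) g = 0 := by
  simpa using C.smul_comp h 0 (0 : C.Hom p Y Z) g

/-- The full sub-supercategory on the objects satisfying `P`. -/
def full (P : C.Obj → Prop) : SuperCat.{u, v} k where
  Obj := {X : C.Obj // P X}
  Hom p X Y := C.Hom p X.1 Y.1
  id X := C.id X.1
  comp h f g := C.comp h f g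
  add_comp h f f' g := C.add_comp h f f' g
  comp_add h f g g' := C.comp_add h f g g'
  smul_comp h c f g := C.smul_comp h c f g
  comp_smul h c f g := C.comp_smul h c f g
  id_comp h f := C.id_comp h f
  comp_id h f := C.comp_id h f
  assoc h₁ h₂ h₃ h₄ f g e := C.assoc h₁ h₂ h₃ h₄ f g e

end SuperCat

/-- Supernatural transformations of parity `p` from `F` to `G`: families `α_X` of morphisms of
parity `p` with `G f ∘ α_X = (-1)^{p r} α_Y ∘ F f` for all `f : X → Y` of parity `r`. -/
def superNat {k : Type*} [CommRing k] {C : SuperCat.{u, v} k} {D : SuperCat.{u', v'} k}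
    (F G : Superfunctor C D) (p : ZMod 2) : Submodule k (∀ X : C.Obj, D.Hom p (F.obj X) (G.obj X)) where
  carrier := {α | ∀ (r s : ZMod 2) (h : r + p = s) (h' : p + r = s) (X Y : C.Obj)
    (f : C.Hom r X Y),
    D.comp h (G.map r X Y f) (α X) = sg (p * r) • D.comp h' (α Y) (F.map r X Y f)}
  add_mem' := by
    intro α β hα hβ r s h h' X Y f
    simp only [Pi.add_apply, D.comp_add, D.add_comp, smul_add]
    rw [hα r s h h', hβ r s h h']
  zero_mem' := by
    intro r s h h' X Y f
    simp only [Pi.zero_apply, D.comp_zero, D.zero_comp, smul_zero]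
  smul_mem' := by
    intro c α hα r s h h' X Y f
    simp only [Pi.smul_apply, D.comp_smul, D.smul_comp]
    rw [hα r s h h', smul_comm]

/-- The supercategory of superfunctors `C → C` and supernatural transformations. -/
def SEnd {k : Type*} [CommRing k] (C : SuperCat.{u, v} k) : SuperCat.{max u v, max u v} k where
  Obj := Superfunctor C C
  Hom p F G := superNat F G p
  id F := ⟨fun X => C.id (F.obj X), by
    intro r s h h' X Y f
    obtain rfl : r = s := by simpa using h
    simp [C.id_comp, C.comp_id, sg_zero]⟩
  comp := fun {p p' s} {F G H} h α β => ⟨fun X => C.comp h (α.1 X) (β.1 X), by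
    intro r t h₁ h₂ X Y f
    rw [← C.assoc (a := r + p) rfl (by rw [← h₁, ← h]; ring) h h₁,
      α.2 r _ rfl (add_comm _ _), C.zsmul_comp,
      C.assoc (add_comm p r) (b := r + p') (by rw [← h₁, ← h]; ring) rfl
        (by rw [← h₁, ← h]; ring), β.2 r _ rfl (add_comm _ _), C.comp_zsmul, smul_smul,
      ← C.assoc h h₂ (add_comm p' r), ← sg_add, ← add_mul, h]⟩
  add_comp h f f' g := Subtype.ext (funext fun X => C.add_comp h _ _ _)
  comp_add h f g g' := Subtype.ext (funext fun X => C.comp_add h _ _ _)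
  smul_comp h c f g := Subtype.ext (funext fun X => C.smul_comp h c _ _)
  comp_smul h c f g := Subtype.ext (funext fun X => C.comp_smul h c _ _)
  id_comp h f := Subtype.ext (funext fun X => C.id_comp h _)
  comp_id h f := Subtype.ext (funext fun X => C.comp_id h _)
  assoc h₁ h₂ h₃ h₄ f g e := Subtype.ext (funext fun X => C.assoc h₁ h₂ h₃ h₄ _ _ _)

/-! ### Strict monoidal supercategories given by generators and relations -/

/-- Generating objects and generating homogeneous morphisms between words in them. -/
structure Sig where
  O : Type
  G : Type
  dom : G → List O
  cod : G → List O
  par : G → ZMod 2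

/-- Formal expressions for homogeneous morphisms of parity `p` between words, built from the
generators by composition, tensor product and linear combinations. -/
inductive Term (k : Type) (S : Sig) : ZMod 2 → List S.O → List S.O → Type
  | id (X : List S.O) : Term k S 0 X X
  | gen (g : S.G) : Term k S (S.par g) (S.dom g) (S.cod g)
  | comp {p r s : ZMod 2} {X Y Z : List S.O} (h : p + r = s) (f : Term k S p Y Z)
      (g : Term k S r X Y) : Term k S s X Z
  | tensor {p r s : ZMod 2} {X Y X' Y' A B : List S.O} (h : p + r = s) (hA : A = X ++ X')
      (hB : B = Y ++ Y') (f : Term k S p X Y) (g : Term k S r X' Y') : Term k S s A B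
  | zero {p : ZMod 2} {X Y : List S.O} : Term k S p X Y
  | add {p : ZMod 2} {X Y : List S.O} (f g : Term k S p X Y) : Term k S p X Y
  | smul {p : ZMod 2} {X Y : List S.O} (c : k) (f : Term k S p X Y) : Term k S p X Y

/-- A family of relations between parallel expressions. -/
abbrev Relations (k : Type) (S : Sig) : Type :=
  ∀ (p : ZMod 2) (X Y : List S.O), Term k S p X Y → Term k S p X Y → Prop

/-- The congruence generated by the relations `R` and the axioms of a strict monoidal
supercategory. -/
inductive Cong {k : Type} [CommRing k] {S : Sig} (R : Relations k S) :
    ∀ {p : ZMod 2} {X Y : List S.O}, Term k S p X Y → Term k S p X Y → Prop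
  | of {p : ZMod 2} {X Y : List S.O} {f g : Term k S p X Y} : R p X Y f g → Cong R f g
  | refl {p : ZMod 2} {X Y : List S.O} (f : Term k S p X Y) : Cong R f f
  | symm {p : ZMod 2} {X Y : List S.O} {f g : Term k S p X Y} : Cong R f g → Cong R g f
  | trans {p : ZMod 2} {X Y : List S.O} {f g e : Term k S p X Y} :
      Cong R f g → Cong R g e → Cong R f e
  -- compatibility with the operations
  | comp_congr {p r s : ZMod 2} {X Y Z : List S.O} (h : p + r = s) {f f' : Term k S p Y Z}
      {g g' : Term k S r X Y} : Cong R f f' → Cong R g g' → Cong R (.comp h f g) (.comp h f' g')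
  | tensor_congr {p r s : ZMod 2} {X Y X' Y' A B : List S.O} (h : p + r = s) (hA : A = X ++ X')
      (hB : B = Y ++ Y') {f f' : Term k S p X Y} {g g' : Term k S r X' Y'} :
      Cong R f f' → Cong R g g' → Cong R (.tensor h hA hB f g) (.tensor h hA hB f' g')
  | add_congr {p : ZMod 2} {X Y : List S.O} {f f' g g' : Term k S p X Y} :
      Cong R f f' → Cong R g g' → Cong R (.add f g) (.add f' g')
  | smul_congr {p : ZMod 2} {X Y : List S.O} (c : k) {f f' : Term k S p X Y} :
      Cong R f f' → Cong R (.smul c f) (.smul c f')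
  -- morphisms of a given parity form a `k`-module
  | add_assoc {p : ZMod 2} {X Y : List S.O} (f g e : Term k S p X Y) :
      Cong R (.add (.add f g) e) (.add f (.add g e))
  | add_comm {p : ZMod 2} {X Y : List S.O} (f g : Term k S p X Y) :
      Cong R (.add f g) (.add g f)
  | zero_add {p : ZMod 2} {X Y : List S.O} (f : Term k S p X Y) : Cong R (.add .zero f) f
  | neg_add {p : ZMod 2} {X Y : List S.O} (f : Term k S p X Y) :
      Cong R (.add (.smul (-1) f) f) .zero
  | smul_add {p : ZMod 2} {X Y : List S.O} (c : k) (f g : Term k S p X Y) :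
      Cong R (.smul c (.add f g)) (.add (.smul c f) (.smul c g))
  | add_smul {p : ZMod 2} {X Y : List S.O} (c d : k) (f : Term k S p X Y) :
      Cong R (.smul (c + d) f) (.add (.smul c f) (.smul d f))
  | mul_smul {p : ZMod 2} {X Y : List S.O} (c d : k) (f : Term k S p X Y) :
      Cong R (.smul (c * d) f) (.smul c (.smul d f))
  | one_smul {p : ZMod 2} {X Y : List S.O} (f : Term k S p X Y) : Cong R (.smul 1 f) f
  | zero_smul {p : ZMod 2} {X Y : List S.O} (f : Term k S p X Y) : Cong R (.smul 0 f) .zero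
  | smul_zero {p : ZMod 2} {X Y : List S.O} (c : k) :
      Cong R (.smul c (.zero : Term k S p X Y)) .zero
  -- composition is bilinear, associative and unital
  | add_comp {p r s : ZMod 2} {X Y Z : List S.O} (h : p + r = s) (f f' : Term k S p Y Z)
      (g : Term k S r X Y) :
      Cong R (.comp h (.add f f') g) (.add (.comp h f g) (.comp h f' g))
  | comp_add {p r s : ZMod 2} {X Y Z : List S.O} (h : p + r = s) (f : Term k S p Y Z)
      (g g' : Term k S r X Y) :
      Cong R (.comp h f (.add g g')) (.add (.comp h f g) (.comp h f g'))
  | smul_comp {p r s : ZMod 2} {X Y Z : List S.O} (h : p + r = s) (c : k) (f : Term k S p Y Z)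
      (g : Term k S r X Y) : Cong R (.comp h (.smul c f) g) (.smul c (.comp h f g))
  | comp_smul {p r s : ZMod 2} {X Y Z : List S.O} (h : p + r = s) (c : k) (f : Term k S p Y Z)
      (g : Term k S r X Y) : Cong R (.comp h f (.smul c g)) (.smul c (.comp h f g))
  | id_comp {p : ZMod 2} {X Y : List S.O} (h : 0 + p = p) (f : Term k S p X Y) :
      Cong R (.comp h (.id Y) f) f
  | comp_id {p : ZMod 2} {X Y : List S.O} (h : p + 0 = p) (f : Term k S p X Y) :
      Cong R (.comp h f (.id X)) f
  | comp_assoc {p r s a b t : ZMod 2} {W X Y Z : List S.O} (h₁ : p + r = a) (h₂ : a + s = t)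
      (h₃ : r + s = b) (h₄ : p + b = t) (f : Term k S p Y Z) (g : Term k S r X Y)
      (e : Term k S s W X) : Cong R (.comp h₂ (.comp h₁ f g) e) (.comp h₄ f (.comp h₃ g e))
  -- the tensor product is bilinear, strictly associative and unital, and satisfies the
  -- super interchange law
  | add_tensor {p r s : ZMod 2} {X Y X' Y' A B : List S.O} (h : p + r = s) (hA : A = X ++ X')
      (hB : B = Y ++ Y') (f f' : Term k S p X Y) (g : Term k S r X' Y') :
      Cong R (.tensor h hA hB (.add f f') g) (.add (.tensor h hA hB f g) (.tensor h hA hB f' g))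
  | tensor_add {p r s : ZMod 2} {X Y X' Y' A B : List S.O} (h : p + r = s) (hA : A = X ++ X')
      (hB : B = Y ++ Y') (f : Term k S p X Y) (g g' : Term k S r X' Y') :
      Cong R (.tensor h hA hB f (.add g g')) (.add (.tensor h hA hB f g) (.tensor h hA hB f g'))
  | smul_tensor {p r s : ZMod 2} {X Y X' Y' A B : List S.O} (h : p + r = s) (hA : A = X ++ X')
      (hB : B = Y ++ Y') (c : k) (f : Term k S p X Y) (g : Term k S r X' Y') :
      Cong R (.tensor h hA hB (.smul c f) g) (.smul c (.tensor h hA hB f g))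
  | tensor_smul {p r s : ZMod 2} {X Y X' Y' A B : List S.O} (h : p + r = s) (hA : A = X ++ X')
      (hB : B = Y ++ Y') (c : k) (f : Term k S p X Y) (g : Term k S r X' Y') :
      Cong R (.tensor h hA hB f (.smul c g)) (.smul c (.tensor h hA hB f g))
  | id_tensor_id {X X' A : List S.O} (h : (0 : ZMod 2) + 0 = 0) (hA : A = X ++ X') :
      Cong R (.tensor h hA hA (.id X) (.id X')) (.id A)
  | one_tensor {p : ZMod 2} {X Y : List S.O} (h : 0 + p = p) (hX : X = [] ++ X)
      (hY : Y = [] ++ Y) (f : Term k S p X Y) : Cong R (.tensor h hX hY (.id []) f) f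
  | tensor_one {p : ZMod 2} {X Y : List S.O} (h : p + 0 = p) (hX : X = X ++ [])
      (hY : Y = Y ++ []) (f : Term k S p X Y) : Cong R (.tensor h hX hY f (.id [])) f
  | tensor_assoc {p r s a b t : ZMod 2} {X Y X' Y' X'' Y'' A B A' B' C D : List S.O}
      (h₁ : p + r = a) (h₂ : a + s = t) (h₃ : r + s = b) (h₄ : p + b = t)
      (hA : A = X ++ X') (hB : B = Y ++ Y') (hA' : A' = X' ++ X'') (hB' : B' = Y' ++ Y'')
      (hC : C = A ++ X'') (hD : D = B ++ Y'') (hC' : C = X ++ A') (hD' : D = Y ++ B')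
      (f : Term k S p X Y) (g : Term k S r X' Y') (e : Term k S s X'' Y'') :
      Cong R (.tensor h₂ hC hD (.tensor h₁ hA hB f g) e)
        (.tensor h₄ hC' hD' f (.tensor h₃ hA' hB' g e))
  | interchange {p p' r r' a b c d t : ZMod 2} {X Y Z X' Y' Z' A B C : List S.O}
      (h₁ : p' + r = a) (h₂ : p + r' = b) (h₃ : a + b = t) (h₄ : p' + p = c) (h₅ : r + r' = d)
      (h₆ : c + d = t) (hA : A = X ++ X') (hB : B = Y ++ Y') (hC : C = Z ++ Z')
      (f' : Term k S p' Y Z) (f : Term k S p X Y) (g : Term k S r Y' Z') (g' : Term k S r' X' Y') :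
      Cong R (.comp h₃ (.tensor h₁ hB hC f' g) (.tensor h₂ hA hB f g'))
        (.smul (sg (p * r) : k) (.tensor h₆ hA hC (.comp h₄ f' f) (.comp h₅ g g')))

/-- A presentation of a strict monoidal supercategory. -/
structure Presentation (k : Type) where
  S : Sig
  R : Relations k S

namespace Presentation

variable {k : Type} [CommRing k] (P : Presentation k)

/-- Equality of expressions modulo the relations. -/
def setoid (p : ZMod 2) (X Y : List P.S.O) : Setoid (Term k P.S p X Y) where
  r := Cong P.R
  iseqv := ⟨Cong.refl, Cong.symm, Cong.trans⟩

/-- The morphisms of parity `p` in the presented strict monoidal supercategory. -/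
def Hom (p : ZMod 2) (X Y : List P.S.O) : Type := Quotient (P.setoid p X Y)

/-- The morphism represented by an expression. -/
def cls {p : ZMod 2} {X Y : List P.S.O} (f : Term k P.S p X Y) : P.Hom p X Y :=
  Quotient.mk (P.setoid p X Y) f

lemma sound {p : ZMod 2} {X Y : List P.S.O} {f g : Term k P.S p X Y} (h : Cong P.R f g) :
    P.cls f = P.cls g := Quotient.sound (s := P.setoid p X Y) h

lemma ind {p : ZMod 2} {X Y : List P.S.O} {motive : P.Hom p X Y → Prop}
    (h : ∀ f, motive (P.cls f)) (f : P.Hom p X Y) : motive f := Quotient.ind h f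

instance (p : ZMod 2) (X Y : List P.S.O) : AddCommGroup (P.Hom p X Y) :=
  letI addI : Add (P.Hom p X Y) := ⟨Quotient.map₂ Term.add fun _ _ h _ _ h' => .add_congr h h'⟩
  letI zeroI : Zero (P.Hom p X Y) := ⟨P.cls .zero⟩
  letI negI : Neg (P.Hom p X Y) := ⟨Quotient.map (Term.smul (-1)) fun _ _ h => .smul_congr _ h⟩
  have hac : ∀ f g : P.Hom p X Y, f + g = g + f :=
    P.ind fun f => P.ind fun g => P.sound (.add_comm f g)
  have hz : ∀ f : P.Hom p X Y, 0 + f = f := P.ind fun f => P.sound (.zero_add f)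
  { add_assoc := P.ind fun f => P.ind fun g => P.ind fun e => P.sound (.add_assoc f g e)
    zero_add := hz
    add_zero := fun f => (hac f 0).trans (hz f)
    add_comm := hac
    neg_add_cancel := P.ind fun f => P.sound (.neg_add f)
    nsmul := nsmulRec
    zsmul := zsmulRec }

instance (p : ZMod 2) (X Y : List P.S.O) : Module k (P.Hom p X Y) where
  smul c := Quotient.map (Term.smul c) fun _ _ h => .smul_congr c h
  one_smul := P.ind fun f => P.sound (.one_smul f)
  mul_smul c d := P.ind fun f => P.sound (.mul_smul c d f)
  smul_zero c := P.sound (.smul_zero c)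
  smul_add c := P.ind fun f => P.ind fun g => P.sound (.smul_add c f g)
  add_smul c d := P.ind fun f => P.sound (.add_smul c d f)
  zero_smul := P.ind fun f => P.sound (.zero_smul f)

/-- The presented supercategory: objects are words in the generating objects. -/
def cat : SuperCat.{0, 0} k where
  Obj := List P.S.O
  Hom := P.Hom
  id X := P.cls (.id X)
  comp h := Quotient.map₂ (Term.comp h) fun _ _ h₁ _ _ h₂ => .comp_congr h h₁ h₂
  add_comp h := P.ind fun f => P.ind fun f' => P.ind fun g => P.sound (.add_comp h f f' g)
  comp_add h := P.ind fun f => P.ind fun g => P.ind fun g' => P.sound (.comp_add h f g g')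
  smul_comp h c := P.ind fun f => P.ind fun g => P.sound (.smul_comp h c f g)
  comp_smul h c := P.ind fun f => P.ind fun g => P.sound (.comp_smul h c f g)
  id_comp h := P.ind fun f => P.sound (.id_comp h f)
  comp_id h := P.ind fun f => P.sound (.comp_id h f)
  assoc h₁ h₂ h₃ h₄ := P.ind fun f => P.ind fun g => P.ind fun e =>
    P.sound (.comp_assoc h₁ h₂ h₃ h₄ f g e)

/-- The tensor product of morphisms; on objects it is concatenation of words. -/
def tensorHom {p r s : ZMod 2} {X Y X' Y' : List P.S.O} (h : p + r = s) :
    P.Hom p X Y → P.Hom r X' Y' → P.Hom s (X ++ X') (Y ++ Y') :=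
  Quotient.map₂ (Term.tensor h rfl rfl) fun _ _ h₁ _ _ h₂ => .tensor_congr h rfl rfl h₁ h₂

end Presentation

/-! ### The quantum isomeric supercategory and its chirally braided extension -/

namespace Term

variable {k : Type} {S : Sig}

/-- Vertical composition `f ∘ g` of even expressions; `Y` is the word in the middle. -/
abbrev after {X Z : List S.O} (Y : List S.O) (f : Term k S 0 Y Z) (g : Term k S 0 X Y) :
    Term k S 0 X Z := .comp (add_zero 0) f g

/-- Tensor product `f ⊗ g` of even expressions. -/
abbrev tens {X Y X' Y' A B : List S.O} (f : Term k S 0 X Y) (g : Term k S 0 X' Y')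
    (hA : A = X ++ X' := by rfl) (hB : B = Y ++ Y' := by rfl) : Term k S 0 A B :=
  .tensor (add_zero 0) hA hB f g

end Term

/-- The generating objects `↑` and `↓`. -/
inductive QObj
  | up
  | dn
  deriving DecidableEq

/-- The generating morphisms: the positive and negative upward crossings, the negative right
crossing, the left cap, the left cup and the Clifford token. -/
inductive QGen
  | pos
  | neg
  | negRight
  | leftCap
  | leftCup
  | tok

open QObj in
/-- Domains, codomains and parities of the generating morphisms. -/
abbrev qSig : Sig where
  O := QObj
  G := QGen
  dom
    | .pos => [up, up]
    | .neg => [up, up]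
    | .negRight => [up, dn]
    | .leftCap => [dn, up]
    | .leftCup => []
    | .tok => [up]
  cod
    | .pos => [up, up]
    | .neg => [up, up]
    | .negRight => [dn, up]
    | .leftCap => []
    | .leftCup => [up, dn]
    | .tok => [up]
  par
    | .pos => 0
    | .neg => 0
    | .negRight => 0
    | .leftCap => 0
    | .leftCup => 0
    | .tok => 1

namespace Q

open QObj

variable {k : Type}

/-- Expressions in the generators. -/
abbrev T (k : Type) (p : ZMod 2) (X Y : List QObj) : Type := Term k qSig p X Y

abbrev one (X : List QObj) : T k 0 X X := Term.id (S := qSig) X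
abbrev pos : T k 0 [up, up] [up, up] := Term.gen (S := qSig) QGen.pos
abbrev neg : T k 0 [up, up] [up, up] := Term.gen (S := qSig) QGen.neg
abbrev negRight : T k 0 [up, dn] [dn, up] := Term.gen (S := qSig) QGen.negRight
abbrev leftCap : T k 0 [dn, up] [] := Term.gen (S := qSig) QGen.leftCap
abbrev leftCup : T k 0 [] [up, dn] := Term.gen (S := qSig) QGen.leftCup
abbrev tok : T k 1 [up] [up] := Term.gen (S := qSig) QGen.tok

/-- The positive left crossing. -/
abbrev posLeft : T k 0 [dn, up] [up, dn] :=
  Term.after [dn, up, up, dn] (Term.tens leftCap (one [up, dn]))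
    (Term.after [dn, up, up, dn] (Term.tens (one [dn]) (Term.tens pos (one [dn])))
      (Term.tens (one [dn, up]) leftCup))

/-- The right cap. -/
abbrev rightCap : T k 0 [up, dn] [] := Term.after [dn, up] leftCap negRight

/-- The right cup. -/
abbrev rightCup : T k 0 [] [dn, up] := Term.after [up, dn] negRight leftCup

end Q

open QObj Q in
/-- The defining relations of the quantum isomeric supercategory. -/
inductive QRel {k : Type} [CommRing k] (z : k) : Relations k qSig
  | neg_pos : QRel z 0 [up, up] [up, up] (Term.after [up, up] neg pos) (one [up, up])
  | pos_neg : QRel z 0 [up, up] [up, up] (Term.after [up, up] pos neg) (one [up, up])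
  | posLeft_negRight : QRel z 0 [up, dn] [up, dn] (Term.after [dn, up] posLeft negRight) (one [up, dn])
  | negRight_posLeft : QRel z 0 [dn, up] [dn, up] (Term.after [up, dn] negRight posLeft) (one [dn, up])
  | braid : QRel z 0 [up, up, up] [up, up, up]
      (Term.after [up, up, up] (Term.tens pos (one [up]))
        (Term.after [up, up, up] (Term.tens (one [up]) pos) (Term.tens pos (one [up]))))
      (Term.after [up, up, up] (Term.tens (one [up]) pos)
        (Term.after [up, up, up] (Term.tens pos (one [up])) (Term.tens (one [up]) pos)))
  | skein : QRel z 0 [up, up] [up, up] (.add pos (.smul (-1) neg)) (.smul z (one [up, up]))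
  | tok_tok : QRel z 0 [up] [up] (.comp (p := 1) (r := 1) (Y := [up]) (by decide) tok tok) (.smul (-1) (one [up]))
  | pos_tok : QRel z 1 [up, up] [up, up] 
      (.comp (p := 0) (r := 1) (Y := [up, up]) (zero_add 1) pos
        (.tensor (p := 1) (r := 0) (add_zero 1) rfl rfl tok (one [up])))
      (.comp (p := 1) (r := 0) (Y := [up, up]) (add_zero 1)
        (.tensor (p := 0) (r := 1) (zero_add 1) rfl rfl (one [up]) tok) pos)
  | bubble_tok : QRel z 1 [] [] 
      (.comp (p := 0) (r := 1) (Y := [up, dn]) (zero_add 1) rightCap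
        (.comp (p := 1) (r := 0) (Y := [up, dn]) (add_zero 1)
          (.tensor (p := 1) (r := 0) (add_zero 1) rfl rfl tok (one [dn])) leftCup))
      .zero
  | bubble : QRel z 0 [] [] (Term.after [up, dn] rightCap leftCup) .zero
  | zigzag_up : QRel z 0 [up] [up]
      (Term.after [up, dn, up] (Term.tens (one [up]) leftCap) (Term.tens leftCup (one [up])))
      (one [up])
  | zigzag_dn : QRel z 0 [dn] [dn]
      (Term.after [dn, up, dn] (Term.tens leftCap (one [dn])) (Term.tens (one [dn]) leftCup))
      (one [dn])

/-- The quantum isomeric supercategory with parameter `z`. -/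
abbrev Qcat {k : Type} [CommRing k] (z : k) : Presentation k where
  S := qSig
  R := QRel z

/-- Generating morphisms of the extended supercategory: the black ones, together with the red
strand crossing over an upward strand from left to right (`posRed`) and from right to left
(`negRed`). -/
inductive WGen
  | black (g : QGen)
  | posRed
  | negRed

/-- Generating objects are `some up`, `some dn` and the red object `none`. -/
abbrev wSig : Sig where
  O := Option QObj
  G := WGen
  dom
    | .black g => (qSig.dom g).map some
    | .posRed => [none, some .up]
    | .negRed => [some .up, none]
  cod
    | .black g => (qSig.cod g).map some
    | .posRed => [some .up, none]
    | .negRed => [none, some .up]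
  par
    | .black g => qSig.par g
    | .posRed => 0
    | .negRed => 0

/-- Expressions in black generators are expressions in the extended set of generators. -/
def inclTerm {k : Type} : ∀ {p : ZMod 2} {X Y : List QObj}, Term k qSig p X Y →
    Term k wSig p (List.map some X) (List.map some Y)
  | _, _, _, .id X => Term.id (S := wSig) (List.map some X)
  | _, _, _, .gen g => Term.gen (S := wSig) (WGen.black g)
  | _, _, _, .comp h f g => .comp h (inclTerm f) (inclTerm g)
  | _, _, _, .tensor h hA hB f g =>
      .tensor h (by rw [hA]; exact List.map_append) (by rw [hB]; exact List.map_append)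
        (inclTerm f) (inclTerm g)
  | _, _, _, .zero => .zero
  | _, _, _, .add f g => .add (inclTerm f) (inclTerm g)
  | _, _, _, .smul c f => .smul c (inclTerm f)

namespace W

variable {k : Type}

/-- The upward strand. -/
abbrev up : Option QObj := some QObj.up
/-- The downward strand. -/
abbrev dn : Option QObj := some QObj.dn
/-- The red strand. -/
abbrev red : Option QObj := none

/-- Expressions in the generators. -/
abbrev T (k : Type) (p : ZMod 2) (X Y : List (Option QObj)) : Type := Term k wSig p X Y

abbrev one (X : List (Option QObj)) : T k 0 X X := Term.id (S := wSig) X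
abbrev posRed : T k 0 [red, up] [up, red] := Term.gen (S := wSig) WGen.posRed
abbrev negRed : T k 0 [up, red] [red, up] := Term.gen (S := wSig) WGen.negRed
abbrev pos : T k 0 [up, up] [up, up] := inclTerm Q.pos
abbrev leftCap : T k 0 [dn, up] [] := inclTerm Q.leftCap
abbrev leftCup : T k 0 [] [up, dn] := inclTerm Q.leftCup
abbrev rightCap : T k 0 [up, dn] [] := inclTerm Q.rightCap
abbrev rightCup : T k 0 [] [dn, up] := inclTerm Q.rightCup

/-- The red strand crossing over a downward strand from left to right. -/
abbrev posDownRed : T k 0 [red, dn] [dn, red] :=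
  Term.after [dn, red, up, dn] (Term.tens (one [dn, red]) rightCap)
    (Term.after [dn, up, red, dn] (Term.tens (one [dn]) (Term.tens negRed (one [dn])))
      (Term.tens rightCup (one [red, dn])))

/-- The red strand crossing over a downward strand from right to left. -/
abbrev negDownRed : T k 0 [dn, red] [red, dn] :=
  Term.after [dn, up, red, dn] (Term.tens leftCap (one [red, dn]))
    (Term.after [dn, red, up, dn] (Term.tens (one [dn]) (Term.tens posRed (one [dn])))
      (Term.tens (one [dn, red]) leftCup))

end W

open W in
/-- The defining relations of the extended supercategory: those among black strands, and the new
ones involving the red strand. -/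
inductive WRel {k : Type} [CommRing k] (z : k) : Relations k wSig
  | black {p : ZMod 2} {X Y : List QObj} {f g : Q.T k p X Y} (h : QRel z p X Y f g) :
      WRel z p (List.map some X) (List.map some Y) (inclTerm f) (inclTerm g)
  | neg_pos : WRel z 0 [red, up] [red, up] (Term.after [up, red] negRed posRed) (one [red, up])
  | pos_neg : WRel z 0 [up, red] [up, red] (Term.after [red, up] posRed negRed) (one [up, red])
  | negDown_posDown : WRel z 0 [red, dn] [red, dn] (Term.after [dn, red] negDownRed posDownRed)
      (one [red, dn])
  | posDown_negDown : WRel z 0 [dn, red] [dn, red] (Term.after [red, dn] posDownRed negDownRed)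
      (one [dn, red])
  | braid : WRel z 0 [red, up, up] [up, up, red]
      (Term.after [up, up, red] (Term.tens pos (one [red]))
        (Term.after [up, red, up] (Term.tens (one [up]) posRed)
          (Term.tens posRed (one [up]))))
      (Term.after [up, red, up] (Term.tens (one [up]) posRed)
        (Term.after [red, up, up] (Term.tens posRed (one [up])) (Term.tens (one [red]) pos)))

/-- The extension of the quantum isomeric supercategory by a red strand. -/
abbrev Wcat {k : Type} [CommRing k] (z : k) : Presentation k where
  S := wSig
  R := WRel z

lemma inclTerm_cong {k : Type} [CommRing k] (z : k) {p : ZMod 2} {X Y : List qSig.O}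
    {f g : Term k qSig p X Y} (h : Cong (QRel z) f g) :
    Cong (WRel z) (inclTerm f) (inclTerm g) := by
  induction h with
  | of h => exact .of (.black h)
  | refl f => exact .refl _
  | symm _ ih => exact .symm ih
  | trans _ _ ih ih' => exact .trans ih ih'
  | comp_congr h _ _ ih ih' => exact .comp_congr h ih ih'
  | tensor_congr h hA hB _ _ ih ih' => exact .tensor_congr h _ _ ih ih'
  | add_congr _ _ ih ih' => exact .add_congr ih ih'
  | smul_congr c _ ih => exact .smul_congr c ih
  | add_assoc f g e => exact .add_assoc _ _ _
  | add_comm f g => exact .add_comm _ _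
  | zero_add f => exact .zero_add _
  | neg_add f => exact .neg_add _
  | smul_add c f g => exact .smul_add _ _ _
  | add_smul c d f => exact .add_smul _ _ _
  | mul_smul c d f => exact .mul_smul _ _ _
  | one_smul f => exact .one_smul _
  | zero_smul f => exact .zero_smul _
  | smul_zero c => exact .smul_zero _
  | add_comp h f f' g => exact .add_comp h _ _ _
  | comp_add h f g g' => exact .comp_add h _ _ _
  | smul_comp h c f g => exact .smul_comp h _ _ _
  | comp_smul h c f g => exact .comp_smul h _ _ _
  | id_comp h f => exact .id_comp h _
  | comp_id h f => exact .comp_id h _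
  | comp_assoc h₁ h₂ h₃ h₄ f g e => exact .comp_assoc h₁ h₂ h₃ h₄ _ _ _
  | add_tensor h hA hB f f' g => exact .add_tensor h _ _ _ _ _
  | tensor_add h hA hB f g g' => exact .tensor_add h _ _ _ _ _
  | smul_tensor h hA hB c f g => exact .smul_tensor h _ _ _ _ _
  | tensor_smul h hA hB c f g => exact .tensor_smul h _ _ _ _ _
  | id_tensor_id h hA => exact .id_tensor_id h _
  | one_tensor h hX hY f => exact .one_tensor h _ _ _
  | tensor_one h hX hY f => exact .tensor_one h _ _ _
  | tensor_assoc h₁ h₂ h₃ h₄ hA hB hA' hB' hC hD hC' hD' f g e =>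
      exact .tensor_assoc h₁ h₂ h₃ h₄ _ _ _ _ _ _ _ _ _ _ _
  | interchange h₁ h₂ h₃ h₄ h₅ h₆ hA hB hC f' f g g' =>
      exact .interchange h₁ h₂ h₃ h₄ h₅ h₆ _ _ _ _ _ _ _

/-- The canonical map on morphisms from the quantum isomeric supercategory to its extension. -/
def inclHom {k : Type} [CommRing k] (z : k) (p : ZMod 2) (X Y : List QObj) :
    (Qcat z).Hom p X Y →ₗ[k] (Wcat z).Hom p (List.map some X) (List.map some Y) where
  toFun := Quotient.map inclTerm fun _ _ h => inclTerm_cong z h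
  map_add' := (Qcat z).ind fun _ => (Qcat z).ind fun _ => rfl
  map_smul' := fun _ => (Qcat z).ind fun _ => rfl

/-- The canonical superfunctor from the quantum isomeric supercategory to its extension. -/
def incl {k : Type} [CommRing k] (z : k) : Superfunctor (Qcat z).cat (Wcat z).cat where
  obj := List.map some
  map p X Y := inclHom z p X Y
  map_id _ := rfl
  map_comp _ := (Qcat z).ind fun _ => (Qcat z).ind fun _ => rfl

/-- The full sub-supercategory of the extended supercategory on the words with exactly one
occurrence of the red object. -/
def W1cat {k : Type} [CommRing k] (z : k) : SuperCat.{0, 0} k :=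
  (Wcat z).cat.full fun X : List (Option QObj) => X.count none = 1

/-! ### The quantum isomeric superalgebra -/

/-- The index set `{1, …, n, -1, …, -n}`, ordered as a set of integers. -/
abbrev Idx (n : ℕ) : Type := {i : ℤ // i ∈ (Finset.Icc (-(n : ℤ)) n).erase 0}

instance (n : ℕ) : Neg (Idx n) := ⟨fun i => ⟨-i.1, by
  have := i.2
  simp only [Finset.mem_erase, Finset.mem_Icc] at this ⊢
  omega⟩⟩

/-- The parity of an index. -/
def par {n : ℕ} (i : Idx n) : ZMod 2 := if 0 < i.1 then 0 else 1

/-- `p(i,j) = p(i) + p(j)`, the parity of the matrix unit `E_ij`. -/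
abbrev par₂ {n : ℕ} (i j : Idx n) : ZMod 2 := par i + par j

/-- `φ(i,j) = δ_{|i|,|j|} sgn(j)`. -/
def phi {n : ℕ} (i j : Idx n) : ℤ := if |i.1| = |j.1| then Int.sign j.1 else 0

section Theta

variable {K : Type} [Field K] (q : Kˣ) {n : ℕ}

/-- The parameter `z = q - q⁻¹`. -/
def zz : K := (q : K) - ((q⁻¹ : Kˣ) : K)

/-- The coefficient of `E_ij ⊗ E_kl` in
`Θ = ∑_{i,j} q^{φ(i,j)} E_ii ⊗ E_jj + z ∑_{i<j} (-1)^{p(i)} (E_ji + E_{-j,-i}) ⊗ E_ij`. -/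
def theta (i j k l : Idx n) : K :=
  (if i = j ∧ k = l then ((q ^ phi i k : Kˣ) : K) else 0) +
    (if k < l then zz q * (sg (par k) : K) *
      ((if i = l ∧ j = k then 1 else 0) + (if i = -l ∧ j = -k then 1 else 0)) else 0)

lemma par_neg (i : Idx n) : par (-i) = par i + 1 := by
  have h := i.2
  simp only [Finset.mem_erase, Finset.mem_Icc] at h
  have h' : (-i).1 = -i.1 := rfl
  unfold par
  rw [h']
  split_ifs <;> first | omega | decide

lemma theta_even (i j k l : Idx n) (h : theta q i j k l ≠ 0) : par₂ i j + par₂ k l = 0 := by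
  have two : ∀ a b : ZMod 2, a + b + (b + a) = 0 := by decide
  have two' : ∀ a b : ZMod 2, a + 1 + (b + 1) + (b + a) = 0 := by decide
  by_contra hc
  have h1 : ¬(i = j ∧ k = l) := by
    rintro ⟨rfl, rfl⟩
    exact hc (by simp only [par₂, CharTwo.add_self_eq_zero])
  have h2 : ¬(i = l ∧ j = k) := by
    rintro ⟨rfl, rfl⟩
    exact hc (two _ _)
  have h3 : ¬(i = -l ∧ j = -k) := by
    rintro ⟨rfl, rfl⟩
    apply hc
    simp only [par₂, par_neg]
    exact two' _ _
  apply h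
  rw [theta, if_neg h1, if_neg h2, if_neg h3]
  simp

end Theta

section Uq

variable {K : Type} [Field K] (q : Kˣ) (n : ℕ)

/-- The free algebra on generators `u_ij`, `i ≤ j`. -/
abbrev FreeU (K : Type) [Field K] (n : ℕ) : Type :=
  FreeAlgebra K {ij : Idx n × Idx n // ij.1 ≤ ij.2}

/-- The free generators `u_ij`, extended by zero to all `i`, `j`. -/
def uF {K : Type} [Field K] {n : ℕ} (i j : Idx n) : FreeU K n :=
  if h : i ≤ j then FreeAlgebra.ι K ⟨(i, j), h⟩ else 0

/-- The parity automorphism of the free superalgebra, in which `u_ij` has parity `p(i,j)`. -/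
def parityF (K : Type) [Field K] (n : ℕ) : FreeU K n →ₐ[K] FreeU K n :=
  FreeAlgebra.lift K fun g => (sg (par₂ g.1.1 g.1.2) : K) • FreeAlgebra.ι K g

/-- Powers of the parity automorphism with exponent in `ℤ/2`. -/
def parityPow {K : Type} [Field K] {n : ℕ} (p : ZMod 2) : FreeU K n →ₐ[K] FreeU K n :=
  if p = 0 then AlgHom.id K _ else parityF K n

/-- Elements `∑ x_ijkl ⊗ E_ij ⊗ E_kl` of `A ⊗ End(V) ⊗ End(V)`, with `A` the free superalgebra. -/
abbrev Arr (K : Type) [Field K] (n : ℕ) : Type := Idx n → Idx n → Idx n → Idx n → FreeU K n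

/-- The multiplication of the superalgebra `A ⊗ End(V) ⊗ End(V)`:
`(x ⊗ E_ij ⊗ E_kl)(y ⊗ E_jb ⊗ E_ld) = ± xy ⊗ E_ib ⊗ E_kd`, where moving `y` to the left past
`E_ij ⊗ E_kl` and `E_jb` past `E_kl` gives the usual signs. -/
def arrMul {K : Type} [Field K] {n : ℕ} (X Y : Arr K n) : Arr K n := fun i b k d =>
  ∑ j, ∑ l, (sg (par₂ k l * par₂ j b) : K) •
    (X i j k l * parityPow (par₂ i j + par₂ k l) (Y j b l d))

/-- `L¹² = ∑ u_ij ⊗ E_ij ⊗ 1`. -/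
def L12 {K : Type} [Field K] {n : ℕ} : Arr K n := fun i j k l => if k = l then uF i j else 0

/-- `L¹³ = ∑ u_ij ⊗ 1 ⊗ E_ij`. -/
def L13 {K : Type} [Field K] {n : ℕ} : Arr K n := fun i j k l => if i = j then uF k l else 0

/-- `Θ²³ = 1 ⊗ Θ`. -/
def theta23 {K : Type} [Field K] (q : Kˣ) {n : ℕ} : Arr K n := fun i j k l =>
  algebraMap K _ (theta q i j k l)

/-- The defining relations of the quantum isomeric superalgebra:
`u_ii u_{-i,-i} = 1` for all `i`, and `L¹² L¹³ Θ²³ = Θ²³ L¹³ L¹²`. -/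
inductive URel : FreeU K n → FreeU K n → Prop
  | diag (i : Idx n) : URel (uF i i * uF (-i) (-i)) 1
  | rll (i j k l : Idx n) : URel (arrMul (arrMul L12 L13) (theta23 q) i j k l)
      (arrMul (theta23 q) (arrMul L13 L12) i j k l)

/-- The quantum isomeric superalgebra `U_q(𝔮_n)`. -/
def Uq : Type := RingQuot (URel q n)

instance : Ring (Uq q n) := inferInstanceAs (Ring (RingQuot (URel q n)))
instance : Algebra K (Uq q n) := inferInstanceAs (Algebra K (RingQuot (URel q n)))

/-- The projection from the free algebra. -/
def Uq.proj : FreeU K n →ₐ[K] Uq q n := RingQuot.mkAlgHom K (URel q n)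

variable {n}

/-- The generators `u_ij` of `U_q(𝔮_n)`, which vanish for `i > j`. -/
def uu (i j : Idx n) : Uq q n := Uq.proj q n (uF i j)

variable (n)

/-- The superspace grading of `U_q(𝔮_n)`: the elements of parity `p` are the linear combinations of
products of generators with total parity `p`. -/
def Uq.gr (p : ZMod 2) : Submodule K (Uq q n) :=
  Submodule.span K {x | ∃ w : List (Idx n × Idx n),
    (w.map fun g => par₂ g.1 g.2).sum = p ∧ (w.map fun g => uu q g.1 g.2).prod = x}

variable {q n}

lemma Uq.uu_mem (i j : Idx n) : uu q i j ∈ Uq.gr q n (par₂ i j) :=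
  Submodule.subset_span ⟨[(i, j)], by simp, by simp⟩

lemma Uq.one_mem : (1 : Uq q n) ∈ Uq.gr q n 0 :=
  Submodule.subset_span ⟨[], by simp, by simp⟩

lemma Uq.mul_mem {p r : ZMod 2} {x y : Uq q n} (hx : x ∈ Uq.gr q n p) (hy : y ∈ Uq.gr q n r) :
    x * y ∈ Uq.gr q n (p + r) := by
  refine Submodule.span_induction (p := fun x _ => x * y ∈ Uq.gr q n (p + r)) ?_ ?_ ?_ ?_ hx
  · rintro _ ⟨w, hw, rfl⟩
    refine Submodule.span_induction
      (p := fun y _ => (w.map fun g => uu q g.1 g.2).prod * y ∈ Uq.gr q n (p + r)) ?_ ?_ ?_ ?_ hy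
    · rintro _ ⟨w', hw', rfl⟩
      exact Submodule.subset_span ⟨w ++ w', by simp [hw, hw'], by simp⟩
    · simp
    · intro a b _ _ ha hb
      rw [mul_add]; exact add_mem ha hb
    · intro c a _ ha
      rw [mul_smul_comm]; exact Submodule.smul_mem _ _ ha
  · simp
  · intro a b _ _ ha hb
    rw [add_mul]; exact add_mem ha hb
  · intro c a _ ha
    rw [smul_mul_assoc]; exact Submodule.smul_mem _ _ ha

lemma sgK_add {K : Type} [Ring K] (p r : ZMod 2) :
    (sg (p + r) : K) = (sg p : K) * (sg r : K) := by rw [sg_add, Int.cast_mul]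

lemma par₂_self (i : Idx n) : par₂ i i = 0 := CharTwo.add_self_eq_zero _

lemma parityPow_uF (p : ZMod 2) (i j : Idx n) :
    parityPow p (uF i j : FreeU K n) = (sg (p * par₂ i j) : K) • uF i j := by
  unfold parityPow uF
  split_ifs with h h' h'
  · simp [h, sg_zero]
  · simp
  · have : p = 1 := by revert h; revert p; decide
    simp [parityF, this]
  · simp

lemma arrMul_L12_L13 (i j k l : Idx n) :
    arrMul (K := K) L12 L13 i j k l = (sg (par₂ i j * par₂ k l) : K) • (uF i j * uF k l) := by
  unfold arrMul L12 L13
  rw [Finset.sum_eq_single j, Finset.sum_eq_single k]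
  · simp [par₂_self, parityPow_uF, sg_zero]
  · intro b _ hb; simp [hb.symm]
  · simp
  · intro b _ hb; simp [hb]
  · simp

lemma arrMul_L13_L12 (i j k l : Idx n) :
    arrMul (K := K) L13 L12 i j k l = uF k l * uF i j := by
  unfold arrMul L12 L13
  rw [Finset.sum_eq_single i, Finset.sum_eq_single l]
  · simp only [par₂_self, parityPow_uF, zero_add, if_true, mul_smul_comm, smul_smul]
    rw [← Int.cast_mul, sg_mul_self]; simp
  · intro b _ hb; simp [hb]
  · simp
  · intro b _ hb; simp [hb.symm]
  · simp

/-- The left-hand side of the quadratic relation, in components. -/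
def rllLeft {B : Type*} [Ring B] [Algebra K B] (q : Kˣ) (x : Idx n → Idx n → B)
    (i b k d : Idx n) : B :=
  ∑ j, ∑ l, ((sg (par₂ k l * par₂ i b) : K) * theta q j b l d) • (x i j * x k l)

/-- The right-hand side of the quadratic relation, in components. -/
def rllRight {B : Type*} [Ring B] [Algebra K B] (q : Kˣ) (x : Idx n → Idx n → B)
    (i b k d : Idx n) : B :=
  ∑ j, ∑ l, ((sg (par₂ k l * par₂ j b) : K) * theta q i j k l) • (x l d * x j b)

lemma arrMul_apply (X Y : Arr K n) (i b k d : Idx n) : arrMul X Y i b k d =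
    ∑ j, ∑ l, (sg (par₂ k l * par₂ j b) : K) •
      (X i j k l * parityPow (par₂ i j + par₂ k l) (Y j b l d)) := rfl

lemma arr_left (i b k d : Idx n) :
    arrMul (arrMul (K := K) L12 L13) (theta23 q) i b k d = rllLeft q uF i b k d := by
  rw [rllLeft, arrMul_apply]
  refine Finset.sum_congr rfl fun j _ => Finset.sum_congr rfl fun l _ => ?_
  rw [arrMul_L12_L13, theta23, AlgHom.commutes, ← Algebra.commutes, ← Algebra.smul_def,
    smul_smul, smul_smul]
  congr 1
  rw [mul_right_comm, ← sgK_add]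
  congr 3
  have h := CharTwo.add_self_eq_zero (par₂ k l * par j)
  simp only [par₂] at h ⊢
  linear_combination h

lemma arr_right (i b k d : Idx n) :
    arrMul (theta23 q) (arrMul (K := K) L13 L12) i b k d = rllRight q uF i b k d := by
  rw [rllRight, arrMul_apply]
  refine Finset.sum_congr rfl fun j _ => Finset.sum_congr rfl fun l _ => ?_
  rw [arrMul_L13_L12, theta23, ← Algebra.smul_def, smul_smul]
  by_cases h0 : theta q i j k l = 0
  · simp [h0]
  · rw [theta_even q _ _ _ _ h0]; simp [parityPow]

variable (q) in
/-- Families of elements of an algebra which satisfy the defining relations. -/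
structure IsRep {B : Type*} [Ring B] [Algebra K B] (x : Idx n → Idx n → B) : Prop where
  tri : ∀ i j, j < i → x i j = 0
  diag : ∀ i, x i i * x (-i) (-i) = 1
  rll : ∀ i b k d, rllLeft q x i b k d = rllRight q x i b k d

lemma uF_of_lt {i j : Idx n} (h : j < i) : (uF i j : FreeU K n) = 0 := dif_neg (not_le.2 h)

lemma map_rllLeft {A B : Type*} [Ring A] [Algebra K A] [Ring B] [Algebra K B] (f : A →ₐ[K] B)
    (x : Idx n → Idx n → A) (i b k d : Idx n) :
    f (rllLeft q x i b k d) = rllLeft q (fun i j => f (x i j)) i b k d := by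
  simp [rllLeft, map_sum]

lemma map_rllRight {A B : Type*} [Ring A] [Algebra K A] [Ring B] [Algebra K B] (f : A →ₐ[K] B)
    (x : Idx n → Idx n → A) (i b k d : Idx n) :
    f (rllRight q x i b k d) = rllRight q (fun i j => f (x i j)) i b k d := by
  simp [rllRight, map_sum]

lemma IsRep.map {A B : Type*} [Ring A] [Algebra K A] [Ring B] [Algebra K B] (f : A →ₐ[K] B)
    {x : Idx n → Idx n → A} (h : IsRep q x) : IsRep q fun i j => f (x i j) where
  tri i j hij := by rw [h.tri i j hij, map_zero]
  diag i := by rw [← map_mul, h.diag, map_one]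
  rll i b k d := by rw [← map_rllLeft, ← map_rllRight, h.rll]

variable (q n) in
lemma isRep_uu : IsRep q (uu q (n := n)) where
  tri i j h := by rw [uu, uF_of_lt h, map_zero]
  diag i := by
    rw [uu, uu, ← map_mul, ← map_one (Uq.proj q n)]
    exact RingQuot.mkAlgHom_rel K (URel.diag i)
  rll i b k d := by
    have := RingQuot.mkAlgHom_rel K (URel.rll (q := q) i b k d)
    rw [arr_left, arr_right] at this
    have h' : Uq.proj q n (rllLeft q uF i b k d) = Uq.proj q n (rllRight q uF i b k d) := this
    rwa [map_rllLeft, map_rllRight] at h'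

/-- A family satisfying the defining relations extends to a homomorphism from `U_q(𝔮_n)`. -/
def Uq.lift {B : Type*} [Ring B] [Algebra K B] (x : Idx n → Idx n → B) (h : IsRep q x) :
    Uq q n →ₐ[K] B :=
  RingQuot.liftAlgHom K ⟨FreeAlgebra.lift K fun g => x g.1.1 g.1.2, by
    have hu : ∀ i j : Idx n,
        FreeAlgebra.lift K (fun g : {ij : Idx n × Idx n // ij.1 ≤ ij.2} => x g.1.1 g.1.2) (uF i j)
          = x i j := by
      intro i j
      unfold uF
      split_ifs with hij
      · simp
      · rw [map_zero, h.tri i j (not_le.1 hij)]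
    intro a b hab
    cases hab with
    | diag i => rw [map_mul, hu, hu, h.diag, map_one]
    | rll i j k l =>
      rw [arr_left, arr_right, map_rllLeft, map_rllRight]
      simp only [hu]
      exact h.rll i j k l⟩

lemma Uq.lift_uu {B : Type*} [Ring B] [Algebra K B] (x : Idx n → Idx n → B) (h : IsRep q x)
    (i j : Idx n) : Uq.lift x h (uu q i j) = x i j := by
  have : Uq.lift x h (uu q i j) =
      FreeAlgebra.lift K (fun g : {ij : Idx n × Idx n // ij.1 ≤ ij.2} => x g.1.1 g.1.2) (uF i j) :=
    RingQuot.liftAlgHom_mkAlgHom_apply _ _ _ _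
  rw [this]
  unfold uF
  split_ifs with hij
  · simp
  · rw [map_zero, h.tri i j (not_le.1 hij)]

/-- Induction principle: `U_q(𝔮_n)` is spanned by products of generators. -/
lemma Uq.induction {P : Uq q n → Prop} (one : P 1) (gen : ∀ i j x, P x → P (uu q i j * x))
    (add : ∀ x y, P x → P y → P (x + y)) (smul : ∀ (c : K) x, P x → P (c • x)) (x : Uq q n) :
    P x := by
  obtain ⟨y, rfl⟩ : ∃ y, Uq.proj q n y = x := RingQuot.mkAlgHom_surjective K _ x
  have key : ∀ a : FreeU K n, ∀ z, P z → P (Uq.proj q n a * z) := by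
    intro a
    induction a using FreeAlgebra.induction with
    | grade0 r => intro z hz; rw [AlgHom.commutes, ← Algebra.smul_def]; exact smul r z hz
    | grade1 g =>
      intro z hz
      have h : uu q g.1.1 g.1.2 = Uq.proj q n (FreeAlgebra.ι K g) := by
        rw [uu, uF, dif_pos g.2]
      rw [← h]; exact gen _ _ z hz
    | mul a b ha hb => intro z hz; rw [map_mul, mul_assoc]; exact ha _ (hb _ hz)
    | add a b ha hb => intro z hz; rw [map_add, add_mul]; exact add _ _ (ha z hz) (hb z hz)
  have := key y 1 one
  rwa [mul_one] at this

end Uq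

/-! ### Commutation relations without signs, and the antipode -/

section Untwist

variable {K : Type} [Field K] {q : Kˣ} {n : ℕ} {B : Type*} [Ring B] [Algebra K B]

/-- The left-hand side of the quadratic relation as an ordinary matrix identity. -/
def mrllLeft (q : Kˣ) (y : Idx n → Idx n → B) (i b k d : Idx n) : B :=
  ∑ j, ∑ l, ((sg (par₂ k l * par j) : K) * ((sg (par₂ l d * par b) : K) * theta q j b l d)) •
    (y i j * y k l)

/-- The right-hand side of the quadratic relation as an ordinary matrix identity. -/
def mrllRight (q : Kˣ) (y : Idx n → Idx n → B) (i b k d : Idx n) : B :=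
  ∑ j, ∑ l, (((sg (par₂ k l * par j) : K) * theta q i j k l) * (sg (par₂ l d * par j) : K)) •
    (y l d * y j b)

/-- The quadratic relation as an ordinary matrix identity. -/
def IsMRep (q : Kˣ) (y : Idx n → Idx n → B) : Prop :=
  ∀ i b k d, mrllLeft q y i b k d = mrllRight q y i b k d

lemma IsMRep.map {A : Type*} [Ring A] [Algebra K A] (f : B →ₐ[K] A) {y : Idx n → Idx n → B}
    (h : IsMRep q y) : IsMRep q fun i j => f (y i j) := by
  intro i b k d
  have := congrArg f (h i b k d)
  simpa [mrllLeft, mrllRight, map_sum] using this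

/-- Powers of an involution with exponent in `ℤ/2`. -/
def ipow {B : Type*} [Monoid B] (s : B) (p : ZMod 2) : B := if p = 0 then 1 else s

lemma ipow_zero {B : Type*} [Monoid B] (s : B) : ipow s 0 = 1 := rfl
lemma ipow_one {B : Type*} [Monoid B] (s : B) : ipow s 1 = s := rfl

lemma zmod2_cases (p : ZMod 2) : p = 0 ∨ p = 1 := by revert p; decide

lemma ipow_add {B : Type*} [Monoid B] {s : B} (hs : s * s = 1) (p r : ZMod 2) :
    ipow s p * ipow s r = ipow s (p + r) := by
  rcases zmod2_cases p with rfl | rfl <;> rcases zmod2_cases r with rfl | rfl <;>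
    simp [ipow_zero, ipow_one, hs, show (1 : ZMod 2) + 1 = 0 from rfl]

lemma ipow_mul_self {B : Type*} [Monoid B] {s : B} (hs : s * s = 1) (p : ZMod 2) :
    ipow s p * ipow s p = 1 := by
  rw [ipow_add hs, CharTwo.add_self_eq_zero, ipow_zero]

lemma sgK_mul_self {K : Type} [Ring K] (p : ZMod 2) : (sg p : K) * (sg p : K) = 1 := by
  rw [← Int.cast_mul, sg_mul_self, Int.cast_one]

lemma ipow_comm {s x : B} {a : ZMod 2} (h : s * x = (sg a : K) • (x * s)) (p : ZMod 2) :
    ipow s p * x = (sg (p * a) : K) • (x * ipow s p) := by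
  rcases zmod2_cases p with rfl | rfl
  · simp [ipow_zero, sg_zero]
  · simp [ipow_one, h]

lemma twist_mul {s : B} (hs : s * s = 1) {x : Idx n → Idx n → B}
    (hx : ∀ i j, s * x i j = (sg (par₂ i j) : K) • (x i j * s)) (i j k l : Idx n) :
    x i j * ipow s (par₂ i j) * (x k l * ipow s (par₂ k l)) =
      (sg (par₂ i j * par₂ k l) : K) • (x i j * x k l * ipow s (par₂ i j + par₂ k l)) := by
  rw [mul_assoc, ← mul_assoc (ipow s _), ipow_comm (hx k l), smul_mul_assoc, mul_smul_comm,
    mul_assoc (x k l), ipow_add hs, mul_assoc]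

lemma mrllLeft_twist {s : B} (hs : s * s = 1) {x : Idx n → Idx n → B}
    (hx : ∀ i j, s * x i j = (sg (par₂ i j) : K) • (x i j * s)) (i b k d : Idx n) :
    mrllLeft q (fun i j => x i j * ipow s (par₂ i j)) i b k d =
      (sg (par b * par₂ k d) : K) • (rllLeft q x i b k d * ipow s (par₂ i b + par₂ k d)) := by
  unfold mrllLeft rllLeft
  simp only [Finset.sum_mul, Finset.smul_sum]
  refine Finset.sum_congr rfl fun j _ => Finset.sum_congr rfl fun l _ => ?_
  by_cases h0 : theta q j b l d = 0
  · simp [h0]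
  have h1 := theta_even q _ _ _ _ h0
  rw [twist_mul hs hx, smul_mul_assoc, smul_smul, smul_smul]
  have e1 : par₂ i j + par₂ k l = par₂ i b + par₂ k d := by
    revert h1
    simp only [par₂]
    generalize par i = a1; generalize par j = a2; generalize par k = a3
    generalize par l = a4; generalize par b = a5; generalize par d = a6
    revert a1 a2 a3 a4 a5 a6; decide
  rw [e1]
  congr 1
  have e2 : (sg (par₂ k l * par j) : K) * (sg (par₂ l d * par b) : K) *
      (sg (par₂ i j * par₂ k l) : K) =
      (sg (par b * par₂ k d) : K) * (sg (par₂ k l * par₂ i b) : K) := by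
    rw [← sgK_add, ← sgK_add, ← sgK_add]
    congr 2
    simp only [par₂]
    generalize par i = a1; generalize par j = a2; generalize par k = a3
    generalize par l = a4; generalize par b = a5; generalize par d = a6
    revert a1 a2 a3 a4 a5 a6; decide
  linear_combination (theta q j b l d) * e2

lemma mrllRight_twist {s : B} (hs : s * s = 1) {x : Idx n → Idx n → B}
    (hx : ∀ i j, s * x i j = (sg (par₂ i j) : K) • (x i j * s)) (i b k d : Idx n) :
    mrllRight q (fun i j => x i j * ipow s (par₂ i j)) i b k d =
      (sg (par b * par₂ k d) : K) • (rllRight q x i b k d * ipow s (par₂ i b + par₂ k d)) := by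
  unfold mrllRight rllRight
  simp only [Finset.sum_mul, Finset.smul_sum]
  refine Finset.sum_congr rfl fun j _ => Finset.sum_congr rfl fun l _ => ?_
  by_cases h0 : theta q i j k l = 0
  · simp [h0]
  have h1 := theta_even q _ _ _ _ h0
  rw [twist_mul hs hx, smul_mul_assoc, smul_smul, smul_smul]
  have e1 : par₂ l d + par₂ j b = par₂ i b + par₂ k d := by
    revert h1
    simp only [par₂]
    generalize par i = a1; generalize par j = a2; generalize par k = a3
    generalize par l = a4; generalize par b = a5; generalize par d = a6
    revert a1 a2 a3 a4 a5 a6; decide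
  rw [e1]
  congr 1
  have e2 : (sg (par₂ k l * par j) : K) * (sg (par₂ l d * par j) : K) *
      (sg (par₂ l d * par₂ j b) : K) =
      (sg (par b * par₂ k d) : K) * (sg (par₂ k l * par₂ j b) : K) := by
    rw [← sgK_add, ← sgK_add, ← sgK_add]
    congr 2
    simp only [par₂]
    generalize par j = a2; generalize par k = a3
    generalize par l = a4; generalize par b = a5; generalize par d = a6
    revert a2 a3 a4 a5 a6; decide
  linear_combination (theta q i j k l) * e2

lemma isMRep_twist_iff {s : B} (hs : s * s = 1) {x : Idx n → Idx n → B}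
    (hx : ∀ i j, s * x i j = (sg (par₂ i j) : K) • (x i j * s)) :
    IsMRep q (fun i j => x i j * ipow s (par₂ i j)) ↔
      ∀ i b k d, rllLeft q x i b k d = rllRight q x i b k d := by
  refine forall_congr' fun i => forall_congr' fun b => forall_congr' fun k =>
    forall_congr' fun d => ?_
  rw [mrllLeft_twist hs hx, mrllRight_twist hs hx]
  constructor
  · intro h
    have h' := congrArg (fun t => (sg (par b * par₂ k d) : K) • t * ipow s (par₂ i b + par₂ k d)) h
    simpa [smul_smul, sgK_mul_self, mul_assoc, ipow_mul_self hs] using h'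
  · intro h; rw [h]

/-! Matrix form. -/

/-- `L¹²` as an ordinary matrix. -/
def Y1 (y : Matrix (Idx n) (Idx n) B) : Matrix (Idx n × Idx n) (Idx n × Idx n) B :=
  fun a c => if a.2 = c.2 then y a.1 c.1 else 0

/-- `L¹³` as an ordinary matrix. -/
def Y2 (K : Type) [Field K] [Algebra K B] (y : Matrix (Idx n) (Idx n) B) :
    Matrix (Idx n × Idx n) (Idx n × Idx n) B :=
  fun a c => if a.1 = c.1 then (sg (par₂ a.2 c.2 * par c.1) : K) • y a.2 c.2 else 0

variable (B) in
/-- `Θ` as an ordinary matrix. -/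
def RM (q : Kˣ) : Matrix (Idx n × Idx n) (Idx n × Idx n) B :=
  fun a c => algebraMap K B ((sg (par₂ a.2 c.2 * par c.1) : K) * theta q a.1 c.1 a.2 c.2)

lemma Y1_mul (y w : Matrix (Idx n) (Idx n) B) : Y1 (y * w) = Y1 y * Y1 w := by
  ext ⟨i, k⟩ ⟨j, l⟩
  simp only [Y1, Matrix.mul_apply, Fintype.sum_prod_type]
  by_cases h : k = l
  · subst h
    simp only [if_true]
    refine Finset.sum_congr rfl fun s _ => ?_
    rw [Finset.sum_eq_single k]
    · simp
    · intro b _ hb; simp [hb.symm]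
    · simp
  · rw [if_neg h, Finset.sum_eq_zero]
    intro s _
    refine Finset.sum_eq_zero fun t _ => ?_
    by_cases h' : k = t
    · subst h'; simp [h]
    · simp [h']

lemma Y1_one : Y1 (1 : Matrix (Idx n) (Idx n) B) = 1 := by
  ext ⟨i, k⟩ ⟨j, l⟩
  simp only [Y1, Matrix.one_apply, Prod.mk.injEq]
  split_ifs <;> simp_all

lemma Y2_mul (y w : Matrix (Idx n) (Idx n) B) : Y2 K (y * w) = Y2 K y * Y2 K w := by
  ext ⟨i, k⟩ ⟨j, l⟩
  simp only [Y2, Matrix.mul_apply, Fintype.sum_prod_type]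
  by_cases h : i = j
  · subst h
    rw [if_pos rfl, Finset.smul_sum]
    symm
    rw [Finset.sum_eq_single i]
    · refine Finset.sum_congr rfl fun t _ => ?_
      rw [if_pos rfl, if_pos rfl, smul_mul_assoc, mul_smul_comm, smul_smul, ← sgK_add]
      congr 4
      simp only [par₂]
      generalize par i = a1; generalize par k = a3
      generalize par l = a4; generalize par t = a5
      revert a1 a3 a4 a5; decide
    · intro b _ hb
      exact Finset.sum_eq_zero fun t _ => by simp [hb.symm]
    · simp
  · rw [if_neg h, Finset.sum_eq_zero]
    intro s _
    refine Finset.sum_eq_zero fun t _ => ?_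
    by_cases h' : i = s
    · subst h'; simp [h]
    · simp [h']

lemma Y2_one : Y2 K (1 : Matrix (Idx n) (Idx n) B) = 1 := by
  ext ⟨i, k⟩ ⟨j, l⟩
  simp only [Y2, Matrix.one_apply, Prod.mk.injEq]
  by_cases h : k = l
  · subst h; simp [par₂_self, sg_zero]
  · simp [h]

lemma Y1_mul_Y2 (y w : Matrix (Idx n) (Idx n) B) (i k j l : Idx n) :
    (Y1 y * Y2 K w) (i, k) (j, l) = (sg (par₂ k l * par j) : K) • (y i j * w k l) := by
  simp only [Y1, Y2, Matrix.mul_apply, Fintype.sum_prod_type]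
  rw [Finset.sum_eq_single j, Finset.sum_eq_single k]
  · simp
  · intro b _ hb; simp [hb.symm]
  · simp
  · intro b _ hb; simp [hb]
  · simp

lemma Y2_mul_Y1 (y w : Matrix (Idx n) (Idx n) B) (i k j l : Idx n) :
    (Y2 K w * Y1 y) (i, k) (j, l) = (sg (par₂ k l * par i) : K) • (w k l * y i j) := by
  simp only [Y1, Y2, Matrix.mul_apply, Fintype.sum_prod_type]
  rw [Finset.sum_eq_single i, Finset.sum_eq_single l]
  · simp
  · intro b _ hb; simp [hb]
  · simp
  · intro b _ hb; simp [hb.symm]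
  · simp

lemma isMRep_iff (y : Matrix (Idx n) (Idx n) B) :
    IsMRep q y ↔ Y1 y * Y2 K y * RM B q = RM B q * (Y2 K y * Y1 y) := by
  have hl : ∀ i k b d, (Y1 y * Y2 K y * RM B q : Matrix (Idx n × Idx n) (Idx n × Idx n) B)
      (i, k) (b, d) = mrllLeft q y i b k d := by
    intro i k b d
    rw [Matrix.mul_apply, Fintype.sum_prod_type]; unfold mrllLeft
    refine Finset.sum_congr rfl fun j _ => Finset.sum_congr rfl fun l _ => ?_
    rw [Y1_mul_Y2, RM, ← Algebra.commutes, ← Algebra.smul_def, smul_smul, mul_comm]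
  have hr : ∀ i k b d, (RM B q * (Y2 K y * Y1 y) : Matrix (Idx n × Idx n) (Idx n × Idx n) B)
      (i, k) (b, d) = mrllRight q y i b k d := by
    intro i k b d
    rw [Matrix.mul_apply, Fintype.sum_prod_type]; unfold mrllRight
    refine Finset.sum_congr rfl fun j _ => Finset.sum_congr rfl fun l _ => ?_
    rw [Y2_mul_Y1, RM, ← Algebra.smul_def, smul_smul]
  constructor
  · intro h
    ext ⟨i, k⟩ ⟨b, d⟩
    rw [hl, hr, h]
  · intro h i b k d
    rw [← hl, ← hr, h]

end Untwist

section Antipode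

variable {K : Type} [Field K] {q : Kˣ} {n : ℕ}

lemma idx_neg_neg (i : Idx n) : - -i = i := Subtype.ext (neg_neg i.1)

/-- The matrix of a family of elements. -/
def fam {B : Type*} (x : Idx n → Idx n → B) : Matrix (Idx n) (Idx n) B := fun i j => x i j

lemma pow_strict {B : Type*} [Ring B] (N : Matrix (Idx n) (Idx n) B)
    (hN : ∀ i j : Idx n, ¬ i < j → N i j = 0) (m : ℕ) :
    ∀ i j : Idx n, ¬ (i.1 + m ≤ j.1) → (N ^ m) i j = 0 := by
  induction m with
  | zero =>
    intro i j h
    rw [pow_zero, Matrix.one_apply_ne]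
    rintro rfl; simp at h
  | succ m ih =>
    intro i j h
    rw [pow_succ, Matrix.mul_apply]
    refine Finset.sum_eq_zero fun k _ => ?_
    by_cases h1 : i.1 + m ≤ k.1
    · rw [hN k j, mul_zero]
      intro h2
      have h3 : k.1 < j.1 := h2
      push_cast at h
      omega
    · rw [ih i k h1, zero_mul]

/-- A matrix satisfying the triangularity and diagonal relations is invertible, and its inverse is
upper triangular with the opposite diagonal entries. -/
lemma IsRep.inverse {B : Type*} [Ring B] [Algebra K B] {x : Idx n → Idx n → B}
    (h : IsRep q x) : ∃ w : Matrix (Idx n) (Idx n) B, fam x * w = 1 ∧ w * fam x = 1 ∧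
      (∀ i j, j < i → w i j = 0) ∧ ∀ i, w i i = x (-i) (-i) := by
  set D : Matrix (Idx n) (Idx n) B := Matrix.diagonal fun i => x (-i) (-i) with hD
  set D' : Matrix (Idx n) (Idx n) B := Matrix.diagonal fun i => x i i with hD'
  have hd : ∀ i : Idx n, x (-i) (-i) * x i i = 1 := fun i => by
    have := h.diag (-i)
    rwa [idx_neg_neg] at this
  have hDD : D * D' = 1 := by
    rw [hD, hD', Matrix.diagonal_mul_diagonal, ← Matrix.diagonal_one]
    congr 1; funext i; exact hd i
  have hDD' : D' * D = 1 := by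
    rw [hD, hD', Matrix.diagonal_mul_diagonal, ← Matrix.diagonal_one]
    congr 1; funext i; exact h.diag i
  set N : Matrix (Idx n) (Idx n) B := 1 - D * fam x with hNdef
  have hN : ∀ i j : Idx n, ¬ i < j → N i j = 0 := by
    intro i j hij
    rw [hNdef, Matrix.sub_apply, hD, Matrix.diagonal_mul]
    rcases eq_or_lt_of_le (not_lt.1 hij) with rfl | hlt
    · rw [Matrix.one_apply_eq, fam, hd, sub_self]
    · rw [Matrix.one_apply_ne hlt.ne', fam, h.tri _ _ hlt, mul_zero, sub_self]
  have hpow : N ^ (2 * n + 1) = 0 := by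
    ext i j
    rw [pow_strict N hN, Matrix.zero_apply]
    have hi := i.2
    have hj := j.2
    simp only [Finset.mem_erase, Finset.mem_Icc] at hi hj
    push_cast
    omega
  set G := ∑ m ∈ Finset.range (2 * n + 1), N ^ m with hG
  have hDx : D * fam x = 1 - N := by rw [hNdef]; abel
  have h1 : G * (1 - N) = 1 := by
    rw [hG, geom_sum_mul_neg, hpow, sub_zero]
  have h2 : (1 - N) * G = 1 := by
    rw [hG, mul_neg_geom_sum, hpow, sub_zero]
  have hGtri : ∀ i j : Idx n, G i j = if i = j then 1 else G i j := by
    intro i j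
    split_ifs with hij
    · subst hij
      rw [hG, Matrix.sum_apply, Finset.sum_eq_single 0]
      · simp
      · intro m _ hm
        apply pow_strict N hN
        have : (0 : ℤ) < m := by exact_mod_cast Nat.pos_of_ne_zero hm
        omega
      · simp
    · rfl
  have hGlow : ∀ i j : Idx n, j < i → G i j = 0 := by
    intro i j hij
    rw [hG, Matrix.sum_apply]
    refine Finset.sum_eq_zero fun m _ => pow_strict N hN m i j ?_
    have h3 : j.1 < i.1 := hij
    omega
  refine ⟨G * D, ?_, ?_, ?_, ?_⟩
  · have : fam x = D' * (1 - N) := by rw [← hDx, ← mul_assoc, hDD', one_mul]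
    rw [this, mul_assoc, ← mul_assoc (1 - N), h2, one_mul, hDD']
  · rw [mul_assoc, hDx, h1]
  · intro i j hij
    rw [hD, Matrix.mul_diagonal, hGlow i j hij, zero_mul]
  · intro i
    rw [hD, Matrix.mul_diagonal, hGtri, if_pos rfl, one_mul]

variable (q n) in
/-- The inverse of the upper triangular matrix `L = (u_ij)` over `U_q(𝔮_n)`. -/
def Linv : Matrix (Idx n) (Idx n) (Uq q n) := Ring.inverse (fam (uu q))

lemma Linv_eq {w : Matrix (Idx n) (Idx n) (Uq q n)} (h1 : fam (uu q) * w = 1)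
    (h2 : w * fam (uu q) = 1) : Linv q n = w := by
  have : (⟨fam (uu q), w, h1, h2⟩ : (Matrix (Idx n) (Idx n) (Uq q n))ˣ).1 = fam (uu q) := rfl
  rw [Linv, ← this, Ring.inverse_unit]
  rfl

lemma L_mul_Linv : fam (uu q) * Linv q n = 1 := by
  obtain ⟨w, h1, h2, -, -⟩ := (isRep_uu q n).inverse
  rw [Linv_eq h1 h2, h1]

lemma Linv_mul_L : Linv q n * fam (uu q) = 1 := by
  obtain ⟨w, h1, h2, -, -⟩ := (isRep_uu q n).inverse
  rw [Linv_eq h1 h2, h2]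

lemma Linv_lower {i j : Idx n} (h : j < i) : Linv q n i j = 0 := by
  obtain ⟨w, h1, h2, h3, -⟩ := (isRep_uu q n).inverse
  rw [Linv_eq h1 h2, h3 i j h]

lemma Linv_diag (i : Idx n) : Linv q n i i = uu q (-i) (-i) := by
  obtain ⟨w, h1, h2, -, h4⟩ := (isRep_uu q n).inverse
  rw [Linv_eq h1 h2, h4]

lemma isRep_parity : IsRep q fun i j : Idx n => (sg (par₂ i j) : K) • uu q i j where
  tri i j h := by rw [(isRep_uu q n).tri i j h, smul_zero]
  diag i := by
    rw [par₂_self, par₂_self, sg_zero]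
    simpa using (isRep_uu q n).diag i
  rll i b k d := by
    have hl : rllLeft q (fun i j : Idx n => (sg (par₂ i j) : K) • uu q i j) i b k d =
        (sg (par₂ i b + par₂ k d) : K) • rllLeft q (uu q) i b k d := by
      unfold rllLeft
      simp only [Finset.smul_sum]
      refine Finset.sum_congr rfl fun j _ => Finset.sum_congr rfl fun l _ => ?_
      by_cases h0 : theta q j b l d = 0
      · simp [h0]
      have h1 := theta_even q _ _ _ _ h0
      have e1 : par₂ i j + par₂ k l = par₂ i b + par₂ k d := by
        revert h1
        simp only [par₂]
        generalize par i = a1; generalize par j = a2; generalize par k = a3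
        generalize par l = a4; generalize par b = a5; generalize par d = a6
        revert a1 a2 a3 a4 a5 a6; decide
      rw [← e1, sgK_add (par₂ i j) (par₂ k l)]
      simp only [smul_mul_assoc, mul_smul_comm, smul_smul]
      congr 1; ring
    have hr : rllRight q (fun i j : Idx n => (sg (par₂ i j) : K) • uu q i j) i b k d =
        (sg (par₂ i b + par₂ k d) : K) • rllRight q (uu q) i b k d := by
      unfold rllRight
      simp only [Finset.smul_sum]
      refine Finset.sum_congr rfl fun j _ => Finset.sum_congr rfl fun l _ => ?_
      by_cases h0 : theta q i j k l = 0
      · simp [h0]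
      have h1 := theta_even q _ _ _ _ h0
      have e1 : par₂ l d + par₂ j b = par₂ i b + par₂ k d := by
        revert h1
        simp only [par₂]
        generalize par i = a1; generalize par j = a2; generalize par k = a3
        generalize par l = a4; generalize par b = a5; generalize par d = a6
        revert a1 a2 a3 a4 a5 a6; decide
      rw [← e1, sgK_add (par₂ l d) (par₂ j b)]
      simp only [smul_mul_assoc, mul_smul_comm, smul_smul]
      congr 1; ring
    rw [hl, hr, (isRep_uu q n).rll]

variable (q n) in
/-- The parity automorphism of `U_q(𝔮_n)`. -/
def Uq.sigma : Uq q n →ₐ[K] Uq q n := Uq.lift _ isRep_parity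

lemma Uq.sigma_uu (i j : Idx n) :
    Uq.sigma q n (uu q i j) = (sg (par₂ i j) : K) • uu q i j := Uq.lift_uu _ _ _ _

lemma Uq.sigma_sigma (x : Uq q n) : Uq.sigma q n (Uq.sigma q n x) = x := by
  induction x using Uq.induction with
  | one => simp
  | gen i j x ih =>
    rw [map_mul, map_mul, ih, sigma_uu, map_smul, sigma_uu, smul_smul, sgK_mul_self, one_smul]
  | add x y hx hy => rw [map_add, map_add, hx, hy]
  | smul c x hx => rw [map_smul, map_smul, hx]

lemma sigma_Linv (i j : Idx n) :
    Uq.sigma q n (Linv q n i j) = (sg (par₂ i j) : K) • Linv q n i j := by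
  set E : Matrix (Idx n) (Idx n) (Uq q n) :=
    Matrix.diagonal fun i => algebraMap K _ (sg (par i) : K) with hE
  have hEE : E * E = 1 := by
    rw [hE, Matrix.diagonal_mul_diagonal, ← Matrix.diagonal_one]
    congr 1; funext i
    rw [← map_mul, sgK_mul_self, map_one]
  have conj : ∀ (w : Matrix (Idx n) (Idx n) (Uq q n)) (i j : Idx n),
      (E * w * E) i j = (sg (par₂ i j) : K) • w i j := by
    intro w i j
    rw [hE, Matrix.mul_diagonal, Matrix.diagonal_mul, mul_assoc, ← Algebra.commutes, ← mul_assoc,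
      ← map_mul, ← sgK_add, ← Algebra.smul_def]
  have hL : (fam (uu q)).map (Uq.sigma q n) = E * fam (uu q) * E := by
    ext i j
    rw [conj, Matrix.map_apply, fam, Uq.sigma_uu]
  have h1 : (fam (uu q)).map (Uq.sigma q n) * (Linv q n).map (Uq.sigma q n) = 1 := by
    rw [← Matrix.map_mul, L_mul_Linv, Matrix.map_one _ (map_zero _) (map_one _)]
  have h2 : (E * Linv q n * E) * (E * fam (uu q) * E) = 1 := by
    calc (E * Linv q n * E) * (E * fam (uu q) * E)
        = E * (Linv q n * ((E * E) * fam (uu q))) * E := by simp only [mul_assoc]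
      _ = 1 := by rw [hEE, one_mul, Linv_mul_L, mul_one, hEE]
  have h3 : (Linv q n).map (Uq.sigma q n) = E * Linv q n * E := by
    rw [hL] at h1
    exact (left_inv_eq_right_inv h2 h1).symm
  have := congrFun (congrFun h3 i) j
  rwa [conj] at this

end Antipode

section Antipode

variable {K : Type} [Field K] {q : Kˣ} {n : ℕ}

open MulOpposite

variable (q n) in
/-- The parity automorphism as a linear map. -/
abbrev Uq.sig : Module.End K (Uq q n) := (Uq.sigma q n).toLinearMap

lemma Uq.sig_sig : Uq.sig q n * Uq.sig q n = 1 := by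
  ext x; exact Uq.sigma_sigma x

lemma Uq.ipow_sig {p r : ZMod 2} {x : Uq q n} (hx : Uq.sigma q n x = (sg r : K) • x) :
    ipow (Uq.sig q n) p x = (sg (p * r) : K) • x := by
  rcases zmod2_cases p with rfl | rfl
  · simp [ipow_zero, sg_zero]
  · simpa [ipow_one] using hx

lemma par_tri {i j k : Idx n} (h : i ≤ j) (h' : j ≤ k) : par₂ i j * par₂ j k = 0 := by
  have h1 : i.1 ≤ j.1 := h
  have h2 : j.1 ≤ k.1 := h'
  unfold par₂ par
  split_ifs <;> first | omega | decide

/-- Left multiplication. -/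
abbrev lmul : Uq q n →ₐ[K] Module.End K (Uq q n) := Algebra.lmul K (Uq q n)

/-- Right multiplication. -/
abbrev rmul : (Uq q n)ᵐᵒᵖ →ₐ[K] Module.End K (Uq q n) := Algebra.lsmul K K (Uq q n)

lemma sig_lmul (x : Uq q n) {a : ZMod 2} (h : Uq.sigma q n x = (sg a : K) • x) :
    Uq.sig q n * lmul x = (sg a : K) • (lmul x * Uq.sig q n) := by
  ext y; simp [h]

lemma sig_rmul (x : Uq q n) {a : ZMod 2} (h : Uq.sigma q n x = (sg a : K) • x) :
    Uq.sig q n * rmul (op x) = (sg a : K) • (rmul (op x) * Uq.sig q n) := by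
  ext y; simp [h]

lemma lmul_ipow_mul (A C : Matrix (Idx n) (Idx n) (Uq q n)) (hA : ∀ i j, j < i → A i j = 0)
    (hC : ∀ i j, j < i → C i j = 0)
    (hC' : ∀ i j, Uq.sigma q n (C i j) = (sg (par₂ i j) : K) • C i j) (h : A * C = 1) :
    fam (fun i j => lmul (A i j) * ipow (Uq.sig q n) (par₂ i j)) *
      fam (fun i j => lmul (C i j) * ipow (Uq.sig q n) (par₂ i j)) = 1 := by
  ext1 i k
  have : ∀ j, lmul (A i j) * ipow (Uq.sig q n) (par₂ i j) *
      (lmul (C j k) * ipow (Uq.sig q n) (par₂ j k)) =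
      lmul (A i j * C j k) * ipow (Uq.sig q n) (par₂ i k) := by
    intro j
    by_cases h1 : j < i
    · rw [hA _ _ h1]; simp
    by_cases h2 : k < j
    · rw [hC _ _ h2]; simp
    rw [mul_assoc, ← mul_assoc (ipow _ _), ipow_comm (sig_lmul _ (hC' j k)),
      par_tri (not_lt.1 h1) (not_lt.1 h2), sg_zero, Int.cast_one, one_smul, mul_assoc (lmul (C j k)),
      ipow_add Uq.sig_sig, ← mul_assoc, ← map_mul]
    congr 2
    simp only [par₂]
    generalize par i = a1; generalize par j = a2; generalize par k = a3
    revert a1 a2 a3; decide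
  rw [Matrix.mul_apply]
  simp only [fam, this]
  rw [← Finset.sum_mul, ← map_sum, ← Matrix.mul_apply, h]
  by_cases hik : i = k
  · subst hik; rw [Matrix.one_apply_eq, Matrix.one_apply_eq, par₂_self, ipow_zero, map_one, one_mul]
  · rw [Matrix.one_apply_ne hik, Matrix.one_apply_ne hik, map_zero, zero_mul]

/-- The entries of the inverse matrix satisfy the quadratic relation in the opposite algebra. -/
lemma isMRep_Linv : IsMRep q (fun i j : Idx n => op (Linv q n i j)) := by
  set y : Matrix (Idx n) (Idx n) (Module.End K (Uq q n)) :=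
    fam (fun i j => lmul (uu q i j) * ipow (Uq.sig q n) (par₂ i j)) with hy
  set w : Matrix (Idx n) (Idx n) (Module.End K (Uq q n)) :=
    fam (fun i j => lmul (Linv q n i j) * ipow (Uq.sig q n) (par₂ i j)) with hw
  have hyw : y * w = 1 := lmul_ipow_mul (fam (uu q)) (Linv q n)
    (fun i j h => (isRep_uu q n).tri i j h) (fun i j h => Linv_lower h)
    (fun i j => sigma_Linv i j) L_mul_Linv
  have hwy : w * y = 1 := lmul_ipow_mul (Linv q n) (fam (uu q)) (fun i j h => Linv_lower h)
    (fun i j h => (isRep_uu q n).tri i j h)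
    (fun i j => Uq.sigma_uu i j) Linv_mul_L
  have hM : IsMRep q y := (isMRep_twist_iff Uq.sig_sig
    (fun i j => sig_lmul _ (Uq.sigma_uu i j))).2 ((isRep_uu q n).map lmul).rll
  rw [isMRep_iff] at hM
  have e1 : Y1 w * Y1 y = 1 := by rw [← Y1_mul, hwy, Y1_one]
  have e1' : Y1 y * Y1 w = 1 := by rw [← Y1_mul, hyw, Y1_one]
  have e2 : Y2 K w * Y2 K y = 1 := by rw [← Y2_mul, hwy, Y2_one]
  have e2' : Y2 K y * Y2 K w = 1 := by rw [← Y2_mul, hyw, Y2_one]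
  have key : RM _ q * (Y1 w * Y2 K w) = Y2 K w * Y1 w * RM _ q := by
    calc RM _ q * (Y1 w * Y2 K w)
        = Y2 K w * (Y1 w * Y1 y) * Y2 K y * RM _ q * (Y1 w * Y2 K w) := by
          rw [e1, mul_one, e2, one_mul]
      _ = Y2 K w * Y1 w * (Y1 y * Y2 K y * RM _ q) * (Y1 w * Y2 K w) := by
          simp only [mul_assoc]
      _ = Y2 K w * Y1 w * RM _ q * (Y2 K y * (Y1 y * Y1 w) * Y2 K w) := by
          rw [hM]; simp only [mul_assoc]
      _ = Y2 K w * Y1 w * RM _ q := by rw [e1', mul_one, e2', mul_one]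
  have ev : ∀ i j k l : Idx n, (w i j * w k l) 1 =
      (sg (par₂ i j * par₂ k l) : K) • (Linv q n i j * Linv q n k l) := by
    intro i j k l
    have h1 : ipow (Uq.sig q n) (par₂ k l) (1 : Uq q n) = 1 := by
      rw [Uq.ipow_sig (r := 0) (by simp [sg_zero])]; simp [sg_zero]
    change Linv q n i j * (ipow (Uq.sig q n) (par₂ i j) (Linv q n k l *
      ipow (Uq.sig q n) (par₂ k l) 1)) = _
    rw [h1, mul_one, Uq.ipow_sig (sigma_Linv k l), mul_smul_comm]
  intro i b k d
  have hl : ((RM _ q * (Y1 w * Y2 K w) : Matrix (Idx n × Idx n) (Idx n × Idx n) (Module.End K (Uq q n))) (i, k) (b, d)) 1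
      = ∑ j, ∑ l, ((sg (par₂ k l * par j) : K) * theta q i j k l *
        ((sg (par₂ l d * par b) : K) * (sg (par₂ j b * par₂ l d) : K))) •
          (Linv q n j b * Linv q n l d) := by
    rw [Matrix.mul_apply, Fintype.sum_prod_type]
    simp only [LinearMap.sum_apply]
    refine Finset.sum_congr rfl fun j _ => Finset.sum_congr rfl fun l _ => ?_
    rw [Y1_mul_Y2, RM, ← Algebra.smul_def, LinearMap.smul_apply, LinearMap.smul_apply, ev,
      smul_smul, smul_smul, mul_assoc]
  have hr : ((Y2 K w * Y1 w * RM _ q : Matrix (Idx n × Idx n) (Idx n × Idx n) (Module.End K (Uq q n))) (i, k) (b, d)) 1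
      = ∑ j, ∑ l, ((sg (par₂ l d * par b) : K) * theta q j b l d *
        ((sg (par₂ k l * par i) : K) * (sg (par₂ k l * par₂ i j) : K))) •
          (Linv q n k l * Linv q n i j) := by
    rw [Matrix.mul_apply, Fintype.sum_prod_type]
    simp only [LinearMap.sum_apply]
    refine Finset.sum_congr rfl fun j _ => Finset.sum_congr rfl fun l _ => ?_
    rw [Y2_mul_Y1, RM, ← Algebra.commutes, ← Algebra.smul_def, LinearMap.smul_apply,
      LinearMap.smul_apply, ev, smul_smul, smul_smul, mul_assoc]
  have h := congrArg (fun t : Module.End K (Uq q n) => op (t 1))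
    (congrFun (congrFun key (i, k)) (b, d))
  rw [hl, hr] at h
  simp only [Finset.op_sum, op_smul, op_mul] at h
  unfold mrllLeft mrllRight
  refine Eq.trans ?_ (h.symm.trans ?_)
  · refine Finset.sum_congr rfl fun j _ => Finset.sum_congr rfl fun l _ => ?_
    congr 1
    have e2 : (sg (par₂ k l * par i) : K) * (sg (par₂ k l * par₂ i j) : K) =
        (sg (par₂ k l * par j) : K) := by
      rw [← sgK_add]
      congr 2
      simp only [par₂]
      generalize par i = a1; generalize par j = a2; generalize par k = a3
      generalize par l = a4
      revert a1 a2 a3 a4; decide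
    linear_combination -(sg (par₂ l d * par b) : K) * theta q j b l d * e2
  · refine Finset.sum_congr rfl fun j _ => Finset.sum_congr rfl fun l _ => ?_
    congr 1
    have e2 : (sg (par₂ l d * par b) : K) * (sg (par₂ j b * par₂ l d) : K) =
        (sg (par₂ l d * par j) : K) := by
      rw [← sgK_add]
      congr 2
      simp only [par₂]
      generalize par b = a1; generalize par j = a2; generalize par d = a3
      generalize par l = a4
      revert a1 a2 a3 a4; decide
    linear_combination (sg (par₂ k l * par j) : K) * theta q i j k l * e2

lemma isRep_antipode : IsRep q
    (fun i j : Idx n => rmul (op (Linv q n i j)) * ipow (Uq.sig q n) (par₂ i j)) where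
  tri i j h := by rw [Linv_lower h]; simp
  diag i := by
    rw [par₂_self, par₂_self, ipow_zero, mul_one, mul_one, ← map_mul, ← op_mul, Linv_diag,
      Linv_diag, idx_neg_neg, (isRep_uu q n).diag, op_one, map_one]
  rll := by
    refine (isMRep_twist_iff (s := Uq.sig q n) Uq.sig_sig ?_).1 ?_
    · intro i j
      rw [← mul_assoc, sig_rmul _ (sigma_Linv i j), smul_mul_assoc, mul_assoc, mul_assoc]
      congr 2
      rcases zmod2_cases (par₂ i j) with h | h <;> rw [h] <;> simp [ipow_zero, ipow_one]
    · have : (fun i j : Idx n => rmul (op (Linv q n i j)) * ipow (Uq.sig q n) (par₂ i j) *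
          ipow (Uq.sig q n) (par₂ i j)) = fun i j => rmul (op (Linv q n i j)) := by
        funext i j
        rw [mul_assoc, ipow_mul_self Uq.sig_sig, mul_one]
      rw [this]
      exact isMRep_Linv.map rmul

variable (q n) in
/-- The antipode `S`: the linear map with `∑ S(u_ij) ⊗ E_ij = L⁻¹` and
`S(xy) = (-1)^{p(x) p(y)} S(y) S(x)`. -/
def Uq.antipode : Uq q n →ₗ[K] Uq q n :=
  (LinearMap.applyₗ (1 : Uq q n)).comp (Uq.lift _ isRep_antipode).toLinearMap

lemma Uq.antipode_one : Uq.antipode q n 1 = 1 := by simp [Uq.antipode]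

lemma Uq.antipode_uu_mul (i j : Idx n) (x : Uq q n) : Uq.antipode q n (uu q i j * x) =
    ipow (Uq.sig q n) (par₂ i j) (Uq.antipode q n x) * Linv q n i j := by
  simp [Uq.antipode, Uq.lift_uu]

lemma Uq.antipode_uu (i j : Idx n) : Uq.antipode q n (uu q i j) = Linv q n i j := by
  have h1 : ipow (Uq.sig q n) (par₂ i j) (1 : Uq q n) = 1 := by
    rw [Uq.ipow_sig (r := 0) (by simp [sg_zero])]; simp [sg_zero]
  have := Uq.antipode_uu_mul (q := q) i j 1
  rwa [mul_one, antipode_one, h1, one_mul] at this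

lemma Uq.ipow_sig_mul (p : ZMod 2) (x y : Uq q n) : ipow (Uq.sig q n) p (x * y) =
    ipow (Uq.sig q n) p x * ipow (Uq.sig q n) p y := by
  rcases zmod2_cases p with rfl | rfl
  · simp [ipow_zero]
  · simp [ipow_one]

lemma Uq.lift_antipode {p : ZMod 2} {x : Uq q n} (hx : x ∈ Uq.gr q n p) (y : Uq q n) :
    Uq.lift _ isRep_antipode x y = ipow (Uq.sig q n) p y * Uq.antipode q n x := by
  refine Submodule.span_induction (p := fun x _ => Uq.lift _ isRep_antipode x y =
    ipow (Uq.sig q n) p y * Uq.antipode q n x) ?_ ?_ ?_ ?_ hx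
  · rintro _ ⟨w, rfl, rfl⟩
    clear hx
    induction w with
    | nil => simp [antipode_one, ipow_zero]
    | cons g w ih =>
      simp only [List.map_cons, List.prod_cons, List.sum_cons]
      rw [map_mul, Module.End.mul_apply, ih, antipode_uu_mul, Uq.lift_uu,
        ← ipow_add Uq.sig_sig (par₂ g.1 g.2), Module.End.mul_apply, Module.End.mul_apply,
        Uq.ipow_sig_mul, ← mul_assoc]
      rfl
  · simp
  · intro a b _ _ ha hb
    rw [map_add, LinearMap.add_apply, ha, hb, map_add, mul_add]
  · intro c a _ ha
    rw [map_smul, LinearMap.smul_apply, ha, map_smul, mul_smul_comm]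

lemma Uq.sigma_gr {p : ZMod 2} {x : Uq q n} (hx : x ∈ Uq.gr q n p) :
    Uq.sigma q n x = (sg p : K) • x := by
  refine Submodule.span_induction (p := fun x _ => Uq.sigma q n x = (sg p : K) • x) ?_ ?_ ?_ ?_ hx
  · rintro _ ⟨w, rfl, rfl⟩
    clear hx
    induction w with
    | nil => simp [sg_zero]
    | cons g w ih =>
      simp only [List.map_cons, List.prod_cons, List.sum_cons]
      rw [map_mul, ih, sigma_uu, smul_mul_smul_comm, ← sgK_add]
  · simp
  · intro a b _ _ ha hb
    rw [map_add, ha, hb, smul_add]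
  · intro c a _ ha
    rw [map_smul, ha, smul_comm]

lemma Uq.sigma_antipode {p : ZMod 2} {x : Uq q n} (hx : x ∈ Uq.gr q n p) :
    Uq.sigma q n (Uq.antipode q n x) = (sg p : K) • Uq.antipode q n x := by
  have hs : ∀ x, Uq.sigma q n (Uq.antipode q n x) = Uq.antipode q n (Uq.sigma q n x) := by
    intro x
    induction x using Uq.induction with
    | one => simp [antipode_one]
    | gen i j x ih =>
      rw [antipode_uu_mul, map_mul, map_mul, sigma_uu, smul_mul_assoc, map_smul, antipode_uu_mul,
        ← ih, sigma_Linv, mul_smul_comm]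
      rcases zmod2_cases (par₂ i j) with h | h <;> simp [h, ipow_zero, ipow_one]
    | add x y hx hy => simp only [map_add, hx, hy]
    | smul c x hx => simp only [map_smul, hx]
  rw [hs, sigma_gr hx, map_smul]

/-- The antipode is an antihomomorphism of superalgebras. -/
lemma Uq.antipode_mul {p r : ZMod 2} {x y : Uq q n} (hx : x ∈ Uq.gr q n p)
    (hy : y ∈ Uq.gr q n r) : Uq.antipode q n (x * y) =
      (sg (p * r) : K) • (Uq.antipode q n y * Uq.antipode q n x) := by
  have : Uq.antipode q n (x * y) = Uq.lift _ isRep_antipode x (Uq.antipode q n y) := by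
    simp [Uq.antipode]
  rw [this, lift_antipode hx, ipow_sig (sigma_antipode hy), smul_mul_assoc]

end Antipode

/-! ### Supermodules -/

section SMod

variable {K : Type} [Field K]

/-- The parity involution `m ↦ (-1)^{p(m)} m` of a `ℤ/2`-graded vector space. -/
def invol {M : Type} [AddCommGroup M] [Module K M] (gr : ZMod 2 → Submodule K M)
    (h : IsCompl (gr 0) (gr 1)) : Module.End K M :=
  (gr 0).projection (gr 1) h - (gr 1).projection (gr 0) h.symm

lemma invol_mem {M : Type} [AddCommGroup M] [Module K M] {gr : ZMod 2 → Submodule K M}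
    (h : IsCompl (gr 0) (gr 1)) {p : ZMod 2} {m : M} (hm : m ∈ gr p) :
    invol gr h m = (sg p : K) • m := by
  rcases zmod2_cases p with rfl | rfl
  · rw [invol, LinearMap.sub_apply, Submodule.projection_apply_of_mem_left h hm,
      Submodule.projection_apply_of_mem_right h.symm hm]
    simp [sg_zero]
  · rw [invol, LinearMap.sub_apply, Submodule.projection_apply_of_mem_left h.symm hm,
      Submodule.projection_apply_of_mem_right h hm]
    simp [sg_one]

lemma ext_graded {M N : Type} [AddCommGroup M] [Module K M] [AddCommGroup N] [Module K N]
    {gr : ZMod 2 → Submodule K M} (h : IsCompl (gr 0) (gr 1)) {f g : M →ₗ[K] N}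
    (hfg : ∀ p, ∀ m ∈ gr p, f m = g m) : f = g := by
  ext m
  have hm : m ∈ gr 0 ⊔ gr 1 := by rw [h.sup_eq_top]; trivial
  obtain ⟨a, ha, b, hb, rfl⟩ := Submodule.mem_sup.1 hm
  rw [map_add, map_add, hfg 0 a ha, hfg 1 b hb]

lemma invol_mul_self {M : Type} [AddCommGroup M] [Module K M] {gr : ZMod 2 → Submodule K M}
    (h : IsCompl (gr 0) (gr 1)) : invol gr h * invol gr h = 1 := by
  refine ext_graded h fun p m hm => ?_
  rw [Module.End.mul_apply, invol_mem h hm, map_smul, invol_mem h hm, smul_smul, sgK_mul_self]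
  simp

/-- `U_q(𝔮_n)`-supermodules. -/
structure SMod (q : Kˣ) (n : ℕ) where
  carrier : Type
  [grp : AddCommGroup carrier]
  [mod : Module K carrier]
  gr : ZMod 2 → Submodule K carrier
  compl : IsCompl (gr 0) (gr 1)
  ρ : Uq q n →ₐ[K] Module.End K carrier
  ρ_mem : ∀ (a b : ZMod 2) (x : Uq q n) (m : carrier), x ∈ Uq.gr q n a → m ∈ gr b →
    ρ x m ∈ gr (a + b)

attribute [instance] SMod.grp SMod.mod

variable {q : Kˣ} {n : ℕ}

/-- The parity involution. -/
def SMod.sgn (M : SMod q n) : Module.End K M.carrier := invol M.gr M.compl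

/-- The action of the generators. -/
def SMod.x (M : SMod q n) (i j : Idx n) : Module.End K M.carrier := M.ρ (uu q i j)

namespace SMod

variable (M : SMod q n)

lemma sgn_mem {M : SMod q n} {p : ZMod 2} {m : M.carrier} (hm : m ∈ M.gr p) :
    M.sgn m = (sg p : K) • m := invol_mem _ hm

lemma sgn_sgn : M.sgn * M.sgn = 1 := invol_mul_self _

lemma isRep : IsRep q M.x := (isRep_uu q n).map M.ρ

lemma sgn_x (i j : Idx n) : M.sgn * M.x i j = (sg (par₂ i j) : K) • (M.x i j * M.sgn) := by
  refine ext_graded M.compl fun p m hm => ?_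
  have h : M.x i j m ∈ M.gr (par₂ i j + p) := M.ρ_mem _ _ _ _ (Uq.uu_mem i j) hm
  rw [Module.End.mul_apply, sgn_mem h, LinearMap.smul_apply, Module.End.mul_apply, sgn_mem hm,
    map_smul, smul_smul, ← sgK_add (par₂ i j)]

end SMod

/-- The superspace of homomorphisms of `U_q(𝔮_n)`-supermodules: its part of parity `p` consists of
the linear maps which raise the parity by `p` and satisfy `f(xm) = (-1)^{p p(x)} x f(m)`. -/
def SHom (p : ZMod 2) (M N : SMod q n) : Submodule K (M.carrier →ₗ[K] N.carrier) where
  carrier := {f | (∀ (a : ZMod 2) (m : M.carrier), m ∈ M.gr a → f m ∈ N.gr (p + a)) ∧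
    ∀ (a : ZMod 2) (x : Uq q n) (m : M.carrier), x ∈ Uq.gr q n a →
      f (M.ρ x m) = (sg (p * a) : K) • N.ρ x (f m)}
  add_mem' := by
    rintro f g ⟨hf, hf'⟩ ⟨hg, hg'⟩
    refine ⟨fun a m hm => add_mem (hf a m hm) (hg a m hm), fun a x m hx => ?_⟩
    rw [LinearMap.add_apply, hf' a x m hx, hg' a x m hx, LinearMap.add_apply, map_add, smul_add]
  zero_mem' := ⟨fun a m hm => by simp, fun a x m hx => by simp⟩
  smul_mem' := by
    rintro c f ⟨hf, hf'⟩
    refine ⟨fun a m hm => Submodule.smul_mem _ _ (hf a m hm), fun a x m hx => ?_⟩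
    rw [LinearMap.smul_apply, hf' a x m hx, LinearMap.smul_apply, map_smul, smul_comm]

/-- The grading defined by an involution: its homogeneous parts are the eigenspaces. -/
def eigen {M : Type} [AddCommGroup M] [Module K M] (s : Module.End K M) (p : ZMod 2) :
    Submodule K M := Module.End.eigenspace s (sg p : K)

lemma mem_eigen {M : Type} [AddCommGroup M] [Module K M] {s : Module.End K M} {p : ZMod 2} {m : M} :
    m ∈ eigen s p ↔ s m = (sg p : K) • m := Module.End.mem_eigenspace_iff

variable [CharZero K]

lemma mem_iff_invol {M : Type} [AddCommGroup M] [Module K M] {gr : ZMod 2 → Submodule K M}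
    (h : IsCompl (gr 0) (gr 1)) (p : ZMod 2) (m : M) :
    m ∈ gr p ↔ invol gr h m = (sg p : K) • m := by
  refine ⟨invol_mem h, fun hm => ?_⟩
  have hm' : m ∈ gr 0 ⊔ gr 1 := by rw [h.sup_eq_top]; trivial
  obtain ⟨a, ha, b, hb, rfl⟩ := Submodule.mem_sup.1 hm'
  rw [map_add, invol_mem h ha, invol_mem h hb, smul_add] at hm
  have two : (2 : K) ≠ 0 := two_ne_zero
  rcases zmod2_cases p with rfl | rfl
  · have : (2 : K) • b = 0 := by
      simp only [sg_zero, sg_one, Int.cast_one, Int.cast_neg, one_smul, neg_smul] at hm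
      rw [two_smul]
      have := add_left_cancel hm
      nth_rw 1 [← this]; simp
    rw [(smul_eq_zero_iff_right two).1 this, add_zero]; exact ha
  · have : (2 : K) • a = 0 := by
      simp only [sg_zero, sg_one, Int.cast_one, Int.cast_neg, one_smul, neg_smul] at hm
      rw [two_smul]
      have := add_right_cancel hm
      nth_rw 1 [this]; simp
    rw [(smul_eq_zero_iff_right two).1 this, zero_add]; exact hb

lemma eigen_compl {M : Type} [AddCommGroup M] [Module K M] {s : Module.End K M} (hs : s * s = 1) :
    IsCompl (eigen s 0) (eigen s 1) := by
  have two : (2 : K) ≠ 0 := two_ne_zero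
  have hs' : ∀ m, s (s m) = m := fun m => congrArg (fun t : Module.End K M => t m) hs
  constructor
  · rw [Submodule.disjoint_def]
    intro m h0 h1
    rw [mem_eigen] at h0 h1
    rw [h0] at h1
    simp only [sg_zero, sg_one, Int.cast_one, Int.cast_neg, one_smul, neg_smul] at h1
    have : (2 : K) • m = 0 := by rw [two_smul]; nth_rw 1 [h1]; simp
    exact (smul_eq_zero_iff_right two).1 this
  · rw [codisjoint_iff, eq_top_iff]
    intro m _
    have : m = (2⁻¹ : K) • (m + s m) + (2⁻¹ : K) • (m - s m) := by
      rw [← smul_add, add_add_sub_cancel, ← two_smul K m, smul_smul, inv_mul_cancel₀ two, one_smul]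
    rw [this]
    refine Submodule.add_mem_sup ?_ ?_
    · rw [mem_eigen, map_smul, map_add, hs']; simp [sg_zero, add_comm]
    · rw [mem_eigen, map_smul, map_sub, hs']; simp [sg_one, ← smul_neg]

lemma invol_eigen {M : Type} [AddCommGroup M] [Module K M] {s : Module.End K M} (hs : s * s = 1) :
    invol (eigen s) (eigen_compl hs) = s :=
  ext_graded (eigen_compl hs) fun p m hm => by rw [invol_mem _ hm, mem_eigen.1 hm]

lemma SMod.mem_iff (M : SMod q n) (p : ZMod 2) (m : M.carrier) :
    m ∈ M.gr p ↔ M.sgn m = (sg p : K) • m := mem_iff_invol _ _ _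

/-- The supermodule on a vector space with parity involution `s`, on which the generator `u_ij` acts
as the operator `x i j`. -/
abbrev SMod.mk' (M : Type) [AddCommGroup M] [Module K M] (s : Module.End K M) (hs : s * s = 1)
    (x : Idx n → Idx n → Module.End K M) (hx : IsRep q x)
    (hsx : ∀ i j, s * x i j = (sg (par₂ i j) : K) • (x i j * s)) : SMod q n where
  carrier := M
  gr := eigen s
  compl := eigen_compl hs
  ρ := Uq.lift x hx
  ρ_mem a b y m hy hm := by
    refine Submodule.span_induction (p := fun y _ => Uq.lift x hx y m ∈ eigen s (a + b))
      ?_ ?_ ?_ ?_ hy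
    · rintro _ ⟨w, rfl, rfl⟩
      clear hy
      induction w with
      | nil => simpa using hm
      | cons g w ih =>
        simp only [List.map_cons, List.prod_cons, List.sum_cons]
        rw [map_mul, Module.End.mul_apply, Uq.lift_uu, mem_eigen]
        have h := congrArg (fun t : Module.End K M =>
          t (Uq.lift x hx (w.map fun g => uu q g.1 g.2).prod m)) (hsx g.1 g.2)
        simp only [Module.End.mul_apply, LinearMap.smul_apply] at h
        rw [h, mem_eigen.1 ih, map_smul, smul_smul, ← sgK_add (par₂ g.1 g.2),
          ← add_assoc]
    · simp
    · intro a b _ _ ha hb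
      rw [map_add, LinearMap.add_apply]; exact add_mem ha hb
    · intro c a _ ha
      rw [map_smul, LinearMap.smul_apply]; exact Submodule.smul_mem _ _ ha

section mk'

variable {M : Type} [AddCommGroup M] [Module K M] {s : Module.End K M} {hs : s * s = 1}
  {x : Idx n → Idx n → Module.End K M} {hx : IsRep q x}
  {hsx : ∀ i j, s * x i j = (sg (par₂ i j) : K) • (x i j * s)}

lemma SMod.mk'_sgn : (SMod.mk' M s hs x hx hsx).sgn = s := invol_eigen hs

lemma SMod.mk'_x (i j : Idx n) : (SMod.mk' M s hs x hx hsx).x i j = x i j :=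
  Uq.lift_uu _ hx _ _

end mk'

end SMod

section UqCat

variable {K : Type} [Field K] {q : Kˣ} {n : ℕ}

namespace SHom

/-- The identity morphism. -/
def one (M : SMod q n) : SHom 0 M M :=
  ⟨LinearMap.id, fun a m hm => by rwa [zero_add], fun a x m _ => by simp [sg_zero]⟩

/-- Composition of morphisms. -/
def comp {p r s : ZMod 2} {L M N : SMod q n} (h : p + r = s) (f : SHom p M N) (g : SHom r L M) :
    SHom s L N :=
  ⟨f.1.comp g.1, fun a m hm => by
    rw [← h, add_assoc]; exact f.2.1 _ _ (g.2.1 _ _ hm), fun a x m hx => by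
    rw [LinearMap.comp_apply, g.2.2 a x m hx, map_smul, f.2.2 a x _ hx, smul_smul, ← sgK_add,
      ← h, add_mul, add_comm, LinearMap.comp_apply]⟩

end SHom

variable (q n) in
/-- The supercategory of `U_q(𝔮_n)`-supermodules. -/
def UqCat : SuperCat.{1, 0} K where
  Obj := SMod q n
  Hom p M N := SHom p M N
  id M := SHom.one M
  comp h f g := SHom.comp h f g
  add_comp _ _ _ _ := Subtype.ext (LinearMap.add_comp _ _ _)
  comp_add _ _ _ _ := Subtype.ext (LinearMap.comp_add _ _ _)
  smul_comp _ _ _ _ := Subtype.ext (LinearMap.smul_comp _ _ _)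
  comp_smul _ _ _ _ := Subtype.ext (LinearMap.comp_smul _ _ _)
  id_comp _ _ := Subtype.ext (LinearMap.id_comp _)
  comp_id _ _ := Subtype.ext (LinearMap.comp_id _)
  assoc _ _ _ _ _ _ _ := rfl

namespace SHom

lemma map_sgn {p : ZMod 2} {M N : SMod q n} (f : SHom p M N) :
    f.1 ∘ₗ M.sgn = (sg p : K) • (N.sgn ∘ₗ f.1) := by
  refine ext_graded M.compl fun a m hm => ?_
  rw [LinearMap.comp_apply, SMod.sgn_mem hm, LinearMap.smul_apply, LinearMap.comp_apply,
    SMod.sgn_mem (f.2.1 a m hm), map_smul, smul_smul, ← sgK_add, ← add_assoc,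
    CharTwo.add_self_eq_zero, zero_add]

lemma map_x {p : ZMod 2} {M N : SMod q n} (f : SHom p M N) (i j : Idx n) :
    f.1 ∘ₗ M.x i j = (sg (p * par₂ i j) : K) • (N.x i j ∘ₗ f.1) := by
  ext m
  exact f.2.2 _ _ m (Uq.uu_mem i j)

variable [CharZero K]

/-- It suffices to check compatibility with the parity involutions and the generators. -/
def mk' {p : ZMod 2} {M N : SMod q n} (f : M.carrier →ₗ[K] N.carrier)
    (h : f ∘ₗ M.sgn = (sg p : K) • (N.sgn ∘ₗ f))
    (h' : ∀ i j, f ∘ₗ M.x i j = (sg (p * par₂ i j) : K) • (N.x i j ∘ₗ f)) : SHom p M N :=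
  ⟨f, by
    intro a m hm
    have h1 : f (M.sgn m) = (sg p : K) • N.sgn (f m) := LinearMap.congr_fun h m
    rw [SMod.sgn_mem hm, map_smul] at h1
    rw [SMod.mem_iff, sgK_add, mul_smul, h1, smul_smul, sgK_mul_self, one_smul], by
    intro a x m hx
    refine Submodule.span_induction
      (p := fun x _ => f (M.ρ x m) = (sg (p * a) : K) • N.ρ x (f m)) ?_ ?_ ?_ ?_ hx
    · rintro _ ⟨w, rfl, rfl⟩
      clear hx
      induction w with
      | nil => simp [sg_zero]
      | cons g w ih =>
        simp only [List.map_cons, List.prod_cons, List.sum_cons]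
        have h2 : f (M.ρ (uu q g.1 g.2) (M.ρ (w.map fun g => uu q g.1 g.2).prod m)) =
            (sg (p * par₂ g.1 g.2) : K) •
              N.ρ (uu q g.1 g.2) (f (M.ρ (w.map fun g => uu q g.1 g.2).prod m)) :=
          LinearMap.congr_fun (h' g.1 g.2) _
        rw [map_mul, Module.End.mul_apply, h2, ih, map_smul, smul_smul, ← sgK_add, ← mul_add,
          map_mul, Module.End.mul_apply]
    · simp
    · intro b c _ _ hb hc
      simp only [map_add, LinearMap.add_apply, hb, hc, smul_add]
    · intro c b _ hb
      rw [map_smul, LinearMap.smul_apply, map_smul, hb, map_smul, LinearMap.smul_apply,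
        smul_comm]⟩

end SHom

/-! ### The trivial supermodule and tensor products -/

/-- The counit of `U_q(𝔮_n)`. -/
lemma isRep_counit {B : Type*} [Ring B] [Algebra K B] :
    IsRep q fun i j : Idx n => if i = j then (1 : B) else 0 where
  tri i j h := if_neg h.ne'
  diag i := by simp
  rll := by
    refine (isMRep_twist_iff (s := (1 : B)) (mul_one 1) ?_).1 ?_
    · intro i j
      by_cases h : i = j
      · subst h; simp [par₂_self, sg_zero]
      · simp [h]
    · have : (fun i j : Idx n => (if i = j then (1 : B) else 0) * ipow (1 : B) (par₂ i j)) =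
          (1 : Matrix (Idx n) (Idx n) B) := by
        funext i j
        rw [Matrix.one_apply]
        rcases zmod2_cases (par₂ i j) with h | h <;> rw [h] <;> simp [ipow_zero, ipow_one]
      rw [this, isMRep_iff, Y1_one, Y2_one, mul_one, one_mul, mul_one]

variable [CharZero K]

variable (q n) in
/-- The trivial supermodule: the ground field, on which `u_ij` acts by the counit `δ_ij`. -/
abbrev SMod.unit : SMod q n :=
  SMod.mk' K (1 : Module.End K K) (mul_one 1) (fun i j => if i = j then 1 else 0) isRep_counit
    (fun i j => by
      by_cases h : i = j
      · subst h; simp [par₂_self, sg_zero]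
      · simp [h])

open TensorProduct in
/-- The action of `u_ij` on `M ⊗ N` through the comultiplication
`Δ(u_ij) = ∑_k (-1)^{p(i,k) p(k,j)} u_ik ⊗ u_kj`, where
`(x ⊗ y)(m ⊗ n) = (-1)^{p(y) p(m)} xm ⊗ yn`. -/
def SMod.tensorX (M N : SMod q n) (i j : Idx n) : Module.End K (M.carrier ⊗[K] N.carrier) :=
  ∑ k, (sg (par₂ i k * par₂ k j) : K) •
    TensorProduct.map (M.x i k * ipow M.sgn (par₂ k j)) (N.x k j)

/-- The parity involution of a tensor product. -/
abbrev SMod.tensorSgn (M N : SMod q n) : Module.End K (M.carrier ⊗[K] N.carrier) :=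
  TensorProduct.map M.sgn N.sgn

lemma SMod.tensorSgn_sq (M N : SMod q n) : M.tensorSgn N * M.tensorSgn N = 1 := by
  rw [SMod.tensorSgn, ← TensorProduct.map_mul, M.sgn_sgn, N.sgn_sgn, TensorProduct.map_one]

lemma SMod.ipow_tensorSgn (M N : SMod q n) (p : ZMod 2) :
    ipow (M.tensorSgn N) p = TensorProduct.map (ipow M.sgn p) (ipow N.sgn p) := by
  rcases zmod2_cases p with rfl | rfl
  · rw [ipow_zero, ipow_zero, ipow_zero, TensorProduct.map_one]
  · rfl

lemma SMod.sgn_tensorX (M N : SMod q n) (i j : Idx n) :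
    M.tensorSgn N * M.tensorX N i j = (sg (par₂ i j) : K) • (M.tensorX N i j * M.tensorSgn N) := by
  rw [SMod.tensorX, Finset.mul_sum, Finset.sum_mul, Finset.smul_sum]
  refine Finset.sum_congr rfl fun k _ => ?_
  rw [mul_smul_comm, smul_mul_assoc, ← TensorProduct.map_mul, ← TensorProduct.map_mul, ← mul_assoc,
    M.sgn_x, N.sgn_x, smul_comm]
  congr 1
  rw [smul_mul_assoc, TensorProduct.map_smul_left, TensorProduct.map_smul_right, smul_smul,
    ← sgK_add, mul_assoc, mul_assoc]
  congr 3
  · simp only [par₂]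
    generalize par i = a1; generalize par j = a2; generalize par k = a3
    revert a1 a2 a3; decide
  · rcases zmod2_cases (par₂ k j) with h | h <;> rw [h] <;> simp [ipow_zero, ipow_one]

lemma SMod.isMRep_x (M : SMod q n) : IsMRep q fun i j => M.x i j * ipow M.sgn (par₂ i j) :=
  (isMRep_twist_iff M.sgn_sgn M.sgn_x).2 M.isRep.rll

lemma SMod.ipow_sgn_x (M : SMod q n) (p : ZMod 2) (i j : Idx n) :
    ipow M.sgn p * M.x i j = (sg (p * par₂ i j) : K) • (M.x i j * ipow M.sgn p) :=
  ipow_comm (M.sgn_x i j) p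

lemma SMod.isMRep_tensor (M N : SMod q n) :
    IsMRep q (fun i j => M.tensorX N i j * ipow (M.tensorSgn N) (par₂ i j)) := by
  set A : Matrix (Idx n) (Idx n) (Module.End K (M.carrier ⊗[K] N.carrier)) :=
    fun i k => TensorProduct.map (M.x i k * ipow M.sgn (par₂ i k)) (ipow N.sgn (par₂ i k)) with hA
  set C : Matrix (Idx n) (Idx n) (Module.End K (M.carrier ⊗[K] N.carrier)) :=
    fun k j => TensorProduct.map 1 (N.x k j * ipow N.sgn (par₂ k j)) with hC
  have hAC : (fun i j => M.tensorX N i j * ipow (M.tensorSgn N) (par₂ i j)) = A * C := by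
    funext i j
    rw [Matrix.mul_apply, SMod.tensorX, Finset.sum_mul]
    refine Finset.sum_congr rfl fun k _ => ?_
    simp only [hA, hC]
    rw [M.ipow_tensorSgn, smul_mul_assoc, ← TensorProduct.map_mul, ← TensorProduct.map_mul,
      mul_one, ← mul_assoc (ipow N.sgn _), N.ipow_sgn_x, smul_mul_assoc,
      TensorProduct.map_smul_right, mul_assoc, ipow_add M.sgn_sgn, mul_assoc, ipow_add N.sgn_sgn]
    have e1 : par₂ k j + par₂ i j = par₂ i k := by
      simp only [par₂]
      generalize par i = a1; generalize par j = a2; generalize par k = a3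
      revert a1 a2 a3; decide
    have e2 : par₂ i k + par₂ k j = par₂ i j := by
      simp only [par₂]
      generalize par i = a1; generalize par j = a2; generalize par k = a3
      revert a1 a2 a3; decide
    rw [e1, e2]
  have hMA : IsMRep q A := by
    have h1 : A = fun i k => Module.End.rTensorAlgHom K M.carrier N.carrier (M.x i k) *
        ipow (M.tensorSgn N) (par₂ i k) := by
      funext i k
      rw [M.ipow_tensorSgn]
      change _ = TensorProduct.map (M.x i k) 1 * _
      rw [← TensorProduct.map_mul, one_mul]
    rw [h1]
    refine (isMRep_twist_iff (M.tensorSgn_sq N) fun i j => ?_).2 (M.isRep.map _).rll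
    change TensorProduct.map M.sgn N.sgn * TensorProduct.map (M.x i j) 1 =
      (sg (par₂ i j) : K) • (TensorProduct.map (M.x i j) 1 * TensorProduct.map M.sgn N.sgn)
    rw [← TensorProduct.map_mul, ← TensorProduct.map_mul, M.sgn_x, TensorProduct.map_smul_left,
      one_mul, mul_one]
  have hMC : IsMRep q C := N.isMRep_x.map (Module.End.lTensorAlgHom K N.carrier M.carrier)
  have hCA : ∀ i j k l : Idx n, C i j * A k l = (sg (par₂ k l * par₂ i j) : K) • (A k l * C i j) := by
    intro i j k l
    simp only [hA, hC]
    rw [← TensorProduct.map_mul, ← TensorProduct.map_mul, mul_one, one_mul,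
      ← mul_assoc (ipow N.sgn _), N.ipow_sgn_x, smul_mul_assoc, TensorProduct.map_smul_right,
      smul_smul, sgK_mul_self, one_smul, mul_assoc, mul_assoc, ipow_add N.sgn_sgn,
      ipow_add N.sgn_sgn, add_comm]
  have h1 : Y1 C * Y2 K A = Y2 K A * Y1 C := by
    ext1 ⟨i, k⟩ ⟨j, l⟩
    rw [Y1_mul_Y2, Y2_mul_Y1, hCA, smul_smul, ← sgK_add, ← mul_add]
    congr 4
    simp only [par₂]
    generalize par i = a1; generalize par j = a2
    revert a1 a2; decide
  have h2 : Y1 A * Y2 K C = Y2 K C * Y1 A := by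
    ext1 ⟨i, k⟩ ⟨j, l⟩
    rw [Y1_mul_Y2, Y2_mul_Y1, hCA, smul_smul, ← sgK_add]
    congr 3
    simp only [par₂]
    generalize par i = a1; generalize par j = a2; generalize par k = a3; generalize par l = a4
    revert a1 a2 a3 a4; decide
  rw [isMRep_iff] at hMA hMC
  rw [hAC, isMRep_iff, Y1_mul, Y2_mul]
  calc Y1 A * Y1 C * (Y2 K A * Y2 K C) * RM _ q
      = Y1 A * (Y1 C * Y2 K A) * Y2 K C * RM _ q := by simp only [mul_assoc]
    _ = Y1 A * Y2 K A * (Y1 C * Y2 K C * RM _ q) := by rw [h1]; simp only [mul_assoc]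
    _ = (Y1 A * Y2 K A * RM _ q) * (Y2 K C * Y1 C) := by rw [hMC]; simp only [mul_assoc]
    _ = RM _ q * (Y2 K A * (Y1 A * Y2 K C) * Y1 C) := by rw [hMA]; simp only [mul_assoc]
    _ = RM _ q * (Y2 K A * Y2 K C * (Y1 A * Y1 C)) := by rw [h2]; simp only [mul_assoc]

lemma SMod.isRep_tensor (M N : SMod q n) : IsRep q (M.tensorX N) where
  tri i j h := by
    refine Finset.sum_eq_zero fun k _ => ?_
    by_cases hk : k < i
    · rw [M.isRep.tri _ _ hk]; simp
    · rw [N.isRep.tri _ _ (lt_of_lt_of_le h (not_lt.1 hk))]; simp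
  diag i := by
    have h : ∀ i, M.tensorX N i i = TensorProduct.map (M.x i i) (N.x i i) := by
      intro i
      rw [SMod.tensorX, Finset.sum_eq_single i]
      · simp [par₂_self, sg_zero, ipow_zero]
      · intro k _ hk
        rcases lt_or_gt_of_ne hk with h | h
        · rw [M.isRep.tri _ _ h]; simp
        · rw [N.isRep.tri _ _ h]; simp
      · simp
    rw [h, h, ← TensorProduct.map_mul, M.isRep.diag, N.isRep.diag, TensorProduct.map_one]
  rll := (isMRep_twist_iff (M.tensorSgn_sq N) (M.sgn_tensorX N)).1 (M.isMRep_tensor N)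

/-- The tensor product of supermodules. -/
abbrev SMod.tensor (M N : SMod q n) : SMod q n :=
  SMod.mk' (M.carrier ⊗[K] N.carrier) (M.tensorSgn N) (M.tensorSgn_sq N) (M.tensorX N)
    (M.isRep_tensor N) (M.sgn_tensorX N)

lemma SHom.ipow_sgn {p : ZMod 2} {M N : SMod q n} (f : SHom p M N) (r : ZMod 2) :
    f.1 ∘ₗ ipow M.sgn r = (sg (p * r) : K) • (ipow N.sgn r ∘ₗ f.1) := by
  rcases zmod2_cases r with rfl | rfl
  · rw [mul_zero, sg_zero, Int.cast_one, one_smul]; rfl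
  · rw [mul_one]; exact SHom.map_sgn f

lemma tensor_sign : ∀ p r a b c : ZMod 2,
    r * (a + c) + p * (a + c) + p * (c + b) + r * (c + b) = (p + r) * (a + b) := by decide

/-- The tensor product of morphisms: `(f ⊗ g)(m ⊗ n) = (-1)^{p(g) p(m)} f(m) ⊗ g(n)`. -/
def SHom.tensor {p r s : ZMod 2} {M M' N N' : SMod q n} (h : p + r = s) (f : SHom p M M')
    (g : SHom r N N') : SHom s (M.tensor N) (M'.tensor N') :=
  SHom.mk' (TensorProduct.map (f.1 ∘ₗ ipow M.sgn r) g.1) (by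
    rw [SMod.mk'_sgn, SMod.mk'_sgn, SMod.tensorSgn, SMod.tensorSgn, ← TensorProduct.map_comp,
      ← TensorProduct.map_comp, SHom.map_sgn g, TensorProduct.map_smul_right]
    have : (f.1 ∘ₗ ipow M.sgn r) ∘ₗ M.sgn = (sg p : K) • (M'.sgn ∘ₗ f.1 ∘ₗ ipow M.sgn r) := by
      have e : ipow M.sgn r ∘ₗ M.sgn = M.sgn ∘ₗ ipow M.sgn r := by
        rcases zmod2_cases r with rfl | rfl <;> rfl
      rw [LinearMap.comp_assoc, e, ← LinearMap.comp_assoc, SHom.map_sgn f, LinearMap.smul_comp,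
        LinearMap.comp_assoc]
    rw [this, TensorProduct.map_smul_left, smul_smul, ← sgK_add, add_comm r p, h]) (by
    intro i j
    rw [SMod.mk'_x, SMod.mk'_x, SMod.tensorX, SMod.tensorX]
    ext m v
    simp only [TensorProduct.AlgebraTensorModule.curry_apply, TensorProduct.curry_apply,
      LinearMap.restrictScalars_self, LinearMap.comp_apply, LinearMap.sum_apply,
      LinearMap.smul_apply, map_sum, map_smul, Finset.smul_sum, TensorProduct.map_tmul,
      Module.End.mul_apply]
    refine Finset.sum_congr rfl fun k _ => ?_
    have e1 : f.1 (ipow M.sgn r (M.x i k (ipow M.sgn (par₂ k j) m))) =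
        ((sg (r * par₂ i k) : K) * (sg (p * par₂ i k) : K) * (sg (p * par₂ k j) : K)) •
          M'.x i k (ipow M'.sgn (par₂ k j) (f.1 (ipow M.sgn r m))) := by
      have h1 : ∀ m, ipow M.sgn r (M.x i k m) =
          (sg (r * par₂ i k) : K) • M.x i k (ipow M.sgn r m) :=
        fun m => LinearMap.congr_fun (M.ipow_sgn_x r i k) m
      have h2 : ∀ m, f.1 (M.x i k m) = (sg (p * par₂ i k) : K) • M'.x i k (f.1 m) :=
        fun m => LinearMap.congr_fun (SHom.map_x f i k) m
      have h3 : ∀ m, f.1 (ipow M.sgn (par₂ k j) m) =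
          (sg (p * par₂ k j) : K) • ipow M'.sgn (par₂ k j) (f.1 m) :=
        fun m => LinearMap.congr_fun (SHom.ipow_sgn f _) m
      have h4 : ipow M.sgn r (ipow M.sgn (par₂ k j) m) =
          ipow M.sgn (par₂ k j) (ipow M.sgn r m) := by
        rcases zmod2_cases r with rfl | rfl <;> rcases zmod2_cases (par₂ k j) with h | h <;>
          rw [h] <;> rfl
      rw [h1, map_smul, h2, h4, h3, map_smul, smul_smul, smul_smul]
    have e2 : g.1 (N.x k j v) = (sg (r * par₂ k j) : K) • N'.x k j (g.1 v) :=
      LinearMap.congr_fun (SHom.map_x g k j) v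
    rw [e1, e2, TensorProduct.smul_tmul_smul, smul_smul, smul_smul]
    congr 1
    have e3 : (sg (r * par₂ i k) : K) * (sg (p * par₂ i k) : K) * (sg (p * par₂ k j) : K) *
        (sg (r * par₂ k j) : K) = (sg (s * par₂ i j) : K) := by
      rw [← sgK_add, ← sgK_add, ← sgK_add, ← h]
      congr 2
      exact tensor_sign p r (par i) (par j) (par k)
    rw [e3, mul_comm])

end UqCat

/-! ### The fundamental supermodule and its dual -/

section YBE

variable {K : Type} [Field K] (q : Kˣ) {n : ℕ}

/-- Row operator of `Θ`. -/
def th (G : Idx n → Idx n → K) (i k : Idx n) : K :=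
  ((q ^ phi i k : Kˣ) : K) * G i k + (if k < i then zz q * (sg (par k) : K) * G k i else 0) +
    (if k < -i then zz q * (sg (par k) : K) * G (-k) (-i) else 0)

lemma sum_theta (G : Idx n → Idx n → K) (i k : Idx n) :
    ∑ j, ∑ l, theta q i j k l * G j l = th q G i k := by
  have h : ∀ j l, theta q i j k l * G j l =
      (if j = i ∧ l = k then ((q ^ phi i k : Kˣ) : K) * G i k else 0) +
      (if j = k ∧ l = i then (if k < i then zz q * (sg (par k) : K) * G k i else 0) else 0) +
      (if j = -k ∧ l = -i then (if k < -i then zz q * (sg (par k) : K) * G (-k) (-i) else 0)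
        else 0) := by
    intro j l
    rw [theta, add_mul]
    have e1 : (if i = j ∧ k = l then ((q ^ phi i k : Kˣ) : K) else 0) * G j l =
        (if j = i ∧ l = k then ((q ^ phi i k : Kˣ) : K) * G i k else 0) := by
      by_cases h : i = j ∧ k = l
      · obtain ⟨rfl, rfl⟩ := h; simp
      · rw [if_neg h, if_neg (fun h' => h ⟨h'.1.symm, h'.2.symm⟩), zero_mul]
    have e2 : (if k < l then zz q * (sg (par k) : K) * ((if i = l ∧ j = k then 1 else 0) +
          (if i = -l ∧ j = -k then 1 else 0)) else 0) * G j l =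
        (if j = k ∧ l = i then (if k < i then zz q * (sg (par k) : K) * G k i else 0) else 0) +
      (if j = -k ∧ l = -i then (if k < -i then zz q * (sg (par k) : K) * G (-k) (-i) else 0)
        else 0) := by
      have e3 : (if i = l ∧ j = k then (1 : K) else 0) = if j = k ∧ l = i then 1 else 0 :=
        if_congr ⟨fun h => ⟨h.2, h.1.symm⟩, fun h => ⟨h.2.symm, h.1⟩⟩ rfl rfl
      have e4 : (if i = -l ∧ j = -k then (1 : K) else 0) = if j = -k ∧ l = -i then 1 else 0 :=
        if_congr ⟨fun h => ⟨h.2, by rw [h.1, idx_neg_neg]⟩,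
          fun h => ⟨by rw [h.2, idx_neg_neg], h.1⟩⟩ rfl rfl
      rw [e3, e4]
      by_cases h : j = k ∧ l = i <;> by_cases h' : j = -k ∧ l = -i
      · rw [if_pos h, if_pos h', if_pos h, if_pos h', ← h'.2, ← h'.1, ← h.2, h.1]
        split_ifs <;> ring
      · rw [if_pos h, if_neg h', if_pos h, if_neg h', ← h.2, h.1]
        split_ifs <;> ring
      · rw [if_neg h, if_pos h', if_neg h, if_pos h', ← h'.2, ← h'.1]
        split_ifs <;> ring
      · rw [if_neg h, if_neg h', if_neg h, if_neg h']
        split_ifs <;> ring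
    rw [e1, e2, add_assoc]
  simp only [h, Finset.sum_add_distrib, ite_and]
  have f : ∀ (a b : Idx n) (c : K), (∑ j, ∑ l, if j = a then if l = b then c else 0 else 0) = c := by
    intro a b c
    rw [Finset.sum_eq_single a]
    · simp
    · intro j _ hj; simp [hj]
    · simp
  rw [f, f, f, th]

variable {q}

lemma exists_pos (a : Idx n) : ∃ x : Idx n, 0 < x.1 ∧ (a = x ∨ a = -x) := by
  have h := a.2
  simp only [Finset.mem_erase, Finset.mem_Icc] at h
  by_cases h' : 0 < a.1
  · exact ⟨a, h', .inl rfl⟩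
  · refine ⟨-a, ?_, .inr (idx_neg_neg a).symm⟩
    change 0 < -a.1
    omega

lemma neg_lt_neg_idx (x y : Idx n) : (-x < -y) = (y < x) := by
  have h1 : (-x < -y) ↔ -x.1 < -y.1 := Iff.rfl
  have h2 : (y < x) ↔ y.1 < x.1 := Iff.rfl
  rw [h1, h2, neg_lt_neg_iff]

lemma lt_neg_idx {x y : Idx n} (hx : 0 < x.1) (hy : 0 < y.1) : (x < -y) = False := by
  have h1 : (x < -y) ↔ x.1 < -y.1 := Iff.rfl
  rw [h1, eq_iff_iff, iff_false]; omega

lemma neg_lt_idx {x y : Idx n} (hx : 0 < x.1) (hy : 0 < y.1) : (-x < y) = True := by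
  have h1 : (-x < y) ↔ -x.1 < y.1 := Iff.rfl
  rw [h1, eq_iff_iff, iff_true]; omega

lemma par_pos {x : Idx n} (hx : 0 < x.1) : par x = 0 := if_pos hx

lemma phi_pos {x y : Idx n} (hx : 0 < x.1) (hy : 0 < y.1) : phi x y = if x = y then 1 else 0 := by
  unfold phi
  rw [abs_of_pos hx, abs_of_pos hy, Int.sign_eq_one_of_pos hy]
  exact if_congr Subtype.ext_iff.symm rfl rfl

lemma phi_neg_left (x y : Idx n) : phi (-x) y = phi x y := by
  unfold phi
  have h : (-x).1 = -x.1 := rfl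
  rw [h, abs_neg]

lemma phi_neg_right (x y : Idx n) : phi x (-y) = -phi x y := by
  unfold phi
  have h : (-y).1 = -y.1 := rfl
  rw [h, abs_neg, Int.sign_neg]
  split_ifs <;> simp

lemma zz_eq : zz q = (q : K) - (q : K)⁻¹ := by rw [zz, Units.val_inv_eq_inv_val]

lemma lt_facts {x y : Idx n} (h : x < y) :
    (x < y) = True ∧ (y < x) = False ∧ (x = y) = False ∧ (y = x) = False :=
  ⟨eq_true h, eq_false h.not_gt, eq_false h.ne, eq_false h.ne'⟩

set_option maxHeartbeats 4000000 in
lemma ybe_core (F : Idx n → Idx n → Idx n → K) (a i k : Idx n) :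
    th q (fun e j => th q (fun m l => th q (fun b d =>
      (sg ((par k + par l) * (par i + par b)) : K) * F m b d) j l) e k) a i =
    th q (fun j l => th q (fun e d => th q (fun m b =>
      (sg ((par k + par l) * (par j + par b)) : K) * F m b d) e j) a l) i k := by
  have hq : (q : K) ≠ 0 := q.ne_zero
  obtain ⟨x, hx, hax⟩ := exists_pos a
  obtain ⟨y, hy, hiy⟩ := exists_pos i
  obtain ⟨w, hw, hkw⟩ := exists_pos k
  have z01 : (0 : ZMod 2) + 1 = 1 := rfl
  have z10 : (1 : ZMod 2) + 0 = 1 := rfl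
  have z11 : (1 : ZMod 2) + 1 = 0 := rfl
  rcases lt_trichotomy x y with h1 | h1 | h1 <;> rcases lt_trichotomy y w with h2 | h2 | h2 <;>
    rcases lt_trichotomy x w with h3 | h3 | h3 <;> (try (exfalso; order)) <;> (try subst h1) <;>
    (try subst h2) <;> (try subst h3) <;> (try replace h1 := lt_facts h1) <;>
    (try replace h2 := lt_facts h2) <;> (try replace h3 := lt_facts h3) <;>
    rcases hax with rfl | rfl <;> rcases hiy with rfl | rfl <;> rcases hkw with rfl | rfl <;>
    simp only [th, neg_lt_neg_idx, lt_neg_idx, neg_lt_idx, par_pos, phi_pos,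
      phi_neg_left, phi_neg_right, par_neg, idx_neg_neg,
      lt_irrefl, ↓reduceIte, add_zero, zero_add, sg_zero, sg_one, mul_zero, zero_mul,
      one_mul, mul_one, neg_zero, zpow_zero, zpow_one, zpow_neg, Int.cast_one, Int.cast_neg,
      Units.val_one, Units.val_inv_eq_inv_val, zz_eq, *]
  all_goals first | ring1 | (field_simp; ring1)

end YBE

section Fundamental

variable {K : Type} [Field K] (q : Kˣ) {n : ℕ}

/-- The matrix of `Θ_ij`, where `Θ = ∑ Θ_ij ⊗ E_ij`. -/
def thetaMat (i j : Idx n) : Matrix (Idx n) (Idx n) K := fun a b => theta q a b i j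

lemma thetaMat_left (a m i b k d : Idx n) : rllLeft q (thetaMat q) i b k d a m =
    th q (fun e j => th q (fun m' l => th q (fun b' d' =>
      (sg ((par k + par l) * (par i + par b')) : K) *
        (if m' = m ∧ b' = b ∧ d' = d then 1 else 0)) j l) e k) a i := by
  simp only [← sum_theta, rllLeft, Matrix.sum_apply, Matrix.smul_apply, Matrix.mul_apply, thetaMat,
    smul_eq_mul]
  have h1 : ∀ j l m' : Idx n, (∑ b', ∑ d', theta q j b' l d' *
      ((sg ((par k + par l) * (par i + par b')) : K) *
        (if m' = m ∧ b' = b ∧ d' = d then 1 else 0))) =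
      if m' = m then (sg (par₂ k l * par₂ i b) : K) * theta q j b l d else 0 := by
    intro j l m'
    rw [Finset.sum_eq_single b, Finset.sum_eq_single d]
    · by_cases h : m' = m
      · simp [h, mul_comm]
      · simp [h]
    · intro x _ hx; simp [hx]
    · simp
    · intro x _ hx; simp [hx]
    · simp
  have h2 : ∀ e j : Idx n, (∑ m', ∑ l, theta q e m' k l *
      if m' = m then (sg (par₂ k l * par₂ i b) : K) * theta q j b l d else 0) =
      ∑ l, theta q e m k l * ((sg (par₂ k l * par₂ i b) : K) * theta q j b l d) := by
    intro e j
    rw [Finset.sum_eq_single m]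
    · simp
    · intro x _ hx; simp [hx]
    · simp
  simp only [h1, h2, Finset.mul_sum]
  refine Eq.trans ?_ Finset.sum_comm
  refine Finset.sum_congr rfl fun j _ => Eq.trans ?_ Finset.sum_comm
  exact Finset.sum_congr rfl fun l _ => Finset.sum_congr rfl fun e _ => by ring

lemma thetaMat_right (a m i b k d : Idx n) : rllRight q (thetaMat q) i b k d a m =
    th q (fun j l => th q (fun e d' => th q (fun m' b' =>
      (sg ((par k + par l) * (par j + par b')) : K) *
        (if m' = m ∧ b' = b ∧ d' = d then 1 else 0)) e j) a l) i k := by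
  simp only [← sum_theta, rllRight, Matrix.sum_apply, Matrix.smul_apply, Matrix.mul_apply, thetaMat,
    smul_eq_mul]
  have h1 : ∀ j l e d' : Idx n, (∑ m', ∑ b', theta q e m' j b' *
      ((sg ((par k + par l) * (par j + par b')) : K) *
        (if m' = m ∧ b' = b ∧ d' = d then 1 else 0))) =
      if d' = d then (sg (par₂ k l * par₂ j b) : K) * theta q e m j b else 0 := by
    intro j l e d'
    rw [Finset.sum_eq_single m, Finset.sum_eq_single b]
    · by_cases h : d' = d
      · simp [h, mul_comm]
      · simp [h]
    · intro x _ hx; simp [hx]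
    · simp
    · intro x _ hx; simp [hx]
    · simp
  have h2 : ∀ j l : Idx n, (∑ e, ∑ d', theta q a e l d' *
      if d' = d then (sg (par₂ k l * par₂ j b) : K) * theta q e m j b else 0) =
      ∑ e, theta q a e l d * ((sg (par₂ k l * par₂ j b) : K) * theta q e m j b) := by
    intro j l
    refine Finset.sum_congr rfl fun e _ => ?_
    rw [Finset.sum_eq_single d]
    · simp
    · intro x _ hx; simp [hx]
    · simp
  simp only [h1, h2, Finset.mul_sum]
  exact Finset.sum_congr rfl fun j _ => Finset.sum_congr rfl fun l _ =>
    Finset.sum_congr rfl fun e _ => by ring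

lemma isRep_thetaMat : IsRep q (thetaMat q (n := n)) where
  tri i j h := by
    ext a b
    rw [thetaMat, theta, if_neg (fun h' => h.ne' h'.2), if_neg h.not_gt, add_zero]; rfl
  diag i := by
    have hd : ∀ i : Idx n, thetaMat q i i = Matrix.diagonal fun a => ((q ^ phi a i : Kˣ) : K) := by
      intro i
      ext a b
      rw [thetaMat, theta, if_neg (lt_irrefl i), add_zero, Matrix.diagonal_apply]
      simp
    rw [hd, hd, Matrix.diagonal_mul_diagonal, ← Matrix.diagonal_one]
    congr 1; funext a
    rw [← Units.val_mul, ← zpow_add, phi_neg_right, add_neg_cancel, zpow_zero, Units.val_one]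
  rll i b k d := by
    ext a m
    rw [thetaMat_left, thetaMat_right]
    exact ybe_core (fun m' b' d' => if m' = m ∧ b' = b ∧ d' = d then 1 else 0) a i k

variable (n) in
/-- The parity involution of `V`. -/
def sgnV (K : Type) [Field K] : Matrix (Idx n) (Idx n) K := Matrix.diagonal fun i => (sg (par i) : K)

lemma sgnV_sq : sgnV n K * sgnV n K = 1 := by
  rw [sgnV, Matrix.diagonal_mul_diagonal, ← Matrix.diagonal_one]
  congr 1; funext i; exact sgK_mul_self _

lemma sgnV_thetaMat (i j : Idx n) : sgnV n K * thetaMat q i j =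
    (sg (par₂ i j) : K) • (thetaMat q i j * sgnV n K) := by
  ext a b
  rw [sgnV, Matrix.smul_apply, Matrix.diagonal_mul, Matrix.mul_diagonal, smul_eq_mul, thetaMat]
  by_cases h : theta q a b i j = 0
  · simp [h]
  · have h1 := theta_even q _ _ _ _ h
    have h2 : par a = par₂ i j + par b := by
      revert h1
      simp only [par₂]
      generalize par a = a1; generalize par b = a2; generalize par i = a3; generalize par j = a4
      revert a1 a2 a3 a4; decide
    rw [h2, sgK_add (par₂ i j)]
    ring

variable (n) in
/-- The fundamental supermodule `V`, with basis `v_i` of parity `p(i)`, on which `u_ij` acts by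
`Θ_ij`, where `Θ = ∑ Θ_ij ⊗ E_ij`. -/
abbrev SMod.fund [CharZero K] : SMod q n :=
  SMod.mk' (Idx n → K) (Matrix.toLinAlgEquiv' (sgnV n K))
    (by rw [← map_mul, sgnV_sq, map_one])
    (fun i j => Matrix.toLinAlgEquiv' (thetaMat q i j))
    ((isRep_thetaMat q).map (Matrix.toLinAlgEquiv' (R := K) (n := Idx n)).toAlgHom)
    (fun i j => by rw [← map_mul, ← map_mul, sgnV_thetaMat, map_smul])

end Fundamental

section Dual

variable {K : Type} [Field K] [CharZero K] {q : Kˣ} {n : ℕ}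

open MulOpposite

/-- The transpose of an endomorphism. -/
def transp {M : Type} [AddCommGroup M] [Module K M] (x : Module.End K M) :
    Module.End K (M →ₗ[K] K) where
  toFun f := f ∘ₗ x
  map_add' _ _ := rfl
  map_smul' _ _ := rfl

lemma transp_mul {M : Type} [AddCommGroup M] [Module K M] (x y : Module.End K M) :
    transp (x * y) = transp y * transp x := rfl

lemma transp_one {M : Type} [AddCommGroup M] [Module K M] :
    transp (1 : Module.End K M) = 1 := rfl

lemma transp_smul {M : Type} [AddCommGroup M] [Module K M] (c : K) (x : Module.End K M) :
    transp (c • x) = c • transp x := by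
  ext f m; exact map_smul f c (x m)

/-- The action of `u_ij` on the dual supermodule: `(xf)(v) = (-1)^{p(x) p(f)} f(S(x) v)`. -/
def SMod.dualX (M : SMod q n) (i j : Idx n) : Module.End K (M.carrier →ₗ[K] K) :=
  transp (M.ρ (Uq.antipode q n (uu q i j))) *
    ipow (transp M.sgn) (par₂ i j)

lemma SMod.sgn_rho (M : SMod q n) (x : Uq q n) :
    M.sgn * M.ρ x = M.ρ (Uq.sigma q n x) * M.sgn := by
  induction x using Uq.induction with
  | one => simp
  | gen i j x ih =>
    have h := M.sgn_x i j
    rw [SMod.x] at h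
    rw [map_mul, map_mul, map_mul, Uq.sigma_uu, map_smul, mul_assoc, ← ih, ← mul_assoc, h,
      smul_mul_assoc, smul_mul_assoc, mul_assoc]
  | add x y hx hy => rw [map_add, map_add, map_add, mul_add, add_mul, hx, hy]
  | smul c x hx => rw [map_smul, map_smul, map_smul, mul_smul_comm, smul_mul_assoc, hx]

lemma SMod.dualSgn_sq (M : SMod q n) : transp M.sgn * transp M.sgn = 1 := by
  rw [← transp_mul, M.sgn_sgn, transp_one]

lemma SMod.dualSgn_rho (M : SMod q n) (i j : Idx n) :
    transp M.sgn * transp (M.ρ (Linv q n i j)) =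
      (sg (par₂ i j) : K) • (transp (M.ρ (Linv q n i j)) * transp M.sgn) := by
  have h := M.sgn_rho (Linv q n i j)
  rw [sigma_Linv, map_smul, smul_mul_assoc] at h
  rw [← transp_mul, ← transp_mul, h, transp_smul, smul_smul, sgK_mul_self, one_smul]

lemma SMod.sgn_dualX (M : SMod q n) (i j : Idx n) :
    transp M.sgn * M.dualX i j =
      (sg (par₂ i j) : K) • (M.dualX i j * transp M.sgn) := by
  rw [SMod.dualX, Uq.antipode_uu, ← mul_assoc, M.dualSgn_rho, smul_mul_assoc, mul_assoc, mul_assoc]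
  congr 2
  rcases zmod2_cases (par₂ i j) with h | h <;> rw [h] <;> simp [ipow_zero, ipow_one]

lemma isMRep_of_anti {D : Type} [AddCommGroup D] [Module K D] (t : Uq q n → Module.End K D)
    (one : t 1 = 1) (mul : ∀ x y, t (x * y) = t y * t x) (add : ∀ x y, t (x + y) = t x + t y)
    (smul : ∀ (c : K) x, t (c • x) = c • t x) : IsMRep q fun i j => t (Linv q n i j) := by
  let f : (Uq q n)ᵐᵒᵖ →ₐ[K] Module.End K D :=
    { toFun := fun x => t x.unop
      map_one' := one
      map_mul' := fun x y => mul _ _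
      map_zero' := by simpa using smul 0 0
      map_add' := fun x y => add _ _
      commutes' := fun c => by
        change t (algebraMap K (Uq q n) c) = _
        rw [Algebra.algebraMap_eq_smul_one, smul, one, Algebra.algebraMap_eq_smul_one] }
  exact IsMRep.map f (isMRep_Linv (q := q) (n := n))

lemma SMod.isRep_dual (M : SMod q n) : IsRep q M.dualX where
  tri i j h := by rw [SMod.dualX, Uq.antipode_uu, Linv_lower h, map_zero]; ext f m; simp [transp]
  diag i := by
    rw [SMod.dualX, SMod.dualX, par₂_self, par₂_self, ipow_zero, mul_one, mul_one, Uq.antipode_uu,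
      Uq.antipode_uu, Linv_diag, Linv_diag, idx_neg_neg, ← transp_mul, ← map_mul,
      (isRep_uu q n).diag, map_one, transp_one]
  rll := by
    refine (isMRep_twist_iff M.dualSgn_sq M.sgn_dualX).1 ?_
    have h : (fun i j : Idx n => M.dualX i j * ipow (transp M.sgn) (par₂ i j)) =
        fun i j => transp (M.ρ (Linv q n i j)) := by
      funext i j
      rw [SMod.dualX, Uq.antipode_uu, mul_assoc, ipow_mul_self M.dualSgn_sq, mul_one]
    rw [h]
    refine isMRep_of_anti (fun x => transp (M.ρ x)) ?_ ?_ ?_ ?_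
    · rw [map_one, transp_one]
    · intro x y; rw [map_mul, transp_mul]
    · intro x y; ext f m; simp [transp]
    · intro c x; rw [map_smul, transp_smul]

/-- The dual supermodule. -/
abbrev SMod.dual (M : SMod q n) : SMod q n :=
  SMod.mk' (M.carrier →ₗ[K] K) (transp M.sgn) M.dualSgn_sq M.dualX
    M.isRep_dual M.sgn_dualX

end Dual

/-! ### The structural maps -/

section Maps

variable {K : Type} [Field K] [CharZero K] {q : Kˣ} {n : ℕ}

/-- The projection to the homogeneous part of parity `p`. -/
def SMod.proj (M : SMod q n) (p : ZMod 2) : Module.End K M.carrier :=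
  if p = 0 then (M.gr 0).projection (M.gr 1) M.compl
  else (M.gr 1).projection (M.gr 0) M.compl.symm

/-- The action of `x ⊗ y` on `M ⊗ N`, with `y` of parity `p`:
`(x ⊗ y)(m ⊗ n) = (-1)^{p p(m)} xm ⊗ yn`. -/
def SMod.opTensor (M N : SMod q n) (x : Module.End K M.carrier) (p : ZMod 2)
    (y : Module.End K N.carrier) : Module.End K (M.tensor N).carrier :=
  TensorProduct.map (x * ipow M.sgn p) y

/-- The flip `m ⊗ n ↦ (-1)^{p(m) p(n)} n ⊗ m`. -/
def SMod.flip (M N : SMod q n) : (M.tensor N).carrier →ₗ[K] (N.tensor M).carrier :=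
  ∑ p : ZMod 2, (TensorProduct.comm K M.carrier N.carrier).toLinearMap ∘ₗ
    TensorProduct.map (ipow M.sgn p) (N.proj p)

lemma SMod.flip_tmul (M N : SMod q n) {a b : ZMod 2} {m : M.carrier} {v : N.carrier}
    (hm : m ∈ M.gr a) (hv : v ∈ N.gr b) :
    M.flip N (m ⊗ₜ[K] v) = (sg (a * b) : K) • (v ⊗ₜ[K] m) := by
  have h0 : ∀ p, ipow M.sgn p m = (sg (a * p) : K) • m := by
    intro p
    rcases zmod2_cases p with rfl | rfl
    · simp [ipow_zero, sg_zero]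
    · rw [ipow_one, mul_one, SMod.sgn_mem hm]
  have h1 : ∀ p, N.proj p v = if p = b then v else 0 := by
    intro p
    unfold SMod.proj
    rcases zmod2_cases p with rfl | rfl <;> rcases zmod2_cases b with rfl | rfl
    · rw [if_pos rfl, if_pos rfl]; exact Submodule.projection_apply_of_mem_left _ hv
    · rw [if_pos rfl, if_neg (by decide)]; exact Submodule.projection_apply_of_mem_right _ hv
    · rw [if_neg (by decide), if_neg (by decide)]
      exact Submodule.projection_apply_of_mem_right _ hv
    · rw [if_neg (by decide), if_pos rfl]; exact Submodule.projection_apply_of_mem_left _ hv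
  rw [SMod.flip, LinearMap.sum_apply, Finset.sum_eq_single b]
  · rw [LinearMap.comp_apply, TensorProduct.map_tmul, h0, h1, if_pos rfl]
    simp [TensorProduct.smul_tmul']
  · intro p _ hp
    rw [LinearMap.comp_apply, TensorProduct.map_tmul, h1, if_neg hp]; simp
  · simp

variable (q) in
/-- The matrix unit `E_ij`, with `E_ij v_k = δ_jk v_i`, as an operator on `V`. -/
def Eop (i j : Idx n) : Module.End K (SMod.fund q n).carrier :=
  Matrix.toLin' (Matrix.single i j (1 : K))

/-- The operator `L = ∑ u_ij ⊗ E_ij` on `M ⊗ V`. -/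
def SMod.L (M : SMod q n) : Module.End K (M.tensor (SMod.fund q n)).carrier :=
  ∑ i, ∑ j, M.opTensor (SMod.fund q n) (M.ρ (uu q i j)) (par₂ i j) (Eop q i j)

/-- The operator `Θ` on `V ⊗ V`. -/
def thetaOp (q : Kˣ) (n : ℕ) : Module.End K ((SMod.fund q n).tensor (SMod.fund q n)).carrier :=
  ∑ i, ∑ j, ∑ k, ∑ l, theta q i j k l •
    (SMod.fund q n).opTensor (SMod.fund q n) (Eop q i j) (par₂ k l) (Eop q k l)

/-- `T_{MV} = flip ∘ L : M ⊗ V → V ⊗ M`. -/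
def SMod.T (M : SMod q n) : (M.tensor (SMod.fund q n)).carrier →ₗ[K]
    ((SMod.fund q n).tensor M).carrier :=
  M.flip (SMod.fund q n) ∘ₗ M.L

/-- `T = flip ∘ Θ : V ⊗ V → V ⊗ V`. -/
def TV (q : Kˣ) (n : ℕ) : Module.End K ((SMod.fund q n).tensor (SMod.fund q n)).carrier :=
  (SMod.fund q n).flip (SMod.fund q n) ∘ₗ thetaOp q n

/-- The odd operator `J v_i = (-1)^{p(i)} v_{-i}` on `V`. -/
def Jop (q : Kˣ) (n : ℕ) : Module.End K (SMod.fund q n).carrier :=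
  ∑ i, (sg (par i) : K) • Eop q (-i) i

/-- The evaluation `f ⊗ v ↦ f(v)`. -/
def evV (q : Kˣ) (n : ℕ) : ((SMod.fund q n).dual.tensor (SMod.fund q n)).carrier →ₗ[K]
    (SMod.unit q n).carrier :=
  TensorProduct.lift LinearMap.id

/-- `E_ij^* : f ↦ (-1)^{p(i,j) p(f)} f ∘ E_ij` on `V^*`. -/
def EopDual (q : Kˣ) {n : ℕ} (i j : Idx n) : Module.End K (SMod.fund q n).dual.carrier :=
  transp (Eop q i j) * ipow (SMod.fund q n).dual.sgn (par₂ i j)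

/-- The operator `∑ x_ij ⊗ E_ij^*` on `M ⊗ V^*`, for elements `x_ij` of the superalgebra. -/
def SMod.LDual (M : SMod q n) (x : Idx n → Idx n → Uq q n) :
    Module.End K (M.tensor (SMod.fund q n).dual).carrier :=
  ∑ i, ∑ j, M.opTensor (SMod.fund q n).dual (M.ρ (x i j)) (par₂ i j) (EopDual q i j)

end Maps

/-! ### Monoidal superfunctors to supermodules -/

section MonFun

variable {K : Type} [Field K] [CharZero K] {q : Kˣ} {n : ℕ}

/-- The tensor product of the supermodules labelling the letters of a word. -/
def tens {O : Type} (lab : O → SMod q n) : List O → SMod q n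
  | [] => SMod.unit q n
  | [o] => lab o
  | o :: o' :: X => (lab o).tensor (tens lab (o' :: X))

/-- The canonical isomorphism between the tensor product of the supermodules of two words and the
supermodule of the concatenated word, given by the unit and associativity isomorphisms of the
tensor product. -/
def tensEquiv {O : Type} (lab : O → SMod q n) : ∀ X Y : List O,
    ((tens lab X).tensor (tens lab Y)).carrier ≃ₗ[K] (tens lab (X ++ Y)).carrier
  | [], Y => TensorProduct.lid K (tens lab Y).carrier
  | [o], [] => TensorProduct.rid K (lab o).carrier
  | [_], _ :: _ => LinearEquiv.refl K _
  | o :: o' :: X, Y =>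
      (TensorProduct.assoc K (lab o).carrier (tens lab (o' :: X)).carrier (tens lab Y).carrier).trans
        (TensorProduct.congr (LinearEquiv.refl K (lab o).carrier) (tensEquiv lab (o' :: X) Y))

/-- A monoidal superfunctor from a presented strict monoidal supercategory to the supercategory of
`U_q(𝔮_n)`-supermodules, sending each generating object to a prescribed supermodule and each word to
the tensor product of the supermodules of its letters; the structure isomorphisms are the canonical
ones. -/
@[ext]
structure MonFun (P : Presentation K) (lab : P.S.O → SMod q n) where
  map : ∀ (p : ZMod 2) (X Y : List P.S.O), P.Hom p X Y →ₗ[K] SHom p (tens lab X) (tens lab Y)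
  map_id : ∀ X, map 0 X X (P.cat.id X) = SHom.one (tens lab X)
  map_comp : ∀ {p r s : ZMod 2} {X Y Z : List P.S.O} (h : p + r = s) (f : P.Hom p Y Z)
    (g : P.Hom r X Y), map s X Z (P.cat.comp h f g) = SHom.comp h (map p Y Z f) (map r X Y g)
  map_tensor : ∀ {p r s : ZMod 2} {X Y X' Y' : List P.S.O} (h : p + r = s) (f : P.Hom p X Y)
    (g : P.Hom r X' Y'),
    (map s (X ++ X') (Y ++ Y') (P.tensorHom h f g)).1 ∘ₗ (tensEquiv lab X X').toLinearMap =
      (tensEquiv lab Y Y').toLinearMap ∘ₗ (SHom.tensor h (map p X Y f) (map r X' Y' g)).1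

/-- The underlying superfunctor of a monoidal superfunctor. -/
def MonFun.toSuperfunctor {P : Presentation K} {lab : P.S.O → SMod q n} (F : MonFun P lab) :
    Superfunctor P.cat (UqCat q n) where
  obj := tens lab
  map := F.map
  map_id := F.map_id
  map_comp := F.map_comp

variable (q n) in
/-- The labelling `↑ ↦ V`, `↓ ↦ V^*`. -/
def labQ : QObj → SMod q n
  | .up => SMod.fund q n
  | .dn => (SMod.fund q n).dual

/-- The labelling `↑ ↦ V`, `↓ ↦ V^*`, sending the red object to `M`. -/
def labW (M : SMod q n) : Option QObj → SMod q n
  | none => M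
  | some o => labQ q n o

lemma tens_map {O O' : Type} (g : O → O') (lab : O' → SMod q n) : ∀ X : List O,
    tens lab (X.map g) = tens (fun o => lab (g o)) X
  | [] => rfl
  | [_] => rfl
  | o :: o' :: X => congrArg (lab (g o)).tensor (tens_map g lab (o' :: X))

/-! ### The endofunctors attached to words with one red letter -/

/-- The identity of the tensor product labelled by a word without red letters, viewed as a morphism
between the supermodules for two choices of the red label. -/
def blackId (M N : SMod q n) : ∀ X : List (Option QObj), SHom 0 (tens (labW M) X) (tens (labW N) X)
  | [] => SHom.one _
  | [none] => 0
  | [some o] => SHom.one (labQ q n o)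
  | none :: _ :: _ => 0
  | some o :: o' :: X => SHom.tensor (add_zero 0) (SHom.one (labQ q n o)) (blackId M N (o' :: X))

/-- For a word with exactly one red letter, the morphism `1 ⊗ g ⊗ 1` with `g` in the position of the
red letter. -/
def redHom {p : ZMod 2} {M N : SMod q n} (g : SHom p M N) : ∀ X : List (Option QObj),
    SHom p (tens (labW M) X) (tens (labW N) X)
  | [] => 0
  | [none] => g
  | [some _] => 0
  | none :: o' :: X => SHom.tensor (add_zero p) g (blackId M N (o' :: X))
  | some o :: o' :: X => SHom.tensor (zero_add p) (SHom.one (labQ q n o)) (redHom g (o' :: X))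

end MonFun

section RedObj

variable {K : Type} [Field K] [CharZero K] {q : Kˣ} {n : ℕ}

namespace SHom

lemma tensor_coe {p r s : ZMod 2} {M M' N N' : SMod q n} (h : p + r = s) (f : SHom p M M')
    (g : SHom r N N') : (SHom.tensor h f g).1 = TensorProduct.map (f.1 ∘ₗ ipow M.sgn r) g.1 := rfl

lemma add_tensor {p r s : ZMod 2} {M M' N N' : SMod q n} (h : p + r = s) (f f' : SHom p M M')
    (g : SHom r N N') : SHom.tensor h (f + f') g = SHom.tensor h f g + SHom.tensor h f' g :=
  Subtype.ext (by
    rw [Submodule.coe_add, tensor_coe, tensor_coe, tensor_coe, Submodule.coe_add,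
      LinearMap.add_comp, TensorProduct.map_add_left])

lemma smul_tensor {p r s : ZMod 2} {M M' N N' : SMod q n} (h : p + r = s) (c : K)
    (f : SHom p M M') (g : SHom r N N') :
    SHom.tensor h (c • f) g = c • SHom.tensor h f g :=
  Subtype.ext (by
    rw [Submodule.coe_smul, tensor_coe, tensor_coe, Submodule.coe_smul,
      LinearMap.smul_comp, TensorProduct.map_smul_left])

lemma tensor_add {p r s : ZMod 2} {M M' N N' : SMod q n} (h : p + r = s) (f : SHom p M M')
    (g g' : SHom r N N') : SHom.tensor h f (g + g') = SHom.tensor h f g + SHom.tensor h f g' :=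
  Subtype.ext (by
    rw [Submodule.coe_add, tensor_coe, tensor_coe, tensor_coe, Submodule.coe_add,
      TensorProduct.map_add_right])

lemma tensor_smul {p r s : ZMod 2} {M M' N N' : SMod q n} (h : p + r = s) (c : K)
    (f : SHom p M M') (g : SHom r N N') :
    SHom.tensor h f (c • g) = c • SHom.tensor h f g :=
  Subtype.ext (by
    rw [Submodule.coe_smul, tensor_coe, tensor_coe, Submodule.coe_smul,
      TensorProduct.map_smul_right])

lemma one_tensor_one (M N : SMod q n) :
    SHom.tensor (add_zero 0) (SHom.one M) (SHom.one N) = SHom.one (M.tensor N) :=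
  Subtype.ext TensorProduct.map_id

lemma comp_tensor_even {p r s : ZMod 2} {L M N L' M' N' : SMod q n} (h : p + r = s)
    (f : SHom p M N) (g : SHom r L M) (b : SHom 0 M' N') (b' : SHom 0 L' M') :
    SHom.comp h (SHom.tensor (add_zero p) f b) (SHom.tensor (add_zero r) g b') =
      SHom.tensor (add_zero s) (SHom.comp h f g) (SHom.comp (add_zero 0) b b') :=
  Subtype.ext (by
    change TensorProduct.map (f.1 ∘ₗ LinearMap.id) b.1 ∘ₗ
      TensorProduct.map (g.1 ∘ₗ LinearMap.id) b'.1 = TensorProduct.map ((f.1 ∘ₗ g.1) ∘ₗ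
        LinearMap.id) (b.1 ∘ₗ b'.1)
    rw [← TensorProduct.map_comp, LinearMap.comp_id, LinearMap.comp_id, LinearMap.comp_id])

lemma comp_one_tensor {p r s : ZMod 2} {L M N : SMod q n} (A : SMod q n) (h : p + r = s)
    (f : SHom p M N) (g : SHom r L M) :
    SHom.comp h (SHom.tensor (zero_add p) (SHom.one A) f)
      (SHom.tensor (zero_add r) (SHom.one A) g) =
      SHom.tensor (zero_add s) (SHom.one A) (SHom.comp h f g) :=
  Subtype.ext (by
    change TensorProduct.map (LinearMap.id ∘ₗ ipow A.sgn p) f.1 ∘ₗ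
      TensorProduct.map (LinearMap.id ∘ₗ ipow A.sgn r) g.1 =
      TensorProduct.map (LinearMap.id ∘ₗ ipow A.sgn s) (f.1 ∘ₗ g.1)
    rw [← TensorProduct.map_comp, LinearMap.id_comp, LinearMap.id_comp, LinearMap.id_comp, ← h,
      ← ipow_add A.sgn_sgn]
    rfl)

end SHom

lemma blackId_self (M : SMod q n) : ∀ X : List (Option QObj), X.count none = 0 →
    blackId M M X = SHom.one _
  | [], _ => rfl
  | [none], h => by simp at h
  | [some o], _ => rfl
  | none :: _ :: _, h => by simp at h
  | some o :: o' :: X, h => by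
    have h' : (o' :: X).count none = 0 := by simpa using h
    rw [blackId, blackId_self M (o' :: X) h']
    exact SHom.one_tensor_one _ _

lemma blackId_comp (L M N : SMod q n) : ∀ X : List (Option QObj), X.count none = 0 →
    SHom.comp (add_zero 0) (blackId M N X) (blackId L M X) = blackId L N X
  | [], _ => rfl
  | [none], h => by simp at h
  | [some o], _ => rfl
  | none :: _ :: _, h => by simp at h
  | some o :: o' :: X, h => by
    have h' : (o' :: X).count none = 0 := by simpa using h
    rw [blackId, blackId, blackId, ← blackId_comp L M N (o' :: X) h']
    exact SHom.comp_tensor_even (add_zero 0) _ _ _ _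

lemma redHom_add {p : ZMod 2} {M N : SMod q n} (g g' : SHom p M N) :
    ∀ X : List (Option QObj), redHom (g + g') X = redHom g X + redHom g' X
  | [] => (add_zero 0).symm
  | [none] => rfl
  | [some _] => (add_zero 0).symm
  | none :: o' :: X => SHom.add_tensor _ _ _ _
  | some o :: o' :: X => by
    rw [redHom, redHom_add g g' (o' :: X)]
    exact SHom.tensor_add _ _ _ _

lemma redHom_smul {p : ZMod 2} {M N : SMod q n} (c : K) (g : SHom p M N) :
    ∀ X : List (Option QObj), redHom (c • g) X = c • redHom g X
  | [] => (smul_zero c).symm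
  | [none] => rfl
  | [some _] => (smul_zero c).symm
  | none :: o' :: X => SHom.smul_tensor _ _ _ _
  | some o :: o' :: X => by
    rw [redHom, redHom_smul c g (o' :: X)]
    exact SHom.tensor_smul _ _ _ _

lemma redHom_one (M : SMod q n) : ∀ X : List (Option QObj), X.count none = 1 →
    redHom (SHom.one M) X = SHom.one _
  | [], h => by simp at h
  | [none], _ => rfl
  | [some _], h => by simp at h
  | none :: o' :: X, h => by
    have h' : (o' :: X).count none = 0 := by
      rw [List.count_cons_self] at h; omega
    rw [redHom, blackId_self M _ h']
    exact SHom.one_tensor_one _ _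
  | some o :: o' :: X, h => by
    have h' : (o' :: X).count none = 1 := by simpa using h
    rw [redHom, redHom_one M (o' :: X) h']
    exact SHom.one_tensor_one _ _

lemma redHom_comp {p r s : ZMod 2} {L M N : SMod q n} (h : p + r = s) (f : SHom p M N)
    (g : SHom r L M) : ∀ X : List (Option QObj), X.count none = 1 →
    redHom (SHom.comp h f g) X = SHom.comp h (redHom f X) (redHom g X)
  | [], h => by simp at h
  | [none], _ => rfl
  | [some _], h => by simp at h
  | none :: o' :: X, hX => by
    have h' : (o' :: X).count none = 0 := by
      rw [List.count_cons_self] at hX; omega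
    rw [redHom, ← blackId_comp L M N _ h']
    exact (SHom.comp_tensor_even h f g _ _).symm
  | some o :: o' :: X, hX => by
    have h' : (o' :: X).count none = 1 := by simpa using hX
    rw [redHom, redHom_comp h f g (o' :: X) h']
    exact (SHom.comp_one_tensor _ h _ _).symm

/-- The linear map `g ↦ 1 ⊗ g ⊗ 1`. -/
def redLin (p : ZMod 2) (M N : SMod q n) (X : List (Option QObj)) :
    SHom p M N →ₗ[K] SHom p (tens (labW M) X) (tens (labW N) X) where
  toFun g := redHom g X
  map_add' g g' := redHom_add g g' X
  map_smul' c g := redHom_smul c g X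

variable (q n) in
/-- The endofunctor of the supercategory of supermodules attached to a word with exactly one red
letter: it sends `M` to the tensor product labelled by the word with red label `M`, and `g` to
`1 ⊗ g ⊗ 1`. -/
def redObj (X : {X : List (Option QObj) // X.count none = 1}) :
    Superfunctor (UqCat q n) (UqCat q n) where
  obj M := tens (labW M) X.1
  map p M N := redLin p M N X.1
  map_id M := redHom_one M X.1 X.2
  map_comp h f g := redHom_comp h f g X.1 X.2

end RedObj

/-! ### The superfunctors of the theorem -/

section Incarnation

variable {K : Type} [Field K] [CharZero K] {q : Kˣ} {n : ℕ}

/-- The conditions `F(↑) = V`, `F(↓) = V^*`, `F(positive crossing) = T`, `F(left cap) = ev` and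
`F(Clifford token) = J`. -/
structure IsIncarnation (F : MonFun (Qcat (zz q)) (labQ q n)) : Prop where
  pos : (F.map 0 [.up, .up] [.up, .up] ((Qcat (zz q)).cls Q.pos)).1 = TV q n
  leftCap : (F.map 0 [.dn, .up] [] ((Qcat (zz q)).cls Q.leftCap)).1 = evV q n
  tok : (F.map 1 [.up] [.up] ((Qcat (zz q)).cls Q.tok)).1 = Jop q n

/-- The monoidal superfunctor `G`, which sends the red object to `M`, extends `F` and sends the
positive red crossing to `T_{MV}`. -/
structure IsExtension (F : MonFun (Qcat (zz q)) (labQ q n)) (M : SMod q n)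
    (G : MonFun (Wcat (zz q)) (labW M)) : Prop where
  extend : ∀ (p : ZMod 2) (X Y : List QObj) (f : (Qcat (zz q)).Hom p X Y),
    HEq (G.map p (X.map some) (Y.map some) (inclHom (zz q) p X Y f)) (F.map p X Y f)
  posRed : (G.map 0 [W.red, W.up] [W.up, W.red] ((Wcat (zz q)).cls W.posRed)).1 = M.T

/-- The superfunctor `R` sends a word `X` with one red letter to the superfunctor
`M ↦ G_M(X)`, and a morphism `f` to the supernatural transformation with components `G_M(f)`. -/
structure IsRedFunctor (G : ∀ M : SMod q n, MonFun (Wcat (zz q)) (labW M))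
    (R : Superfunctor (W1cat (zz q)) (SEnd (UqCat q n))) : Prop where
  obj : ∀ X : {X : List (Option QObj) // X.count none = 1}, R.obj X = redObj q n X
  map : ∀ (p : ZMod 2) (X Y : {X : List (Option QObj) // X.count none = 1})
    (f : (Wcat (zz q)).Hom p X.1 Y.1) (M : SMod q n),
    HEq ((R.map p X Y f : superNat (R.obj X) (R.obj Y) p).1 M) ((G M).map p X.1 Y.1 f)

end Incarnation

/-- The element `q` of the field `ℂ(q)`. -/
def qq : (RatFunc ℂ)ˣ := Units.mk0 RatFunc.X RatFunc.X_ne_zero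

instance : CharZero (RatFunc ℂ) :=
  charZero_of_injective_algebraMap (algebraMap ℂ (RatFunc ℂ)).injective

end Isomeric

end

open Isomeric

/-! The computation rests on replacing the generators by the operators τ_ij with T_{MV}(m ⊗ v_j) = ∑
v_i ⊗ τ_ij m. Up to a sign and a power of the parity involution τ_ij is u_ij, so τ and the
involution together determine the action. In terms of τ almost all signs disappear. On a tensor
product τ is the matrix product of the two factors (`SMod.tau_tensor`). On a dual it is given by the
transposed operators of the inverse matrix κ (`SMod.tau_dual`). Even homomorphisms commute with it,
and the defining relation of U_q becomes the relation `SMod.frt`, whose structure constants `Tc` are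
the matrix entries of T on V ⊗ V. Hence T_{MV} is invertible because τ is, it is a homomorphism by
`SMod.frt`, and it is natural by `SHom.map_tau`. The braid relations are `SMod.frt` once more, and
the relation T² = zT + 1 is the finite check `hecke_core`.

Rotating T_{MV} with evaluation and coevaluation gives v_k^* ⊗ m ↦ ∑ τ_ki m ⊗ v_i^*. Its inverse is
described by the inverse λ of the transposed matrix of τ, which exists because τ is triangular with
invertible diagonal. For M = V there are weights c_i, equal to ± powers of q, for which the weighted
partial traces of T are the identity; this is a telescoping sum (`sum_wt_cap`, `sum_wt_cup`). It
follows that the right cap is v_i ⊗ v_i^* ↦ c_i and the right cup is ∑ c_i⁻¹ v_i^* ⊗ v_i. The bubble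
vanishes since c_{-i} = -c_i, and the bubble with a token vanishes since the unit object is purely
even.

The decisive identity is λ_kj = c_j⁻¹ c_k κ_kj, valid for every M (`SMod.quad`, `SMod.lam_eq`). To
obtain it, multiply `SMod.frt` by κ on both sides, take a weighted partial trace, and cancel the
coefficients `Tc`, which is possible because V itself has a λ. This identity says that rotating
T_{MV}⁻¹ with the right cap and cup gives the inverse of the rotated T_{MV}, which yields the
relations for a' and b'. Applied to the regular supermodule it shows that S² rescales u_ij by a
ratio of weights (`Uq.antipode_antipode`), so S is bijective, and the formula with S⁻¹ follows.

A monoidal superfunctor from a presented category is the same as a choice of values on the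
generators which satisfies the relations, because the canonical isomorphisms are coherent
(`SHom.eval_cong`, `MonFun.ofGens`, `MonFun.ext_gens`). The values that are not prescribed are
forced: they are inverses of known morphisms, or, for the left cup, determined by a zigzag relation.
Supernaturality in the red label is an induction on expressions (`redHom_eval`), in which the only
substantial case is the naturality of T_{MV}. -/

set_option linter.unusedSectionVars false

noncomputable section

open scoped TensorProduct

namespace Isomeric

/-! ### The sign-free operators τ, their inverse κ, and the relation between them -/

section Tau

variable {K : Type} [Field K] [CharZero K] {q : Kˣ} {n : ℕ}

/-- The matrix entries of `T_{MV}`, for which `T(m ⊗ v_j) = ∑ v_i ⊗ τ_ij m`. -/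
def SMod.tau (M : SMod q n) (i j : Idx n) : Module.End K M.carrier :=
  (sg (par i * par₂ i j) : K) • (M.x i j * ipow M.sgn (par j))

/-- The entries of the inverse of the matrix `τ`. -/
def SMod.kap (M : SMod q n) (i j : Idx n) : Module.End K M.carrier :=
  (sg (par₂ i j) : K) • (ipow M.sgn (par i) * M.ρ (Linv q n i j))

variable (M : SMod q n)

lemma SMod.tau_lower {i j : Idx n} (h : j < i) : M.tau i j = 0 := by
  rw [SMod.tau, M.isRep.tri i j h]; simp

lemma SMod.kap_lower {i j : Idx n} (h : j < i) : M.kap i j = 0 := by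
  rw [SMod.kap, Linv_lower h]; simp

/-- For i ≤ j the parity p(i,j) is odd only if i < 0 < j, and then p(i) = 1. -/
lemma par_mul_par₂ {i j : Idx n} (h : i ≤ j) : par i * par₂ i j = par₂ i j := by
  have h1 : i.1 ≤ j.1 := h
  unfold par₂ par
  split_ifs <;> first | omega | decide

/-- Because u_ij vanishes below the diagonal, the quadratic exponent of the sign may be replaced by
p(i,j), which is additive along matrix products. -/
lemma SMod.tau_eq (i j : Idx n) :
    M.tau i j = (sg (par₂ i j) : K) • (M.x i j * ipow M.sgn (par j)) := by
  by_cases h : j < i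
  · rw [M.tau_lower h, M.isRep.tri i j h]; simp
  · rw [SMod.tau, par_mul_par₂ (not_lt.1 h)]

/-- The normalisation is invertible: τ and the parity involution recover the generators, so
homomorphisms can be tested on τ. -/
lemma SMod.x_eq_tau (i j : Idx n) :
    M.x i j = (sg (par₂ i j) : K) • (M.tau i j * ipow M.sgn (par j)) := by
  rw [M.tau_eq, smul_mul_assoc, smul_smul, sgK_mul_self, one_smul, mul_assoc,
    ipow_mul_self M.sgn_sgn, mul_one]

lemma SMod.sgn_tau (i j : Idx n) :
    M.sgn * M.tau i j = (sg (par₂ i j) : K) • (M.tau i j * M.sgn) := by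
  have h : ipow M.sgn (par j) * M.sgn = M.sgn * ipow M.sgn (par j) := by
    rcases zmod2_cases (par j) with h | h <;> rw [h] <;> simp [ipow_zero, ipow_one]
  rw [SMod.tau, mul_smul_comm, ← mul_assoc, M.sgn_x, smul_mul_assoc, smul_mul_assoc, mul_assoc,
    mul_assoc, h, smul_comm]

lemma sum_par₂ (i j k : Idx n) : par₂ i k + par₂ k j = par₂ i j := by
  simp only [par₂]
  generalize par i = a1; generalize par j = a2; generalize par k = a3
  revert a1 a2 a3; decide

/-- The two powers of the parity involution meet at the inner index k and cancel, and the signs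
combine to one independent of k; what remains is L L⁻¹ = 1. -/
lemma SMod.tau_mul_kap (i j : Idx n) :
    ∑ k, M.tau i k * M.kap k j = if i = j then 1 else 0 := by
  have h : ∀ k, M.tau i k * M.kap k j =
      (sg (par₂ i j) : K) • M.ρ (fam (uu q) i k * Linv q n k j) := by
    intro k
    rw [M.tau_eq, SMod.kap, smul_mul_smul_comm, ← sgK_add, sum_par₂, mul_assoc,
      ← mul_assoc (ipow _ _), ipow_mul_self M.sgn_sgn, one_mul, map_mul]
    rfl
  simp only [h]
  rw [← Finset.smul_sum, ← map_sum, ← Matrix.mul_apply, L_mul_Linv]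
  by_cases hij : i = j
  · subst hij; simp [par₂_self, sg_zero]
  · simp [hij]

/-- In this order the powers of the involution stand at the outer ends; L⁻¹ L = 1 forces i = j, and
then they cancel as well. -/
lemma SMod.kap_mul_tau (i j : Idx n) :
    ∑ k, M.kap i k * M.tau k j = if i = j then 1 else 0 := by
  have h : ∀ k, M.kap i k * M.tau k j =
      (sg (par₂ i j) : K) • (ipow M.sgn (par i) * M.ρ (Linv q n i k * fam (uu q) k j) *
        ipow M.sgn (par j)) := by
    intro k
    rw [M.tau_eq, SMod.kap, smul_mul_smul_comm, ← sgK_add, sum_par₂, map_mul]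
    simp only [mul_assoc]
    rfl
  simp only [h]
  rw [← Finset.smul_sum, ← Finset.sum_mul, ← Finset.mul_sum, ← map_sum, ← Matrix.mul_apply,
    Linv_mul_L]
  by_cases hij : i = j
  · subst hij; simp [par₂_self, sg_zero, ipow_mul_self M.sgn_sgn]
  · simp [hij]

/-- The coefficient of `v_a ⊗ v_b` in `T(v_i ⊗ v_k)`. -/
def Tc (q : Kˣ) (a b i k : Idx n) : K :=
  (sg (par₂ a k * par i + par a * par b) : K) * theta q b i a k

/-- The relations between the entries of `τ`. -/
lemma SMod.frt (a b j l : Idx n) :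
    ∑ i, ∑ k, Tc q a b i k • (M.tau k l * M.tau i j) =
      ∑ i, ∑ k, Tc q i k j l • (M.tau b k * M.tau a i) := by
  have tt : ∀ i j k l, M.tau k l * M.tau i j =
      (sg (par k * par₂ k l + par i * par₂ i j + par l * par₂ i j) : K) •
        (M.x k l * M.x i j * ipow M.sgn (par l + par j)) := by
    intro i j k l
    rw [SMod.tau, SMod.tau, smul_mul_smul_comm, mul_assoc, ← mul_assoc (ipow _ _), M.ipow_sgn_x,
      smul_mul_assoc, mul_smul_comm, smul_smul, mul_assoc (M.x i j), ipow_add M.sgn_sgn, sgK_add,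
      sgK_add]
    simp only [mul_assoc]
  -- Since Θ is even, the sign of each nonzero term differs from the sign in the defining relation
  -- by a factor which depends only on a, b, j, l. The same factor occurs on the right-hand side
  -- below.
  have hl : ∀ i k, Tc q a b i k • (M.tau k l * M.tau i j) =
      (sg (par b * par j + par a * par b + par a + par b + par a * par l + par b * par l
        + par l * par j) : K) • (((sg (par₂ a k * par₂ i j) : K) * theta q b i a k) •
          (M.x k l * M.x i j) * ipow M.sgn (par l + par j)) := by
    intro i k
    by_cases h0 : theta q b i a k = 0
    · simp [Tc, h0]
    have h1 := theta_even q _ _ _ _ h0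
    rw [tt, Tc, smul_mul_assoc, smul_smul, smul_smul, mul_right_comm, ← sgK_add, ← mul_assoc,
      ← sgK_add]
    congr 4
    revert h1
    simp only [par₂]
    generalize par i = a1; generalize par j = a2; generalize par k = a3
    generalize par l = a4; generalize par a = a5; generalize par b = a6
    revert a1 a2 a3 a4 a5 a6; decide
  have hr : ∀ i k, Tc q i k j l • (M.tau b k * M.tau a i) =
      (sg (par b * par j + par a * par b + par a + par b + par a * par l + par b * par l
        + par l * par j) : K) • (((sg (par₂ a i * par₂ b j) : K) * theta q k j i l) •
          (M.x b k * M.x a i) * ipow M.sgn (par l + par j)) := by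
    intro i k
    by_cases h0 : theta q k j i l = 0
    · simp [Tc, h0]
    have h1 := theta_even q _ _ _ _ h0
    -- Here the product leaves the involution with exponent p(k) + p(i); evenness of Θ makes it
    -- agree with the exponent on the left-hand side.
    have h2 : par k + par i = par l + par j := by
      revert h1
      simp only [par₂]
      generalize par i = a1; generalize par j = a2; generalize par k = a3
      generalize par l = a4
      revert a1 a2 a3 a4; decide
    rw [tt, Tc, smul_mul_assoc, smul_smul, smul_smul, mul_right_comm, ← sgK_add, ← mul_assoc,
      ← sgK_add, h2]
    congr 4
    revert h1
    simp only [par₂]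
    generalize par i = a1; generalize par j = a2; generalize par k = a3
    generalize par l = a4; generalize par a = a5; generalize par b = a6
    revert a1 a2 a3 a4 a5 a6; decide
  simp only [hl, hr, ← Finset.smul_sum, ← Finset.sum_mul]
  congr 2
  -- The flip in T exchanges the tensor factors, so (b, j) labels the first slot of Θ and (a, l) the
  -- second.
  have h := M.isRep.rll b j a l
  rw [rllLeft, rllRight] at h
  rw [← h, Finset.sum_comm]

end Tau

/-! ### Behaviour of τ under tensor products, duals and morphisms -/

section TauConstructions

variable {K : Type} [Field K] [CharZero K] {q : Kˣ} {n : ℕ}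

/-- The sign of the comultiplication and the sign for u_kj passing the first factor are exactly
absorbed by the normalisation of τ. This is the reason for working with τ instead of u. -/
lemma SMod.tau_tensor (M N : SMod q n) (i j : Idx n) :
    (M.tensor N).tau i j = ∑ k, TensorProduct.map (M.tau i k) (N.tau k j) := by
  rw [SMod.tau, SMod.mk'_x, SMod.mk'_sgn, SMod.tensorX, SMod.ipow_tensorSgn, Finset.sum_mul,
    Finset.smul_sum]
  refine Finset.sum_congr rfl fun k _ => ?_
  rw [SMod.tau, SMod.tau, TensorProduct.map_smul_left, TensorProduct.map_smul_right, smul_mul_assoc,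
    ← TensorProduct.map_mul, smul_smul, smul_smul, ← sgK_add, ← sgK_add, mul_assoc,
    ipow_add M.sgn_sgn]
  have h : par₂ k j + par j = par k := by
    simp only [par₂]
    generalize par j = a2; generalize par k = a3
    revert a2 a3; decide
  rw [h]
  congr 3
  simp only [par₂]
  generalize par i = a1; generalize par j = a2; generalize par k = a3
  revert a1 a2 a3; decide

lemma SMod.tau_unit (i j : Idx n) :
    (SMod.unit q n).tau i j = if i = j then 1 else 0 := by
  have h : ∀ p, ipow (1 : Module.End K K) p = 1 := by
    intro p; rcases zmod2_cases p with rfl | rfl <;> rfl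
  rw [SMod.tau, SMod.mk'_x, SMod.mk'_sgn, h, mul_one]
  by_cases hij : i = j
  · subst hij; simp [par₂_self, sg_zero]
  · simp [hij]

/-- The antipode replaces L by L⁻¹, and p(i,j) + p(j) = p(i) collects the powers of the involution
into the one that occurs in κ. -/
lemma SMod.tau_dual (M : SMod q n) (i j : Idx n) :
    M.dual.tau i j = transp (M.kap i j) := by
  have h : par₂ i j + par j = par i := by
    simp only [par₂]
    generalize par i = a2; generalize par j = a3
    revert a2 a3; decide
  have h' : ipow (transp M.sgn) (par i) = transp (ipow M.sgn (par i)) := by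
    rcases zmod2_cases (par i) with h | h <;> rw [h] <;> rfl
  rw [SMod.tau_eq, SMod.mk'_x, SMod.mk'_sgn, SMod.dualX, mul_assoc, ipow_add M.dualSgn_sq, h,
    SMod.kap, transp_smul, transp_mul, Uq.antipode_uu, h']

lemma SHom.map_ipow_sgn {p : ZMod 2} {M N : SMod q n} (f : SHom p M N) (r : ZMod 2) (m : M.carrier) :
    f.1 (ipow M.sgn r m) = (sg (p * r) : K) • ipow N.sgn r (f.1 m) :=
  LinearMap.congr_fun (SHom.ipow_sgn f r) m

lemma tau_sign' : ∀ p a b : ZMod 2, a * (a + b) + p * (a + b) + p * b = p * a + a * (a + b) := by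
  decide

/-- The sign involves only the row index i: it is the sign for moving f past v_i in V ⊗ N, which is
what naturality of T requires. -/
lemma SHom.map_tau {p : ZMod 2} {M N : SMod q n} (f : SHom p M N) (i j : Idx n) (m : M.carrier) :
    f.1 (M.tau i j m) = (sg (p * par i) : K) • N.tau i j (f.1 m) := by
  have h : ∀ m, f.1 (M.x i j m) = (sg (p * par₂ i j) : K) • N.x i j (f.1 m) :=
    fun m => LinearMap.congr_fun (SHom.map_x f i j) m
  rw [SMod.tau, SMod.tau, LinearMap.smul_apply, LinearMap.smul_apply, Module.End.mul_apply,
    Module.End.mul_apply, map_smul, h, SHom.map_ipow_sgn, map_smul, smul_smul, smul_smul, smul_smul,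
    ← sgK_add, ← sgK_add, ← sgK_add]
  congr 3
  exact tau_sign' p (par i) (par j)

lemma tau_sign : ∀ p a b : ZMod 2, a + b + p * a + p * b = p * (a + b) + (a + b) := by decide

/-- A linear map which is compatible with the parity involutions and the entries of `τ` is a
homomorphism of supermodules. -/
def SHom.ofTau {p : ZMod 2} {M N : SMod q n} (f : M.carrier →ₗ[K] N.carrier)
    (h : ∀ m, f (M.sgn m) = (sg p : K) • N.sgn (f m))
    (h' : ∀ i j m, f (M.tau i j m) = (sg (p * par i) : K) • N.tau i j (f m)) : SHom p M N :=
  SHom.mk' f (LinearMap.ext h) fun i j => LinearMap.ext fun m => by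
    have h2 : ∀ r m, f (ipow M.sgn r m) = (sg (p * r) : K) • ipow N.sgn r (f m) := by
      intro r m
      rcases zmod2_cases r with rfl | rfl
      · simp [ipow_zero, sg_zero]
      · simpa [ipow_one] using h m
    rw [SMod.x_eq_tau, SMod.x_eq_tau, LinearMap.comp_apply, LinearMap.smul_apply,
      LinearMap.smul_apply, LinearMap.comp_apply, LinearMap.smul_apply, Module.End.mul_apply,
      Module.End.mul_apply, map_smul, h', h2, map_smul, smul_smul, smul_smul, smul_smul,
      ← sgK_add, ← sgK_add, ← sgK_add]
    congr 3
    exact tau_sign p (par i) (par j)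

/-- An even linear map compatible with parity involutions and the entries of `τ` is a homomorphism. -/
def SHom.ofTauEven {M N : SMod q n} (f : M.carrier →ₗ[K] N.carrier)
    (h : ∀ m, f (M.sgn m) = N.sgn (f m))
    (h' : ∀ i j m, f (M.tau i j m) = N.tau i j (f m)) : SHom 0 M N :=
  SHom.ofTau f (fun m => by rw [h]; simp [sg_zero]) fun i j m => by rw [h']; simp [sg_zero]

lemma SHom.map_sgn_even {M N : SMod q n} (f : SHom 0 M N) (m : M.carrier) :
    f.1 (M.sgn m) = N.sgn (f.1 m) := by
  simpa [sg_zero, ipow_one] using SHom.map_ipow_sgn f 1 m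

lemma SHom.map_tau_even {M N : SMod q n} (f : SHom 0 M N) (i j : Idx n) (m : M.carrier) :
    f.1 (M.tau i j m) = N.tau i j (f.1 m) := by
  simpa [sg_zero] using SHom.map_tau f i j m

/-- The inverse of a bijective even homomorphism. -/
def SHom.symmOf {M N : SMod q n} (e : M.carrier ≃ₗ[K] N.carrier) (f : SHom 0 M N)
    (hf : f.1 = e.toLinearMap) : SHom 0 N M :=
  have hf' : ∀ m, f.1 m = e m := fun m => by rw [hf]; rfl
  SHom.ofTauEven e.symm.toLinearMap
    (fun m => e.injective (by
      have h := SHom.map_sgn_even f (e.symm m)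
      rw [hf', hf'] at h
      simpa using h.symm))
    (fun i j m => e.injective (by
      have h := SHom.map_tau_even f i j (e.symm m)
      rw [hf', hf'] at h
      simpa using h.symm))

lemma SMod.tensor_sgn (M N : SMod q n) (m : M.carrier) (v : N.carrier) :
    (M.tensor N).sgn (m ⊗ₜ[K] v) = M.sgn m ⊗ₜ[K] N.sgn v := by
  rw [SMod.mk'_sgn]; rfl

lemma SMod.tensor_tau (M N : SMod q n) (i j : Idx n) (m : M.carrier) (v : N.carrier) :
    (M.tensor N).tau i j (m ⊗ₜ[K] v) = ∑ k, M.tau i k m ⊗ₜ[K] N.tau k j v := by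
  rw [SMod.tau_tensor, LinearMap.sum_apply]; rfl

/-- The associativity isomorphism. -/
def SHom.assoc (L M N : SMod q n) : SHom 0 ((L.tensor M).tensor N) (L.tensor (M.tensor N)) :=
  SHom.ofTauEven (TensorProduct.assoc K L.carrier M.carrier N.carrier).toLinearMap
    (fun m => by
      refine LinearMap.congr_fun (f := (TensorProduct.assoc K _ _ _).toLinearMap ∘ₗ
        ((L.tensor M).tensor N).sgn) (g := (L.tensor (M.tensor N)).sgn ∘ₗ
        (TensorProduct.assoc K _ _ _).toLinearMap) ?_ m
      refine TensorProduct.ext_threefold fun a b c => ?_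
      rw [LinearMap.comp_apply, LinearMap.comp_apply, SMod.tensor_sgn, SMod.tensor_sgn,
        LinearEquiv.coe_coe, TensorProduct.assoc_tmul, TensorProduct.assoc_tmul, SMod.tensor_sgn,
        SMod.tensor_sgn])
    (fun i j m => by
      refine LinearMap.congr_fun (f := (TensorProduct.assoc K _ _ _).toLinearMap ∘ₗ
        ((L.tensor M).tensor N).tau i j) (g := (L.tensor (M.tensor N)).tau i j ∘ₗ
        (TensorProduct.assoc K _ _ _).toLinearMap) ?_ m
      refine TensorProduct.ext_threefold fun a b c => ?_
      rw [LinearMap.comp_apply, LinearMap.comp_apply, SMod.tensor_tau, LinearEquiv.coe_coe,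
        TensorProduct.assoc_tmul, SMod.tensor_tau, map_sum]
      have h1 : ∀ k, TensorProduct.assoc K _ _ _ ((L.tensor M).tau i k (a ⊗ₜ b) ⊗ₜ N.tau k j c) =
          ∑ l, L.tau i l a ⊗ₜ[K] (M.tau l k b ⊗ₜ[K] N.tau k j c) := by
        intro k
        rw [SMod.tensor_tau, TensorProduct.sum_tmul, map_sum]
        exact Finset.sum_congr rfl fun l _ => TensorProduct.assoc_tmul _ _ _
      have h2 : ∀ l, L.tau i l a ⊗ₜ[K] (M.tensor N).tau l j (b ⊗ₜ c) =
          ∑ k, L.tau i l a ⊗ₜ[K] (M.tau l k b ⊗ₜ[K] N.tau k j c) := by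
        intro l
        rw [SMod.tensor_tau, TensorProduct.tmul_sum]
      exact (Finset.sum_congr rfl fun k _ => h1 k).trans (Finset.sum_comm.trans
        (Finset.sum_congr rfl fun l _ => (h2 l).symm)))

/-- The left unit isomorphism. -/
def SHom.lid (M : SMod q n) : SHom 0 ((SMod.unit q n).tensor M) M :=
  SHom.ofTauEven (TensorProduct.lid K M.carrier).toLinearMap
    (fun m => by
      refine LinearMap.congr_fun (f := (TensorProduct.lid K M.carrier).toLinearMap ∘ₗ
        ((SMod.unit q n).tensor M).sgn) (g := M.sgn ∘ₗ
        (TensorProduct.lid K M.carrier).toLinearMap) ?_ m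
      refine TensorProduct.ext' fun a b => ?_
      rw [LinearMap.comp_apply, SMod.tensor_sgn, SMod.mk'_sgn]
      simp)
    (fun i j m => by
      refine LinearMap.congr_fun (f := (TensorProduct.lid K M.carrier).toLinearMap ∘ₗ
        ((SMod.unit q n).tensor M).tau i j) (g := M.tau i j ∘ₗ
        (TensorProduct.lid K M.carrier).toLinearMap) ?_ m
      refine TensorProduct.ext' fun a b => ?_
      rw [LinearMap.comp_apply, SMod.tensor_tau, Finset.sum_eq_single i]
      · rw [SMod.tau_unit, if_pos rfl]; simp
      · intro k _ hk
        rw [SMod.tau_unit, if_neg hk.symm]; simp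
      · simp)

/-- The right unit isomorphism. -/
def SHom.rid (M : SMod q n) : SHom 0 (M.tensor (SMod.unit q n)) M :=
  SHom.ofTauEven (TensorProduct.rid K M.carrier).toLinearMap
    (fun m => by
      refine LinearMap.congr_fun (f := (TensorProduct.rid K M.carrier).toLinearMap ∘ₗ
        (M.tensor (SMod.unit q n)).sgn) (g := M.sgn ∘ₗ
        (TensorProduct.rid K M.carrier).toLinearMap) ?_ m
      refine TensorProduct.ext' fun a b => ?_
      rw [LinearMap.comp_apply, SMod.tensor_sgn, SMod.mk'_sgn]
      simp)
    (fun i j m => by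
      refine LinearMap.congr_fun (f := (TensorProduct.rid K M.carrier).toLinearMap ∘ₗ
        (M.tensor (SMod.unit q n)).tau i j) (g := M.tau i j ∘ₗ
        (TensorProduct.rid K M.carrier).toLinearMap) ?_ m
      refine TensorProduct.ext' fun a b => ?_
      rw [LinearMap.comp_apply, SMod.tensor_tau, Finset.sum_eq_single j]
      · rw [SMod.tau_unit, if_pos rfl]; simp
      · intro k _ hk
        rw [SMod.tau_unit, if_neg hk]; simp
      · simp)

end TauConstructions

/-! ### Bases of V and its dual, and τ on V -/

section FundBasis

variable {K : Type} [Field K] [CharZero K] {q : Kˣ} {n : ℕ}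

variable (q) in
/-- The basis vector `v_j` of `V`. -/
def vv (j : Idx n) : (SMod.fund q n).carrier := (Pi.single j 1 : Idx n → K)

variable (q) in
/-- The dual basis vector `v_j^*` of `V^*`. -/
def vd (j : Idx n) : (SMod.fund q n).dual.carrier := (LinearMap.proj j : (Idx n → K) →ₗ[K] K)

lemma fund_ext {P : Type} [AddCommGroup P] [Module K P] {f g : (SMod.fund q n).carrier →ₗ[K] P}
    (h : ∀ j, f (vv q j) = g (vv q j)) : f = g :=
  LinearMap.pi_ext' (M := P) (φ := fun _ : Idx n => K) fun j => LinearMap.ext_ring (h j)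

lemma vd_vv (i j : Idx n) : (vd q i : (SMod.fund q n).carrier →ₗ[K] K) (vv q j) =
    if i = j then 1 else 0 := by
  change (Pi.single j 1 : Idx n → K) i = _
  rw [Pi.single_apply]

lemma dual_eq_sum (f : (SMod.fund q n).dual.carrier) :
    f = ∑ j, (f : (SMod.fund q n).carrier →ₗ[K] K) (vv q j) • vd q j := by
  refine fund_ext fun j => ?_
  rw [show (∑ j, (f : (SMod.fund q n).carrier →ₗ[K] K) (vv q j) • vd q j : (SMod.fund q n).dual.carrier)
    = (∑ j, (f : (SMod.fund q n).carrier →ₗ[K] K) (vv q j) •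
      (vd q j : (SMod.fund q n).carrier →ₗ[K] K) : (SMod.fund q n).carrier →ₗ[K] K) from rfl,
    LinearMap.sum_apply, Finset.sum_eq_single j]
  · rw [LinearMap.smul_apply, vd_vv, if_pos rfl, smul_eq_mul, mul_one]
  · intro k _ hk
    rw [LinearMap.smul_apply, vd_vv, if_neg hk, smul_zero]
  · simp

lemma fund_eq_sum (v : (SMod.fund q n).carrier) :
    v = ∑ j, (v : Idx n → K) j • vv q j :=
  pi_eq_sum_univ' (R := K) (ι := Idx n) v

lemma dual_ext {P : Type} [AddCommGroup P] [Module K P] {f g : (SMod.fund q n).dual.carrier →ₗ[K] P}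
    (h : ∀ j, f (vd q j) = g (vd q j)) : f = g := by
  ext x
  rw [dual_eq_sum x, map_sum, map_sum]
  exact Finset.sum_congr rfl fun j _ => by rw [map_smul, map_smul, h]

/-- Extensionality on N is taken as the hypothesis `hb`, so that one argument serves both for the
basis of V and for the dual basis. -/
lemma ext_right {M N : Type} {P : Type} [AddCommGroup M] [Module K M] [AddCommGroup N] [Module K N]
    [AddCommGroup P] [Module K P] {ι : Type} {b : ι → N}
    (hb : ∀ f g : N →ₗ[K] P, (∀ j, f (b j) = g (b j)) → f = g) {f g : M ⊗[K] N →ₗ[K] P}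
    (h : ∀ m j, f (m ⊗ₜ b j) = g (m ⊗ₜ b j)) : f = g :=
  TensorProduct.ext' fun m v => LinearMap.congr_fun
    (hb (f ∘ₗ TensorProduct.mk K M N m) (g ∘ₗ TensorProduct.mk K M N m) (h m)) v

lemma ext_left {M N : Type} {P : Type} [AddCommGroup M] [Module K M] [AddCommGroup N] [Module K N]
    [AddCommGroup P] [Module K P] {ι : Type} {b : ι → M}
    (hb : ∀ f g : M →ₗ[K] P, (∀ j, f (b j) = g (b j)) → f = g) {f g : M ⊗[K] N →ₗ[K] P}
    (h : ∀ j m, f (b j ⊗ₜ m) = g (b j ⊗ₜ m)) : f = g :=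
  TensorProduct.ext' fun v m => LinearMap.congr_fun
    (hb (f ∘ₗ (TensorProduct.mk K M N).flip m) (g ∘ₗ (TensorProduct.mk K M N).flip m)
      (fun j => h j m)) v

lemma SMod.ext_tensor_fund {M : SMod q n} {P : Type} [AddCommGroup P] [Module K P]
    {f g : (M.tensor (SMod.fund q n)).carrier →ₗ[K] P}
    (h : ∀ m j, f (m ⊗ₜ[K] vv q j) = g (m ⊗ₜ[K] vv q j)) : f = g :=
  ext_right (fun _ _ => fund_ext) h

lemma SMod.ext_fund_tensor {M : SMod q n} {P : Type} [AddCommGroup P] [Module K P]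
    {f g : ((SMod.fund q n).tensor M).carrier →ₗ[K] P}
    (h : ∀ j m, f (vv q j ⊗ₜ[K] m) = g (vv q j ⊗ₜ[K] m)) : f = g :=
  ext_left (fun _ _ => fund_ext) h

lemma SMod.ext_tensor_dual {M : SMod q n} {P : Type} [AddCommGroup P] [Module K P]
    {f g : (M.tensor (SMod.fund q n).dual).carrier →ₗ[K] P}
    (h : ∀ m j, f (m ⊗ₜ[K] vd q j) = g (m ⊗ₜ[K] vd q j)) : f = g :=
  ext_right (fun _ _ => dual_ext) h

lemma SMod.ext_dual_tensor {M : SMod q n} {P : Type} [AddCommGroup P] [Module K P]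
    {f g : ((SMod.fund q n).dual.tensor M).carrier →ₗ[K] P}
    (h : ∀ j m, f (vd q j ⊗ₜ[K] m) = g (vd q j ⊗ₜ[K] m)) : f = g :=
  ext_left (fun _ _ => dual_ext) h

lemma fund_sgn_eq : (SMod.fund q n).sgn = Matrix.toLinAlgEquiv' (sgnV n K) := SMod.mk'_sgn

lemma fund_x_eq (i j : Idx n) :
    (SMod.fund q n).x i j = Matrix.toLinAlgEquiv' (thetaMat q i j) := SMod.mk'_x i j

lemma fund_sgn (j : Idx n) : (SMod.fund q n).sgn (vv q j) = (sg (par j) : K) • vv q j := by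
  rw [fund_sgn_eq]
  change Matrix.mulVec (sgnV n K) (Pi.single j 1) = (sg (par j) : K) • (Pi.single j 1 : Idx n → K)
  ext i
  rw [Matrix.mulVec_single_one, Matrix.col_apply, sgnV, Matrix.diagonal_apply, Pi.smul_apply,
    Pi.single_apply]
  by_cases h : i = j
  · subst h; simp
  · simp [h]

lemma dual_sgn (j : Idx n) : (SMod.fund q n).dual.sgn (vd q j) = (sg (par j) : K) • vd q j := by
  rw [SMod.mk'_sgn]
  refine fund_ext fun i => ?_
  change (vd q j : (SMod.fund q n).carrier →ₗ[K] K) ((SMod.fund q n).sgn (vv q i)) =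
    (sg (par j) : K) • (vd q j : (SMod.fund q n).carrier →ₗ[K] K) (vv q i)
  rw [fund_sgn, map_smul, vd_vv]
  by_cases h : j = i
  · subst h; rfl
  · simp [h]

lemma vv_mem (j : Idx n) : vv q j ∈ (SMod.fund q n).gr (par j) := by
  rw [SMod.mem_iff, fund_sgn]

lemma vd_mem (j : Idx n) : vd q j ∈ (SMod.fund q n).dual.gr (par j) := by
  rw [SMod.mem_iff, dual_sgn]

lemma SMod.ipow_of_mem (M : SMod q n) {a : ZMod 2} {m : M.carrier} (hm : m ∈ M.gr a) (p : ZMod 2) :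
    ipow M.sgn p m = (sg (p * a) : K) • m := by
  rcases zmod2_cases p with rfl | rfl
  · simp [ipow_zero, sg_zero]
  · rw [ipow_one, one_mul, SMod.sgn_mem hm]

/-- When one factor is homogeneous, the sign of the flip is a power of the parity involution on the
other factor, which need not be homogeneous. -/
lemma SMod.flip_right (M N : SMod q n) {b : ZMod 2} {v : N.carrier} (hv : v ∈ N.gr b)
    (m : M.carrier) : M.flip N (m ⊗ₜ[K] v) = v ⊗ₜ[K] ipow M.sgn b m := by
  refine LinearMap.congr_fun (f := M.flip N ∘ₗ (TensorProduct.mk K M.carrier N.carrier).flip v)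
    (g := TensorProduct.mk K N.carrier M.carrier v ∘ₗ ipow M.sgn b) ?_ m
  refine ext_graded M.compl fun a m hm => ?_
  change M.flip N (m ⊗ₜ[K] v) = v ⊗ₜ[K] ipow M.sgn b m
  rw [SMod.flip_tmul M N hm hv, M.ipow_of_mem hm, TensorProduct.tmul_smul, mul_comm]

lemma SMod.flip_left (M N : SMod q n) {a : ZMod 2} {m : M.carrier} (hm : m ∈ M.gr a)
    (v : N.carrier) : M.flip N (m ⊗ₜ[K] v) = ipow N.sgn a v ⊗ₜ[K] m := by
  refine LinearMap.congr_fun (f := M.flip N ∘ₗ TensorProduct.mk K M.carrier N.carrier m)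
    (g := (TensorProduct.mk K N.carrier M.carrier).flip m ∘ₗ ipow N.sgn a) ?_ v
  refine ext_graded N.compl fun b v hv => ?_
  change M.flip N (m ⊗ₜ[K] v) = ipow N.sgn a v ⊗ₜ[K] m
  rw [SMod.flip_tmul M N hm hv, N.ipow_of_mem hv, TensorProduct.smul_tmul']

lemma Eop_vv (i j k : Idx n) : Eop q i j (vv q k) = if j = k then vv q i else 0 := by
  change Matrix.mulVec (Matrix.single i j (1 : K)) (Pi.single k 1) =
    if j = k then (Pi.single i 1 : Idx n → K) else 0
  rw [Matrix.mulVec_single_one]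
  ext a
  rw [Matrix.col_apply, Matrix.single_apply]
  by_cases h : j = k
  · subst h; simp [Pi.single_apply, eq_comm]
  · simp [h]

lemma transp_Eop_vd (i j k : Idx n) :
    transp (Eop q i j) (vd q k) = if i = k then vd q j else 0 := by
  refine fund_ext fun a => ?_
  change (vd q k : (SMod.fund q n).carrier →ₗ[K] K) (Eop q i j (vv q a)) = _
  rw [Eop_vv]
  by_cases h : i = k
  · subst h
    rw [if_pos rfl, vd_vv]
    by_cases h' : j = a
    · subst h'; rw [if_pos rfl, vd_vv, if_pos rfl, if_pos rfl]
    · rw [if_neg h', if_neg h', map_zero]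
  · rw [if_neg h]
    by_cases h' : j = a
    · rw [if_pos h', vd_vv, if_neg (Ne.symm h)]; rfl
    · rw [if_neg h', map_zero]; rfl

/-- Evenness of Θ matches the sign in τ with the sign in `Tc`. Thus `Tc` is at once the matrix of T
on V ⊗ V and the matrix of τ on V, and statements about one can be read as statements about the
other. -/
lemma fund_tau (i l b : Idx n) : (SMod.fund q n).tau i l (vv q b) = ∑ a, Tc q i a b l • vv q a := by
  have hx : (SMod.fund q n).x i l (vv q b) = ∑ a, theta q a b i l • vv q a := by
    rw [fund_x_eq, fund_eq_sum (q := q) (Matrix.toLinAlgEquiv' (thetaMat q i l) (vv q b))]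
    refine Finset.sum_congr rfl fun a _ => ?_
    change Matrix.mulVec (thetaMat q i l) (Pi.single b 1) a • vv q a = _
    rw [Matrix.mulVec_single_one]
    rfl
  rw [SMod.tau, LinearMap.smul_apply, Module.End.mul_apply, (SMod.fund q n).ipow_of_mem (vv_mem b),
    map_smul, hx, smul_smul, Finset.smul_sum]
  refine Finset.sum_congr rfl fun a _ => ?_
  rw [smul_smul]
  congr 1
  by_cases h0 : theta q a b i l = 0
  · simp [Tc, h0]
  have h1 := theta_even q _ _ _ _ h0
  rw [Tc, ← sgK_add]
  congr 3
  revert h1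
  simp only [par₂]
  generalize par i = a1; generalize par a = a2; generalize par b = a3
  generalize par l = a4
  revert a1 a2 a3 a4; decide

end FundBasis

/-! ### The isomorphism T_{MV} -/

section Braiding

variable {K : Type} [Field K] [CharZero K] {q : Kˣ} {n : ℕ}

lemma SMod.opTensor_tmul (M N : SMod q n) (x : Module.End K M.carrier) (p : ZMod 2)
    (y : Module.End K N.carrier) (m : M.carrier) (v : N.carrier) :
    M.opTensor N x p y (m ⊗ₜ[K] v) = x (ipow M.sgn p m) ⊗ₜ[K] y v := rfl

/-- The flip applies the involution p(i) times to the factor in M. Moving it across u_ij gives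
(-1)^{p(i) p(i,j)}, and p(i) + p(i,j) = p(j) gives the remaining exponent; this is where the
definition of τ comes from. -/
lemma SMod.T_apply (M : SMod q n) (m : M.carrier) (j : Idx n) :
    M.T (m ⊗ₜ[K] vv q j) = ∑ i, vv q i ⊗ₜ[K] M.tau i j m := by
  have h : M.L (m ⊗ₜ[K] vv q j) = ∑ i, M.x i j (ipow M.sgn (par₂ i j) m) ⊗ₜ[K] vv q i := by
    rw [SMod.L, LinearMap.sum_apply]
    refine Finset.sum_congr rfl fun i _ => ?_
    rw [LinearMap.sum_apply, Finset.sum_eq_single j]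
    · rw [SMod.opTensor_tmul, Eop_vv, if_pos rfl]; rfl
    · intro k _ hk
      rw [SMod.opTensor_tmul, Eop_vv, if_neg hk, TensorProduct.tmul_zero]
    · simp
  rw [SMod.T, LinearMap.comp_apply, h, map_sum]
  refine Finset.sum_congr rfl fun i _ => ?_
  have h' : par i + par₂ i j = par j := by
    simp only [par₂]
    generalize par i = a1; generalize par j = a2
    revert a1 a2; decide
  rw [M.flip_right _ (vv_mem i), ← Module.End.mul_apply, M.ipow_sgn_x, LinearMap.smul_apply,
    Module.End.mul_apply, ← Module.End.mul_apply (ipow M.sgn _), ipow_add M.sgn_sgn, h']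
  rfl

/-- The inverse of `T_{MV}` as a linear map. -/
def SMod.Tinv (M : SMod q n) : ((SMod.fund q n).tensor M).carrier →ₗ[K]
    (M.tensor (SMod.fund q n)).carrier :=
  (TensorProduct.comm K (SMod.fund q n).carrier M.carrier).toLinearMap ∘ₗ
    ∑ i, ∑ j, TensorProduct.map (Eop q i j) (M.kap i j)

lemma SMod.Tinv_apply (M : SMod q n) (j : Idx n) (m : M.carrier) :
    M.Tinv (vv q j ⊗ₜ[K] m) = ∑ i, M.kap i j m ⊗ₜ[K] vv q i := by
  rw [SMod.Tinv, LinearMap.comp_apply, LinearMap.sum_apply, map_sum]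
  refine Finset.sum_congr rfl fun i _ => ?_
  rw [LinearMap.sum_apply, Finset.sum_eq_single j]
  · rw [TensorProduct.map_tmul, Eop_vv, if_pos rfl]; rfl
  · intro k _ hk
    rw [TensorProduct.map_tmul, Eop_vv, if_neg hk, TensorProduct.zero_tmul]
  · simp

lemma sum_ite_apply {M P : Type} [AddCommGroup M] [Module K M] [AddCommGroup P] (i : Idx n)
    (m : M) (f : Idx n → M → P) (hf : ∀ j, f j 0 = 0) :
    ∑ j, f j ((if i = j then (1 : Module.End K M) else 0) m) = f i m := by
  rw [Finset.sum_eq_single i]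
  · simp
  · intro j _ hj; simp [hj.symm, hf]
  · simp

lemma sum_ite_apply' {M P : Type} [AddCommGroup M] [Module K M] [AddCommGroup P] (i : Idx n)
    (m : M) (f : Idx n → M → P) (hf : ∀ j, f j 0 = 0) :
    ∑ j, f j ((if j = i then (1 : Module.End K M) else 0) m) = f i m := by
  rw [Finset.sum_eq_single i]
  · simp
  · intro j _ hj; simp [hj, hf]
  · simp

lemma SMod.T_Tinv (M : SMod q n) : M.T ∘ₗ M.Tinv = LinearMap.id := by
  refine SMod.ext_fund_tensor fun j m => ?_
  rw [LinearMap.comp_apply, M.Tinv_apply, map_sum]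
  refine (Finset.sum_congr rfl fun k _ => M.T_apply _ _).trans ?_
  rw [Finset.sum_comm]
  have h : ∀ i, ∑ k, vv q i ⊗ₜ[K] M.tau i k (M.kap k j m) =
      vv q i ⊗ₜ[K] (if i = j then (1 : Module.End K M.carrier) else 0) m := by
    intro i
    rw [← M.tau_mul_kap, LinearMap.sum_apply, TensorProduct.tmul_sum]
    rfl
  simp only [h]
  exact sum_ite_apply' j m (fun i m => vv q i ⊗ₜ[K] m) fun i => TensorProduct.tmul_zero _ _

lemma SMod.Tinv_T (M : SMod q n) : M.Tinv ∘ₗ M.T = LinearMap.id := by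
  refine SMod.ext_tensor_fund fun m j => ?_
  rw [LinearMap.comp_apply, M.T_apply, map_sum]
  simp only [M.Tinv_apply]
  rw [Finset.sum_comm]
  have h : ∀ i, ∑ k, M.kap i k (M.tau k j m) ⊗ₜ[K] vv q i =
      (if i = j then (1 : Module.End K M.carrier) else 0) m ⊗ₜ[K] vv q i := by
    intro i
    rw [← M.kap_mul_tau, LinearMap.sum_apply, TensorProduct.sum_tmul]
    rfl
  simp only [h]
  exact sum_ite_apply' j m (fun i m => m ⊗ₜ[K] vv q i) fun i => TensorProduct.zero_tmul _ _

/-- `T_{MV}` as an isomorphism of vector spaces. -/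
def SMod.Tequiv (M : SMod q n) : (M.tensor (SMod.fund q n)).carrier ≃ₗ[K]
    ((SMod.fund q n).tensor M).carrier :=
  LinearEquiv.ofLinearMap M.T M.Tinv M.T_Tinv M.Tinv_T

/-- `T_{MV}` as a homomorphism of supermodules. -/
def SHom.T (M : SMod q n) : SHom 0 (M.tensor (SMod.fund q n)) ((SMod.fund q n).tensor M) :=
  SHom.ofTauEven M.T
    (fun m => by
      refine LinearMap.congr_fun (f := M.T ∘ₗ (M.tensor (SMod.fund q n)).sgn)
        (g := ((SMod.fund q n).tensor M).sgn ∘ₗ M.T) ?_ m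
      refine SMod.ext_tensor_fund fun m j => ?_
      rw [LinearMap.comp_apply, LinearMap.comp_apply, SMod.tensor_sgn, fund_sgn,
        TensorProduct.tmul_smul, map_smul, M.T_apply, M.T_apply, map_sum, Finset.smul_sum]
      refine Finset.sum_congr rfl fun i _ => ?_
      have e : M.sgn (M.tau i j m) = (sg (par₂ i j) : K) • M.tau i j (M.sgn m) :=
        LinearMap.congr_fun (M.sgn_tau i j) m
      rw [SMod.tensor_sgn, fund_sgn, e, TensorProduct.tmul_smul, ← TensorProduct.smul_tmul', smul_smul, ← sgK_add]
      congr 3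
      simp only [par₂]
      generalize par i = a1; generalize par j = a2
      revert a1 a2; decide)
    (fun a b m => by
      refine LinearMap.congr_fun (f := M.T ∘ₗ (M.tensor (SMod.fund q n)).tau a b)
        (g := ((SMod.fund q n).tensor M).tau a b ∘ₗ M.T) ?_ m
      refine SMod.ext_tensor_fund fun m j => ?_
      have hl : ∀ k, M.T (M.tau a k m ⊗ₜ[K] (SMod.fund q n).tau k b (vv q j)) =
          ∑ i, vv q i ⊗ₜ[K] ∑ r, Tc q k r j b • M.tau i r (M.tau a k m) := by
        intro k
        rw [fund_tau, TensorProduct.tmul_sum, map_sum]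
        simp only [TensorProduct.tmul_smul, map_smul, M.T_apply, TensorProduct.tmul_sum,
          Finset.smul_sum]
        exact Finset.sum_comm
      have hr : ∀ i, ((SMod.fund q n).tensor M).tau a b (vv q i ⊗ₜ[K] M.tau i j m) =
          ∑ r, vv q r ⊗ₜ[K] ∑ k, Tc q a r i k • M.tau k b (M.tau i j m) := by
        intro i
        rw [SMod.tensor_tau]
        have h : ∀ k, (SMod.fund q n).tau a k (vv q i) ⊗ₜ[K] M.tau k b (M.tau i j m) =
            ∑ r, vv q r ⊗ₜ[K] (Tc q a r i k • M.tau k b (M.tau i j m)) := by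
          intro k
          rw [fund_tau, TensorProduct.sum_tmul]
          exact Finset.sum_congr rfl fun r _ => TensorProduct.smul_tmul _ _ _
        refine (Finset.sum_congr rfl fun k _ => h k).trans (Finset.sum_comm.trans ?_)
        exact Finset.sum_congr rfl fun r _ => (TensorProduct.tmul_sum _ _ _).symm
      rw [LinearMap.comp_apply, LinearMap.comp_apply, SMod.tensor_tau, M.T_apply, map_sum, map_sum]
      simp only [hl, hr]
      rw [Finset.sum_comm, Finset.sum_comm (f := fun i r => vv q r ⊗ₜ[K]
        ∑ k, Tc q a r i k • M.tau k b (M.tau i j m))]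
      refine Finset.sum_congr rfl fun i _ => ?_
      rw [← TensorProduct.tmul_sum, ← TensorProduct.tmul_sum]
      congr 1
      -- After both sides are expanded in the basis of V, the coefficients of v_i are the two sides
      -- of the relation among the entries of τ.
      have h := LinearMap.congr_fun (M.frt a i j b) m
      simp only [LinearMap.sum_apply, LinearMap.smul_apply, Module.End.mul_apply] at h
      exact h.symm)

/-- Naturality of `T_{MV}` in `M`. -/
lemma T_natural {p : ZMod 2} {M N : SMod q n} (f : SHom p M N) :
    N.T ∘ₗ (SHom.tensor (add_zero p) f (SHom.one (SMod.fund q n))).1 =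
      (SHom.tensor (zero_add p) (SHom.one (SMod.fund q n)) f).1 ∘ₗ M.T := by
  refine SMod.ext_tensor_fund fun m j => ?_
  rw [LinearMap.comp_apply, LinearMap.comp_apply, M.T_apply, map_sum]
  change N.T (f.1 m ⊗ₜ[K] vv q j) = ∑ i, ipow (SMod.fund q n).sgn p (vv q i) ⊗ₜ[K] f.1 (M.tau i j m)
  rw [N.T_apply]
  refine Finset.sum_congr rfl fun i _ => ?_
  -- The sign for f passing τ_ij cancels the sign for f passing v_i.
  rw [SHom.map_tau f, (SMod.fund q n).ipow_of_mem (vv_mem i), TensorProduct.smul_tmul_smul,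
    sgK_mul_self, one_smul]

end Braiding

/-! ### Evaluation, coevaluation and the operator J -/

section Duality

variable {K : Type} [Field K] [CharZero K] {q : Kˣ} {n : ℕ}

lemma evV_tmul (f : (SMod.fund q n).carrier →ₗ[K] K) (v : (SMod.fund q n).carrier) :
    evV q n ((f : (SMod.fund q n).dual.carrier) ⊗ₜ[K] v) = f v := rfl

variable (q n) in
/-- The evaluation as a homomorphism of supermodules. -/
def SHom.ev : SHom 0 ((SMod.fund q n).dual.tensor (SMod.fund q n)) (SMod.unit q n) :=
  SHom.ofTauEven (evV q n)
    (fun m => by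
      refine LinearMap.congr_fun (f := evV q n ∘ₗ ((SMod.fund q n).dual.tensor (SMod.fund q n)).sgn)
        (g := (SMod.unit q n).sgn ∘ₗ evV q n) ?_ m
      refine TensorProduct.ext' fun f v => ?_
      rw [LinearMap.comp_apply, LinearMap.comp_apply, SMod.tensor_sgn,
        show (SMod.unit q n).sgn = 1 from SMod.mk'_sgn,
        show (SMod.fund q n).dual.sgn = transp (SMod.fund q n).sgn from SMod.mk'_sgn]
      change f ((SMod.fund q n).sgn ((SMod.fund q n).sgn v)) = f v
      rw [← Module.End.mul_apply, (SMod.fund q n).sgn_sgn]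
      rfl)
    (fun i j m => by
      refine LinearMap.congr_fun (f := evV q n ∘ₗ
        ((SMod.fund q n).dual.tensor (SMod.fund q n)).tau i j)
        (g := (SMod.unit q n).tau i j ∘ₗ evV q n) ?_ m
      refine TensorProduct.ext' fun f v => ?_
      rw [LinearMap.comp_apply, LinearMap.comp_apply, SMod.tensor_tau, SMod.tau_unit, map_sum]
      -- On V^* the operators are transposes of κ, so evaluation contracts κ with τ, and κτ = 1 is
      -- the counit.
      have h : ∀ k, evV q n ((SMod.fund q n).dual.tau i k f ⊗ₜ[K] (SMod.fund q n).tau k j v) =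
          f (((SMod.fund q n).kap i k * (SMod.fund q n).tau k j) v) := by
        intro k
        rw [SMod.tau_dual]
        rfl
      refine (Finset.sum_congr rfl fun k _ => h k).trans ?_
      rw [← map_sum, ← LinearMap.sum_apply, SMod.kap_mul_tau]
      by_cases hij : i = j
      · rw [if_pos hij, if_pos hij]; rfl
      · rw [if_neg hij, if_neg hij]; exact map_zero f)

variable (q n) in
/-- The canonical element of `V ⊗ V^*`. -/
def coevElt : ((SMod.fund q n).tensor (SMod.fund q n).dual).carrier := ∑ k, vv q k ⊗ₜ[K] vd q k

variable (q n) in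
/-- The coevaluation. -/
def coevV : (SMod.unit q n).carrier →ₗ[K] ((SMod.fund q n).tensor (SMod.fund q n).dual).carrier :=
  LinearMap.toSpanSingleton K _ (coevElt q n)

lemma coevV_apply (c : K) : coevV q n c = c • coevElt q n := rfl

/-- The canonical element corresponds to the identity of V, so a transposed operator on V^* may be
moved to V, where it acts first. -/
lemma coev_slide (A B : Module.End K (SMod.fund q n).carrier) :
    ∑ k, A (vv q k) ⊗ₜ[K] transp B (vd q k) = ∑ k, A (B (vv q k)) ⊗ₜ[K] vd q k := by
  have h1 : ∀ k, transp B (vd q k) = ∑ j, (B (vv q j) : Idx n → K) k • vd q j :=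
    fun k => dual_eq_sum (q := q) (transp B (vd q k))
  have h2 : ∀ k, A (B (vv q k)) = ∑ j, (B (vv q k) : Idx n → K) j • A (vv q j) := by
    intro k
    conv_lhs => rw [fund_eq_sum (B (vv q k)), map_sum]
    exact Finset.sum_congr rfl fun j _ => map_smul _ _ _
  have h3 : ∀ k, A (vv q k) ⊗ₜ[K] transp B (vd q k) =
      ∑ j, A (vv q k) ⊗ₜ[K] ((B (vv q j) : Idx n → K) k • vd q j) := by
    intro k
    rw [h1, TensorProduct.tmul_sum]
  have h4 : ∀ k, A (B (vv q k)) ⊗ₜ[K] vd q k =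
      ∑ j, A (vv q j) ⊗ₜ[K] ((B (vv q k) : Idx n → K) j • vd q k) := by
    intro k
    rw [h2, TensorProduct.sum_tmul]
    exact Finset.sum_congr rfl fun j _ => TensorProduct.smul_tmul _ _ _
  refine (Finset.sum_congr rfl fun k _ => h3 k).trans (Finset.sum_comm.trans ?_)
  exact Finset.sum_congr rfl fun k _ => (h4 k).symm

variable (q n) in
/-- The coevaluation as a homomorphism of supermodules. -/
def SHom.coev : SHom 0 (SMod.unit q n) ((SMod.fund q n).tensor (SMod.fund q n).dual) :=
  SHom.ofTauEven (coevV q n)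
    (fun c => by
      rw [show (SMod.unit q n).sgn = 1 from SMod.mk'_sgn, Module.End.one_apply]
      change c • coevElt q n = _
      rw [coevV_apply, map_smul, coevElt, map_sum]
      congr 1
      refine Finset.sum_congr rfl fun k _ => ?_
      rw [SMod.tensor_sgn, fund_sgn, dual_sgn, TensorProduct.smul_tmul_smul, sgK_mul_self, one_smul])
    (fun i j c => by
      rw [SMod.tau_unit]
      have h : ∀ k, ((SMod.fund q n).tensor (SMod.fund q n).dual).tau i j (vv q k ⊗ₜ[K] vd q k) =
          ∑ l, (SMod.fund q n).tau i l (vv q k) ⊗ₜ[K] transp ((SMod.fund q n).kap l j) (vd q k) := by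
        intro k
        rw [SMod.tensor_tau]
        exact Finset.sum_congr rfl fun l _ => by rw [SMod.tau_dual]
      have h' : ((SMod.fund q n).tensor (SMod.fund q n).dual).tau i j (coevElt q n) =
          if i = j then coevElt q n else 0 := by
        rw [coevElt, map_sum]
        refine (Finset.sum_congr rfl fun k _ => h k).trans (Finset.sum_comm.trans ?_)
        -- Sliding κ to the factor V leaves the product τκ, the opposite order to the one used for
        -- evaluation.
        refine (Finset.sum_congr rfl fun l _ => coev_slide _ _).trans (Finset.sum_comm.trans ?_)
        have h2 : ∀ k, ∑ l, (SMod.fund q n).tau i l ((SMod.fund q n).kap l j (vv q k)) ⊗ₜ[K] vd q k =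
            (if i = j then (1 : Module.End K (SMod.fund q n).carrier) else 0) (vv q k) ⊗ₜ[K]
              vd q k := by
          intro k
          rw [← SMod.tau_mul_kap, LinearMap.sum_apply, TensorProduct.sum_tmul]
          rfl
        refine (Finset.sum_congr rfl fun k _ => h2 k).trans ?_
        by_cases hij : i = j
        · rw [if_pos hij, if_pos hij]; rfl
        · rw [if_neg hij, if_neg hij]
          exact Finset.sum_eq_zero fun k _ => TensorProduct.zero_tmul _ _
      rw [coevV_apply, coevV_apply, map_smul, h']
      by_cases hij : i = j
      · rw [if_pos hij, if_pos hij]; rfl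
      · rw [if_neg hij, if_neg hij, smul_zero]; exact zero_smul K _)

/-- The negation of indices as a permutation. -/
def negEquiv (n : ℕ) : Idx n ≃ Idx n := ⟨Neg.neg, Neg.neg, idx_neg_neg, idx_neg_neg⟩

lemma sum_neg {P : Type*} [AddCommMonoid P] (f : Idx n → P) : ∑ i, f (-i) = ∑ i, f i :=
  (negEquiv n).sum_comp f

lemma neg_eq_iff (i j : Idx n) : -i = j ↔ i = -j :=
  ⟨fun h => by rw [← h, idx_neg_neg], fun h => by rw [h, idx_neg_neg]⟩

/-- Negating both indices of the first matrix unit exchanges the summands E_ji and E_{-j,-i}, and φ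
depends on its first argument only through the absolute value. This symmetry is why J is a
homomorphism. -/
lemma theta_neg_neg (a b i j : Idx n) : theta q (-a) (-b) i j = theta q a b i j := by
  have hn : ∀ x y : Idx n, (-x = -y) = (x = y) := fun x y => by
    rw [neg_eq_iff, idx_neg_neg]
  have hn' : ∀ x y : Idx n, (-x = y) = (x = -y) := fun x y => propext (neg_eq_iff x y)
  simp only [theta, phi_neg_left, hn, hn']
  split_ifs <;> ring

lemma Jop_vv (j : Idx n) : Jop q n (vv q j) = (sg (par j) : K) • vv q (-j) := by
  rw [Jop, LinearMap.sum_apply, Finset.sum_eq_single j]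
  · rw [LinearMap.smul_apply, Eop_vv, if_pos rfl]
  · intro i _ hi
    rw [LinearMap.smul_apply, Eop_vv, if_neg hi, smul_zero]
  · simp

variable (q n) in
/-- The odd operator `J` as a homomorphism of supermodules. -/
def SHom.J : SHom 1 (SMod.fund q n) (SMod.fund q n) :=
  SHom.ofTau (Jop q n)
    (fun m => by
      refine LinearMap.congr_fun (f := Jop q n ∘ₗ (SMod.fund q n).sgn)
        (g := (sg 1 : K) • ((SMod.fund q n).sgn ∘ₗ Jop q n)) ?_ m
      refine fund_ext fun j => ?_
      rw [LinearMap.comp_apply, LinearMap.smul_apply, LinearMap.comp_apply, fund_sgn, map_smul,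
        Jop_vv, map_smul, fund_sgn, smul_smul, smul_smul, smul_smul, ← sgK_add, ← sgK_add,
        ← sgK_add, par_neg]
      congr 3
      generalize par j = a
      revert a; decide)
    (fun i l m => by
      refine LinearMap.congr_fun (f := Jop q n ∘ₗ (SMod.fund q n).tau i l)
        (g := (sg (1 * par i) : K) • ((SMod.fund q n).tau i l ∘ₗ Jop q n)) ?_ m
      refine fund_ext fun b => ?_
      -- Since J sends v_a to a multiple of v_{-a}, one of the two sums is reindexed by negation
      -- before coefficients are compared.
      rw [LinearMap.comp_apply, LinearMap.smul_apply, LinearMap.comp_apply, fund_tau, Jop_vv,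
        map_smul, fund_tau, map_sum, smul_smul, ← sum_neg, Finset.smul_sum]
      refine Finset.sum_congr rfl fun a _ => ?_
      rw [map_smul, Jop_vv, smul_smul, smul_smul, idx_neg_neg]
      congr 1
      have h := theta_neg_neg (q := q) (-a) b i l
      rw [idx_neg_neg] at h
      rw [Tc, Tc, ← theta_neg_neg (q := q) a (-b) i l, idx_neg_neg]
      by_cases h0 : theta q (-a) b i l = 0
      · rw [h0]; ring
      have h1 := theta_even q _ _ _ _ h0
      rw [mul_right_comm, ← sgK_add, ← mul_assoc, ← sgK_add, ← sgK_add]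
      congr 3
      revert h1
      simp only [par₂, par_neg]
      generalize par i = a1; generalize par a = a2; generalize par b = a3
      generalize par l = a4
      revert a1 a2 a3 a4; decide)

lemma Jop_Jop (v : (SMod.fund q n).carrier) : Jop q n (Jop q n v) = (-1 : K) • v := by
  refine LinearMap.congr_fun (f := Jop q n ∘ₗ Jop q n)
    (g := (-1 : K) • LinearMap.id) (fund_ext fun j => ?_) v
  rw [LinearMap.comp_apply, Jop_vv, map_smul, Jop_vv, smul_smul, par_neg, sgK_add, sg_one,
    idx_neg_neg, ← mul_assoc, sgK_mul_self]
  simp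

lemma sum_comm_four {P : Type*} [AddCommMonoid P] (f : Idx n → Idx n → Idx n → Idx n → P) :
    ∑ i, ∑ j, ∑ k, ∑ l, f i j k l = ∑ k, ∑ l, ∑ i, ∑ j, f i j k l :=
  ((Finset.sum_congr rfl fun _ _ => Finset.sum_comm).trans Finset.sum_comm).trans
    (Finset.sum_congr rfl fun _ _ =>
      (Finset.sum_congr rfl fun _ _ => Finset.sum_comm).trans Finset.sum_comm)

/-- On V the generator u_kl acts by Θ_kl, so L on V ⊗ V is Θ itself. The positive crossing is
therefore the case M = V of T_{MV}. -/
lemma TV_eq : TV q n = (SMod.fund q n).T := by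
  have h : ∀ k l, (SMod.fund q n).ρ (uu q k l) = ∑ i, ∑ j, theta q i j k l • Eop q i j := by
    intro k l
    refine fund_ext fun b => ?_
    change (SMod.fund q n).x k l (vv q b) = _
    rw [fund_x_eq, fund_eq_sum (q := q) (Matrix.toLinAlgEquiv' (thetaMat q k l) (vv q b)),
      LinearMap.sum_apply]
    refine Finset.sum_congr rfl fun a _ => ?_
    rw [LinearMap.sum_apply, Finset.sum_eq_single b]
    · rw [LinearMap.smul_apply, Eop_vv, if_pos rfl]
      change Matrix.mulVec (thetaMat q k l) (Pi.single b 1) a • vv q a = _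
      rw [Matrix.mulVec_single_one]
      rfl
    · intro j _ hj
      rw [LinearMap.smul_apply, Eop_vv, if_neg hj, smul_zero]
    · simp
  have h' : thetaOp q n = (SMod.fund q n).L := by
    refine TensorProduct.ext' fun v w => ?_
    have e : ∀ k l, (SMod.fund q n).opTensor (SMod.fund q n) ((SMod.fund q n).ρ (uu q k l))
        (par₂ k l) (Eop q k l) (v ⊗ₜ[K] w) = ∑ i, ∑ j, theta q i j k l •
          (SMod.fund q n).opTensor (SMod.fund q n) (Eop q i j) (par₂ k l) (Eop q k l)
            (v ⊗ₜ[K] w) := by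
      intro k l
      rw [SMod.opTensor_tmul, h, LinearMap.sum_apply, TensorProduct.sum_tmul]
      refine Finset.sum_congr rfl fun i _ => ?_
      rw [LinearMap.sum_apply, TensorProduct.sum_tmul]
      refine Finset.sum_congr rfl fun j _ => ?_
      rw [LinearMap.smul_apply, SMod.opTensor_tmul, TensorProduct.smul_tmul']
    rw [thetaOp, SMod.L]
    simp only [LinearMap.sum_apply, LinearMap.smul_apply, e]
    exact sum_comm_four _
  rw [TV, SMod.T, h']

end Duality

/-! ### The weights of the right cap and cup -/

section Weights

variable {K : Type} [Field K] {n : ℕ}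

/-- The weights `c_m`, as a function on the integers, with `c_m = q^{-2(n-m)-1}` for `m > 0` and
`c_{-m} = -c_m`. -/
def wtZ (q : Kˣ) (n : ℕ) (m : ℤ) : K :=
  if 0 < m then ((q ^ (-(2 * (n - m) + 1)) : Kˣ) : K)
  else if m < 0 then -((q ^ (-(2 * (n + m) + 1)) : Kˣ) : K) else 0

/-- The partial sums of the weights. -/
def wtSum (q : Kˣ) (n : ℕ) (m : ℤ) : K :=
  if 0 ≤ m then ((q ^ (-(2 * (n - m))) : Kˣ) : K) else ((q ^ (-(2 * (n + m + 1))) : Kˣ) : K)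

lemma zz_mul_zpow (q : Kˣ) (m : ℤ) :
    (zz q : K) * ((q ^ m : Kˣ) : K) = ((q ^ (m + 1) : Kˣ) : K) - ((q ^ (m - 1) : Kˣ) : K) := by
  rw [zz, sub_mul, ← Units.val_mul, ← Units.val_mul, ← zpow_one_add, add_comm 1 m, ← zpow_neg_one,
    ← zpow_add, neg_add_eq_sub]

/-- The identity z q^m = q^{m+1} - q^{m-1} makes the weights telescope. The zero weight at m = 0 is
consistent because the partial sums at 0 and -1 are both q^{-2n}. -/
lemma zz_mul_wtZ (q : Kˣ) (n : ℕ) (m : ℤ) :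
    zz q * wtZ q n m = wtSum q n m - wtSum q n (m - 1) := by
  unfold wtZ wtSum
  rcases lt_trichotomy m 0 with h | h | h
  · rw [if_neg (by omega), if_pos h, if_neg (by omega), if_neg (by omega), mul_neg, zz_mul_zpow,
      neg_sub]
    congr 4 <;> ring
  · subst h; simp
  · rw [if_pos h, if_pos (by omega), if_pos (by omega), zz_mul_zpow]
    congr 4 <;> ring

/-- The sum telescopes downwards from the top index n, where the partial sum equals 1. -/
lemma zz_mul_sum_wtZ (q : Kˣ) (n k : ℕ) :
    zz q * ∑ m ∈ Finset.Ioc ((n : ℤ) - k) n, wtZ q n m = 1 - wtSum q n (n - k) := by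
  induction k with
  | zero => simp [wtSum]
  | succ k ih =>
    have h : Finset.Ioc ((n : ℤ) - (k + 1 : ℕ)) n =
        insert ((n : ℤ) - k) (Finset.Ioc ((n : ℤ) - k) n) := by
      ext m; simp only [Finset.mem_Ioc, Finset.mem_insert]; push_cast; omega
    rw [h, Finset.sum_insert (by simp), mul_add, ih, zz_mul_wtZ]
    have e : ((n : ℤ) - k) - 1 = n - (k + 1 : ℕ) := by push_cast; ring
    rw [e]; ring

lemma idx_bounds (i : Idx n) : i.1 ≠ 0 ∧ -(n : ℤ) ≤ i.1 ∧ i.1 ≤ n := by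
  have := i.2
  simpa only [Finset.mem_erase, Finset.mem_Icc] using this

/-- The weight of an index. -/
def wt (q : Kˣ) (i : Idx n) : K := wtZ q n i.1

lemma zz_mul_sum_wt (q : Kˣ) (b : Idx n) :
    zz q * ∑ c : Idx n, (if b < c then wt q c else 0) = 1 - wtSum q n b.1 := by
  have hb := idx_bounds b
  have h := zz_mul_sum_wtZ q n ((n : ℤ) - b.1).toNat
  have e : (n : ℤ) - ((n : ℤ) - b.1).toNat = b.1 := by omega
  rw [e] at h
  rw [← h]
  congr 1
  have h1 : ∑ c : Idx n, (if b < c then wt q c else 0) =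
      ∑ m ∈ (Finset.Icc (-(n : ℤ)) n).erase 0, if b.1 < m then wtZ q n m else 0 :=
    Finset.sum_coe_sort ((Finset.Icc (-(n : ℤ)) n).erase 0) fun m => if b.1 < m then wtZ q n m else 0
  rw [h1, ← Finset.sum_filter]
  refine Finset.sum_subset (fun m hm => ?_) fun m hm hm' => ?_
  · simp only [Finset.mem_filter, Finset.mem_erase, Finset.mem_Icc, Finset.mem_Ioc] at hm ⊢
    omega
  -- The interval of integers may contain 0, which is not an index; its weight was set to 0 so that
  -- it does not count.
  · simp only [Finset.mem_filter, Finset.mem_erase, Finset.mem_Icc, Finset.mem_Ioc] at hm hm'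
    have : m = 0 := by omega
    subst this; simp [wtZ]

/-- The diagonal coefficient of T at b, times the weight, is exactly what the tail sum above b lacks
to reach 1. -/
lemma wt_diag (q : Kˣ) (b : Idx n) :
    wt q b * ((sg (par b) : K) * ((q ^ Int.sign b.1 : Kˣ) : K)) = wtSum q n b.1 := by
  have hb := idx_bounds b
  unfold wt wtZ wtSum par
  rcases lt_or_gt_of_ne hb.1 with h | h
  · rw [if_neg (by omega), if_pos h, if_neg (by omega), if_neg (by omega), sg_one,
      Int.sign_eq_neg_one_of_neg h]
    push_cast
    rw [neg_one_mul, neg_mul_neg, ← zpow_add₀ q.ne_zero]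
    congr 1; ring
  · rw [if_pos h, if_pos h, if_pos h.le, sg_zero, Int.sign_eq_one_of_pos h]
    push_cast
    rw [one_mul, ← zpow_add₀ q.ne_zero]
    congr 1; ring

lemma wt_neg (q : Kˣ) (b : Idx n) : wt q (-b) = -wt q b := by
  have hb := idx_bounds b
  have h' : (-b).1 = -b.1 := rfl
  unfold wt wtZ
  rw [h']
  rcases lt_or_gt_of_ne hb.1 with h | h
  · rw [if_pos (by omega), if_neg (by omega), if_pos h, neg_neg, sub_neg_eq_add]
  · rw [if_neg (by omega), if_pos (by omega), if_pos h, sub_eq_add_neg]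

/-- Opposite indices have opposite weights, and 2 is invertible. This sum is the value of the
bubble. -/
lemma sum_wt (q : Kˣ) [CharZero K] : ∑ b : Idx n, wt q b = 0 := by
  have h := sum_neg fun b : Idx n => wt q b
  simp only [wt_neg, Finset.sum_neg_distrib] at h
  have h2 : (2 : K) * ∑ b : Idx n, wt q b = 0 := by linear_combination -h
  exact (mul_eq_zero.1 h2).resolve_left two_ne_zero

lemma wt_inv (q : Kˣ) (b : Idx n) : wt q b * wt q⁻¹ b = 1 := by
  have hb := idx_bounds b
  unfold wt wtZ
  rcases lt_or_gt_of_ne hb.1 with h | h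
  · rw [if_neg (by omega), if_pos h, if_neg (by omega), if_pos h, inv_zpow]
    simp [mul_inv_cancel₀ (zpow_ne_zero _ q.ne_zero)]
  · rw [if_pos h, if_pos h, inv_zpow]
    simp [mul_inv_cancel₀ (zpow_ne_zero _ q.ne_zero)]

lemma wt_ne_zero (q : Kˣ) (b : Idx n) : wt q b ≠ 0 := left_ne_zero_of_mul_eq_one (wt_inv q b)

lemma zz_inv (q : Kˣ) : (zz q⁻¹ : K) = -zz q := by simp [zz]

lemma idx_ne_neg (a : Idx n) : ¬ a = -a := fun h => by
  have h' : a.1 = -a.1 := congrArg Subtype.val h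
  have := idx_bounds a
  omega

lemma cap_sign : ∀ x y : ZMod 2, (x + y) * x + x * y + x = 0 := by decide

/-- The summand with E_{-j,-i} would contribute only if a = -a, which no index satisfies. -/
lemma Tc_cap (q : Kˣ) (k a b : Idx n) : Tc q k a b a = if k = b then
    (if a = b then (sg (par b) : K) * ((q ^ Int.sign b.1 : Kˣ) : K) else 0) +
      (if b < a then zz q else 0) else 0 := by
  have hn := idx_ne_neg a
  unfold Tc theta phi
  by_cases hk : k = b
  · subst hk
    by_cases hak : a = k
    · subst hak
      have h : par a * par a = par a := by generalize par a = x; revert x; decide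
      simp [par₂_self, h]
    · by_cases h : k < a
      · have e : (sg (par₂ k a * par k + par k * par a) : K) * (sg (par k) : K) = 1 := by
          rw [← sgK_add, cap_sign, sg_zero, Int.cast_one]
        simp [h, hak, hn]
        linear_combination zz q * e
      · simp [h, hak]
  · have h1 : ¬ (a = b ∧ k = a) := fun h => hk (h.2.trans h.1)
    have h2 : ¬ (b = k) := fun h => hk h.symm
    simp [hk, h1, h2, hn]

/-- As for the cap, the summand with E_{-j,-i} is excluded, this time since k ≠ -k. -/
lemma Tc_cup (q : Kˣ) (k a i : Idx n) : Tc q k a k i = if a = i then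
    (if k = i then (sg (par i) : K) * ((q ^ Int.sign i.1 : Kˣ) : K) else 0) +
      (if k < i then zz q else 0) else 0 := by
  have hn := idx_ne_neg k
  unfold Tc theta phi
  by_cases ha : a = i
  · subst ha
    by_cases hak : k = a
    · subst hak
      have h : par k * par k = par k := by generalize par k = x; revert x; decide
      simp [par₂_self, h]
    · have hak' : ¬ a = k := fun h => hak h.symm
      by_cases h : k < a
      · have e : (sg (par₂ k a * par k + par k * par a) : K) * (sg (par k) : K) = 1 := by
          rw [← sgK_add, cap_sign, sg_zero, Int.cast_one]
        simp [h, hak, hak', hn]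
        linear_combination zz q * e
      · simp [h, hak, hak']
  · have h1 : ¬ (a = k ∧ k = i) := fun h => ha (h.1.trans h.2)
    simp [ha, h1, hn]

/-- The weighted partial trace of T over the second factor is the identity: the diagonal term gives
the partial sum at b, and the terms with a > b give 1 minus it. -/
lemma sum_wt_cap (q : Kˣ) (k b : Idx n) :
    ∑ a, wt q a * Tc q k a b a = if k = b then 1 else 0 := by
  simp only [Tc_cap]
  by_cases hk : k = b
  · simp only [if_pos hk, mul_add, Finset.sum_add_distrib, mul_ite, mul_zero, Finset.sum_ite_eq',
      Finset.mem_univ, if_true]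
    have h := zz_mul_sum_wt q b
    rw [mul_comm, Finset.sum_mul] at h
    simp only [ite_mul, zero_mul] at h
    rw [wt_diag, h, add_sub_cancel]
  · simp [hk]

/-- The same for the partial trace over the first factor with the inverse weights. Replacing q by
q⁻¹ and negating indices turns the sum over k < i into a tail sum of the previous kind. -/
lemma sum_wt_cup (q : Kˣ) (a i : Idx n) :
    ∑ k, wt q⁻¹ k * Tc q k a k i = if a = i then 1 else 0 := by
  simp only [Tc_cup]
  by_cases ha : a = i
  · simp only [if_pos ha, mul_add, Finset.sum_add_distrib, mul_ite, mul_zero, Finset.sum_ite_eq',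
      Finset.mem_univ, if_true]
    have h := zz_mul_sum_wt q⁻¹ (-i)
    rw [Finset.mul_sum] at h
    -- Both z and the weight change sign under these substitutions, so their product does not.
    have e : ∀ k : Idx n, (zz q⁻¹ * if -i < -k then wt q⁻¹ (-k) else 0) =
        if k < i then wt q⁻¹ k * zz q else 0 := by
      intro k
      simp only [neg_lt_neg_idx]
      split_ifs
      · rw [wt_neg, zz_inv]; ring
      · rw [mul_zero]
    rw [← sum_neg] at h
    simp only [e] at h
    have h2 := wt_diag q⁻¹ (-i)
    have h3 : (-i).1 = -i.1 := rfl
    rw [wt_neg, par_neg, sgK_add, sg_one, h3, Int.sign_neg, inv_zpow', neg_neg] at h2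
    rw [h, h3]
    linear_combination h2
  · simp [ha]

end Weights

/-! ### The quadratic relation for T -/

section Hecke

variable {K : Type} [Field K] [CharZero K] {q : Kˣ} {n : ℕ}

/-- Rewriting the double sum as the three-term row operator of Θ makes the quadratic relation
accessible to a case distinction. -/
lemma sum_Tc (F : Idx n → Idx n → K) (a b : Idx n) : ∑ i, ∑ k, Tc q a b i k * F i k =
    th q (fun i k => (sg (par₂ a k * par i + par a * par b) : K) * F i k) b a := by
  rw [← sum_theta]
  refine Finset.sum_congr rfl fun i _ => Finset.sum_congr rfl fun k _ => ?_
  rw [Tc]; ring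

-- Up to sign and order Θ does not change a pair of indices. Writing a and b as ± positive indices
-- and fixing the order of these leaves finitely many identities between rational expressions in q.
set_option maxHeartbeats 1000000 in
lemma hecke_core (F : Idx n → Idx n → K) (a b : Idx n) :
    th q (fun i k => (sg ((par a + par k) * par i + par a * par b) : K) *
      th q (fun i' k' => (sg ((par i + par k') * par i' + par i * par k) : K) * F i' k') k i) b a =
    zz q * th q (fun i k => (sg ((par a + par k) * par i + par a * par b) : K) * F i k) b a
      + F a b := by
  have hq : (q : K) ≠ 0 := q.ne_zero
  obtain ⟨x, hx, hax⟩ := exists_pos a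
  obtain ⟨y, hy, hby⟩ := exists_pos b
  have z01 : (0 : ZMod 2) + 1 = 1 := rfl
  have z10 : (1 : ZMod 2) + 0 = 1 := rfl
  have z11 : (1 : ZMod 2) + 1 = 0 := rfl
  rcases lt_trichotomy x y with h1 | h1 | h1 <;> (try subst h1) <;>
    (try replace h1 := lt_facts h1) <;>
    rcases hax with rfl | rfl <;> rcases hby with rfl | rfl <;>
    simp only [th, neg_lt_neg_idx, lt_neg_idx, neg_lt_idx, par_pos, phi_pos,
      phi_neg_left, phi_neg_right, par_neg, idx_neg_neg,
      lt_irrefl, ↓reduceIte, add_zero, sg_zero, sg_one, mul_zero,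
      one_mul, mul_one, neg_zero, zpow_zero, zpow_one, zpow_neg, Int.cast_one, Int.cast_neg,
      Units.val_one, Units.val_inv_eq_inv_val, zz_eq, *]
  all_goals first | ring1 | (field_simp; ring1)

/-- The function-valued identity `hecke_core` is applied to the delta function at (b, j). -/
lemma Tc_Tc (r s b j : Idx n) : ∑ i, ∑ a, Tc q r s i a * Tc q i a b j =
    zz q * Tc q r s b j + if r = b ∧ s = j then 1 else 0 := by
  have h := hecke_core (q := q) (fun i a => if i = b ∧ a = j then 1 else 0) r s
  have h1 : ∀ i a, Tc q i a b j =
      ∑ i', ∑ k', Tc q i a i' k' * if i' = b ∧ k' = j then 1 else 0 := by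
    intro i a
    rw [Finset.sum_eq_single b, Finset.sum_eq_single j]
    · simp
    · intro k _ hk; simp [hk]
    · simp
    · intro k _ hk; simp [hk]
    · simp
  simp only [sum_Tc] at h1
  rw [sum_Tc]
  simp only [h1]
  exact h

lemma TV_vv (b j : Idx n) : TV q n (vv q b ⊗ₜ[K] vv q j) =
    ∑ i, ∑ a, Tc q i a b j • (vv q i ⊗ₜ[K] vv q a) := by
  rw [TV_eq, SMod.T_apply]
  refine Finset.sum_congr rfl fun i _ => ?_
  rw [fund_tau, TensorProduct.tmul_sum]
  exact Finset.sum_congr rfl fun a _ => TensorProduct.tmul_smul _ _ _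

lemma fund_ext₂ {P : Type} [AddCommGroup P] [Module K P]
    {f g : ((SMod.fund q n).tensor (SMod.fund q n)).carrier →ₗ[K] P}
    (h : ∀ i j, f (vv q i ⊗ₜ[K] vv q j) = g (vv q i ⊗ₜ[K] vv q j)) : f = g :=
  SMod.ext_tensor_fund fun m j => LinearMap.congr_fun
    (fund_ext (f := f ∘ₗ (TensorProduct.mk K _ _).flip (vv q j))
      (g := g ∘ₗ (TensorProduct.mk K _ _).flip (vv q j)) fun i => h i j) m

/-- The quadratic relation for `T`. -/
lemma TV_TV : TV q n ∘ₗ TV q n = (zz q : K) • TV q n + LinearMap.id := by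
  refine fund_ext₂ fun b j => ?_
  have h : ∀ i a, TV q n (Tc q i a b j • (vv q i ⊗ₜ[K] vv q a)) =
      ∑ r, ∑ s, (Tc q r s i a * Tc q i a b j) • (vv q r ⊗ₜ[K] vv q s) := by
    intro i a
    rw [map_smul, TV_vv, Finset.smul_sum]
    refine Finset.sum_congr rfl fun r _ => ?_
    rw [Finset.smul_sum]
    exact Finset.sum_congr rfl fun s _ => by rw [smul_smul, mul_comm]
  rw [LinearMap.comp_apply, LinearMap.add_apply, LinearMap.smul_apply, TV_vv, map_sum]
  have h' : ∀ i, TV q n (∑ a, Tc q i a b j • (vv q i ⊗ₜ[K] vv q a)) =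
      ∑ a, ∑ r, ∑ s, (Tc q r s i a * Tc q i a b j) • (vv q r ⊗ₜ[K] vv q s) := by
    intro i
    rw [map_sum]
    exact Finset.sum_congr rfl fun a _ => h i a
  refine (Finset.sum_congr rfl fun i _ => h' i).trans ((sum_comm_four _).trans ?_)
  have h'' : ∀ r s, ∑ i, ∑ a, (Tc q r s i a * Tc q i a b j) • (vv q r ⊗ₜ[K] vv q s) =
      zz q • Tc q r s b j • (vv q r ⊗ₜ[K] vv q s) +
        (if r = b then if s = j then vv q r ⊗ₜ[K] vv q s else 0 else 0) := by
    intro r s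
    rw [smul_smul]
    refine Eq.trans ?_ ((congrArg (fun c : K => c • (vv q r ⊗ₜ[K] vv q s))
      (Tc_Tc (q := q) r s b j)).trans ?_)
    · simp only [Finset.sum_smul]
    · simp only [add_smul, ite_smul, one_smul, zero_smul, ite_and]
  refine (Finset.sum_congr rfl fun r _ => Finset.sum_congr rfl fun s _ => h'' r s).trans ?_
  simp only [Finset.sum_add_distrib, Finset.smul_sum]
  congr 1
  refine (Finset.sum_eq_single b ?_ (by simp)).trans ?_
  · intro k _ hk
    exact Finset.sum_eq_zero fun s _ => if_neg hk
  · refine (Finset.sum_eq_single j ?_ (by simp)).trans ?_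
    · intro k _ hk
      rw [if_pos rfl, if_neg hk]
    · rw [if_pos rfl, if_pos rfl]; rfl

end Hecke

/-! ### The crossing of M with V^*, and the right cap and cup -/

section DualCrossing

/-- A triangular matrix with invertible diagonal entries is invertible. -/
lemma exists_inverse_of_triangular {n : ℕ} {B : Type*} [Ring B] (x : Matrix (Idx n) (Idx n) B)
    (hx : ∀ i j, j < i → x i j = 0) (d : Idx n → B) (hd : ∀ i, d i * x i i = 1)
    (hd' : ∀ i, x i i * d i = 1) : ∃ w : Matrix (Idx n) (Idx n) B, x * w = 1 ∧ w * x = 1 := by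
  set D : Matrix (Idx n) (Idx n) B := Matrix.diagonal d with hD
  set D' : Matrix (Idx n) (Idx n) B := Matrix.diagonal fun i => x i i with hD'
  have hDD : D' * D = 1 := by
    rw [hD, hD', Matrix.diagonal_mul_diagonal, ← Matrix.diagonal_one]
    congr 1; funext i; exact hd' i
  -- Dividing by the diagonal makes the matrix unipotent, so its inverse is a finite geometric
  -- series in N.
  set N : Matrix (Idx n) (Idx n) B := 1 - D * x with hNdef
  have hN : ∀ i j : Idx n, ¬ i < j → N i j = 0 := by
    intro i j hij
    rw [hNdef, Matrix.sub_apply, hD, Matrix.diagonal_mul]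
    rcases eq_or_lt_of_le (not_lt.1 hij) with rfl | hlt
    · rw [Matrix.one_apply_eq, hd, sub_self]
    · rw [Matrix.one_apply_ne hlt.ne', hx _ _ hlt, mul_zero, sub_self]
  -- An entry of N^m can be nonzero only when the column exceeds the row by at least m, and two
  -- indices differ by at most 2n.
  have hpow : N ^ (2 * n + 1) = 0 := by
    ext i j
    rw [pow_strict N hN, Matrix.zero_apply]
    have hi := idx_bounds i
    have hj := idx_bounds j
    push_cast
    omega
  set G := ∑ m ∈ Finset.range (2 * n + 1), N ^ m with hG
  have hDx : D * x = 1 - N := by rw [hNdef]; abel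
  have h1 : G * (1 - N) = 1 := by rw [hG, geom_sum_mul_neg, hpow, sub_zero]
  have h2 : (1 - N) * G = 1 := by rw [hG, mul_neg_geom_sum, hpow, sub_zero]
  refine ⟨G * D, ?_, ?_⟩
  · have : x = D' * (1 - N) := by rw [← hDx, ← mul_assoc, hDD, one_mul]
    rw [this, mul_assoc, ← mul_assoc (1 - N), h2, one_mul, hDD]
  · rw [mul_assoc, hDx, h1]

variable {K : Type} [Field K] [CharZero K] {q : Kˣ} {n : ℕ}

lemma SMod.tau_diag_kap (M : SMod q n) (i : Idx n) : M.tau i i * M.kap i i = 1 := by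
  have h := M.tau_mul_kap i i
  rwa [if_pos rfl, Finset.sum_eq_single i] at h
  · intro k _ hk
    rcases lt_or_gt_of_ne hk with h | h
    · rw [M.tau_lower h, zero_mul]
    · rw [M.kap_lower h, mul_zero]
  · simp

lemma SMod.kap_diag_tau (M : SMod q n) (i : Idx n) : M.kap i i * M.tau i i = 1 := by
  have h := M.kap_mul_tau i i
  rwa [if_pos rfl, Finset.sum_eq_single i] at h
  · intro k _ hk
    rcases lt_or_gt_of_ne hk with h | h
    · rw [M.kap_lower h, zero_mul]
    · rw [M.tau_lower h, mul_zero]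
  · simp

/-- The entries of τ do not commute, so the transpose of κ need not invert the transpose of τ.
Transposing and negating the indices preserves upper triangularity, so the triangular inverse exists
for this reflected matrix. -/
lemma SMod.exists_lam (M : SMod q n) : ∃ lam : Idx n → Idx n → Module.End K M.carrier,
    (∀ k l, ∑ i, M.tau i l * lam k i = if k = l then 1 else 0) ∧
    ∀ k l, ∑ i, lam i l * M.tau k i = if k = l then 1 else 0 := by
  set A : Matrix (Idx n) (Idx n) (Module.End K M.carrier) := fun i j => M.tau (-j) (-i) with hA
  obtain ⟨w, h1, h2⟩ := exists_inverse_of_triangular A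
    (fun i j h => M.tau_lower (by rwa [neg_lt_neg_idx])) (fun i => M.kap (-i) (-i))
    (fun i => M.kap_diag_tau _) (fun i => M.tau_diag_kap _)
  have hn : ∀ x y : Idx n, (-x = -y) = (x = y) := fun x y => by
    rw [neg_eq_iff, idx_neg_neg]
  refine ⟨fun k i => w (-i) (-k), fun k l => ?_, fun k l => ?_⟩
  · have h := congrFun (congrFun h1 (-l)) (-k)
    rw [Matrix.mul_apply, Matrix.one_apply, ← sum_neg] at h
    simp only [hA, idx_neg_neg, hn] at h
    rw [h]
    exact if_congr eq_comm rfl rfl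
  · have h := congrFun (congrFun h2 (-l)) (-k)
    rw [Matrix.mul_apply, Matrix.one_apply, ← sum_neg] at h
    simp only [hA, idx_neg_neg, hn] at h
    rw [h]
    exact if_congr eq_comm rfl rfl

/-- The inverse of the transpose of the matrix `τ`. -/
def SMod.lam (M : SMod q n) : Idx n → Idx n → Module.End K M.carrier := M.exists_lam.choose

lemma SMod.tau_mul_lam (M : SMod q n) (k l : Idx n) :
    ∑ i, M.tau i l * M.lam k i = if k = l then 1 else 0 := M.exists_lam.choose_spec.1 k l

lemma SMod.lam_mul_tau (M : SMod q n) (k l : Idx n) :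
    ∑ i, M.lam i l * M.tau k i = if k = l then 1 else 0 := M.exists_lam.choose_spec.2 k l

/-- The map `v_k^* ⊗ m ↦ ∑ τ_ki m ⊗ v_i^*`. -/
def SMod.dualCross (M : SMod q n) : ((SMod.fund q n).dual.tensor M).carrier →ₗ[K]
    (M.tensor (SMod.fund q n).dual).carrier :=
  (TensorProduct.comm K (SMod.fund q n).dual.carrier M.carrier).toLinearMap ∘ₗ
    ∑ k, ∑ i, TensorProduct.map (transp (Eop q k i)) (M.tau k i)

lemma SMod.dualCross_apply (M : SMod q n) (k : Idx n) (m : M.carrier) :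
    M.dualCross (vd q k ⊗ₜ[K] m) = ∑ i, M.tau k i m ⊗ₜ[K] vd q i := by
  rw [SMod.dualCross, LinearMap.comp_apply, LinearMap.sum_apply, Finset.sum_eq_single k]
  · rw [LinearMap.sum_apply, map_sum]
    refine Finset.sum_congr rfl fun i _ => ?_
    rw [TensorProduct.map_tmul, transp_Eop_vd, if_pos rfl]; rfl
  · intro j _ hj
    rw [LinearMap.sum_apply]
    refine Finset.sum_eq_zero fun i _ => ?_
    rw [TensorProduct.map_tmul, transp_Eop_vd, if_neg hj, TensorProduct.zero_tmul]
  · simp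

/-- The map `m ⊗ v_k^* ↦ ∑ v_i^* ⊗ λ_ki m`. -/
def SMod.dualCrossInv (M : SMod q n) : (M.tensor (SMod.fund q n).dual).carrier →ₗ[K]
    ((SMod.fund q n).dual.tensor M).carrier :=
  (TensorProduct.comm K M.carrier (SMod.fund q n).dual.carrier).toLinearMap ∘ₗ
    ∑ k, ∑ i, TensorProduct.map (M.lam k i) (transp (Eop q k i))

lemma SMod.dualCrossInv_apply (M : SMod q n) (m : M.carrier) (k : Idx n) :
    M.dualCrossInv (m ⊗ₜ[K] vd q k) = ∑ i, vd q i ⊗ₜ[K] M.lam k i m := by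
  rw [SMod.dualCrossInv, LinearMap.comp_apply, LinearMap.sum_apply, Finset.sum_eq_single k]
  · rw [LinearMap.sum_apply, map_sum]
    refine Finset.sum_congr rfl fun i _ => ?_
    rw [TensorProduct.map_tmul, transp_Eop_vd, if_pos rfl]; rfl
  · intro j _ hj
    rw [LinearMap.sum_apply]
    refine Finset.sum_eq_zero fun i _ => ?_
    rw [TensorProduct.map_tmul, transp_Eop_vd, if_neg hj, TensorProduct.tmul_zero]
  · simp

lemma SMod.dualCross_dualCrossInv (M : SMod q n) :
    M.dualCross ∘ₗ M.dualCrossInv = LinearMap.id := by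
  refine SMod.ext_tensor_dual fun m k => ?_
  rw [LinearMap.comp_apply, M.dualCrossInv_apply, map_sum]
  refine (Finset.sum_congr rfl fun i _ => M.dualCross_apply _ _).trans (Finset.sum_comm.trans ?_)
  have h : ∀ l, ∑ i, M.tau i l (M.lam k i m) ⊗ₜ[K] vd q l =
      (if k = l then (1 : Module.End K M.carrier) else 0) m ⊗ₜ[K] vd q l := by
    intro l
    rw [← M.tau_mul_lam, LinearMap.sum_apply, TensorProduct.sum_tmul]
    rfl
  simp only [h]
  exact sum_ite_apply k m (fun i m => m ⊗ₜ[K] vd q i) fun i => TensorProduct.zero_tmul _ _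

lemma SMod.dualCrossInv_dualCross (M : SMod q n) :
    M.dualCrossInv ∘ₗ M.dualCross = LinearMap.id := by
  refine SMod.ext_dual_tensor fun k m => ?_
  rw [LinearMap.comp_apply, M.dualCross_apply, map_sum]
  refine (Finset.sum_congr rfl fun i _ => M.dualCrossInv_apply _ _).trans (Finset.sum_comm.trans ?_)
  have h : ∀ l, ∑ i, vd q l ⊗ₜ[K] M.lam i l (M.tau k i m) =
      vd q l ⊗ₜ[K] (if k = l then (1 : Module.End K M.carrier) else 0) m := by
    intro l
    rw [← M.lam_mul_tau, LinearMap.sum_apply, TensorProduct.tmul_sum]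
    rfl
  simp only [h]
  exact sum_ite_apply k m (fun i m => vd q i ⊗ₜ[K] m) fun i => TensorProduct.tmul_zero _ _

/-- The crossing `V^* ⊗ M → M ⊗ V^*` as an isomorphism of vector spaces. -/
def SMod.dualCrossEquiv (M : SMod q n) : ((SMod.fund q n).dual.tensor M).carrier ≃ₗ[K]
    (M.tensor (SMod.fund q n).dual).carrier :=
  LinearEquiv.ofLinearMap M.dualCross M.dualCrossInv M.dualCross_dualCrossInv
    M.dualCrossInv_dualCross

/-- The map `V^* ⊗ M → M ⊗ V^*` obtained by rotating `T_{MV}`. -/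
def SMod.rotate (M : SMod q n) (f : (SMod.fund q n).dual.carrier) (m : M.carrier) :
    (M.tensor (SMod.fund q n).dual).carrier :=
  TensorProduct.lid K _ (TensorProduct.map (evV q n) LinearMap.id
    ((TensorProduct.assoc K (SMod.fund q n).dual.carrier (SMod.fund q n).carrier
      (M.carrier ⊗[K] (SMod.fund q n).dual.carrier)).symm
      (f ⊗ₜ[K] TensorProduct.assoc K (SMod.fund q n).carrier M.carrier (SMod.fund q n).dual.carrier
        (TensorProduct.map M.T LinearMap.id
          ((TensorProduct.assoc K M.carrier (SMod.fund q n).carrier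
            (SMod.fund q n).dual.carrier).symm (m ⊗ₜ[K] coevElt q n))))))

/-- Coevaluation supplies v_i ⊗ v_i^*, the crossing turns v_i into v_j with the operator τ_ji on M,
and evaluation against v_k^* keeps j = k. -/
lemma SMod.rotate_eq (M : SMod q n) (k : Idx n) (m : M.carrier) :
    M.rotate (vd q k) m = M.dualCross (vd q k ⊗ₜ[K] m) := by
  have h1 : TensorProduct.assoc K (SMod.fund q n).carrier M.carrier (SMod.fund q n).dual.carrier
        (TensorProduct.map M.T LinearMap.id
          ((TensorProduct.assoc K M.carrier (SMod.fund q n).carrier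
            (SMod.fund q n).dual.carrier).symm (m ⊗ₜ[K] coevElt q n))) =
      ∑ i, ∑ j, vv q j ⊗ₜ[K] (M.tau j i m ⊗ₜ[K] vd q i) := by
    rw [coevElt, TensorProduct.tmul_sum, map_sum, map_sum, map_sum]
    refine Finset.sum_congr rfl fun i _ => ?_
    rw [TensorProduct.assoc_symm_tmul, TensorProduct.map_tmul, M.T_apply, TensorProduct.sum_tmul,
      map_sum]
    rfl
  rw [SMod.rotate, h1, M.dualCross_apply, TensorProduct.tmul_sum, map_sum, map_sum, map_sum]
  refine Finset.sum_congr rfl fun i _ => ?_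
  rw [TensorProduct.tmul_sum, map_sum, map_sum, map_sum, Finset.sum_eq_single k]
  · rw [TensorProduct.assoc_symm_tmul, TensorProduct.map_tmul, evV_tmul, vd_vv, if_pos rfl]
    exact (TensorProduct.lid_tmul _ _).trans (one_smul K _)
  · intro j _ hj
    rw [TensorProduct.assoc_symm_tmul, TensorProduct.map_tmul, evV_tmul, vd_vv, if_neg hj.symm]
    exact (TensorProduct.lid_tmul _ _).trans (zero_smul K _)
  · simp

/-- The inverse of the associativity isomorphism. -/
def SHom.assocSymm (L M N : SMod q n) : SHom 0 (L.tensor (M.tensor N)) ((L.tensor M).tensor N) :=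
  SHom.symmOf (TensorProduct.assoc K L.carrier M.carrier N.carrier) (SHom.assoc L M N) rfl

/-- The inverse of the right unit isomorphism. -/
def SHom.ridSymm (M : SMod q n) : SHom 0 M (M.tensor (SMod.unit q n)) :=
  SHom.symmOf (TensorProduct.rid K M.carrier) (SHom.rid M) rfl

/-- The crossing `V^* ⊗ M → M ⊗ V^*` as a homomorphism of supermodules. -/
def SHom.dualCross (M : SMod q n) :
    SHom 0 ((SMod.fund q n).dual.tensor M) (M.tensor (SMod.fund q n).dual) :=
  SHom.comp (add_zero 0) (SHom.lid _) <|
  SHom.comp (add_zero 0) (SHom.tensor (add_zero 0) (SHom.ev q n) (SHom.one _)) <|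
  SHom.comp (add_zero 0) (SHom.assocSymm _ _ _) <|
  SHom.comp (add_zero 0) (SHom.tensor (add_zero 0) (SHom.one _) (SHom.comp (add_zero 0)
    (SHom.assoc _ _ _) (SHom.comp (add_zero 0) (SHom.tensor (add_zero 0) (SHom.T M) (SHom.one _))
      (SHom.assocSymm _ _ _)))) <|
  SHom.comp (add_zero 0) (SHom.tensor (add_zero 0) (SHom.one _)
    (SHom.tensor (add_zero 0) (SHom.one _) (SHom.coev q n)))
  (SHom.tensor (add_zero 0) (SHom.one _) (SHom.ridSymm M))

/-- A composite of known homomorphisms is a homomorphism, so compatibility with the action need not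
be checked for the explicit map; identifying the two suffices. Its inverse then inherits the
property. -/
lemma SHom.dualCross_coe (M : SMod q n) : (SHom.dualCross M).1 = M.dualCross := by
  refine SMod.ext_dual_tensor fun k m => ?_
  rw [← M.rotate_eq]
  have h : coevElt q n = coevV q n (1 : K) := (one_smul K _).symm
  rw [SMod.rotate, h]
  rfl

/-- The inverse of the crossing `V^* ⊗ M → M ⊗ V^*`. -/
def SHom.dualCrossInv (M : SMod q n) :
    SHom 0 (M.tensor (SMod.fund q n).dual) ((SMod.fund q n).dual.tensor M) :=
  SHom.symmOf M.dualCrossEquiv (SHom.dualCross M) (SHom.dualCross_coe M)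

/-- The right cap, the form `v_a ⊗ v_i^* ↦ δ_ai c_i`. -/
def rightCapV (q : Kˣ) (n : ℕ) : ((SMod.fund q n).tensor (SMod.fund q n).dual).carrier →ₗ[K] K :=
  TensorProduct.lift (∑ i, wt q i • (LinearMap.toSpanSingleton K _
    ((LinearMap.applyₗ (vv q i : (SMod.fund q n).carrier) :
      ((SMod.fund q n).carrier →ₗ[K] K) →ₗ[K] K))).comp
        (vd q i : (SMod.fund q n).carrier →ₗ[K] K))

lemma rightCapV_apply (a i : Idx n) :
    rightCapV q n (vv q a ⊗ₜ[K] vd q i) = if a = i then wt q i else 0 := by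
  rw [rightCapV]
  refine (TensorProduct.lift.tmul _ _).trans ?_
  rw [LinearMap.sum_apply, LinearMap.sum_apply, Finset.sum_eq_single a]
  · change wt q a • ((vd q a : (SMod.fund q n).carrier →ₗ[K] K) (vv q a) •
      (vd q i : (SMod.fund q n).carrier →ₗ[K] K) (vv q a)) = _
    rw [vd_vv, vd_vv, if_pos rfl, one_smul]
    by_cases h : i = a
    · subst h; simp
    · rw [if_neg h, if_neg (Ne.symm h), smul_zero]
  · intro j _ hj
    change wt q j • ((vd q j : (SMod.fund q n).carrier →ₗ[K] K) (vv q a) •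
      (vd q i : (SMod.fund q n).carrier →ₗ[K] K) (vv q j)) = _
    rw [vd_vv, if_neg hj, zero_smul, smul_zero]
  · simp

/-- Evaluated on v_k^* ⊗ v_b the left-hand side is the weighted partial trace of T. The lemma
identifies the right cap, which is evaluation after the inverse crossing. -/
lemma rightCapV_dualCross : rightCapV q n ∘ₗ (SMod.fund q n).dualCross = evV q n := by
  refine SMod.ext_dual_tensor fun k v => ?_
  refine LinearMap.congr_fun (f := (rightCapV q n ∘ₗ (SMod.fund q n).dualCross) ∘ₗ
    TensorProduct.mk K _ _ (vd q k)) (g := evV q n ∘ₗ TensorProduct.mk K _ _ (vd q k)) ?_ v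
  refine fund_ext fun b => ?_
  change rightCapV q n ((SMod.fund q n).dualCross (vd q k ⊗ₜ[K] vv q b)) = _
  rw [SMod.dualCross_apply, map_sum]
  have h : ∀ i, rightCapV q n ((SMod.fund q n).tau k i (vv q b) ⊗ₜ[K] vd q i) =
      wt q i * Tc q k i b i := by
    intro i
    rw [fund_tau, TensorProduct.sum_tmul, map_sum, Finset.sum_eq_single i]
    · rw [← TensorProduct.smul_tmul', map_smul, rightCapV_apply, if_pos rfl, smul_eq_mul, mul_comm]
    · intro a _ ha
      rw [← TensorProduct.smul_tmul', map_smul, rightCapV_apply, if_neg ha, smul_zero]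
    · simp
  refine (Finset.sum_congr rfl fun i _ => h i).trans ?_
  rw [sum_wt_cap]
  exact (vd_vv k b).symm

lemma evV_dualCrossInv : evV q n ∘ₗ (SMod.fund q n).dualCrossInv = rightCapV q n := by
  rw [← rightCapV_dualCross, LinearMap.comp_assoc, SMod.dualCross_dualCrossInv, LinearMap.comp_id]

variable (q n) in
/-- The right cup `∑ c_i⁻¹ v_i^* ⊗ v_i`. -/
def rightCupElt : ((SMod.fund q n).dual.tensor (SMod.fund q n)).carrier :=
  ∑ k, wt q⁻¹ k • (vd q k ⊗ₜ[K] vv q k)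

/-- The coefficients are the partial traces of T over the first factor with the inverse weights. The
right cup is obtained from this by applying the inverse crossing. -/
lemma dualCross_rightCupElt : (SMod.fund q n).dualCross (rightCupElt q n) = coevElt q n := by
  rw [rightCupElt, map_sum]
  have h : ∀ k, (SMod.fund q n).dualCross (wt q⁻¹ k • (vd q k ⊗ₜ[K] vv q k)) =
      ∑ i, ∑ a, (wt q⁻¹ k * Tc q k a k i) • (vv q a ⊗ₜ[K] vd q i) := by
    intro k
    rw [map_smul, SMod.dualCross_apply, Finset.smul_sum]
    refine Finset.sum_congr rfl fun i _ => ?_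
    rw [fund_tau, TensorProduct.sum_tmul, Finset.smul_sum]
    refine Finset.sum_congr rfl fun a _ => ?_
    rw [mul_smul, ← TensorProduct.smul_tmul']
  refine (Finset.sum_congr rfl fun k _ => h k).trans (Finset.sum_comm.trans ?_)
  refine Finset.sum_congr rfl fun i _ => Finset.sum_comm.trans ?_
  have h' : ∀ a, ∑ k, (wt q⁻¹ k * Tc q k a k i) • (vv q a ⊗ₜ[K] vd q i) =
      (if a = i then (1 : K) else 0) • (vv q a ⊗ₜ[K] vd q i) := by
    intro a
    rw [← sum_wt_cup, Finset.sum_smul]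
  refine (Finset.sum_congr rfl fun a _ => h' a).trans ?_
  rw [Finset.sum_eq_single i]
  · rw [if_pos rfl, one_smul]
  · intro a _ ha
    rw [if_neg ha, zero_smul]
  · simp

lemma dualCrossInv_coevElt : (SMod.fund q n).dualCrossInv (coevElt q n) = rightCupElt q n := by
  rw [← dualCross_rightCupElt]
  exact LinearMap.congr_fun (SMod.dualCrossInv_dualCross _) _

/-- The value of the bubble is the sum of all weights. -/
lemma rightCapV_coevElt : rightCapV q n (coevElt q n) = 0 := by
  rw [coevElt, map_sum, ← sum_wt (n := n) q]
  exact Finset.sum_congr rfl fun i _ => by rw [rightCapV_apply, if_pos rfl]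

end DualCrossing

/-! ### The inverse of the transpose of τ in terms of κ and the weights -/

section Quad

variable {K : Type} [Field K] [CharZero K] {q : Kˣ} {n : ℕ}

/-- The matrix of coefficients `Tc i b j l`, with rows `(i, j)` and columns `(b, l)`, has
independent rows. -/
lemma Tc_faithful {B : Type*} [AddCommGroup B] [Module K B] (E : Idx n → Idx n → B)
    (h : ∀ b l, ∑ i, ∑ j, Tc q i b j l • E i j = 0) (m r : Idx n) : E m r = 0 := by
  -- The scalars Tc i b j l are matrix coefficients of τ_il on V, so the entries of λ for M = V
  -- provide a one-sided inverse of the coefficient matrix.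
  set C : Idx n → Idx n → K := fun b l =>
    (vd q r : (SMod.fund q n).carrier →ₗ[K] K) ((SMod.fund q n).lam l m (vv q b)) with hC
  have h1 : ∀ i j, ∑ l, ∑ b, C b l * Tc q i b j l = if i = m ∧ j = r then 1 else 0 := by
    intro i j
    have h2 : ∀ l, ∑ b, C b l * Tc q i b j l = (vd q r : (SMod.fund q n).carrier →ₗ[K] K)
        (((SMod.fund q n).lam l m * (SMod.fund q n).tau i l) (vv q j)) := by
      intro l
      rw [Module.End.mul_apply, fund_tau, map_sum, map_sum]
      refine Finset.sum_congr rfl fun b _ => ?_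
      rw [map_smul, map_smul, smul_eq_mul, mul_comm]
    refine (Finset.sum_congr rfl fun l _ => h2 l).trans ?_
    rw [← map_sum, ← LinearMap.sum_apply, SMod.lam_mul_tau]
    by_cases him : i = m
    · rw [if_pos him, Module.End.one_apply, vd_vv]
      exact if_congr ⟨fun h => ⟨him, h.symm⟩, fun h => h.2.symm⟩ rfl rfl
    · rw [if_neg him, if_neg fun h => him h.1]
      simp
  have h3 : E m r = ∑ i, ∑ j, (if i = m ∧ j = r then (1 : K) else 0) • E i j := by
    rw [Finset.sum_eq_single m, Finset.sum_eq_single r]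
    · rw [if_pos ⟨rfl, rfl⟩, one_smul]
    · intro j _ hj
      rw [if_neg fun h => hj h.2, zero_smul]
    · simp
    · intro i _ hi
      exact Finset.sum_eq_zero fun j _ => by rw [if_neg fun h => hi h.1, zero_smul]
    · simp
  rw [h3]
  simp only [← h1, Finset.sum_smul, mul_smul]
  rw [sum_comm_four]
  have h4 : ∀ l b, ∑ i, ∑ j, C b l • Tc q i b j l • E i j = 0 := by
    intro l b
    simp only [← Finset.smul_sum]
    rw [h, smul_zero]
  exact Finset.sum_eq_zero fun l _ => Finset.sum_eq_zero fun b _ => h4 l b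

/-- Multiplying the relation `SMod.frt` by κ on the left and on the right removes one τ from each
side and exchanges the order of κ and τ. -/
lemma SMod.kap_tau_exchange (M : SMod q n) (a b' j' l : Idx n) :
    ∑ b, ∑ k, Tc q a b j' k • (M.kap b' b * M.tau k l) =
      ∑ i, ∑ j, Tc q i b' j l • (M.tau a i * M.kap j j') := by
  have h : ∑ b, ∑ j, M.kap b' b * (∑ i, ∑ k, Tc q a b i k • (M.tau k l * M.tau i j)) * M.kap j j' =
      ∑ b, ∑ j, M.kap b' b * (∑ i, ∑ k, Tc q i k j l • (M.tau b k * M.tau a i)) * M.kap j j' := by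
    refine Finset.sum_congr rfl fun b _ => Finset.sum_congr rfl fun j _ => ?_
    rw [M.frt]
  have hl : ∀ b, ∑ j, M.kap b' b * (∑ i, ∑ k, Tc q a b i k • (M.tau k l * M.tau i j)) * M.kap j j' =
      ∑ k, Tc q a b j' k • (M.kap b' b * M.tau k l) := by
    intro b
    have h1 : ∀ j, M.kap b' b * (∑ i, ∑ k, Tc q a b i k • (M.tau k l * M.tau i j)) * M.kap j j' =
        ∑ i, (∑ k, Tc q a b i k • (M.kap b' b * M.tau k l)) * (M.tau i j * M.kap j j') := by
      intro j
      simp only [Finset.mul_sum, Finset.sum_mul, mul_smul_comm, smul_mul_assoc, mul_assoc]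
    rw [Finset.sum_congr rfl fun j _ => h1 j, Finset.sum_comm]
    have h2 : ∀ i, ∑ j, (∑ k, Tc q a b i k • (M.kap b' b * M.tau k l)) * (M.tau i j * M.kap j j') =
        if i = j' then ∑ k, Tc q a b i k • (M.kap b' b * M.tau k l) else 0 := by
      intro i
      rw [← Finset.mul_sum, M.tau_mul_kap, mul_ite, mul_one, mul_zero]
    rw [Finset.sum_congr rfl fun i _ => h2 i, Finset.sum_ite_eq' Finset.univ j',
      if_pos (Finset.mem_univ _)]
  have hr : ∑ b, ∑ j, M.kap b' b * (∑ i, ∑ k, Tc q i k j l • (M.tau b k * M.tau a i)) * M.kap j j' =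
      ∑ j, ∑ i, Tc q i b' j l • (M.tau a i * M.kap j j') := by
    rw [Finset.sum_comm]
    refine Finset.sum_congr rfl fun j _ => ?_
    have h1 : ∀ b, M.kap b' b * (∑ i, ∑ k, Tc q i k j l • (M.tau b k * M.tau a i)) * M.kap j j' =
        ∑ k, (M.kap b' b * M.tau b k) * (∑ i, Tc q i k j l • (M.tau a i * M.kap j j')) := by
      intro b
      rw [Finset.sum_comm]
      simp only [Finset.mul_sum, Finset.sum_mul, mul_smul_comm, smul_mul_assoc, mul_assoc]
    rw [Finset.sum_congr rfl fun b _ => h1 b, Finset.sum_comm]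
    have h2 : ∀ k, ∑ b, (M.kap b' b * M.tau b k) * (∑ i, Tc q i k j l • (M.tau a i * M.kap j j')) =
        if b' = k then ∑ i, Tc q i k j l • (M.tau a i * M.kap j j') else 0 := by
      intro k
      rw [← Finset.sum_mul, M.kap_mul_tau, ite_mul, one_mul, zero_mul]
    rw [Finset.sum_congr rfl fun i _ => h2 i, Finset.sum_ite_eq Finset.univ b',
      if_pos (Finset.mem_univ _)]
  rw [Finset.sum_congr rfl fun b _ => hl b, hr, Finset.sum_comm (s := Finset.univ (α := Idx n))
    (f := fun j i => Tc q i b' j l • (M.tau a i * M.kap j j'))] at h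
  exact h

/-- The square of the duality, in terms of the entries of `τ` and its inverse. -/
lemma SMod.quad (M : SMod q n) (i j : Idx n) :
    ∑ a, wt q⁻¹ a • (M.tau a i * M.kap j a) = if i = j then wt q⁻¹ i • 1 else 0 := by
  rw [← sub_eq_zero]
  -- It is enough to compare the two sides after contraction with `Tc`. The exchange relation then
  -- turns τκ into κτ, the weighted partial trace of `Tc` collapses to a delta, and κτ = 1 finishes
  -- the left-hand side; the right-hand side is another partial trace.
  refine Tc_faithful (q := q) (fun i j => ∑ a, wt q⁻¹ a • (M.tau a i * M.kap j a) -
    (if i = j then wt q⁻¹ i • (1 : Module.End K M.carrier) else 0)) (fun b l => ?_) i j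
  simp only [smul_sub, Finset.sum_sub_distrib]
  rw [sub_eq_zero]
  have hR : ∑ i, ∑ j, Tc q i b j l • (if i = j then wt q⁻¹ i • (1 : Module.End K M.carrier) else 0) =
      (if b = l then (1 : K) else 0) • 1 := by
    rw [← sum_wt_cup (q := q), Finset.sum_smul]
    refine Finset.sum_congr rfl fun i _ => ?_
    rw [Finset.sum_eq_single i]
    · rw [if_pos rfl, smul_smul, mul_comm]
    · intro j _ hj
      rw [if_neg hj.symm, smul_zero]
    · simp
  have hL : ∑ i, ∑ j, Tc q i b j l • ∑ a, wt q⁻¹ a • (M.tau a i * M.kap j a) =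
      ∑ a, wt q⁻¹ a • ∑ i, ∑ j, Tc q i b j l • (M.tau a i * M.kap j a) := by
    simp only [Finset.smul_sum]
    refine (Finset.sum_congr rfl fun i _ => Finset.sum_comm).trans (Finset.sum_comm.trans ?_)
    refine Finset.sum_congr rfl fun a _ => Finset.sum_congr rfl fun i _ =>
      Finset.sum_congr rfl fun j _ => smul_comm _ _ _
  have hM : ∀ b', ∑ k, (∑ a, wt q⁻¹ a * Tc q a b' a k) • (M.kap b b' * M.tau k l) =
      M.kap b b' * M.tau b' l := by
    intro b'
    rw [Finset.sum_eq_single b']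
    · rw [sum_wt_cup, if_pos rfl, one_smul]
    · intro k _ hk
      rw [sum_wt_cup, if_neg hk.symm, zero_smul]
    · simp
  have hN : ∑ a, wt q⁻¹ a • ∑ b', ∑ k, Tc q a b' a k • (M.kap b b' * M.tau k l) =
      ∑ b', ∑ k, (∑ a, wt q⁻¹ a * Tc q a b' a k) • (M.kap b b' * M.tau k l) := by
    simp only [Finset.smul_sum, Finset.sum_smul, mul_smul]
    exact Finset.sum_comm.trans (Finset.sum_congr rfl fun b' _ => Finset.sum_comm)
  rw [hL, hR, ← Finset.sum_congr rfl fun a _ => congrArg _ (M.kap_tau_exchange a b a l), hN,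
    Finset.sum_congr rfl fun b' _ => hM b', M.kap_mul_tau]
  by_cases h : b = l
  · rw [if_pos h, if_pos h, one_smul]
  · rw [if_neg h, if_neg h, zero_smul]

/-- By `SMod.quad` the rescaled κ is a right inverse of the transposed matrix of τ, of which λ is a
left inverse, so the two coincide. -/
lemma SMod.lam_eq (M : SMod q n) (k j : Idx n) :
    M.lam k j = (wt q⁻¹ j * wt q k) • M.kap k j := by
  have h1 : ∀ l, ∑ i, M.tau i l * ((wt q⁻¹ i * wt q k) • M.kap k i) =
      if k = l then (1 : Module.End K M.carrier) else 0 := by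
    intro l
    have h2 : ∀ i, M.tau i l * ((wt q⁻¹ i * wt q k) • M.kap k i) =
        wt q k • (wt q⁻¹ i • (M.tau i l * M.kap k i)) := by
      intro i
      rw [mul_smul_comm, smul_smul, mul_comm]
    rw [Finset.sum_congr rfl fun i _ => h2 i, ← Finset.smul_sum, M.quad]
    by_cases h : k = l
    · subst h
      rw [if_pos rfl, if_pos rfl, smul_smul, wt_inv, one_smul]
    · rw [if_neg h, if_neg (Ne.symm h), smul_zero]
  have h3 : ∑ i, (∑ l, M.lam l j * M.tau i l) * ((wt q⁻¹ i * wt q k) • M.kap k i) =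
      (wt q⁻¹ j * wt q k) • M.kap k j := by
    rw [Finset.sum_eq_single j]
    · rw [M.lam_mul_tau, if_pos rfl, one_mul]
    · intro i _ hi
      rw [M.lam_mul_tau, if_neg hi, zero_mul]
    · simp
  have h4 : ∀ l, ∑ i, M.lam l j * M.tau i l * ((wt q⁻¹ i * wt q k) • M.kap k i) =
      M.lam l j * if k = l then (1 : Module.End K M.carrier) else 0 := by
    intro l
    rw [← h1, Finset.mul_sum]
    simp only [mul_assoc]
  rw [← h3]
  simp only [Finset.sum_mul]
  rw [Finset.sum_comm, Finset.sum_congr rfl fun l _ => h4 l, Finset.sum_eq_single k]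
  · rw [if_pos rfl, mul_one]
  · intro l _ hl
    rw [if_neg hl.symm, mul_zero]
  · simp

end Quad

/-! ### The square of the antipode and its bijectivity -/

section AntipodeSquare

variable {K : Type} [Field K] [CharZero K] {q : Kˣ} {n : ℕ}

variable (q n) in
/-- The regular supermodule. -/
abbrev SMod.reg : SMod q n :=
  SMod.mk' (Uq q n) (Uq.sig q n) Uq.sig_sig (fun i j => lmul (uu q i j))
    ((isRep_uu q n).map lmul) (fun i j => sig_lmul _ (Uq.sigma_uu i j))

lemma SMod.reg_rho (x y : Uq q n) : (SMod.reg q n).ρ x y = x * y := by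
  induction x using Uq.induction with
  | one => rw [map_one]; exact (one_mul y).symm
  | gen i j x ih =>
    rw [map_mul, Module.End.mul_apply, ih]
    refine (LinearMap.congr_fun (SMod.mk'_x (hs := Uq.sig_sig) (hx := (isRep_uu q n).map lmul)
      (hsx := fun i j => sig_lmul _ (Uq.sigma_uu i j)) i j) (x * y)).trans ?_
    exact (mul_assoc _ _ _).symm
  | add x x' h h' => rw [map_add, LinearMap.add_apply, h, h', add_mul]
  | smul c x h => rw [map_smul, LinearMap.smul_apply, h, smul_mul_assoc]

/-- The weights `(-1)^{p(i)} c_i⁻¹`, which are invariant under `i ↦ -i`. -/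
def wtAbs (q : Kˣ) (i : Idx n) : K := (sg (par i) : K) * wt q⁻¹ i

lemma wtAbs_neg (i : Idx n) : wtAbs q (-i) = wtAbs q i := by
  rw [wtAbs, wtAbs, par_neg, wt_neg, sgK_add, sg_one]
  push_cast
  ring

lemma sgK_ne_zero (p : ZMod 2) : (sg p : K) ≠ 0 := fun h => by
  have := sgK_mul_self (K := K) p
  rw [h, mul_zero] at this
  exact zero_ne_one this

lemma wtAbs_ne_zero (i : Idx n) : wtAbs q i ≠ 0 := mul_ne_zero (sgK_ne_zero _) (wt_ne_zero _ _)

lemma quad_sign : ∀ pa pi pj : ZMod 2, (pa = pi ∧ pa = pj) ∨ (pj = 1 ∧ pi = 0) →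
    pa + pi + pi * (pj + pa) + (pj + pa) + pj * (pj + pa) = pi + pa := by
  decide

/-- The parity is 1 on negative and 0 on positive indices, so it changes at most once between j and
i. Together with triangularity this makes the signs in `sum_uu_Linv` manageable. -/
lemma par_between {j a i : Idx n} (h : j ≤ a) (h' : a ≤ i) :
    (par a = par i ∧ par a = par j) ∨ (par j = 1 ∧ par i = 0) := by
  have h1 : j.1 ≤ a.1 := h
  have h2 : a.1 ≤ i.1 := h'
  unfold par
  split_ifs <;> first | omega | decide

lemma ipow_sig_Linv (p : ZMod 2) (i j : Idx n) : ipow (Uq.sig q n) p (Linv q n i j) =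
    (sg (p * par₂ i j) : K) • Linv q n i j := Uq.ipow_sig (sigma_Linv i j)

/-- `SMod.quad` for the regular supermodule is evaluated at 1. Only j ≤ a ≤ i contributes, and there
the total sign is (-1)^{p(i)+p(a)}, which turns the inverse weights into `wtAbs`. -/
lemma sum_uu_Linv (i j : Idx n) :
    ∑ a, wtAbs q a • (uu q a i * Linv q n j a) = if i = j then wtAbs q i • 1 else 0 := by
  have h := LinearMap.congr_fun ((SMod.reg q n).quad i j) (1 : Uq q n)
  have h1 : ∀ x : Uq q n, (SMod.reg q n).ρ x (1 : Uq q n) = x := fun x =>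
    (SMod.reg_rho x 1).trans (mul_one x)
  have hs : ∀ (p : ZMod 2) (x : Uq q n), ipow (SMod.reg q n).sgn p x = ipow (Uq.sig q n) p x := by
    intro p x
    rw [SMod.mk'_sgn]
  have hk : ∀ a, (SMod.reg q n).kap j a (1 : Uq q n) =
      (sg (par₂ j a + par j * par₂ j a) : K) • Linv q n j a := by
    intro a
    refine (LinearMap.smul_apply _ _ _).trans ?_
    rw [Module.End.mul_apply, h1]
    refine (congrArg _ ((hs _ _).trans (ipow_sig_Linv _ _ _))).trans ?_
    rw [smul_smul, ← sgK_add]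
  have ht : ∀ a, (SMod.reg q n).tau a i ((SMod.reg q n).kap j a (1 : Uq q n)) =
      (sg (par₂ a i + par i * par₂ j a + par₂ j a + par j * par₂ j a) : K) •
        (uu q a i * Linv q n j a) := by
    intro a
    rw [hk, SMod.tau_eq]
    refine (LinearMap.smul_apply _ _ _).trans ?_
    rw [Module.End.mul_apply]
    refine (congrArg _ ((SMod.reg_rho _ _).trans (congrArg _ (hs _ _)))).trans ?_
    rw [map_smul, ipow_sig_Linv, mul_smul_comm, mul_smul_comm, smul_smul, smul_smul, ← sgK_add,
      ← sgK_add]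
    congr 3
    ring
  have hz : ∀ a, wt q⁻¹ a • (SMod.reg q n).tau a i ((SMod.reg q n).kap j a (1 : Uq q n)) =
      (sg (par i) : K) • wtAbs q a • (uu q a i * Linv q n j a) := by
    intro a
    rw [ht]
    by_cases h1 : a ≤ i
    · by_cases h2 : j ≤ a
      · have h3 := quad_sign _ _ _ (par_between h2 h1)
        have h4 : par₂ a i + par i * par₂ j a + par₂ j a + par j * par₂ j a = par i + par a := h3
        rw [h4, wtAbs, smul_smul, smul_smul, sgK_add]
        congr 1
        ring
      · rw [Linv_lower (not_le.1 h2)]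
        simp
    · rw [(isRep_uu q n).tri _ _ (not_le.1 h1)]
      simp
  have hsum : (sg (par i) : K) • ∑ a, wtAbs q a • (uu q a i * Linv q n j a) =
      if i = j then wt q⁻¹ i • 1 else 0 := by
    rw [Finset.smul_sum, ← Finset.sum_congr rfl fun a _ => hz a]
    refine Eq.trans ?_ (h.trans ?_)
    · rw [LinearMap.sum_apply]
      rfl
    · by_cases hij : i = j
      · rw [if_pos hij, if_pos hij]; rfl
      · rw [if_neg hij, if_neg hij]; rfl
  have h5 := congrArg (fun x : Uq q n => (sg (par i) : K) • x) hsum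
  simp only [smul_smul, sgK_mul_self, one_smul] at h5
  rw [h5]
  by_cases hij : i = j
  · rw [if_pos hij, if_pos hij, smul_smul]; rfl
  · rw [if_neg hij, if_neg hij, smul_zero]

lemma Uq.sigma_antipode_comm (x : Uq q n) :
    Uq.sigma q n (Uq.antipode q n x) = Uq.antipode q n (Uq.sigma q n x) := by
  induction x using Uq.induction with
  | one => simp [Uq.antipode_one]
  | gen i j x ih =>
    rw [antipode_uu_mul, map_mul, map_mul, sigma_uu, smul_mul_assoc, map_smul, antipode_uu_mul,
      ← ih, sigma_Linv, mul_smul_comm]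
    rcases zmod2_cases (par₂ i j) with h | h <;> simp [h, ipow_zero, ipow_one]
  | add x y hx hy => simp only [map_add, hx, hy]
  | smul c x hx => simp only [map_smul, hx]

lemma Uq.ipow_sig_antipode (p : ZMod 2) (x : Uq q n) :
    ipow (Uq.sig q n) p (Uq.antipode q n x) = Uq.antipode q n (ipow (Uq.sig q n) p x) := by
  rcases zmod2_cases p with rfl | rfl
  · rfl
  · exact Uq.sigma_antipode_comm x

lemma Uq.ipow_sig_sig (p : ZMod 2) (x : Uq q n) :
    ipow (Uq.sig q n) p (ipow (Uq.sig q n) p x) = x :=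
  LinearMap.congr_fun (ipow_mul_self Uq.sig_sig p) x

lemma Uq.ipow_sig_one (p : ZMod 2) : ipow (Uq.sig q n) p (1 : Uq q n) = 1 := by
  rcases zmod2_cases p with rfl | rfl
  · rfl
  · exact map_one (Uq.sigma q n)

/-- The antipode of a product whose right factor is homogeneous. -/
lemma Uq.antipode_mul_right {p : ZMod 2} {x : Uq q n} (hx : Uq.sigma q n x = (sg p : K) • x)
    (y : Uq q n) : Uq.antipode q n (y * x) =
      Uq.antipode q n x * ipow (Uq.sig q n) p (Uq.antipode q n y) := by
  have hx' : Uq.sigma q n (Uq.antipode q n x) = (sg p : K) • Uq.antipode q n x := by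
    rw [Uq.sigma_antipode_comm, hx, map_smul]
  induction y using Uq.induction with
  | one => rw [one_mul, Uq.antipode_one, Uq.ipow_sig_one, mul_one]
  | gen i j y ih =>
    have hc : ∀ z : Uq q n, ipow (Uq.sig q n) (par₂ i j) (ipow (Uq.sig q n) p z) =
        ipow (Uq.sig q n) p (ipow (Uq.sig q n) (par₂ i j) z) := fun z => by
      rcases zmod2_cases p with rfl | rfl <;> rcases zmod2_cases (par₂ i j) with h | h <;>
        rw [h] <;> rfl
    rw [mul_assoc, antipode_uu_mul, ih, antipode_uu_mul, Uq.ipow_sig_mul, Uq.ipow_sig_mul,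
      Uq.ipow_sig hx', ipow_sig_Linv, hc, mul_smul_comm, mul_smul_comm, smul_mul_assoc,
      smul_mul_assoc, mul_assoc, mul_comm p]
  | add y y' h h' => simp only [add_mul, map_add, mul_add, h, h']
  | smul c y h => simp only [smul_mul_assoc, map_smul, mul_smul_comm, h]

/-- The antipode is applied to L⁻¹ L = 1. Its sign is trivial because p(i,k) p(k,j) = 0 for i ≤ k ≤
j. -/
lemma sum_Linv_mul_antipode (i j : Idx n) :
    ∑ k, Linv q n k j * Uq.antipode q n (Linv q n i k) = if i = j then 1 else 0 := by
  have h := congrArg (Uq.antipode q n) (congrFun (congrFun (Linv_mul_L (q := q) (n := n)) i) j)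
  rw [Matrix.mul_apply, map_sum, Matrix.one_apply, apply_ite (Uq.antipode q n), Uq.antipode_one,
    map_zero] at h
  rw [← h]
  refine Finset.sum_congr rfl fun k _ => ?_
  change _ = Uq.antipode q n (Linv q n i k * uu q k j)
  rw [Uq.antipode_mul_right (Uq.sigma_uu k j), Uq.antipode_uu]
  by_cases h1 : i ≤ k
  · by_cases h2 : k ≤ j
    · have h3 : Uq.sigma q n (Uq.antipode q n (Linv q n i k)) =
          (sg (par₂ i k) : K) • Uq.antipode q n (Linv q n i k) := by
        rw [Uq.sigma_antipode_comm, sigma_Linv, map_smul]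
      rw [Uq.ipow_sig h3, mul_comm (par₂ k j), par_tri h1 h2, sg_zero, Int.cast_one, one_smul]
    · rw [Linv_lower (not_le.1 h2)]; simp
  · rw [Linv_lower (not_le.1 h1)]; simp

/-- The square of the antipode on the inverse of the generators. -/
lemma antipode_Linv (m j : Idx n) :
    Uq.antipode q n (Linv q n m j) = (wtAbs q m / wtAbs q j) • uu q m j := by
  -- The transposed matrix of L⁻¹ has the transpose of the rescaled L as a left inverse and the
  -- transpose of S(L⁻¹) as a right inverse; these must agree.
  have hB : ∀ k, ∑ i, ((wtAbs q i / wtAbs q j) • uu q i j) * Linv q n k i =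
      if j = k then (1 : Uq q n) else 0 := by
    intro k
    have h := congrArg (fun x : Uq q n => (wtAbs q j)⁻¹ • x) (sum_uu_Linv (q := q) j k)
    simp only [Finset.smul_sum, smul_smul] at h
    refine Eq.trans (Finset.sum_congr rfl fun i _ => ?_) (h.trans ?_)
    · rw [smul_mul_assoc, div_eq_inv_mul]
    · by_cases hjk : j = k
      · rw [if_pos hjk, if_pos hjk, smul_smul, inv_mul_cancel₀ (wtAbs_ne_zero j), one_smul]
      · rw [if_neg hjk, if_neg hjk, smul_zero]
  have h1 : ∑ i, ((wtAbs q i / wtAbs q j) • uu q i j) *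
      (∑ k, Linv q n k i * Uq.antipode q n (Linv q n m k)) = (wtAbs q m / wtAbs q j) • uu q m j := by
    rw [Finset.sum_eq_single m]
    · rw [sum_Linv_mul_antipode, if_pos rfl, mul_one]
    · intro i _ hi
      rw [sum_Linv_mul_antipode, if_neg hi.symm, mul_zero]
    · simp
  have h2 : ∑ k, (∑ i, ((wtAbs q i / wtAbs q j) • uu q i j) * Linv q n k i) *
      Uq.antipode q n (Linv q n m k) = Uq.antipode q n (Linv q n m j) := by
    rw [Finset.sum_eq_single j]
    · rw [hB, if_pos rfl, one_mul]
    · intro k _ hk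
      rw [hB, if_neg hk.symm, zero_mul]
    · simp
  rw [← h1, ← h2]
  simp only [Finset.mul_sum, Finset.sum_mul, mul_assoc]
  exact Finset.sum_comm

/-- Rescaled generators satisfy the defining relations. -/
lemma isRep_scaled (a : Idx n → K) (ha : ∀ i, a i ≠ 0) (ha' : ∀ i, a (-i) = a i) :
    IsRep q fun i j : Idx n => (a i / a j) • uu q i j where
  tri i j h := by rw [(isRep_uu q n).tri i j h, smul_zero]
  diag i := by rw [div_self (ha _), div_self (ha _), one_smul, one_smul, (isRep_uu q n).diag]
  rll i b k d := by
    -- Θ commutes with diag(a) ⊗ diag(a): diagonal terms obviously, E_ji ⊗ E_ij because it exchanges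
    -- the factors, and E_{-j,-i} ⊗ E_ij because a is invariant under negation.
    have hth : ∀ i j k l : Idx n, theta q i j k l ≠ 0 → a i * a k = a j * a l := by
      intro i j k l h
      by_contra hc
      have h1 : ¬(i = j ∧ k = l) := by
        rintro ⟨rfl, rfl⟩; exact hc rfl
      have h2 : ¬(i = l ∧ j = k) := by
        rintro ⟨rfl, rfl⟩; exact hc (mul_comm _ _)
      have h3 : ¬(i = -l ∧ j = -k) := by
        rintro ⟨rfl, rfl⟩
        apply hc
        rw [ha', ha', mul_comm]
      apply h
      rw [theta, if_neg h1, if_neg h2, if_neg h3]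
      simp
    have hl : rllLeft q (fun i j : Idx n => (a i / a j) • uu q i j) i b k d =
        (a i * a k / (a b * a d)) • rllLeft q (uu q) i b k d := by
      rw [rllLeft, rllLeft, Finset.smul_sum]
      refine Finset.sum_congr rfl fun j _ => ?_
      rw [Finset.smul_sum]
      refine Finset.sum_congr rfl fun l _ => ?_
      by_cases h0 : theta q j b l d = 0
      · rw [h0]; simp
      · rw [smul_mul_smul_comm, smul_smul, smul_smul, ← hth _ _ _ _ h0, div_mul_div_comm, mul_comm]
    have hr : rllRight q (fun i j : Idx n => (a i / a j) • uu q i j) i b k d =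
        (a i * a k / (a b * a d)) • rllRight q (uu q) i b k d := by
      rw [rllRight, rllRight, Finset.smul_sum]
      refine Finset.sum_congr rfl fun j _ => ?_
      rw [Finset.smul_sum]
      refine Finset.sum_congr rfl fun l _ => ?_
      by_cases h0 : theta q i j k l = 0
      · rw [h0]; simp
      · rw [smul_mul_smul_comm, smul_smul, smul_smul, hth _ _ _ _ h0, div_mul_div_comm, mul_comm,
          mul_comm (a j), mul_comm (a b)]
    rw [hl, hr, (isRep_uu q n).rll]

/-- The automorphism which rescales the generators. -/
def Uq.scale (a : Idx n → K) (ha : ∀ i, a i ≠ 0) (ha' : ∀ i, a (-i) = a i) :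
    Uq q n →ₐ[K] Uq q n := Uq.lift _ (isRep_scaled a ha ha')

lemma Uq.scale_scale (a b : Idx n → K) (ha : ∀ i, a i ≠ 0) (ha' : ∀ i, a (-i) = a i)
    (hb : ∀ i, b i ≠ 0) (hb' : ∀ i, b (-i) = b i) (hab : ∀ i, a i * b i = 1) (x : Uq q n) :
    Uq.scale a ha ha' (Uq.scale b hb hb' x) = x := by
  induction x using Uq.induction with
  | one => simp
  | gen i j x ih =>
    rw [map_mul, map_mul, ih, Uq.scale, Uq.scale, Uq.lift_uu, map_smul, Uq.lift_uu, smul_smul,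
      div_mul_div_comm, mul_comm (b i), mul_comm (b j), hab, hab, div_one, one_smul]
  | add x y hx hy => rw [map_add, map_add, hx, hy]
  | smul c x hx => rw [map_smul, map_smul, hx]

/-- The two reversals and their signs cancel, so S² is multiplicative, and on a generator it is
computed by `antipode_Linv`. -/
lemma Uq.antipode_antipode (x : Uq q n) : Uq.antipode q n (Uq.antipode q n x) =
    Uq.scale (wtAbs q) wtAbs_ne_zero wtAbs_neg x := by
  induction x using Uq.induction with
  | one => rw [antipode_one, antipode_one, map_one]
  | gen i j x ih =>
    rw [map_mul (Uq.scale (wtAbs q) wtAbs_ne_zero wtAbs_neg), antipode_uu_mul,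
      antipode_mul_right (sigma_Linv i j), antipode_Linv, ipow_sig_antipode, ipow_sig_sig, ih,
      Uq.scale, Uq.lift_uu]
  | add x y hx hy => rw [map_add, map_add, map_add, hx, hy]
  | smul c x hx => rw [map_smul, map_smul, map_smul, hx]

/-- S² is a rescaling automorphism, with inverse the rescaling by the reciprocal weights. Hence S
has a left inverse and a right inverse. -/
lemma Uq.antipode_bijective : Function.Bijective (Uq.antipode q n) := by
  have hb : ∀ i : Idx n, (wtAbs q i)⁻¹ ≠ 0 := fun i => inv_ne_zero (wtAbs_ne_zero i)
  have hb' : ∀ i : Idx n, (wtAbs q (-i))⁻¹ = (wtAbs q i)⁻¹ := fun i => by rw [wtAbs_neg]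
  constructor
  · intro x y h
    have h1 := congrArg (Uq.antipode q n) h
    rw [Uq.antipode_antipode, Uq.antipode_antipode] at h1
    have h2 := congrArg (Uq.scale (fun i => (wtAbs q i)⁻¹) hb hb') h1
    rwa [Uq.scale_scale _ _ _ _ _ _ fun i => inv_mul_cancel₀ (wtAbs_ne_zero i),
      Uq.scale_scale _ _ _ _ _ _ fun i => inv_mul_cancel₀ (wtAbs_ne_zero i)] at h2
  · intro y
    refine ⟨Uq.antipode q n (Uq.scale (fun i => (wtAbs q i)⁻¹) hb hb' y), ?_⟩
    rw [Uq.antipode_antipode]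
    exact Uq.scale_scale _ _ _ _ _ _ (fun i => mul_inv_cancel₀ (wtAbs_ne_zero i)) y

variable (q n) in
/-- The antipode as a linear automorphism. -/
def Uq.antipodeEquiv : Uq q n ≃ₗ[K] Uq q n :=
  LinearEquiv.ofBijective (Uq.antipode q n) Uq.antipode_bijective

lemma Uq.antipodeEquiv_apply (x : Uq q n) : Uq.antipodeEquiv q n x = Uq.antipode q n x := rfl

lemma Uq.antipodeEquiv_symm_uu (i j : Idx n) :
    (Uq.antipodeEquiv q n).symm (uu q i j) = (wtAbs q j / wtAbs q i) • Linv q n i j := by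
  rw [LinearEquiv.symm_apply_eq, Uq.antipodeEquiv_apply, map_smul, antipode_Linv, smul_smul,
    div_mul_div_cancel₀ (wtAbs_ne_zero i), div_self (wtAbs_ne_zero j), one_smul]

end AntipodeSquare

/-! ### The crossings with V^* in terms of L and the antipode -/

section DualFormulas

variable {K : Type} [Field K] [CharZero K] {q : Kˣ} {n : ℕ}

lemma SMod.LDual_apply (M : SMod q n) (x : Idx n → Idx n → Uq q n) (m : M.carrier) (k : Idx n) :
    M.LDual x (m ⊗ₜ[K] vd q k) = ∑ j, (sg (par₂ k j * par k) : K) •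
      (M.ρ (x k j) (ipow M.sgn (par₂ k j) m) ⊗ₜ[K] vd q j) := by
  rw [SMod.LDual, LinearMap.sum_apply, Finset.sum_eq_single k]
  · rw [LinearMap.sum_apply]
    refine Finset.sum_congr rfl fun j _ => ?_
    rw [SMod.opTensor_tmul, EopDual, Module.End.mul_apply, SMod.ipow_of_mem _ (vd_mem k), map_smul,
      transp_Eop_vd, if_pos rfl, TensorProduct.tmul_smul]
  · intro i _ hi
    rw [LinearMap.sum_apply]
    refine Finset.sum_eq_zero fun j _ => ?_
    rw [SMod.opTensor_tmul, EopDual, Module.End.mul_apply, SMod.ipow_of_mem _ (vd_mem k), map_smul,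
      transp_Eop_vd, if_neg hi, smul_zero, TensorProduct.tmul_zero]
  · simp

/-- The flip contributes the involution p(k) times, moving E_kj^* past M contributes it p(k,j)
times, and E_kj^* carries the sign (-1)^{p(k,j) p(k)}; together these turn u_kj into τ_kj. -/
lemma SMod.dualCross_formula (M : SMod q n) :
    M.dualCross = M.LDual (uu q) ∘ₗ (SMod.fund q n).dual.flip M := by
  refine SMod.ext_dual_tensor fun k m => ?_
  rw [LinearMap.comp_apply, SMod.flip_left _ _ (vd_mem k), M.LDual_apply, M.dualCross_apply]
  refine Finset.sum_congr rfl fun j _ => ?_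
  rw [TensorProduct.smul_tmul', SMod.tau]
  congr 1
  refine (LinearMap.smul_apply _ _ _).trans ?_
  rw [mul_comm (par₂ k j)]
  congr 1
  rw [Module.End.mul_apply, ← Module.End.mul_apply (ipow M.sgn (par₂ k j)), ipow_add M.sgn_sgn]
  have h : par₂ k j + par k = par j := by
    simp only [par₂]
    generalize par k = a2; generalize par j = a3
    revert a2 a3; decide
  rw [h]
  rfl

/-- By `SMod.lam_eq` and `Uq.antipodeEquiv_symm_uu`, both λ_kj and S⁻¹(u_kj) are multiples of the
same entry of L⁻¹ by a ratio of weights, so only signs remain to be compared. -/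
lemma SMod.dualCrossInv_formula (M : SMod q n) :
    M.dualCrossInv = M.flip (SMod.fund q n).dual ∘ₗ
      M.LDual (fun i j => (Uq.antipodeEquiv q n).symm (uu q i j)) := by
  refine SMod.ext_tensor_dual fun m k => ?_
  rw [LinearMap.comp_apply, M.LDual_apply, M.dualCrossInv_apply, map_sum]
  refine Finset.sum_congr rfl fun j _ => ?_
  rw [map_smul, SMod.flip_right _ _ (vd_mem j), ← TensorProduct.tmul_smul, M.lam_eq]
  congr 1
  have hS := Uq.antipodeEquiv_symm_uu (q := q) k j
  -- Below the diagonal both sides vanish; on and above it the quadratic sign exponent p(k) p(k,j)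
  -- simplifies to p(k,j).
  by_cases hkj : j < k
  · rw [M.kap_lower hkj, hS, Linv_lower hkj]
    simp
  have h1 : ∀ p, ipow M.sgn p * M.ρ (Linv q n k j) =
      (sg (p * par₂ k j) : K) • (M.ρ (Linv q n k j) * ipow M.sgn p) := by
    intro p
    have := M.sgn_rho (Linv q n k j)
    rw [sigma_Linv, map_smul, smul_mul_assoc] at this
    exact (ipow_comm this p)
  have h2 : par j + par₂ k j = par k := by
    simp only [par₂]
    generalize par k = a2; generalize par j = a3
    revert a2 a3; decide
  have h3 : M.ρ (Linv q n k j) (ipow M.sgn (par₂ k j) m) =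
      (sg (par₂ k j * par₂ k j) : K) • ipow M.sgn (par₂ k j) (M.ρ (Linv q n k j) m) := by
    have := LinearMap.congr_fun (h1 (par₂ k j)) m
    rw [LinearMap.smul_apply, Module.End.mul_apply, Module.End.mul_apply] at this
    rw [this, smul_smul, sgK_mul_self, one_smul]
  have h4 : M.ρ ((Uq.antipodeEquiv q n).symm (uu q k j)) (ipow M.sgn (par₂ k j) m) =
      ((wtAbs q j / wtAbs q k) * (sg (par₂ k j * par₂ k j) : K)) •
        ipow M.sgn (par₂ k j) (M.ρ (Linv q n k j) m) := by
    rw [hS, map_smul, LinearMap.smul_apply, h3, smul_smul]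
  rw [h4, map_smul, ← Module.End.mul_apply (ipow M.sgn (par j)), ipow_add M.sgn_sgn, h2, SMod.kap,
    LinearMap.smul_apply, LinearMap.smul_apply, smul_smul, smul_smul, mul_comm (par₂ k j) (par k),
    par_mul_par₂ (not_lt.1 hkj)]
  rw [← Module.End.mul_apply]
  congr 1
  have h5 : ∀ a b : ZMod 2, (a + b) * (a + b) = a + b := by decide
  have h6 : (sg (par j) : K) = sg (par₂ k j) * sg (par k) := by
    rw [← sgK_add]
    congr 2
    simp only [par₂]
    generalize par k = a2; generalize par j = a3
    revert a2 a3; decide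
  -- Dividing by the weight of k in `wtAbs`, which is taken at q⁻¹, produces the weight at q that
  -- occurs in λ.
  have h7 : (wt q⁻¹ k)⁻¹ = wt q k := inv_eq_of_mul_eq_one_left (wt_inv q k)
  rw [show par₂ k j * par₂ k j = par₂ k j from h5 _ _, wtAbs, wtAbs, h6, div_eq_mul_inv, mul_inv,
    h7]
  have h8 : (sg (par k) : K) * (sg (par k) : K)⁻¹ = 1 := mul_inv_cancel₀ (sgK_ne_zero _)
  have h9 := sgK_mul_self (K := K) (par₂ k j)
  linear_combination -
    (wt q⁻¹ j * wt q k * sg (par₂ k j) * sg (par₂ k j) * sg (par₂ k j) : K) * h8 -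
    (wt q⁻¹ j * wt q k * sg (par₂ k j) : K) * h9

end DualFormulas

/-! ### Coherence of the canonical isomorphisms between words -/

section Joins

variable {K : Type} [Field K] [CharZero K] {q : Kˣ} {n : ℕ} {O : Type} (lab : O → SMod q n)

/-- The identification of the supermodules of two equal words. -/
def castE : ∀ {A B : List O}, A = B → (tens lab A).carrier ≃ₗ[K] (tens lab B).carrier
  | _, _, rfl => LinearEquiv.refl K _

lemma castE_rfl {A : List O} (h : A = A) : castE lab h = LinearEquiv.refl K _ := rfl

lemma castE_castE {A B C : List O} (h : A = B) (h' : B = C) (x : (tens lab A).carrier) :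
    castE lab h' (castE lab h x) = castE lab (h.trans h') x := by
  subst h h'; rfl

/-- Equal words give different types, so inductions over words must push the identification into the
tail. -/
lemma castE_cons {o a b : O} {A B : List O} (h : o :: a :: A = o :: b :: B) (h' : a :: A = b :: B)
    (x : (lab o).carrier) (y : (tens lab (a :: A)).carrier) :
    castE lab h (x ⊗ₜ[K] y : (lab o).carrier ⊗[K] (tens lab (a :: A)).carrier) =
      (x ⊗ₜ[K] castE lab h' y : (lab o).carrier ⊗[K] (tens lab (b :: B)).carrier) := by
  obtain ⟨rfl, rfl⟩ : a = b ∧ A = B := by simpa using h'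
  rfl

/-- The canonical isomorphism of the tensor product of two words with their concatenation, as a
homomorphism of supermodules. -/
def SHom.join : ∀ X Y : List O, SHom 0 ((tens lab X).tensor (tens lab Y)) (tens lab (X ++ Y))
  | [], Y => SHom.lid _
  | [_], [] => SHom.rid _
  | [_], _ :: _ => SHom.one _
  | o :: o' :: X, Y => SHom.comp (add_zero 0)
      (SHom.tensor (add_zero 0) (SHom.one (lab o)) (SHom.join (o' :: X) Y)) (SHom.assoc _ _ _)

lemma SHom.join_coe : ∀ X Y : List O, (SHom.join lab X Y).1 = (tensEquiv lab X Y).toLinearMap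
  | [], _ => rfl
  | [_], [] => rfl
  | [_], _ :: _ => rfl
  | o :: o' :: X, Y => by
    have h := SHom.join_coe (o' :: X) Y
    rw [SHom.join]
    change (SHom.tensor (add_zero 0) (SHom.one (lab o)) (SHom.join lab (o' :: X) Y)).1 ∘ₗ _ = _
    rw [SHom.tensor_coe, h]
    rfl

/-- The canonical isomorphism of the tensor product of two words with a word equal to their
concatenation. -/
def joinE {A X Y : List O} (h : A = X ++ Y) :
    ((tens lab X).tensor (tens lab Y)).carrier ≃ₗ[K] (tens lab A).carrier :=
  (tensEquiv lab X Y).trans (castE lab h.symm)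

/-- The isomorphism `joinE` as a homomorphism of supermodules. -/
def SHom.joinTo : ∀ {A X Y : List O}, A = X ++ Y →
    SHom 0 ((tens lab X).tensor (tens lab Y)) (tens lab A)
  | _, X, Y, rfl => SHom.join lab X Y

lemma SHom.joinTo_coe {A X Y : List O} (h : A = X ++ Y) :
    (SHom.joinTo lab h).1 = (joinE lab h).toLinearMap := by
  subst h; exact SHom.join_coe lab X Y

/-- The inverse of `joinE` as a homomorphism of supermodules. -/
def SHom.split {A X Y : List O} (h : A = X ++ Y) :
    SHom 0 (tens lab A) ((tens lab X).tensor (tens lab Y)) :=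
  SHom.symmOf (joinE lab h) (SHom.joinTo lab h) (SHom.joinTo_coe lab h)

lemma tens_cons_ext {o o' : O} {X : List O} {P : Type} [AddCommGroup P] [Module K P]
    {f g : (tens lab (o :: o' :: X)).carrier →ₗ[K] P}
    (h : ∀ (y : (lab o).carrier) (w : (tens lab (o' :: X)).carrier),
      f (y ⊗ₜ[K] w : (lab o).carrier ⊗[K] (tens lab (o' :: X)).carrier) =
        g (y ⊗ₜ[K] w : (lab o).carrier ⊗[K] (tens lab (o' :: X)).carrier)) : f = g :=
  TensorProduct.ext' h

lemma castE_tensEquiv_nil : ∀ (X : List O) (h : X ++ [] = X) (x : (tens lab X).carrier) (c : K),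
    castE lab h (tensEquiv lab X [] (x ⊗ₜ[K] c)) = c • x
  -- For two empty words the canonical map is the left unit isomorphism, so commutativity of K is
  -- used here.
  | [], h, x, c => (TensorProduct.lid_tmul (R := K) (M := K) c x).trans (mul_comm _ _)
  | [o], h, x, c => TensorProduct.rid_tmul _ _
  | o :: o' :: X, h, x, c => by
    have ih := castE_tensEquiv_nil (o' :: X) (List.append_nil _)
    refine LinearMap.congr_fun (f := (castE lab h).toLinearMap ∘ₗ
      (tensEquiv lab (o :: o' :: X) []).toLinearMap ∘ₗ
        (TensorProduct.mk K (tens lab (o :: o' :: X)).carrier K).flip c)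
      (g := c • LinearMap.id) (tens_cons_ext lab fun y w => ?_) x
    refine (castE_cons lab h (List.append_nil (o' :: X)) y
      (tensEquiv lab (o' :: X) [] (w ⊗ₜ[K] c))).trans ?_
    rw [ih]
    exact TensorProduct.tmul_smul _ _ _

lemma joinE_nil_right {X : List O} (h : X = X ++ []) :
    joinE lab h = TensorProduct.rid K (tens lab X).carrier := by
  refine LinearEquiv.toLinearMap_injective (TensorProduct.ext' fun x c => ?_)
  exact (castE_tensEquiv_nil lab X h.symm x c).trans (TensorProduct.rid_tmul _ _).symm

/-- Words are bracketed to the right, so the induction on X peels off its first letter. The short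
cases are separate because a one-letter word carries no unit factor. -/
lemma castE_tensEquiv_assoc : ∀ (X Y Z : List O) (h : (X ++ Y) ++ Z = X ++ (Y ++ Z))
    (x : (tens lab X).carrier) (y : (tens lab Y).carrier) (z : (tens lab Z).carrier),
    castE lab h (tensEquiv lab (X ++ Y) Z (tensEquiv lab X Y (x ⊗ₜ[K] y) ⊗ₜ[K] z)) =
      tensEquiv lab X (Y ++ Z) (x ⊗ₜ[K] tensEquiv lab Y Z (y ⊗ₜ[K] z))
  | [], Y, Z, h, x, y, z => by
    have h1 : tensEquiv lab [] Y (x ⊗ₜ[K] y) = (show K from x) • y := TensorProduct.lid_tmul _ _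
    have h2 : tensEquiv lab [] (Y ++ Z) (x ⊗ₜ[K] tensEquiv lab Y Z (y ⊗ₜ[K] z)) =
      (show K from x) • tensEquiv lab Y Z (y ⊗ₜ[K] z) := TensorProduct.lid_tmul _ _
    rw [h1, h2, ← TensorProduct.smul_tmul', map_smul, map_smul]
    rfl
  -- This is the triangle identity, comparing the right unit isomorphism on the letter with the left
  -- one on Z.
  | [o], [], Z, h, x, y, z => by
    refine congrArg (tensEquiv lab [o] Z) (Eq.trans (b := (show K from y) • x ⊗ₜ[K] z) ?_ ?_)
    · exact congrArg (fun w : (tens lab [o]).carrier => w ⊗ₜ[K] z)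
        (TensorProduct.rid_tmul (R := K) (M := (lab o).carrier) x y)
    · refine (TensorProduct.smul_tmul (show K from y) x z).trans ?_
      exact congrArg (fun w : (tens lab Z).carrier => x ⊗ₜ[K] w)
        (TensorProduct.lid_tmul (R := K) (M := (tens lab Z).carrier) z y).symm
  | [o], a :: Y, Z, h, x, y, z => rfl
  | o :: o' :: X, Y, Z, h, x, y, z => by
    have h' : (o' :: X ++ Y) ++ Z = o' :: X ++ (Y ++ Z) := List.append_assoc _ _ _
    have ih := castE_tensEquiv_assoc (o' :: X) Y Z h'
    refine LinearMap.congr_fun (f := (castE lab h).toLinearMap ∘ₗ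
      (tensEquiv lab (o :: o' :: X ++ Y) Z).toLinearMap ∘ₗ
        (TensorProduct.mk K _ (tens lab Z).carrier).flip z ∘ₗ
          (tensEquiv lab (o :: o' :: X) Y).toLinearMap ∘ₗ
            (TensorProduct.mk K (tens lab (o :: o' :: X)).carrier (tens lab Y).carrier).flip y)
      (g := (tensEquiv lab (o :: o' :: X) (Y ++ Z)).toLinearMap ∘ₗ
        (TensorProduct.mk K (tens lab (o :: o' :: X)).carrier (tens lab (Y ++ Z)).carrier).flip
          (tensEquiv lab Y Z (y ⊗ₜ[K] z))) (tens_cons_ext lab fun v w => ?_) x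
    refine (castE_cons lab h h' v (tensEquiv lab (o' :: X ++ Y) Z
      (tensEquiv lab (o' :: X) Y (w ⊗ₜ[K] y) ⊗ₜ[K] z))).trans ?_
    rw [ih]
    rfl

/-- Coherence of the canonical isomorphisms. -/
lemma joinE_assoc {X Y Z A B C : List O} (hA : A = X ++ Y) (hB : B = Y ++ Z) (hC : C = A ++ Z)
    (hC' : C = X ++ B) (x : (tens lab X).carrier) (y : (tens lab Y).carrier)
    (z : (tens lab Z).carrier) :
    joinE lab hC (joinE lab hA (x ⊗ₜ[K] y) ⊗ₜ[K] z) =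
      joinE lab hC' (x ⊗ₜ[K] joinE lab hB (y ⊗ₜ[K] z)) := by
  subst hA hB hC
  have h := castE_tensEquiv_assoc lab X Y Z hC' x y z
  have h2 := congrArg (castE lab hC'.symm) h
  rw [castE_castE, castE_rfl] at h2
  exact h2

end Joins

/-! ### Evaluation of formal expressions as homomorphisms -/

section Eval

variable {K : Type} [Field K] [CharZero K] {q : Kˣ} {n : ℕ}

/-- The super interchange law. -/
lemma SHom.interchange {p p' r r' a b c d t : ZMod 2} {L M N L' M' N' : SMod q n} (h₁ : p' + r = a)
    (h₂ : p + r' = b) (h₃ : a + b = t) (h₄ : p' + p = c) (h₅ : r + r' = d) (h₆ : c + d = t)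
    (f' : SHom p' M N) (f : SHom p L M) (g : SHom r M' N') (g' : SHom r' L' M') :
    SHom.comp h₃ (SHom.tensor h₁ f' g) (SHom.tensor h₂ f g') =
      (sg (p * r) : K) • SHom.tensor h₆ (SHom.comp h₄ f' f) (SHom.comp h₅ g g') := by
  refine Subtype.ext ?_
  rw [Submodule.coe_smul]
  change (SHom.tensor h₁ f' g).1 ∘ₗ (SHom.tensor h₂ f g').1 = _
  rw [SHom.tensor_coe, SHom.tensor_coe, SHom.tensor_coe, ← TensorProduct.map_comp,
    ← TensorProduct.map_smul_left]
  refine congrArg₂ TensorProduct.map ?_ rfl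
  refine LinearMap.ext fun m => ?_
  change f'.1 (ipow M.sgn r (f.1 (ipow L.sgn r' m))) = (sg (p * r) : K) • f'.1 (f.1 (ipow L.sgn d m))
  have h : ipow L.sgn d m = ipow L.sgn r (ipow L.sgn r' m) := by
    rw [← Module.End.mul_apply, ipow_add L.sgn_sgn, h₅]
  rw [h, ← map_smul, SHom.map_ipow_sgn f r (ipow L.sgn r' m), smul_smul, sgK_mul_self, one_smul]

variable {S : Sig} {lab : S.O → SMod q n}
  (gens : ∀ g : S.G, SHom (S.par g) (tens lab (S.dom g)) (tens lab (S.cod g)))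

/-- The tensor product of morphisms between words. -/
def SHom.tensorTo {O : Type} (lab : O → SMod q n) {p r s : ZMod 2} {X Y X' Y' A B : List O}
    (h : p + r = s) (hA : A = X ++ X') (hB : B = Y ++ Y') (f : SHom p (tens lab X) (tens lab Y))
    (g : SHom r (tens lab X') (tens lab Y')) : SHom s (tens lab A) (tens lab B) :=
  SHom.comp (zero_add s) (SHom.joinTo lab hB)
    (SHom.comp (add_zero s) (SHom.tensor h f g) (SHom.split lab hA))

lemma SHom.tensorTo_coe {O : Type} (lab : O → SMod q n) {p r s : ZMod 2} {X Y X' Y' A B : List O}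
    (h : p + r = s) (hA : A = X ++ X') (hB : B = Y ++ Y') (f : SHom p (tens lab X) (tens lab Y))
    (g : SHom r (tens lab X') (tens lab Y')) : (SHom.tensorTo lab h hA hB f g).1 =
      (joinE lab hB).toLinearMap ∘ₗ (SHom.tensor h f g).1 ∘ₗ (joinE lab hA).symm.toLinearMap := by
  rw [← SHom.joinTo_coe]; rfl

/-- Identities for tensor products of morphisms between words are tested on joined pure tensors,
where the only sign is that of g passing m. -/
lemma SHom.tensorTo_join {O : Type} (lab : O → SMod q n) {p r s : ZMod 2} {X Y X' Y' A B : List O}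
    (h : p + r = s) (hA : A = X ++ X') (hB : B = Y ++ Y') (f : SHom p (tens lab X) (tens lab Y))
    (g : SHom r (tens lab X') (tens lab Y')) (m : (tens lab X).carrier) (v : (tens lab X').carrier) :
    (SHom.tensorTo lab h hA hB f g).1 (joinE lab hA (m ⊗ₜ[K] v)) =
      joinE lab hB (f.1 (ipow (tens lab X).sgn r m) ⊗ₜ[K] g.1 v) := by
  rw [SHom.tensorTo_coe, LinearMap.comp_apply, LinearMap.comp_apply, LinearEquiv.coe_coe,
    LinearEquiv.coe_coe, LinearEquiv.symm_apply_apply]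
  rfl

lemma joinE_ext {O : Type} (lab : O → SMod q n) {A X Y : List O} (hA : A = X ++ Y) {P : Type}
    [AddCommGroup P] [Module K P] {f g : (tens lab A).carrier →ₗ[K] P}
    (h : ∀ x y, f (joinE lab hA (x ⊗ₜ[K] y)) = g (joinE lab hA (x ⊗ₜ[K] y))) : f = g := by
  have h1 : f ∘ₗ (joinE lab hA).toLinearMap = g ∘ₗ (joinE lab hA).toLinearMap :=
    TensorProduct.ext' h
  refine LinearMap.ext fun m => ?_
  obtain ⟨x, rfl⟩ := (joinE lab hA).surjective m
  exact LinearMap.congr_fun h1 x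

lemma joinE_sgn {O : Type} (lab : O → SMod q n) {A X Y : List O} (hA : A = X ++ Y) (p : ZMod 2)
    (x : (tens lab X).carrier) (y : (tens lab Y).carrier) :
    ipow (tens lab A).sgn p (joinE lab hA (x ⊗ₜ[K] y)) =
      joinE lab hA (ipow (tens lab X).sgn p x ⊗ₜ[K] ipow (tens lab Y).sgn p y) := by
  rcases zmod2_cases p with rfl | rfl
  · rfl
  · have h := SHom.map_sgn_even (SHom.joinTo lab hA) (x ⊗ₜ[K] y)
    rw [SHom.joinTo_coe, SMod.tensor_sgn] at h
    exact h.symm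

/-- The value of an expression, for given values of the generators. -/
def SHom.eval : ∀ {p : ZMod 2} {X Y : List S.O}, Term K S p X Y → SHom p (tens lab X) (tens lab Y)
  | _, _, _, .id X => SHom.one (tens lab X)
  | _, _, _, .gen g => gens g
  | _, _, _, .comp h f g => SHom.comp h (SHom.eval f) (SHom.eval g)
  | _, _, _, .tensor h hA hB f g => SHom.tensorTo lab h hA hB (SHom.eval f) (SHom.eval g)
  | _, _, _, .zero => 0
  | _, _, _, .add f g => SHom.eval f + SHom.eval g
  | _, _, _, .smul c f => c • SHom.eval f

/-- Coherence of the joins moves the brackets, and the signs agree because powers of the involution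
add: the last two morphisms pass the first factor together or one after the other. -/
lemma SHom.tensorTo_assoc {O : Type} (lab : O → SMod q n) {p r s a b t : ZMod 2}
    {X Y X' Y' X'' Y'' A B A' B' C D : List O} (h₁ : p + r = a) (h₂ : a + s = t) (h₃ : r + s = b)
    (h₄ : p + b = t) (hA : A = X ++ X') (hB : B = Y ++ Y') (hA' : A' = X' ++ X'')
    (hB' : B' = Y' ++ Y'') (hC : C = A ++ X'') (hD : D = B ++ Y'') (hC' : C = X ++ A')
    (hD' : D = Y ++ B') (f : SHom p (tens lab X) (tens lab Y))
    (g : SHom r (tens lab X') (tens lab Y')) (e : SHom s (tens lab X'') (tens lab Y'')) :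
    SHom.tensorTo lab h₂ hC hD (SHom.tensorTo lab h₁ hA hB f g) e =
      SHom.tensorTo lab h₄ hC' hD' f (SHom.tensorTo lab h₃ hA' hB' g e) := by
  refine Subtype.ext (joinE_ext lab hC fun u z => ?_)
  refine LinearMap.congr_fun (f := (SHom.tensorTo lab h₂ hC hD (SHom.tensorTo lab h₁ hA hB f g) e).1
    ∘ₗ (joinE lab hC).toLinearMap ∘ₗ (TensorProduct.mk K _ _).flip z)
    (g := (SHom.tensorTo lab h₄ hC' hD' f (SHom.tensorTo lab h₃ hA' hB' g e)).1 ∘ₗ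
      (joinE lab hC).toLinearMap ∘ₗ (TensorProduct.mk K _ _).flip z)
    (joinE_ext lab hA fun x y => ?_) u
  change (SHom.tensorTo lab h₂ hC hD (SHom.tensorTo lab h₁ hA hB f g) e).1
      (joinE lab hC (joinE lab hA (x ⊗ₜ[K] y) ⊗ₜ[K] z)) =
    (SHom.tensorTo lab h₄ hC' hD' f (SHom.tensorTo lab h₃ hA' hB' g e)).1
      (joinE lab hC (joinE lab hA (x ⊗ₜ[K] y) ⊗ₜ[K] z))
  rw [SHom.tensorTo_join, joinE_sgn, SHom.tensorTo_join, joinE_assoc lab hA hA' hC hC',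
    SHom.tensorTo_join, SHom.tensorTo_join, joinE_assoc lab hB hB' hD hD',
    ← Module.End.mul_apply (ipow (tens lab X).sgn r), ipow_add (tens lab X).sgn_sgn, h₃]

/-- The joining isomorphisms in the middle cancel, which reduces this to the interchange law for
tensor products of supermodules. -/
lemma SHom.tensorTo_interchange {O : Type} (lab : O → SMod q n) {p p' r r' a b c d t : ZMod 2}
    {X Y Z X' Y' Z' A B C : List O} (h₁ : p' + r = a) (h₂ : p + r' = b) (h₃ : a + b = t)
    (h₄ : p' + p = c) (h₅ : r + r' = d) (h₆ : c + d = t) (hA : A = X ++ X') (hB : B = Y ++ Y')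
    (hC : C = Z ++ Z') (f' : SHom p' (tens lab Y) (tens lab Z)) (f : SHom p (tens lab X) (tens lab Y))
    (g : SHom r (tens lab Y') (tens lab Z')) (g' : SHom r' (tens lab X') (tens lab Y')) :
    SHom.comp h₃ (SHom.tensorTo lab h₁ hB hC f' g) (SHom.tensorTo lab h₂ hA hB f g') =
      (sg (p * r) : K) • SHom.tensorTo lab h₆ hA hC (SHom.comp h₄ f' f) (SHom.comp h₅ g g') := by
  refine Subtype.ext (joinE_ext lab hA fun x y => ?_)
  have h := congrArg (fun F : SHom t _ _ => joinE lab hC (F.1 (x ⊗ₜ[K] y)))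
    (SHom.interchange h₁ h₂ h₃ h₄ h₅ h₆ f' f g g')
  change (SHom.tensorTo lab h₁ hB hC f' g).1 ((SHom.tensorTo lab h₂ hA hB f g').1
    (joinE lab hA (x ⊗ₜ[K] y))) = (sg (p * r) : K) • (SHom.tensorTo lab h₆ hA hC
      (SHom.comp h₄ f' f) (SHom.comp h₅ g g')).1 (joinE lab hA (x ⊗ₜ[K] y))
  rw [SHom.tensorTo_join, SHom.tensorTo_join, SHom.tensorTo_join, ← map_smul]
  exact h

lemma unit_ipow_sgn (p : ZMod 2) (m : K) : ipow (SMod.unit q n).sgn p m = m := by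
  rw [SMod.mk'_sgn]
  rcases zmod2_cases p with rfl | rfl <;> rfl

lemma SHom.one_tensorTo {O : Type} (lab : O → SMod q n) {p : ZMod 2} {X Y : List O} (h : 0 + p = p)
    (hX : X = [] ++ X) (hY : Y = [] ++ Y) (f : SHom p (tens lab X) (tens lab Y)) :
    SHom.tensorTo lab h hX hY (SHom.one (tens lab [])) f = f := by
  refine Subtype.ext (joinE_ext lab hX fun (c : K) x => ?_)
  refine (SHom.tensorTo_join lab h hX hY _ _ _ _).trans ((TensorProduct.lid_tmul _ _).trans ?_)
  have h1 : joinE lab hX (c ⊗ₜ[K] x) = c • x := TensorProduct.lid_tmul _ _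
  rw [h1, map_smul]
  exact congrArg (· • f.1 x) (unit_ipow_sgn p c)

lemma SHom.tensorTo_one {O : Type} (lab : O → SMod q n) {p : ZMod 2} {X Y : List O} (h : p + 0 = p)
    (hX : X = X ++ []) (hY : Y = Y ++ []) (f : SHom p (tens lab X) (tens lab Y)) :
    SHom.tensorTo lab h hX hY f (SHom.one (tens lab [])) = f := by
  refine Subtype.ext (joinE_ext lab hX fun x (c : K) => ?_)
  refine (SHom.tensorTo_join lab h hX hY _ _ _ _).trans ?_
  rw [joinE_nil_right, joinE_nil_right]
  refine (TensorProduct.rid_tmul _ _).trans ?_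
  have h1 : TensorProduct.rid K (tens lab X).carrier (x ⊗ₜ[K] c) = c • x :=
    TensorProduct.rid_tmul _ _
  exact (map_smul f.1 c x).symm.trans (congrArg f.1 h1.symm)

lemma SHom.add_mid {s : ZMod 2} {L M N P : SMod q n} (f : SHom 0 N P) (a b : SHom s M N)
    (g : SHom 0 L M) : SHom.comp (zero_add s) f (SHom.comp (add_zero s) (a + b) g) =
      SHom.comp (zero_add s) f (SHom.comp (add_zero s) a g) +
        SHom.comp (zero_add s) f (SHom.comp (add_zero s) b g) :=
  Subtype.ext (LinearMap.ext fun _ => map_add f.1 _ _)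

lemma SHom.smul_mid {s : ZMod 2} {L M N P : SMod q n} (f : SHom 0 N P) (c : K) (a : SHom s M N)
    (g : SHom 0 L M) : SHom.comp (zero_add s) f (SHom.comp (add_zero s) (c • a) g) =
      c • SHom.comp (zero_add s) f (SHom.comp (add_zero s) a g) :=
  Subtype.ext (LinearMap.ext fun _ => map_smul f.1 _ _)

/-- The values of congruent expressions agree if the relations hold. -/
lemma SHom.eval_cong {R : Relations K S}
    (hR : ∀ {p : ZMod 2} {X Y : List S.O} {f g : Term K S p X Y}, R p X Y f g →
      SHom.eval gens f = SHom.eval gens g)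
    {p : ZMod 2} {X Y : List S.O} {f g : Term K S p X Y} (h : Cong R f g) :
    SHom.eval gens f = SHom.eval gens g := by
  induction h with
  | of h => exact hR h
  | refl f => rfl
  | symm _ ih => exact ih.symm
  | trans _ _ ih ih' => exact ih.trans ih'
  | comp_congr h _ _ ih ih' => rw [SHom.eval, SHom.eval, ih, ih']
  | tensor_congr h hA hB _ _ ih ih' => rw [SHom.eval, SHom.eval, ih, ih']
  | add_congr _ _ ih ih' => rw [SHom.eval, SHom.eval, ih, ih']
  | smul_congr c _ ih => rw [SHom.eval, SHom.eval, ih]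
  | add_assoc f g e => exact add_assoc (SHom.eval gens f) (SHom.eval gens g) (SHom.eval gens e)
  | add_comm f g => exact add_comm (SHom.eval gens f) (SHom.eval gens g)
  | zero_add f => exact zero_add (SHom.eval gens f)
  | neg_add f =>
    refine (congrArg (· + SHom.eval gens f) (neg_one_smul K (SHom.eval gens f))).trans ?_
    exact neg_add_cancel (SHom.eval gens f)
  | smul_add c f g => exact smul_add c (SHom.eval gens f) (SHom.eval gens g)
  | add_smul c d f => exact add_smul c d (SHom.eval gens f)
  | mul_smul c d f => exact mul_smul c d (SHom.eval gens f)
  | one_smul f => exact one_smul K (SHom.eval gens f)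
  | zero_smul f => exact zero_smul K (SHom.eval gens f)
  | smul_zero c => exact smul_zero c
  | add_comp h f f' g => exact (UqCat q n).add_comp h _ _ _
  | comp_add h f g g' => exact (UqCat q n).comp_add h _ _ _
  | smul_comp h c f g => exact (UqCat q n).smul_comp h c _ _
  | comp_smul h c f g => exact (UqCat q n).comp_smul h c _ _
  | id_comp h f => exact (UqCat q n).id_comp h _
  | comp_id h f => exact (UqCat q n).comp_id h _
  | comp_assoc h₁ h₂ h₃ h₄ f g e => rfl
  | add_tensor h hA hB f f' g =>
    simp only [SHom.eval, SHom.tensorTo, SHom.add_tensor]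
    exact SHom.add_mid _ _ _ _
  | tensor_add h hA hB f g g' =>
    simp only [SHom.eval, SHom.tensorTo, SHom.tensor_add]
    exact SHom.add_mid _ _ _ _
  | smul_tensor h hA hB c f g =>
    simp only [SHom.eval, SHom.tensorTo, SHom.smul_tensor]
    exact SHom.smul_mid _ _ _ _
  | tensor_smul h hA hB c f g =>
    simp only [SHom.eval, SHom.tensorTo, SHom.tensor_smul]
    exact SHom.smul_mid _ _ _ _
  | id_tensor_id h hA =>
    refine Subtype.ext (joinE_ext lab hA fun x y => ?_)
    exact SHom.tensorTo_join lab h hA hA (SHom.one _) (SHom.one _) x y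
  | one_tensor h hX hY f => exact SHom.one_tensorTo lab h hX hY _
  | tensor_one h hX hY f => exact SHom.tensorTo_one lab h hX hY _
  | tensor_assoc h₁ h₂ h₃ h₄ hA hB hA' hB' hC hD hC' hD' f g e =>
    exact SHom.tensorTo_assoc lab h₁ h₂ h₃ h₄ hA hB hA' hB' hC hD hC' hD' _ _ _
  | interchange h₁ h₂ h₃ h₄ h₅ h₆ hA hB hC f' f g g' =>
    exact SHom.tensorTo_interchange lab h₁ h₂ h₃ h₄ h₅ h₆ hA hB hC _ _ _ _

end Eval

/-! ### Monoidal superfunctors from values on generators -/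

section OfGens

variable {K : Type} [Field K] [CharZero K] {q : Kˣ} {n : ℕ}

/-- The monoidal superfunctor determined by values of the generators satisfying the relations. -/
def MonFun.ofGens (P : Presentation K) (lab : P.S.O → SMod q n)
    (gens : ∀ g : P.S.G, SHom (P.S.par g) (tens lab (P.S.dom g)) (tens lab (P.S.cod g)))
    (hR : ∀ {p : ZMod 2} {X Y : List P.S.O} {f g : Term K P.S p X Y}, P.R p X Y f g →
      SHom.eval gens f = SHom.eval gens g) : MonFun P lab where
  map p X Y :=
    { toFun := Quotient.lift (SHom.eval gens) fun _ _ h => SHom.eval_cong gens hR h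
      map_add' := P.ind fun f => P.ind fun g => rfl
      map_smul' := fun c => P.ind fun f => rfl }
  map_id X := rfl
  map_comp h := P.ind fun f => P.ind fun g => rfl
  map_tensor h := P.ind fun f => P.ind fun g => by
    refine TensorProduct.ext' fun x y => ?_
    exact SHom.tensorTo_join lab h rfl rfl (SHom.eval gens f) (SHom.eval gens g) x y

/-- A monoidal superfunctor is given on expressions by its values on the generators. -/
lemma MonFun.map_cls {P : Presentation K} {lab : P.S.O → SMod q n} (F : MonFun P lab)
    {p : ZMod 2} {X Y : List P.S.O} (f : Term K P.S p X Y) :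
    F.map p X Y (P.cls f) = SHom.eval (fun g => F.map _ _ _ (P.cls (.gen g))) f := by
  induction f with
  | id X => exact F.map_id X
  | gen g => rfl
  | comp h f g hf hg =>
    refine (F.map_comp h (P.cls f) (P.cls g)).trans ?_
    rw [hf, hg]; rfl
  | tensor h hA hB f g hf hg =>
    subst hA hB
    refine Subtype.ext (joinE_ext lab rfl fun x y => ?_)
    refine (LinearMap.congr_fun (F.map_tensor h (P.cls f) (P.cls g)) (x ⊗ₜ[K] y)).trans ?_
    rw [hf, hg]
    exact (SHom.tensorTo_join lab h rfl rfl (SHom.eval _ f) (SHom.eval _ g) x y).symm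
  | zero => exact map_zero (F.map _ _ _)
  | add f g hf hg =>
    refine (map_add (F.map _ _ _) (P.cls f) (P.cls g)).trans ?_
    rw [hf, hg]; rfl
  | smul c f hf =>
    refine (map_smul (F.map _ _ _) c (P.cls f)).trans ?_
    rw [hf]; rfl

/-- All morphisms are classes of expressions, and compatibility with composition and tensor product
determines their values recursively. -/
lemma MonFun.ext_gens {P : Presentation K} {lab : P.S.O → SMod q n} {F G : MonFun P lab}
    (h : ∀ g, F.map _ _ _ (P.cls (.gen g)) = G.map _ _ _ (P.cls (.gen g))) : F = G := by
  have h' : (fun g => F.map _ _ _ (P.cls (.gen g))) = fun g => G.map _ _ _ (P.cls (.gen g)) :=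
    funext h
  refine MonFun.ext (funext fun p => funext fun X => funext fun Y => LinearMap.ext ?_)
  refine P.ind fun f => ?_
  rw [F.map_cls, G.map_cls, h']

end OfGens

/-! ### Explicit form of the composites occurring in the relations -/

section Words

variable {K : Type} [Field K] [CharZero K] {q : Kˣ} {n : ℕ}

/-- A map of the two left factors of a triple tensor product. -/
def onLeft {A B C D : Type} [AddCommGroup A] [Module K A] [AddCommGroup B] [Module K B]
    [AddCommGroup C] [Module K C] [AddCommGroup D] [Module K D] (E : Type) [AddCommGroup E]
    [Module K E] (f : A ⊗[K] B →ₗ[K] C ⊗[K] D) :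
    A ⊗[K] (B ⊗[K] E) →ₗ[K] C ⊗[K] (D ⊗[K] E) :=
  (TensorProduct.assoc K C D E).toLinearMap ∘ₗ TensorProduct.map f LinearMap.id ∘ₗ
    (TensorProduct.assoc K A B E).symm.toLinearMap

variable {O : Type} (lab : O → SMod q n)

lemma joinE_two {a b o : O} {X : List O} (h : a :: b :: o :: X = [a, b] ++ (o :: X)) :
    joinE lab h = TensorProduct.assoc K (lab a).carrier (lab b).carrier (tens lab (o :: X)).carrier :=
  LinearEquiv.toLinearMap_injective (TensorProduct.ext_threefold fun _ _ _ => rfl)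

lemma tensorTo_two_left {p : ZMod 2} {a b c d o : O} {X : List O} (h : p + 0 = p)
    (hA : a :: b :: o :: X = [a, b] ++ (o :: X)) (hB : c :: d :: o :: X = [c, d] ++ (o :: X))
    (f : SHom p (tens lab [a, b]) (tens lab [c, d])) :
    (SHom.tensorTo lab h hA hB f (SHom.one (tens lab (o :: X)))).1 =
      onLeft (tens lab (o :: X)).carrier f.1 := by
  rw [SHom.tensorTo_coe, joinE_two, joinE_two]
  rfl

lemma tensorTo_cap_left {a b o : O} {X : List O} (h : (0 : ZMod 2) + 0 = 0)
    (hA : a :: b :: o :: X = [a, b] ++ (o :: X)) (hB : o :: X = [] ++ (o :: X))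
    (f : SHom 0 (tens lab [a, b]) (tens lab [])) :
    (SHom.tensorTo lab h hA hB f (SHom.one (tens lab (o :: X)))).1 =
      (TensorProduct.lid K (tens lab (o :: X)).carrier).toLinearMap ∘ₗ
        TensorProduct.map f.1 LinearMap.id ∘ₗ (TensorProduct.assoc K (lab a).carrier
          (lab b).carrier (tens lab (o :: X)).carrier).symm.toLinearMap := by
  rw [SHom.tensorTo_coe, joinE_two]
  rfl

/-- A morphism out of the unit is known by its value at 1, so x is first written as the join of 1
and x. -/
lemma tensorTo_cup_left {a b o : O} {X : List O} (h : (0 : ZMod 2) + 0 = 0)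
    (hA : o :: X = [] ++ (o :: X)) (hB : a :: b :: o :: X = [a, b] ++ (o :: X))
    (f : SHom 0 (tens lab []) (tens lab [a, b])) (x : (tens lab (o :: X)).carrier) :
    (SHom.tensorTo lab h hA hB f (SHom.one (tens lab (o :: X)))).1 x =
      TensorProduct.assoc K (lab a).carrier (lab b).carrier (tens lab (o :: X)).carrier
        (f.1 (1 : K) ⊗ₜ[K] x) := by
  have h1 : x = joinE lab hA ((1 : K) ⊗ₜ[K] x) :=
    ((TensorProduct.lid_tmul _ _).trans (one_smul K x)).symm
  conv_lhs => rw [h1]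
  refine (SHom.tensorTo_join lab h hA hB _ _ _ _).trans ?_
  rw [joinE_two]
  rfl

lemma tensorTo_single {p r s : ZMod 2} {a b c d : O} {X Y : List O} (h : p + r = s)
    (hA : a :: b :: X = [a] ++ (b :: X)) (hB : c :: d :: Y = [c] ++ (d :: Y))
    (f : SHom p (tens lab [a]) (tens lab [c])) (g : SHom r (tens lab (b :: X)) (tens lab (d :: Y))) :
    (SHom.tensorTo lab h hA hB f g).1 = (SHom.tensor h f g).1 := by
  rw [SHom.tensorTo_coe]
  rfl

lemma tensorTo_single_right {a b d : O} {X Y : List O} (h : (0 : ZMod 2) + 0 = 0)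
    (hA : a :: b :: X = [a] ++ (b :: X)) (hB : a :: d :: Y = [a] ++ (d :: Y))
    (g : SHom 0 (tens lab (b :: X)) (tens lab (d :: Y))) :
    (SHom.tensorTo lab h hA hB (SHom.one (tens lab [a])) g).1 =
      TensorProduct.map LinearMap.id g.1 := by
  rw [tensorTo_single]
  rfl

lemma tensorTo_single_cap {a b c : O} (h : (0 : ZMod 2) + 0 = 0)
    (hA : [a, b, c] = [a] ++ [b, c]) (hB : [a] = [a] ++ [])
    (g : SHom 0 (tens lab [b, c]) (tens lab [])) :
    (SHom.tensorTo lab h hA hB (SHom.one (tens lab [a])) g).1 =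
      (TensorProduct.rid K (lab a).carrier).toLinearMap ∘ₗ TensorProduct.map LinearMap.id g.1 := by
  rw [SHom.tensorTo_coe]
  rfl

lemma tensorTo_single_cup {a b c : O} (h : (0 : ZMod 2) + 0 = 0)
    (hA : [a] = [a] ++ []) (hB : [a, b, c] = [a] ++ [b, c])
    (g : SHom 0 (tens lab []) (tens lab [b, c])) (x : (lab a).carrier) :
    (SHom.tensorTo lab h hA hB (SHom.one (tens lab [a])) g).1 x = x ⊗ₜ[K] g.1 (1 : K) := by
  have h1 : x = joinE lab hA (x ⊗ₜ[K] (1 : K)) :=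
    ((TensorProduct.rid_tmul _ _).trans (one_smul K x)).symm
  conv_lhs => rw [h1]
  exact SHom.tensorTo_join lab h hA hB _ _ _ _

lemma tensorTo_two_cup {a b c d : O} (h : (0 : ZMod 2) + 0 = 0)
    (hA : [a, b] = [a, b] ++ []) (hB : [a, b, c, d] = [a, b] ++ [c, d])
    (g : SHom 0 (tens lab []) (tens lab [c, d])) (x : (lab a).carrier) (y : (lab b).carrier) :
    (SHom.tensorTo lab h hA hB (SHom.one (tens lab [a, b])) g).1
      (x ⊗ₜ[K] y : (lab a).carrier ⊗[K] (lab b).carrier) =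
        x ⊗ₜ[K] (y ⊗ₜ[K] g.1 (1 : K) : (lab b).carrier ⊗[K] (tens lab [c, d]).carrier) := by
  have h1 : ∀ w : (tens lab [a, b]).carrier, w = joinE lab hA (w ⊗ₜ[K] (1 : K)) := by
    intro w
    rw [joinE_nil_right]
    exact ((TensorProduct.rid_tmul _ _).trans (one_smul K _)).symm
  refine (congrArg _ (h1 _)).trans ?_
  exact SHom.tensorTo_join lab h hA hB _ _ _ _

lemma tensorTo_two_cap {a b c d : O} (h : (0 : ZMod 2) + 0 = 0)
    (hA : [a, b, c, d] = [a, b] ++ [c, d]) (hB : [a, b] = [a, b] ++ [])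
    (g : SHom 0 (tens lab [c, d]) (tens lab [])) :
    (SHom.tensorTo lab h hA hB (SHom.one (tens lab [a, b])) g).1 =
      TensorProduct.map LinearMap.id ((TensorProduct.rid K (lab b).carrier).toLinearMap ∘ₗ
        TensorProduct.map LinearMap.id g.1) := by
  rw [SHom.tensorTo_coe, joinE_two, joinE_nil_right]
  refine TensorProduct.ext' fun x w => ?_
  refine LinearMap.congr_fun (f := ((TensorProduct.rid K (tens lab [a, b]).carrier).toLinearMap ∘ₗ
    (SHom.tensor h (SHom.one (tens lab [a, b])) g).1 ∘ₗ (TensorProduct.assoc K (lab a).carrier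
      (lab b).carrier (tens lab [c, d]).carrier).symm.toLinearMap) ∘ₗ TensorProduct.mk K _ _ x)
    (g := (TensorProduct.map LinearMap.id ((TensorProduct.rid K (lab b).carrier).toLinearMap ∘ₗ
        TensorProduct.map LinearMap.id g.1)) ∘ₗ TensorProduct.mk K _ _ x)
        (TensorProduct.ext' fun y v => ?_) w
  refine Eq.trans (b := (show K from g.1 v) • (show (tens lab [a, b]).carrier from
    (x ⊗ₜ[K] y : (lab a).carrier ⊗[K] (lab b).carrier))) ?_ ?_
  · exact TensorProduct.rid_tmul (R := K) (M := (tens lab [a, b]).carrier)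
      (x ⊗ₜ[K] y : (lab a).carrier ⊗[K] (lab b).carrier) (g.1 v)
  · refine Eq.trans ?_ (congrArg (fun u : (lab b).carrier => x ⊗ₜ[K] u)
      (TensorProduct.rid_tmul (R := K) (M := (lab b).carrier) y (g.1 v)).symm)
    exact (TensorProduct.tmul_smul (R := K) (show K from g.1 v) x y).symm

lemma SHom.comp_coe {p r s : ZMod 2} {L M N : SMod q n} (h : p + r = s) (f : SHom p M N)
    (g : SHom r L M) : (SHom.comp h f g).1 = f.1 ∘ₗ g.1 := rfl

/-- The crossing obtained by rotating `t`. -/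
lemma rotate_left_word {r u d : O} (cap : SHom 0 (tens lab [d, u]) (tens lab []))
    (cup : SHom 0 (tens lab []) (tens lab [u, d])) (t : SHom 0 (tens lab [r, u]) (tens lab [u, r]))
    (f : (lab d).carrier) (m : (lab r).carrier) :
    (SHom.comp (add_zero 0) (SHom.tensorTo lab (A := [d, u, r, d]) (B := [r, d]) (add_zero 0) rfl rfl
        cap (SHom.one (tens lab [r, d])))
      (SHom.comp (add_zero 0) (SHom.tensorTo lab (A := [d, r, u, d]) (B := [d, u, r, d]) (add_zero 0)
        rfl rfl (SHom.one (tens lab [d])) (SHom.tensorTo lab (A := [r, u, d]) (B := [u, r, d])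
          (add_zero 0) rfl rfl t (SHom.one (tens lab [d]))))
        (SHom.tensorTo lab (A := [d, r]) (B := [d, r, u, d]) (add_zero 0) rfl rfl
          (SHom.one (tens lab [d, r])) cup))).1 (f ⊗ₜ[K] m : (lab d).carrier ⊗[K] (lab r).carrier) =
      TensorProduct.lid K ((lab r).carrier ⊗[K] (lab d).carrier) (TensorProduct.map cap.1
        LinearMap.id ((TensorProduct.assoc K (lab d).carrier (lab u).carrier
          ((lab r).carrier ⊗[K] (lab d).carrier)).symm (f ⊗ₜ[K] onLeft (lab d).carrier t.1
            (m ⊗ₜ[K] cup.1 (1 : K))))) := by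
  rw [SHom.comp_coe, SHom.comp_coe, tensorTo_cap_left, tensorTo_single_right, tensorTo_two_left]
  exact congrArg (fun z : (lab d).carrier ⊗[K] (tens lab [r, u, d]).carrier =>
    TensorProduct.lid K ((lab r).carrier ⊗[K] (lab d).carrier) (TensorProduct.map cap.1
      LinearMap.id ((TensorProduct.assoc K (lab d).carrier (lab u).carrier
        ((lab r).carrier ⊗[K] (lab d).carrier)).symm (TensorProduct.map LinearMap.id
          (onLeft (lab d).carrier t.1) z)))) (tensorTo_two_cup lab (add_zero 0) rfl rfl cup f m)

/-- The crossing obtained by rotating `t` in the other direction. -/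
lemma rotate_right_word {r u d : O} (cap : SHom 0 (tens lab [u, d]) (tens lab []))
    (cup : SHom 0 (tens lab []) (tens lab [d, u])) (t : SHom 0 (tens lab [u, r]) (tens lab [r, u]))
    (w : (tens lab [r, d]).carrier) :
    (SHom.comp (add_zero 0) (SHom.tensorTo lab (A := [d, r, u, d]) (B := [d, r]) (add_zero 0) rfl rfl
        (SHom.one (tens lab [d, r])) cap)
      (SHom.comp (add_zero 0) (SHom.tensorTo lab (A := [d, u, r, d]) (B := [d, r, u, d]) (add_zero 0)
        rfl rfl (SHom.one (tens lab [d])) (SHom.tensorTo lab (A := [u, r, d]) (B := [r, u, d])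
          (add_zero 0) rfl rfl t (SHom.one (tens lab [d]))))
        (SHom.tensorTo lab (A := [r, d]) (B := [d, u, r, d]) (add_zero 0) rfl rfl cup
          (SHom.one (tens lab [r, d]))))).1 w =
      TensorProduct.map LinearMap.id ((TensorProduct.rid K (lab r).carrier).toLinearMap ∘ₗ
        TensorProduct.map LinearMap.id cap.1) (TensorProduct.map LinearMap.id
          (onLeft (lab d).carrier t.1) (TensorProduct.assoc K (lab d).carrier (lab u).carrier
            (tens lab [r, d]).carrier (cup.1 (1 : K) ⊗ₜ[K] w))) := by
  rw [SHom.comp_coe, SHom.comp_coe, tensorTo_two_cap, tensorTo_single_right, tensorTo_two_left]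
  exact congrArg _ (congrArg _ (tensorTo_cup_left lab _ _ _ cup w))

end Words

/-! ### The braid relation and the rotated inverse crossing -/

section Relations

variable {K : Type} [Field K] [CharZero K] {q : Kˣ} {n : ℕ}

/-- The braid relation for `T_{MV}`. -/
lemma SMod.braid (M : SMod q n) :
    onLeft M.carrier (SMod.fund q n).T ∘ₗ TensorProduct.map LinearMap.id M.T ∘ₗ
        onLeft (SMod.fund q n).carrier M.T =
      TensorProduct.map LinearMap.id M.T ∘ₗ onLeft (SMod.fund q n).carrier M.T ∘ₗ
        TensorProduct.map LinearMap.id (SMod.fund q n).T := by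
  have hT : ∀ i k : Idx n, (SMod.fund q n).T (vv q i ⊗ₜ[K] vv q k) =
      ∑ a, ∑ b, Tc q a b i k • (vv q a ⊗ₜ[K] vv q b) := by
    intro i k
    rw [← TV_eq, TV_vv]
  have hM : ∀ (P : Type) [AddCommGroup P] [Module K P] (m : M.carrier) (j : Idx n) (w : P),
      onLeft P M.T (m ⊗ₜ[K] (vv q j ⊗ₜ[K] w)) = ∑ i, vv q i ⊗ₜ[K] (M.tau i j m ⊗ₜ[K] w) := by
    intro P _ _ m j w
    change TensorProduct.assoc K _ _ _ (M.T (m ⊗ₜ[K] vv q j) ⊗ₜ[K] w) = _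
    rw [M.T_apply, TensorProduct.sum_tmul, map_sum]
    rfl
  have hV : ∀ (i k : Idx n) (w : M.carrier),
      onLeft M.carrier (SMod.fund q n).T (vv q i ⊗ₜ[K] (vv q k ⊗ₜ[K] w)) =
        ∑ a, ∑ b, Tc q a b i k • (vv q a ⊗ₜ[K] (vv q b ⊗ₜ[K] w)) := by
    intro i k w
    change TensorProduct.assoc K _ _ _ ((SMod.fund q n).T (vv q i ⊗ₜ[K] vv q k) ⊗ₜ[K] w) = _
    rw [hT, TensorProduct.sum_tmul, map_sum]
    refine Finset.sum_congr rfl fun a _ => ?_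
    rw [TensorProduct.sum_tmul, map_sum]
    refine Finset.sum_congr rfl fun b _ => ?_
    rw [← TensorProduct.smul_tmul', map_smul]
    rfl
  refine TensorProduct.ext' fun m w => ?_
  refine LinearMap.congr_fun (f := (onLeft M.carrier (SMod.fund q n).T ∘ₗ
    TensorProduct.map LinearMap.id M.T ∘ₗ onLeft (SMod.fund q n).carrier M.T) ∘ₗ
      TensorProduct.mk K _ _ m) (g := (TensorProduct.map LinearMap.id M.T ∘ₗ
        onLeft (SMod.fund q n).carrier M.T ∘ₗ TensorProduct.map LinearMap.id (SMod.fund q n).T) ∘ₗ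
          TensorProduct.mk K _ _ m) (fund_ext₂ fun j l => ?_) w
  change onLeft M.carrier (SMod.fund q n).T (TensorProduct.map LinearMap.id M.T
      (onLeft (SMod.fund q n).carrier M.T (m ⊗ₜ[K] (vv q j ⊗ₜ[K] vv q l)))) =
    TensorProduct.map LinearMap.id M.T (onLeft (SMod.fund q n).carrier M.T
      (m ⊗ₜ[K] (SMod.fund q n).T (vv q j ⊗ₜ[K] vv q l)))
  have hl : onLeft M.carrier (SMod.fund q n).T (TensorProduct.map LinearMap.id M.T
      (onLeft (SMod.fund q n).carrier M.T (m ⊗ₜ[K] (vv q j ⊗ₜ[K] vv q l)))) =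
      ∑ i, ∑ k, ∑ a, ∑ b, Tc q a b i k • (vv q a ⊗ₜ[K] (vv q b ⊗ₜ[K] (M.tau k l * M.tau i j) m)) := by
    rw [hM, map_sum, map_sum]
    refine Finset.sum_congr rfl fun i _ => ?_
    rw [TensorProduct.map_tmul, LinearMap.id_apply, M.T_apply, TensorProduct.tmul_sum, map_sum]
    exact Finset.sum_congr rfl fun k _ => hV _ _ _
  have hr : TensorProduct.map LinearMap.id M.T (onLeft (SMod.fund q n).carrier M.T
      (m ⊗ₜ[K] (SMod.fund q n).T (vv q j ⊗ₜ[K] vv q l))) =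
      ∑ i, ∑ k, ∑ a, ∑ b, Tc q i k j l • (vv q a ⊗ₜ[K] (vv q b ⊗ₜ[K] (M.tau b k * M.tau a i) m)) := by
    rw [hT, TensorProduct.tmul_sum, map_sum, map_sum]
    refine Finset.sum_congr rfl fun i _ => ?_
    rw [TensorProduct.tmul_sum, map_sum, map_sum]
    refine Finset.sum_congr rfl fun k _ => ?_
    rw [TensorProduct.tmul_smul, map_smul, map_smul, hM, map_sum, Finset.smul_sum]
    refine Finset.sum_congr rfl fun a _ => ?_
    rw [TensorProduct.map_tmul, M.T_apply, TensorProduct.tmul_sum, Finset.smul_sum]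
    rfl
  rw [hl, hr]
  -- With the sums over the outgoing indices a, b outermost, the factors in M are the two sides of
  -- the relation among the entries of τ.
  refine (sum_comm_four _).trans (Eq.trans ?_ (sum_comm_four _).symm)
  refine Finset.sum_congr rfl fun a _ => Finset.sum_congr rfl fun b _ => ?_
  have hs : ∀ (c : Idx n → Idx n → K) (A : Idx n → Idx n → Module.End K M.carrier),
      ∑ i, ∑ k, c i k • (vv q a ⊗ₜ[K] (vv q b ⊗ₜ[K] A i k m)) =
        vv q a ⊗ₜ[K] (vv q b ⊗ₜ[K] (∑ i, ∑ k, c i k • A i k) m) := by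
    intro c A
    rw [LinearMap.sum_apply, TensorProduct.tmul_sum, TensorProduct.tmul_sum]
    refine Finset.sum_congr rfl fun i _ => ?_
    rw [LinearMap.sum_apply, TensorProduct.tmul_sum, TensorProduct.tmul_sum]
    refine Finset.sum_congr rfl fun k _ => ?_
    rw [LinearMap.smul_apply, TensorProduct.tmul_smul, TensorProduct.tmul_smul]
  rw [hs (fun i k => Tc q a b i k) (fun i k => M.tau k l * M.tau i j),
    hs (fun i k => Tc q i k j l) (fun i k => M.tau b k * M.tau a i), M.frt]

/-- The rotation of `T_{MV}⁻¹` is the inverse of the rotation of `T_{MV}`. -/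
lemma SMod.rotate_right (M : SMod q n) (w : (M.tensor (SMod.fund q n).dual).carrier) :
    TensorProduct.map LinearMap.id ((TensorProduct.rid K M.carrier).toLinearMap ∘ₗ
        TensorProduct.map LinearMap.id (rightCapV q n)) (TensorProduct.map LinearMap.id
          (onLeft (SMod.fund q n).dual.carrier M.Tinv) (TensorProduct.assoc K
            (SMod.fund q n).dual.carrier (SMod.fund q n).carrier
            (M.tensor (SMod.fund q n).dual).carrier (rightCupElt q n ⊗ₜ[K] w))) =
      M.dualCrossInv w := by
  set F : (M.tensor (SMod.fund q n).dual).carrier →ₗ[K] ((SMod.fund q n).dual.tensor M).carrier :=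
    TensorProduct.map LinearMap.id ((TensorProduct.rid K
      M.carrier).toLinearMap ∘ₗ TensorProduct.map LinearMap.id (rightCapV q n)) ∘ₗ
      TensorProduct.map LinearMap.id (onLeft (SMod.fund q n).dual.carrier M.Tinv) ∘ₗ
        (TensorProduct.assoc K (SMod.fund q n).dual.carrier (SMod.fund q n).carrier
            (M.tensor (SMod.fund q n).dual).carrier).toLinearMap ∘ₗ
              TensorProduct.mk K _ _ (rightCupElt q n)
  suffices h : F = M.dualCrossInv from LinearMap.congr_fun h w
  refine SMod.ext_tensor_dual fun m k => ?_
  change TensorProduct.map LinearMap.id ((TensorProduct.rid K M.carrier).toLinearMap ∘ₗ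
        TensorProduct.map LinearMap.id (rightCapV q n)) (TensorProduct.map LinearMap.id
          (onLeft (SMod.fund q n).dual.carrier M.Tinv) (TensorProduct.assoc K
            (SMod.fund q n).dual.carrier (SMod.fund q n).carrier
            (M.tensor (SMod.fund q n).dual).carrier (rightCupElt q n ⊗ₜ[K] (m ⊗ₜ[K] vd q k)))) = _
  rw [M.dualCrossInv_apply, rightCupElt, TensorProduct.sum_tmul, map_sum, map_sum, map_sum]
  refine Finset.sum_congr rfl fun i _ => ?_
  rw [← TensorProduct.smul_tmul', map_smul, map_smul, map_smul, TensorProduct.assoc_tmul,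
    TensorProduct.map_tmul, TensorProduct.map_tmul, LinearMap.id_apply, LinearMap.id_apply,
    ← TensorProduct.tmul_smul]
  refine congrArg _ ?_
  have h1 : onLeft (SMod.fund q n).dual.carrier M.Tinv (vv q i ⊗ₜ[K] (m ⊗ₜ[K] vd q k)) =
      ∑ j, M.kap j i m ⊗ₜ[K] (vv q j ⊗ₜ[K] vd q k) := by
    change TensorProduct.assoc K _ _ _ (M.Tinv (vv q i ⊗ₜ[K] m) ⊗ₜ[K] vd q k) = _
    rw [M.Tinv_apply, TensorProduct.sum_tmul, map_sum]
    rfl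
  -- The right cap keeps only j = k and contributes the weight of k, the right cup contributed the
  -- inverse weight of i, and with both κ_ki becomes λ_ki by `SMod.lam_eq`.
  rw [h1, map_sum, Finset.sum_eq_single k]
  · rw [LinearMap.comp_apply, TensorProduct.map_tmul, rightCapV_apply, if_pos rfl, M.lam_eq]
    refine (congrArg _ (TensorProduct.rid_tmul _ _)).trans ?_
    rw [smul_smul]
    rfl
  · intro j _ hj
    rw [LinearMap.comp_apply, TensorProduct.map_tmul, rightCapV_apply, if_neg hj,
      TensorProduct.tmul_zero, map_zero]
  · simp

end Relations

/-! ### Existence and uniqueness of the superfunctor on black strands -/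

section Incarnation

variable {K : Type} [Field K] [CharZero K] {q : Kˣ} {n : ℕ}

variable (q n) in
/-- The values of the generators of the quantum isomeric supercategory. -/
def gensQ : ∀ g : QGen, SHom (qSig.par g) (tens (labQ q n) (qSig.dom g)) (tens (labQ q n) (qSig.cod g))
  | .pos => SHom.T (SMod.fund q n)
  | .neg => SHom.T (SMod.fund q n) - zz q • SHom.one _
  | .negRight => SHom.dualCrossInv (SMod.fund q n)
  | .leftCap => SHom.ev q n
  | .leftCup => SHom.coev q n
  | .tok => SHom.J q n

lemma TT : (SMod.fund q n).T ∘ₗ (SMod.fund q n).T = zz q • (SMod.fund q n).T + LinearMap.id := by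
  have h := TV_TV (q := q) (n := n)
  rwa [TV_eq] at h

/-- The quadratic relation T² = zT + 1 exhibits T - z as the inverse of T, which fixes the value of
the negative crossing and gives the skein relation. -/
lemma neg_comp_T : ((SMod.fund q n).T - zz q • LinearMap.id) ∘ₗ (SMod.fund q n).T =
    LinearMap.id := by
  rw [LinearMap.sub_comp, TT, LinearMap.smul_comp, LinearMap.id_comp, add_sub_cancel_left]

lemma T_comp_neg : (SMod.fund q n).T ∘ₗ ((SMod.fund q n).T - zz q • LinearMap.id) =
    LinearMap.id := by
  rw [LinearMap.comp_sub, TT, LinearMap.comp_smul, LinearMap.comp_id, add_sub_cancel_left]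

-- The left crossing is defined by rotating the positive crossing, so its value is the rotated
-- T_{VV}.
open QObj in
lemma eval_posLeft : (SHom.eval (gensQ q n) (Q.posLeft (k := K))).1 = (SMod.fund q n).dualCross := by
  refine SMod.ext_dual_tensor fun k m => ?_
  refine Eq.trans ?_ (SMod.rotate_eq (SMod.fund q n) k m)
  have h : coevElt q n = coevV q n (1 : K) := (one_smul K _).symm
  have h2 := rotate_left_word (labQ q n) (r := up) (u := up) (d := dn) (SHom.ev q n) (SHom.coev q n)
    (SHom.T (SMod.fund q n)) (vd q k) m
  exact h2.trans (congrArg (fun c : ((SMod.fund q n).tensor (SMod.fund q n).dual).carrier =>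
    TensorProduct.lid K ((SMod.fund q n).carrier ⊗[K] (SMod.fund q n).dual.carrier)
      (TensorProduct.map (evV q n) LinearMap.id
        ((TensorProduct.assoc K (SMod.fund q n).dual.carrier (SMod.fund q n).carrier
          ((SMod.fund q n).carrier ⊗[K] (SMod.fund q n).dual.carrier)).symm
            (vd q k ⊗ₜ[K] onLeft (SMod.fund q n).dual.carrier (SMod.fund q n).T (m ⊗ₜ[K] c))))) h.symm)

lemma eval_rightCap : (SHom.eval (gensQ q n) (Q.rightCap (k := K))).1 = rightCapV q n :=
  evV_dualCrossInv

lemma eval_rightCup : (SHom.eval (gensQ q n) (Q.rightCup (k := K))).1 (1 : K) = rightCupElt q n := by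
  refine Eq.trans ?_ dualCrossInv_coevElt
  exact congrArg (SMod.fund q n).dualCrossInv (one_smul K (coevElt q n))

/-- The unit object is purely even, so an odd endomorphism equals its own negative. This disposes of
the bubble with a token without any computation. -/
lemma sgn_odd_unit (f : SHom 1 (SMod.unit q n) (SMod.unit q n)) : f = 0 := by
  refine Subtype.ext (LinearMap.ext fun m => ?_)
  have h := LinearMap.congr_fun (SHom.map_sgn f) m
  rw [show (SMod.unit q n).sgn = 1 from SMod.mk'_sgn] at h
  have h' : f.1 m = -f.1 m := by
    refine h.trans ?_
    change (sg 1 : K) • f.1 m = _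
    rw [sg_one, Int.cast_neg, Int.cast_one, neg_smul, one_smul]
  have h2 : (2 : K) * f.1 m = 0 := by
    have : (f.1 m : K) + f.1 m = 0 := by
      nth_rewrite 1 [h']
      exact neg_add_cancel _
    rw [two_mul]; exact this
  exact (mul_eq_zero.1 h2).resolve_left two_ne_zero

lemma zigzag_fund (v : (SMod.fund q n).carrier) :
    TensorProduct.rid K _ (TensorProduct.map LinearMap.id (evV q n)
      (TensorProduct.assoc K (SMod.fund q n).carrier (SMod.fund q n).dual.carrier
        (SMod.fund q n).carrier (coevElt q n ⊗ₜ[K] v))) = v := by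
  rw [coevElt, TensorProduct.sum_tmul, map_sum, map_sum, map_sum]
  refine Eq.trans (Finset.sum_congr rfl fun k _ => ?_) (fund_eq_sum v).symm
  exact TensorProduct.rid_tmul _ _

lemma zigzag_dual (f : (SMod.fund q n).dual.carrier) :
    TensorProduct.lid K _ (TensorProduct.map (evV q n) LinearMap.id
      ((TensorProduct.assoc K (SMod.fund q n).dual.carrier (SMod.fund q n).carrier
        (SMod.fund q n).dual.carrier).symm (f ⊗ₜ[K] coevElt q n))) = f := by
  rw [coevElt, TensorProduct.tmul_sum, map_sum, map_sum, map_sum]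
  refine Eq.trans (Finset.sum_congr rfl fun k _ => ?_) (dual_eq_sum f).symm
  exact TensorProduct.lid_tmul _ _

/-- The first zigzag. -/
lemma zigzag_up_word {O : Type} (lab : O → SMod q n) {u d : O}
    (cap : SHom 0 (tens lab [d, u]) (tens lab [])) (cup : SHom 0 (tens lab []) (tens lab [u, d]))
    (v : (lab u).carrier) :
    (SHom.comp (add_zero 0) (SHom.tensorTo lab (A := [u, d, u]) (B := [u]) (add_zero 0) rfl rfl
        (SHom.one (tens lab [u])) cap) (SHom.tensorTo lab (A := [u]) (B := [u, d, u]) (add_zero 0)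
          rfl rfl cup (SHom.one (tens lab [u])))).1 v =
      TensorProduct.rid K (lab u).carrier (TensorProduct.map LinearMap.id cap.1
        (TensorProduct.assoc K (lab u).carrier (lab d).carrier (lab u).carrier
          (cup.1 (1 : K) ⊗ₜ[K] v))) := by
  rw [SHom.comp_coe, tensorTo_single_cap]
  exact congrArg (fun z : (lab u).carrier ⊗[K] (tens lab [d, u]).carrier =>
    TensorProduct.rid K (lab u).carrier (TensorProduct.map LinearMap.id cap.1 z))
      (tensorTo_cup_left lab (o := u) (X := []) (add_zero 0) rfl rfl cup v)

/-- The second zigzag. -/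
lemma zigzag_dn_word {O : Type} (lab : O → SMod q n) {u d : O}
    (cap : SHom 0 (tens lab [d, u]) (tens lab [])) (cup : SHom 0 (tens lab []) (tens lab [u, d]))
    (f : (lab d).carrier) :
    (SHom.comp (add_zero 0) (SHom.tensorTo lab (A := [d, u, d]) (B := [d]) (add_zero 0) rfl rfl
        cap (SHom.one (tens lab [d]))) (SHom.tensorTo lab (A := [d]) (B := [d, u, d]) (add_zero 0)
          rfl rfl (SHom.one (tens lab [d])) cup)).1 f =
      TensorProduct.lid K (lab d).carrier (TensorProduct.map cap.1 LinearMap.id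
        ((TensorProduct.assoc K (lab d).carrier (lab u).carrier (lab d).carrier).symm
          (f ⊗ₜ[K] cup.1 (1 : K)))) := by
  rw [SHom.comp_coe, tensorTo_cap_left]
  exact congrArg (fun z : (lab d).carrier ⊗[K] (tens lab [u, d]).carrier =>
    TensorProduct.lid K (lab d).carrier (TensorProduct.map cap.1 LinearMap.id
      ((TensorProduct.assoc K (lab d).carrier (lab u).carrier (lab d).carrier).symm z)))
        (tensorTo_single_cup lab (add_zero 0) rfl rfl cup f)

lemma coev_one : (SHom.coev q n).1 (1 : K) = coevElt q n := one_smul K _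

open QObj in
lemma eval_zigzag_up (v : (SMod.fund q n).carrier) : (SHom.eval (gensQ q n)
    (Term.after (X := [up]) (Z := [up]) [up, dn, up] (Term.tens (Q.one [up]) Q.leftCap)
      (Term.tens (Q.leftCup (k := K)) (Q.one [up])))).1 v = v := by
  refine Eq.trans ?_ (zigzag_fund v)
  refine (zigzag_up_word (labQ q n) (u := up) (d := dn) (SHom.ev q n) (SHom.coev q n) v).trans ?_
  exact congrArg (fun c : ((SMod.fund q n).tensor (SMod.fund q n).dual).carrier =>
    TensorProduct.rid K _ (TensorProduct.map LinearMap.id (evV q n)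
      (TensorProduct.assoc K (SMod.fund q n).carrier (SMod.fund q n).dual.carrier
        (SMod.fund q n).carrier (c ⊗ₜ[K] v)))) coev_one

open QObj in
lemma eval_zigzag_dn (f : (SMod.fund q n).dual.carrier) :
    (SHom.eval (gensQ q n) (Term.after (X := [dn]) (Z := [dn]) [dn, up, dn]
      (Term.tens Q.leftCap (Q.one [dn])) (Term.tens (Q.one [dn]) (Q.leftCup (k := K))))).1 f = f := by
  refine Eq.trans ?_ (zigzag_dual f)
  refine (zigzag_dn_word (labQ q n) (u := up) (d := dn) (SHom.ev q n) (SHom.coev q n) f).trans ?_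
  exact congrArg (fun c : ((SMod.fund q n).tensor (SMod.fund q n).dual).carrier =>
    TensorProduct.lid K _ (TensorProduct.map (evV q n) LinearMap.id
      ((TensorProduct.assoc K (SMod.fund q n).dual.carrier (SMod.fund q n).carrier
        (SMod.fund q n).dual.carrier).symm (f ⊗ₜ[K] c)))) coev_one

open QObj in
/-- The braid relation, on any word. -/
lemma braid_word {O : Type} (lab : O → SMod q n) {r u : O}
    (x : SHom 0 (tens lab [u, u]) (tens lab [u, u])) (t : SHom 0 (tens lab [r, u]) (tens lab [u, r]))
    (x' : (lab u).carrier ⊗[K] (lab u).carrier →ₗ[K] (lab u).carrier ⊗[K] (lab u).carrier)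
    (t' : (lab r).carrier ⊗[K] (lab u).carrier →ₗ[K] (lab u).carrier ⊗[K] (lab r).carrier)
    (hx : x.1 = x') (ht : t.1 = t')
    (h : onLeft (lab r).carrier x' ∘ₗ TensorProduct.map LinearMap.id t' ∘ₗ
        onLeft (lab u).carrier t' =
      TensorProduct.map LinearMap.id t' ∘ₗ onLeft (lab u).carrier t' ∘ₗ
        TensorProduct.map LinearMap.id x') :
    SHom.comp (add_zero 0) (SHom.tensorTo lab (A := [u, u, r]) (B := [u, u, r]) (add_zero 0) rfl rfl x
        (SHom.one (tens lab [r])))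
      (SHom.comp (add_zero 0) (SHom.tensorTo lab (A := [u, r, u]) (B := [u, u, r]) (add_zero 0) rfl rfl
        (SHom.one (tens lab [u])) t)
        (SHom.tensorTo lab (A := [r, u, u]) (B := [u, r, u]) (add_zero 0) rfl rfl t
          (SHom.one (tens lab [u])))) =
    SHom.comp (add_zero 0) (SHom.tensorTo lab (A := [u, r, u]) (B := [u, u, r]) (add_zero 0) rfl rfl
        (SHom.one (tens lab [u])) t)
      (SHom.comp (add_zero 0) (SHom.tensorTo lab (A := [r, u, u]) (B := [u, r, u]) (add_zero 0) rfl rfl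
        t (SHom.one (tens lab [u])))
        (SHom.tensorTo lab (A := [r, u, u]) (B := [r, u, u]) (add_zero 0) rfl rfl
          (SHom.one (tens lab [r])) x)) := by
  refine Subtype.ext ?_
  rw [SHom.comp_coe, SHom.comp_coe, SHom.comp_coe, SHom.comp_coe, tensorTo_two_left,
    tensorTo_two_left, tensorTo_single_right, tensorTo_single_right, hx, ht]
  exact h

-- Sliding the token through the crossing is naturality of T_{MV} for the odd endomorphism J of V.
open QObj in
lemma eval_pos_tok : SHom.eval (gensQ q n)
      (.comp (p := 0) (r := 1) (Y := [up, up]) (zero_add 1) (Q.pos (k := K))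
        (.tensor (p := 1) (r := 0) (add_zero 1) rfl rfl Q.tok (Q.one [up]))) =
    SHom.eval (gensQ q n) (.comp (p := 1) (r := 0) (Y := [up, up]) (add_zero 1)
        (.tensor (p := 0) (r := 1) (zero_add 1) rfl rfl (Q.one [up]) Q.tok) (Q.pos (k := K))) := by
  refine Subtype.ext ?_
  have h := T_natural (SHom.J q n)
  have h1 := tensorTo_single (labQ q n) (a := up) (b := up) (c := up) (d := up) (X := []) (Y := [])
    (add_zero 1) rfl rfl (SHom.J q n) (SHom.one (SMod.fund q n))
  have h2 := tensorTo_single (labQ q n) (a := up) (b := up) (c := up) (d := up) (X := []) (Y := [])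
    (zero_add 1) rfl rfl (SHom.one (SMod.fund q n)) (SHom.J q n)
  refine (congrArg ((SMod.fund q n).T ∘ₗ ·) h1).trans (h.trans ?_)
  exact (congrArg (· ∘ₗ (SMod.fund q n).T) h2).symm

open QObj in
lemma eval_QRel {p : ZMod 2} {X Y : List QObj} {f g : Term K qSig p X Y} (h : QRel (zz q) p X Y f g) :
    SHom.eval (gensQ q n) f = SHom.eval (gensQ q n) g := by
  cases h with
  | neg_pos => exact Subtype.ext neg_comp_T
  | pos_neg => exact Subtype.ext T_comp_neg
  -- The negative right crossing was given the inverse of the rotated T as its value, so this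
  -- relation and the next hold by construction.
  | posLeft_negRight =>
    refine Subtype.ext ((congrArg (· ∘ₗ (SMod.fund q n).dualCrossInv) eval_posLeft).trans ?_)
    exact (SMod.fund q n).dualCross_dualCrossInv
  | negRight_posLeft =>
    refine Subtype.ext ((congrArg ((SMod.fund q n).dualCrossInv ∘ₗ ·) eval_posLeft).trans ?_)
    exact (SMod.fund q n).dualCrossInv_dualCross
  | braid =>
    exact braid_word (labQ q n) (r := up) (u := up) (SHom.T (SMod.fund q n))
      (SHom.T (SMod.fund q n)) _ _ rfl rfl (SMod.fund q n).braid
  | skein =>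
    refine Subtype.ext ?_
    refine LinearMap.ext fun v => ?_
    have h : ∀ a b : ((SMod.fund q n).tensor (SMod.fund q n)).carrier,
        a + (-1 : K) • (a - b) = b := fun a b => by
      rw [neg_one_smul]
      abel
    exact h ((SMod.fund q n).T v) (zz q • v)
  | tok_tok => exact Subtype.ext (LinearMap.ext fun v => Jop_Jop v)
  | pos_tok => exact eval_pos_tok
  | bubble_tok => exact sgn_odd_unit _
  | bubble =>
    refine Subtype.ext ((congrArg (· ∘ₗ coevV q n) eval_rightCap).trans (LinearMap.ext fun c => ?_))
    change rightCapV q n (c • coevElt q n) = 0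
    rw [map_smul, rightCapV_coevElt, smul_zero]
  | zigzag_up => exact Subtype.ext (LinearMap.ext fun v => eval_zigzag_up v)
  | zigzag_dn => exact Subtype.ext (LinearMap.ext fun v => eval_zigzag_dn v)

variable (q n) in
/-- The incarnation superfunctor. -/
def incarnation : MonFun (Qcat (zz q)) (labQ q n) :=
  MonFun.ofGens (Qcat (zz q)) (labQ q n) (gensQ q n) eval_QRel

lemma isIncarnation : IsIncarnation (incarnation q n) where
  pos := TV_eq.symm
  leftCap := rfl
  tok := rfl

lemma eq_of_inverse {A B : Type} [AddCommGroup A] [Module K A] [AddCommGroup B] [Module K B]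
    {f : A →ₗ[K] B} {g g' : B →ₗ[K] A} (h : g ∘ₗ f = LinearMap.id) (h' : f ∘ₗ g' = LinearMap.id) :
    g = g' := by
  rw [← LinearMap.comp_id g, ← h', ← LinearMap.comp_assoc, h, LinearMap.id_comp]

/-- Contracting the first factor of c with the dual basis recovers its components, and the zigzag
identity prescribes these contractions. -/
lemma coevElt_unique (c : ((SMod.fund q n).tensor (SMod.fund q n).dual).carrier)
    (h : ∀ f : (SMod.fund q n).dual.carrier, TensorProduct.lid K _
      (TensorProduct.map (evV q n) LinearMap.id
        ((TensorProduct.assoc K (SMod.fund q n).dual.carrier (SMod.fund q n).carrier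
          (SMod.fund q n).dual.carrier).symm (f ⊗ₜ[K] c))) = f) : c = coevElt q n := by
  have h1 : c = ∑ j, vv q j ⊗ₜ[K] TensorProduct.lid K _ (TensorProduct.map (evV q n) LinearMap.id
      ((TensorProduct.assoc K (SMod.fund q n).dual.carrier (SMod.fund q n).carrier
        (SMod.fund q n).dual.carrier).symm (vd q j ⊗ₜ[K] c))) := by
    refine TensorProduct.induction_on (M := (SMod.fund q n).carrier)
      (N := (SMod.fund q n).dual.carrier) c ?_ ?_ ?_
    · simp
    · intro v f
      have h2 : ∀ j, vv q j ⊗ₜ[K] TensorProduct.lid K _ (TensorProduct.map (evV q n) LinearMap.id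
          ((TensorProduct.assoc K (SMod.fund q n).dual.carrier (SMod.fund q n).carrier
            (SMod.fund q n).dual.carrier).symm (vd q j ⊗ₜ[K] (v ⊗ₜ[K] f)))) =
          ((v : Idx n → K) j • vv q j) ⊗ₜ[K] f := by
        intro j
        rw [TensorProduct.smul_tmul]
        refine congrArg (vv q j ⊗ₜ[K] ·) ?_
        exact TensorProduct.lid_tmul _ _
      refine Eq.trans ?_ (Finset.sum_congr rfl fun j _ => (h2 j).symm)
      rw [← TensorProduct.sum_tmul, ← fund_eq_sum]
    · intro x y hx hy
      conv_lhs => rw [hx, hy]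
      rw [← Finset.sum_add_distrib]
      refine Finset.sum_congr rfl fun j _ => ?_
      simp only [TensorProduct.tmul_add, map_add]
  rw [h1, coevElt]
  exact Finset.sum_congr rfl fun j _ => by rw [h]

-- The prescribed values force the others: the negative crossing is the inverse of the positive one,
-- the left cup is determined by the left cap through a zigzag, and the negative right crossing is
-- the inverse of the left crossing built from these.
open QObj in
lemma IsIncarnation.eq {F : MonFun (Qcat (zz q)) (labQ q n)} (hF : IsIncarnation F) :
    F = incarnation q n := by
  set γ : ∀ g : QGen, SHom (qSig.par g) (tens (labQ q n) (qSig.dom g)) (tens (labQ q n) (qSig.cod g)) :=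
    fun g => F.map (qSig.par g) (qSig.dom g) (qSig.cod g) ((Qcat (zz q)).cls (Term.gen (S := qSig) g))
    with hγ
  have hrel : ∀ {p : ZMod 2} {X Y : List QObj} {f g : Term K qSig p X Y}, QRel (zz q) p X Y f g →
      SHom.eval γ f = SHom.eval γ g := fun {p X Y f g} h => by
    rw [← F.map_cls, ← F.map_cls, (Qcat (zz q)).sound (.of h)]
  have hpos : γ .pos = gensQ q n .pos := Subtype.ext (hF.pos.trans TV_eq)
  have hcap : γ .leftCap = gensQ q n .leftCap := Subtype.ext hF.leftCap
  have htok : γ .tok = gensQ q n .tok := Subtype.ext hF.tok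
  have hneg : γ .neg = gensQ q n .neg := by
    have h1 := congrArg Subtype.val (hrel QRel.neg_pos)
    have h2 := congrArg Subtype.val (eval_QRel (q := q) (n := n) QRel.pos_neg)
    change (γ .neg).1 ∘ₗ (γ .pos).1 = LinearMap.id at h1
    rw [hpos] at h1
    exact Subtype.ext (eq_of_inverse h1 h2)
  have hcup : γ .leftCup = gensQ q n .leftCup := by
    have h1 := congrArg Subtype.val (hrel QRel.zigzag_dn)
    have h2 : (γ .leftCup).1 (1 : K) = coevElt q n := by
      refine coevElt_unique _ fun f => ?_
      refine Eq.trans ?_ (LinearMap.congr_fun h1 f)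
      refine Eq.trans ?_ (zigzag_dn_word (labQ q n) (u := up) (d := dn) (γ .leftCap) (γ .leftCup)
        f).symm
      rw [hcap]
      rfl
    refine Subtype.ext (LinearMap.ext_ring (R := K) ?_)
    exact h2.trans coev_one.symm
  have hright : γ .negRight = gensQ q n .negRight := by
    have h1 := congrArg Subtype.val (hrel QRel.negRight_posLeft)
    have h2 := congrArg Subtype.val (eval_QRel (q := q) (n := n) QRel.posLeft_negRight)
    -- The left crossing involves only the left cap, the positive crossing and the left cup, all of
    -- which are already known.
    have h3 : SHom.eval γ (Q.posLeft (k := K)) = SHom.eval (gensQ q n) Q.posLeft := by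
      change SHom.comp _ (SHom.tensorTo _ _ _ _ (γ .leftCap) _) (SHom.comp _ (SHom.tensorTo _ _ _ _ _
        (SHom.tensorTo _ _ _ _ (γ .pos) _)) (SHom.tensorTo _ _ _ _ _ (γ .leftCup))) = _
      rw [hcap, hpos, hcup]
      rfl
    change (γ .negRight).1 ∘ₗ (SHom.eval γ Q.posLeft).1 = LinearMap.id at h1
    rw [h3] at h1
    exact Subtype.ext (eq_of_inverse h1 h2)
  refine MonFun.ext_gens fun g => ?_
  cases g
  · exact hpos
  · exact hneg
  · exact hright
  · exact hcap
  · exact hcup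
  · exact htok

end Incarnation

/-! ### Changing the alphabet of words -/

section Relabel

variable {K : Type} [Field K] [CharZero K] {q : Kˣ} {n : ℕ}

/-- A black word has the same tensor product under both labellings, but for a general word this
equality is proved by induction. Morphisms are therefore compared heterogeneously, operation by
operation. -/
lemma SHom.one_heq {A B : SMod q n} (h : A = B) : HEq (SHom.one A) (SHom.one B) := by
  subst h; rfl

lemma SHom.lid_heq {A B : SMod q n} (h : A = B) : HEq (SHom.lid A) (SHom.lid B) := by
  subst h; rfl

lemma SHom.zero_heq {p : ZMod 2} {A A' B B' : SMod q n} (hA : A = A') (hB : B = B') :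
    HEq (0 : SHom p A B) (0 : SHom p A' B') := by
  subst hA hB; rfl

lemma SHom.add_heq {p : ZMod 2} {A A' B B' : SMod q n} (hA : A = A') (hB : B = B')
    {f g : SHom p A B} {f' g' : SHom p A' B'} (hf : HEq f f') (hg : HEq g g') :
    HEq (f + g) (f' + g') := by
  subst hA hB hf hg; rfl

lemma SHom.smul_heq {p : ZMod 2} {A A' B B' : SMod q n} (hA : A = A') (hB : B = B') (c : K)
    {f : SHom p A B} {f' : SHom p A' B'} (hf : HEq f f') : HEq (c • f) (c • f') := by
  subst hA hB hf; rfl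

lemma SHom.comp_heq {p r s : ZMod 2} (h : p + r = s) {A A' B B' C C' : SMod q n} (hA : A = A')
    (hB : B = B') (hC : C = C') {f : SHom p B C} {f' : SHom p B' C'} {g : SHom r A B}
    {g' : SHom r A' B'} (hf : HEq f f') (hg : HEq g g') :
    HEq (SHom.comp h f g) (SHom.comp h f' g') := by
  subst hA hB hC hf hg; rfl

lemma SHom.tensor_heq {p r s : ZMod 2} (h : p + r = s) {A A' B B' C C' D D' : SMod q n}
    (hA : A = A') (hB : B = B') (hC : C = C') (hD : D = D') {f : SHom p A B} {f' : SHom p A' B'}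
    {g : SHom r C D} {g' : SHom r C' D'} (hf : HEq f f') (hg : HEq g g') :
    HEq (SHom.tensor h f g) (SHom.tensor h f' g') := by
  subst hA hB hC hD hf hg; rfl

lemma SHom.assoc_heq {A A' B B' C C' : SMod q n} (hA : A = A') (hB : B = B') (hC : C = C') :
    HEq (SHom.assoc A B C) (SHom.assoc A' B' C') := by
  subst hA hB hC; rfl

/-- Inverses are unique, so the comparison of `SHom.split` follows from that of `SHom.joinTo`
without unfolding. -/
lemma SHom.inverse_heq {A A' B B' : SMod q n} (hA : A = A') (hB : B = B') {f : SHom 0 A B}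
    {f' : SHom 0 A' B'} {g : SHom 0 B A} {g' : SHom 0 B' A'} (hf : HEq f f')
    (h : g.1 ∘ₗ f.1 = LinearMap.id) (h' : f'.1 ∘ₗ g'.1 = LinearMap.id) : HEq g g' := by
  subst hA hB hf
  exact heq_of_eq (Subtype.ext (eq_of_inverse h h'))

variable {O O' : Type} (ι : O → O') (lab : O' → SMod q n)

lemma SHom.join_heq : ∀ X Y : List O,
    HEq (SHom.join lab (X.map ι) (Y.map ι)) (SHom.join (fun o => lab (ι o)) X Y)
  | [], Y => SHom.lid_heq (tens_map ι lab Y)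
  | [_], [] => HEq.rfl
  | [o], y :: Y => SHom.one_heq (congrArg (lab (ι o)).tensor (tens_map ι lab (y :: Y)))
  | o :: o' :: X, Y => by
    have h1 := tens_map ι lab (o' :: X)
    have h2 := tens_map ι lab Y
    have h3 : tens lab ((o' :: X).map ι ++ Y.map ι) = tens (fun o => lab (ι o)) (o' :: X ++ Y) := by
      rw [← List.map_append]; exact tens_map ι lab (o' :: X ++ Y)
    exact SHom.comp_heq (add_zero 0) (congrArg₂ SMod.tensor (congrArg (lab (ι o)).tensor h1) h2)
      (congrArg (lab (ι o)).tensor (congrArg₂ SMod.tensor h1 h2))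
      (congrArg (lab (ι o)).tensor h3)
      (SHom.tensor_heq (add_zero 0) rfl rfl (congrArg₂ SMod.tensor h1 h2) h3 HEq.rfl
        (SHom.join_heq (o' :: X) Y))
      (SHom.assoc_heq rfl h1 h2)

lemma SHom.joinTo_heq {A X Y : List O} (h : A = X ++ Y) (h' : A.map ι = X.map ι ++ Y.map ι) :
    HEq (SHom.joinTo lab h') (SHom.joinTo (fun o => lab (ι o)) h) := by
  subst h
  refine HEq.trans ?_ (SHom.join_heq ι lab X Y)
  have : ∀ (A' : List O') (h' : A' = X.map ι ++ Y.map ι),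
      HEq (SHom.joinTo lab h') (SHom.join lab (X.map ι) (Y.map ι)) := by
    intro A' h'; subst h'; rfl
  exact this _ h'

lemma SHom.split_heq {A X Y : List O} (h : A = X ++ Y) (h' : A.map ι = X.map ι ++ Y.map ι) :
    HEq (SHom.split lab h') (SHom.split (fun o => lab (ι o)) h) := by
  refine SHom.inverse_heq (congrArg₂ SMod.tensor (tens_map ι lab X) (tens_map ι lab Y))
    (tens_map ι lab A) (SHom.joinTo_heq ι lab h h') ?_ ?_
  · rw [SHom.joinTo_coe]
    exact LinearMap.ext fun x => (joinE lab h').symm_apply_apply x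
  · rw [SHom.joinTo_coe]
    exact LinearMap.ext fun x => (joinE (fun o => lab (ι o)) h).apply_symm_apply x

lemma SHom.tensorTo_heq {p r s : ZMod 2} {X Y X' Y' A B : List O} (h : p + r = s) (hA : A = X ++ X')
    (hB : B = Y ++ Y') (hA' : A.map ι = X.map ι ++ X'.map ι) (hB' : B.map ι = Y.map ι ++ Y'.map ι)
    {f : SHom p (tens lab (X.map ι)) (tens lab (Y.map ι))}
    {f' : SHom p (tens (fun o => lab (ι o)) X) (tens (fun o => lab (ι o)) Y)}
    {g : SHom r (tens lab (X'.map ι)) (tens lab (Y'.map ι))}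
    {g' : SHom r (tens (fun o => lab (ι o)) X') (tens (fun o => lab (ι o)) Y')}
    (hf : HEq f f') (hg : HEq g g') :
    HEq (SHom.tensorTo lab h hA' hB' f g) (SHom.tensorTo (fun o => lab (ι o)) h hA hB f' g') :=
  SHom.comp_heq _ (tens_map ι lab A)
    (congrArg₂ SMod.tensor (tens_map ι lab Y) (tens_map ι lab Y')) (tens_map ι lab B)
    (SHom.joinTo_heq ι lab hB hB')
    (SHom.comp_heq _ (tens_map ι lab A)
      (congrArg₂ SMod.tensor (tens_map ι lab X) (tens_map ι lab X'))
      (congrArg₂ SMod.tensor (tens_map ι lab Y) (tens_map ι lab Y'))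
      (SHom.tensor_heq h (tens_map ι lab X) (tens_map ι lab Y) (tens_map ι lab X')
        (tens_map ι lab Y') hf hg) (SHom.split_heq ι lab hA hA'))

end Relabel

/-! ### Existence and uniqueness of the extension to the red strand -/

section Extension

variable {K : Type} [Field K] [CharZero K] {q : Kˣ} {n : ℕ} (M : SMod q n)

/-- The values of the generators of the extended supercategory, for the red label `M`. -/
def gensW : ∀ g : WGen, SHom (wSig.par g) (tens (labW M) (wSig.dom g)) (tens (labW M) (wSig.cod g))
  | .black .pos => SHom.T (SMod.fund q n)
  | .black .neg => SHom.T (SMod.fund q n) - zz q • SHom.one _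
  | .black .negRight => SHom.dualCrossInv (SMod.fund q n)
  | .black .leftCap => SHom.ev q n
  | .black .leftCup => SHom.coev q n
  | .black .tok => SHom.J q n
  | .posRed => SHom.T M
  | .negRed => SHom.symmOf M.Tequiv (SHom.T M) rfl

lemma tens_labW (X : List QObj) : tens (labW M) (X.map some) = tens (labQ q n) X :=
  tens_map some (labW M) X

/-- The black generators have the same values in both settings and every operation is compatible
with relabelling, so the relations among black strands carry over. -/
lemma eval_inclTerm {p : ZMod 2} {X Y : List qSig.O} (t : Term K qSig p X Y) :
    HEq (SHom.eval (gensW M) (inclTerm t)) (SHom.eval (gensQ q n) t) := by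
  induction t with
  | id X => exact SHom.one_heq (tens_labW M X)
  | gen g => cases g <;> rfl
  | comp h f g hf hg =>
    exact SHom.comp_heq h (tens_labW M _) (tens_labW M _) (tens_labW M _) hf hg
  | tensor h hA hB f g hf hg => exact SHom.tensorTo_heq some (labW M) h hA hB _ _ hf hg
  | zero => exact SHom.zero_heq (tens_labW M _) (tens_labW M _)
  | add f g hf hg => exact SHom.add_heq (tens_labW M _) (tens_labW M _) hf hg
  | smul c f hf => exact SHom.smul_heq (tens_labW M _) (tens_labW M _) c hf

-- By definition this crossing is the positive red crossing rotated by the left cap and cup, hence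
-- the rotated T_{MV}.
open QObj in
lemma eval_negDownRed : (SHom.eval (gensW M) (W.negDownRed (k := K))).1 = M.dualCross := by
  refine SMod.ext_dual_tensor fun k m => ?_
  refine Eq.trans ?_ (SMod.rotate_eq M k m)
  have h2 := rotate_left_word (labW M) (r := none) (u := some up) (d := some dn) (SHom.ev q n)
    (SHom.coev q n) (SHom.T M) (vd q k) m
  exact h2.trans (congrArg (fun c : ((SMod.fund q n).tensor (SMod.fund q n).dual).carrier =>
    TensorProduct.lid K (M.carrier ⊗[K] (SMod.fund q n).dual.carrier)
      (TensorProduct.map (evV q n) LinearMap.id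
        ((TensorProduct.assoc K (SMod.fund q n).dual.carrier (SMod.fund q n).carrier
          (M.carrier ⊗[K] (SMod.fund q n).dual.carrier)).symm
            (vd q k ⊗ₜ[K] onLeft (SMod.fund q n).dual.carrier M.T (m ⊗ₜ[K] c))))) coev_one)

-- This crossing rotates T_{MV}⁻¹ with the right cap and cup. Their weights change κ into λ, so the
-- result inverts the rotated T_{MV}; both relations for downward red crossings follow from this.
open QObj in
lemma eval_posDownRed : (SHom.eval (gensW M) (W.posDownRed (k := K))).1 = M.dualCrossInv := by
  refine LinearMap.ext fun w => ?_
  refine Eq.trans ?_ (SMod.rotate_right M w)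
  set cap : SHom 0 (tens (labW M) [some up, some dn]) (tens (labW M) []) :=
    SHom.eval (gensW M) (W.rightCap (k := K))
  set cup : SHom 0 (tens (labW M) []) (tens (labW M) [some dn, some up]) :=
    SHom.eval (gensW M) (W.rightCup (k := K))
  have hcap : cap.1 = rightCapV q n := evV_dualCrossInv
  have hcup : cup.1 (1 : K) = rightCupElt q n := eval_rightCup
  have h2 := rotate_right_word (labW M) (r := none) (u := some up) (d := some dn) cap cup
    (SHom.symmOf M.Tequiv (SHom.T M) rfl) w
  rw [hcap] at h2
  exact h2.trans (congrArg (fun c : ((SMod.fund q n).dual.tensor (SMod.fund q n)).carrier =>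
    TensorProduct.map LinearMap.id ((TensorProduct.rid K M.carrier).toLinearMap ∘ₗ
        TensorProduct.map LinearMap.id (rightCapV q n)) (TensorProduct.map LinearMap.id
          (onLeft (SMod.fund q n).dual.carrier M.Tinv) (TensorProduct.assoc K
            (SMod.fund q n).dual.carrier (SMod.fund q n).carrier
            (M.tensor (SMod.fund q n).dual).carrier (c ⊗ₜ[K] w)))) hcup)

lemma SHom.comp_eq_one {A B : SMod q n} (f : SHom 0 A B) (g : SHom 0 B A)
    {f' : A.carrier →ₗ[K] B.carrier} {g' : B.carrier →ₗ[K] A.carrier} (hf : f.1 = f')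
    (hg : g.1 = g') (h : g' ∘ₗ f' = LinearMap.id) : SHom.comp (add_zero 0) g f = SHom.one A := by
  subst hf hg
  exact Subtype.ext h

lemma eval_negDown_posDown : SHom.comp (add_zero 0) (SHom.eval (gensW M) (W.negDownRed (k := K)))
    (SHom.eval (gensW M) (W.posDownRed (k := K))) = SHom.one (tens (labW M) [W.red, W.dn]) :=
  SHom.comp_eq_one _ _ (eval_posDownRed M) (eval_negDownRed M) M.dualCross_dualCrossInv

lemma eval_posDown_negDown : SHom.comp (add_zero 0) (SHom.eval (gensW M) (W.posDownRed (k := K)))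
    (SHom.eval (gensW M) (W.negDownRed (k := K))) = SHom.one (tens (labW M) [W.dn, W.red]) :=
  SHom.comp_eq_one _ _ (eval_negDownRed M) (eval_posDownRed M) M.dualCrossInv_dualCross

open QObj in
lemma eval_WRel {p : ZMod 2} {X Y : List (Option QObj)} {f g : Term K wSig p X Y}
    (h : WRel (zz q) p X Y f g) : SHom.eval (gensW M) f = SHom.eval (gensW M) g := by
  cases h with
  | black h =>
    -- A black relation already holds for `gensQ` and is transported along the change of labelling.
    refine eq_of_heq ((eval_inclTerm M _).trans (HEq.trans ?_ (eval_inclTerm M _).symm))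
    exact heq_of_eq (eval_QRel h)
  | neg_pos => exact Subtype.ext M.Tinv_T
  | pos_neg => exact Subtype.ext M.T_Tinv
  | negDown_posDown => exact eval_negDown_posDown M
  | posDown_negDown => exact eval_posDown_negDown M
  | braid =>
    exact braid_word (labW M) (r := none) (u := some up) (SHom.T (SMod.fund q n)) (SHom.T M) _ _
      rfl rfl M.braid

/-- The extension of the incarnation superfunctor with red label `M`. -/
def incarnationW : MonFun (Wcat (zz q)) (labW M) :=
  MonFun.ofGens (Wcat (zz q)) (labW M) (gensW M) (eval_WRel M)

lemma isExtension : IsExtension (incarnation q n) M (incarnationW M) where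
  extend _ _ _ := (Qcat (zz q)).ind fun f => eval_inclTerm M f
  posRed := rfl

/-- The black generators are fixed by the extension property and the positive red crossing is
prescribed; the relation between the red crossings makes the negative one its inverse. -/
lemma IsExtension.eq {G : MonFun (Wcat (zz q)) (labW M)} (hG : IsExtension (incarnation q n) M G) :
    G = incarnationW M := by
  have hpos : G.map 0 [W.red, W.up] [W.up, W.red] ((Wcat (zz q)).cls W.posRed) = SHom.T M :=
    Subtype.ext hG.posRed
  refine MonFun.ext_gens fun g => ?_
  cases g with
  | black g =>
    exact eq_of_heq ((hG.extend _ _ _ ((Qcat (zz q)).cls (Term.gen (S := qSig) g))).trans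
      ((isExtension M).extend _ _ _ ((Qcat (zz q)).cls (Term.gen (S := qSig) g))).symm)
  | posRed => exact hpos
  | negRed =>
    have h1 := congrArg (G.map 0 [W.red, W.up] [W.red, W.up])
      ((Wcat (zz q)).sound (.of (WRel.neg_pos (z := zz q))))
    have h2 : SHom.comp (add_zero 0)
        (G.map 0 [W.up, W.red] [W.red, W.up] ((Wcat (zz q)).cls W.negRed))
        (G.map 0 [W.red, W.up] [W.up, W.red] ((Wcat (zz q)).cls W.posRed)) = SHom.one _ :=
      (G.map_comp (add_zero 0) ((Wcat (zz q)).cls W.negRed) ((Wcat (zz q)).cls W.posRed)).symm.trans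
        (h1.trans (G.map_id [W.red, W.up]))
    rw [hpos] at h2
    exact Subtype.ext (eq_of_inverse (congrArg Subtype.val h2) M.T_Tinv)

end Extension

/-! ### Changing the red label and joining words -/

section RedJoin

variable {K : Type} [Field K] [CharZero K] {q : Kˣ} {n : ℕ} {M N : SMod q n}

/-- On black words the supermodule does not depend on the red label, although its type mentions it.
The canonical isomorphisms are therefore respected. -/
lemma blackId_join : ∀ X Y : List (Option QObj), X.count none = 0 → Y.count none = 0 →
    ∀ (x : (tens (labW M) X).carrier) (y : (tens (labW M) Y).carrier),
      (blackId M N (X ++ Y)).1 (tensEquiv (labW M) X Y (x ⊗ₜ[K] y)) =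
        tensEquiv (labW N) X Y ((blackId M N X).1 x ⊗ₜ[K] (blackId M N Y).1 y)
  | [], Y, _, _, x, y => by
    have h1 : tensEquiv (labW M) [] Y (x ⊗ₜ[K] y) = (show K from x) • y := TensorProduct.lid_tmul _ _
    have h2 : tensEquiv (labW N) [] Y ((blackId M N []).1 x ⊗ₜ[K] (blackId M N Y).1 y) =
      (show K from x) • (blackId M N Y).1 y := TensorProduct.lid_tmul _ _
    rw [h1, h2]
    exact map_smul (blackId M N Y).1 (show K from x) y
  | [none], _, h, _, _, _ => by simp at h
  | [some _], [], _, _, _, _ => rfl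
  | [some _], _ :: _, _, _, _, _ => rfl
  | none :: _ :: _, _, h, _, _, _ => by simp at h
  | some o :: o' :: X, Y, hX, hY, x, y => by
    have hX' : (o' :: X).count none = 0 := by simpa using hX
    have ih := blackId_join (o' :: X) Y hX' hY
    refine LinearMap.congr_fun (f := (blackId M N (some o :: o' :: X ++ Y)).1 ∘ₗ
      (tensEquiv (labW M) (some o :: o' :: X) Y).toLinearMap ∘ₗ
        (TensorProduct.mk K (tens (labW M) (some o :: o' :: X)).carrier
          (tens (labW M) Y).carrier).flip y)
      (g := (tensEquiv (labW N) (some o :: o' :: X) Y).toLinearMap ∘ₗ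
        (TensorProduct.mk K (tens (labW N) (some o :: o' :: X)).carrier
          (tens (labW N) Y).carrier).flip ((blackId M N Y).1 y) ∘ₗ
            (blackId M N (some o :: o' :: X)).1) (tens_cons_ext (labW M) fun v w => ?_) x
    exact congrArg (fun u : (tens (labW N) (o' :: X ++ Y)).carrier =>
      (show (labQ q n o).carrier from v) ⊗ₜ[K] u) (ih w y)

lemma redHom_join_left {r : ZMod 2} (g : SHom r M N) : ∀ X Y : List (Option QObj),
    X.count none = 1 → Y.count none = 0 →
    ∀ (x : (tens (labW M) X).carrier) (y : (tens (labW M) Y).carrier),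
      (redHom g (X ++ Y)).1 (tensEquiv (labW M) X Y (x ⊗ₜ[K] y)) =
        tensEquiv (labW N) X Y ((redHom g X).1 x ⊗ₜ[K] (blackId M N Y).1 y)
  | [], Y, h, _, x, y => by simp at h
  | [none], [], _, _, x, y => by
    have h1 : tensEquiv (labW M) [none] [] (x ⊗ₜ[K] y) =
      (show K from y) • (show M.carrier from x) :=
      TensorProduct.rid_tmul (R := K) (M := M.carrier) x y
    have h2 : tensEquiv (labW N) [none] [] ((redHom g [none]).1 x ⊗ₜ[K] (blackId M N []).1 y) =
      (show K from y) • g.1 x :=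
      TensorProduct.rid_tmul (R := K) (M := N.carrier) (g.1 x) y
    rw [h1, h2]
    exact map_smul g.1 (show K from y) x
  | [none], _ :: _, _, _, _, _ => rfl
  | [some _], _, h, _, _, _ => by simp at h
  | none :: o' :: X, Y, hX, hY, x, y => by
    have hX' : (o' :: X).count none = 0 := by
      rw [List.count_cons_self] at hX; omega
    have ih := blackId_join (M := M) (N := N) (o' :: X) Y hX' hY
    refine LinearMap.congr_fun (f := (redHom g (none :: o' :: X ++ Y)).1 ∘ₗ
      (tensEquiv (labW M) (none :: o' :: X) Y).toLinearMap ∘ₗ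
        (TensorProduct.mk K (tens (labW M) (none :: o' :: X)).carrier
          (tens (labW M) Y).carrier).flip y)
      (g := (tensEquiv (labW N) (none :: o' :: X) Y).toLinearMap ∘ₗ
        (TensorProduct.mk K (tens (labW N) (none :: o' :: X)).carrier
          (tens (labW N) Y).carrier).flip ((blackId M N Y).1 y) ∘ₗ
            (redHom g (none :: o' :: X)).1) (tens_cons_ext (labW M) fun v w => ?_) x
    exact congrArg (fun u : (tens (labW N) (o' :: X ++ Y)).carrier =>
      g.1 v ⊗ₜ[K] u) (ih w y)
  | some o :: o' :: X, Y, hX, hY, x, y => by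
    have hX' : (o' :: X).count none = 1 := by simpa using hX
    have ih := redHom_join_left g (o' :: X) Y hX' hY
    refine LinearMap.congr_fun (f := (redHom g (some o :: o' :: X ++ Y)).1 ∘ₗ
      (tensEquiv (labW M) (some o :: o' :: X) Y).toLinearMap ∘ₗ
        (TensorProduct.mk K (tens (labW M) (some o :: o' :: X)).carrier
          (tens (labW M) Y).carrier).flip y)
      (g := (tensEquiv (labW N) (some o :: o' :: X) Y).toLinearMap ∘ₗ
        (TensorProduct.mk K (tens (labW N) (some o :: o' :: X)).carrier
          (tens (labW N) Y).carrier).flip ((blackId M N Y).1 y) ∘ₗ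
            (redHom g (some o :: o' :: X)).1) (tens_cons_ext (labW M) fun v w => ?_) x
    exact congrArg (fun u : (tens (labW N) (o' :: X ++ Y)).carrier =>
      ipow (labQ q n o).sgn r v ⊗ₜ[K] u) (ih w y)

/-- With the red letter in the second word, g has to pass the whole first word; this is the power of
the involution on x. The letters of X contribute it one at a time, and the joins combine these
contributions. -/
lemma redHom_join_right {r : ZMod 2} (g : SHom r M N) : ∀ X Y : List (Option QObj),
    X.count none = 0 → Y.count none = 1 →
    ∀ (x : (tens (labW M) X).carrier) (y : (tens (labW M) Y).carrier),
      (redHom g (X ++ Y)).1 (tensEquiv (labW M) X Y (x ⊗ₜ[K] y)) =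
        tensEquiv (labW N) X Y ((blackId M N X).1 (ipow (tens (labW M) X).sgn r x) ⊗ₜ[K]
          (redHom g Y).1 y)
  | [], Y, _, _, x, y => by
    have h1 : tensEquiv (labW M) [] Y (x ⊗ₜ[K] y) = (show K from x) • y := TensorProduct.lid_tmul _ _
    have h2 : tensEquiv (labW N) [] Y ((blackId M N []).1 (ipow (tens (labW M) []).sgn r x) ⊗ₜ[K]
      (redHom g Y).1 y) = (show K from x) • (redHom g Y).1 y :=
      (TensorProduct.lid_tmul _ _).trans (congrArg (fun c : K => c • (redHom g Y).1 y)
        (unit_ipow_sgn (q := q) (n := n) r (show K from x)))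
    rw [h1, h2]
    exact map_smul (redHom g Y).1 (show K from x) y
  | [none], _, h, _, _, _ => by simp at h
  | [some _], [], _, h, _, _ => by simp at h
  | [some _], _ :: _, _, _, _, _ => rfl
  | none :: _ :: _, _, h, _, _, _ => by simp at h
  | some o :: o' :: X, Y, hX, hY, x, y => by
    have hX' : (o' :: X).count none = 0 := by simpa using hX
    have ih := redHom_join_right g (o' :: X) Y hX' hY
    refine LinearMap.congr_fun (f := (redHom g (some o :: o' :: X ++ Y)).1 ∘ₗ
      (tensEquiv (labW M) (some o :: o' :: X) Y).toLinearMap ∘ₗ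
        (TensorProduct.mk K (tens (labW M) (some o :: o' :: X)).carrier
          (tens (labW M) Y).carrier).flip y)
      (g := (tensEquiv (labW N) (some o :: o' :: X) Y).toLinearMap ∘ₗ
        (TensorProduct.mk K (tens (labW N) (some o :: o' :: X)).carrier
          (tens (labW N) Y).carrier).flip ((redHom g Y).1 y) ∘ₗ
            (blackId M N (some o :: o' :: X)).1 ∘ₗ ipow (tens (labW M) (some o :: o' :: X)).sgn r)
      (tens_cons_ext (labW M) fun v w => ?_) x
    have h1 : ipow (tens (labW M) (some o :: o' :: X)).sgn r
        (v ⊗ₜ[K] w : (labW M (some o)).carrier ⊗[K] (tens (labW M) (o' :: X)).carrier) =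
        (ipow (labQ q n o).sgn r v ⊗ₜ[K] ipow (tens (labW M) (o' :: X)).sgn r w :
          (labQ q n o).carrier ⊗[K] (tens (labW M) (o' :: X)).carrier) :=
      joinE_sgn (labW M) (X := [some o]) (Y := o' :: X) rfl r v w
    refine (congrArg (fun u : (tens (labW N) (o' :: X ++ Y)).carrier =>
      ipow (labQ q n o).sgn r v ⊗ₜ[K] u) (ih w y)).trans ?_
    exact congrArg (fun u : (tens (labW M) (some o :: o' :: X)).carrier =>
      tensEquiv (labW N) (some o :: o' :: X) Y
        ((blackId M N (some o :: o' :: X)).1 u ⊗ₜ[K] (redHom g Y).1 y)) h1.symm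

end RedJoin

/-! ### Supernaturality in the red label and the superfunctor on words with one red letter -/

section RedNatural

variable {K : Type} [Field K] [CharZero K] {q : Kˣ} {n : ℕ} {M N : SMod q n}

lemma blackId_two (a b : QObj) (w : (tens (labQ q n) [a, b]).carrier) :
    (blackId M N [some a, some b]).1 w = w :=
  LinearMap.congr_fun (TensorProduct.map_id (R := K) (M := (labQ q n a).carrier)
    (N := (labQ q n b).carrier)) w

/-- Identities and generators preserve the number of red letters. In a composite or tensor product
that changes it some factor changes it too, and that factor is zero by induction. This handles
expressions passing through words with the wrong number of red letters. -/
lemma eval_zero_of_count {p : ZMod 2} {X Y : List wSig.O} (t : Term K wSig p X Y)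
    (h : X.count none ≠ Y.count none) : SHom.eval (gensW M) t = 0 := by
  induction t with
  | id X => exact absurd rfl h
  | gen g =>
    refine absurd ?_ h
    rcases g with g | _ | _
    · cases g <;> rfl
    · rfl
    · rfl
  | @comp p r s X Y Z hs f g hf hg =>
    refine Subtype.ext (LinearMap.ext fun w => ?_)
    change (SHom.eval (gensW M) f).1 ((SHom.eval (gensW M) g).1 w) = 0
    by_cases hXY : X.count none = Y.count none
    · rw [hf (hXY ▸ h)]; rfl
    · rw [hg hXY]; exact map_zero (SHom.eval (gensW M) f).1
  | @tensor p r s X Y X' Y' A B hs hA hB f g hf hg =>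
    refine Subtype.ext (joinE_ext (labW M) hA fun x y => ?_)
    refine (SHom.tensorTo_join (labW M) hs hA hB _ _ x y).trans ?_
    by_cases hXY : X.count none = Y.count none
    · have h' : X'.count none ≠ Y'.count none := fun h' => h (by
        rw [hA, hB, List.count_append, List.count_append, hXY, h'])
      rw [hg h']
      exact (congrArg _ (TensorProduct.tmul_zero _ _)).trans (map_zero _)
    · rw [hf hXY]
      exact (congrArg _ (TensorProduct.zero_tmul _ _)).trans (map_zero _)
  | zero => rfl
  | add f g hf hg => rw [SHom.eval, hf h, hg h, add_zero]
  | smul c f hf => rw [SHom.eval, hf h, smul_zero]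

lemma blackId_joinE {A X Y : List (Option QObj)} (hA : A = X ++ Y) (hX : X.count none = 0)
    (hY : Y.count none = 0) (x : (tens (labW M) X).carrier) (y : (tens (labW M) Y).carrier) :
    (blackId M N A).1 (joinE (labW M) hA (x ⊗ₜ[K] y)) =
      joinE (labW N) hA ((blackId M N X).1 x ⊗ₜ[K] (blackId M N Y).1 y) := by
  subst hA
  exact blackId_join X Y hX hY x y

lemma blackId_black (g : QGen) (w : (tens (labW M) ((qSig.dom g).map some)).carrier) :
    (blackId M N ((qSig.cod g).map some)).1 ((gensW M (.black g)).1 w) =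
      (gensW N (.black g)).1 ((blackId M N ((qSig.dom g).map some)).1 w) := by
  cases g
  · exact (blackId_two _ _ _).trans (congrArg (gensQ q n .pos).1 (blackId_two _ _ w).symm)
  · exact (blackId_two _ _ _).trans (congrArg (gensQ q n .neg).1 (blackId_two _ _ w).symm)
  · exact (blackId_two _ _ _).trans (congrArg (gensQ q n .negRight).1 (blackId_two _ _ w).symm)
  · exact congrArg (gensQ q n .leftCap).1 (blackId_two _ _ w).symm
  · exact blackId_two _ _ _
  · rfl

lemma blackId_ipow_sgn (X : List (Option QObj)) (r : ZMod 2) (x : (tens (labW M) X).carrier) :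
    (blackId M N X).1 (ipow (tens (labW M) X).sgn r x) =
      ipow (tens (labW N) X).sgn r ((blackId M N X).1 x) := by
  rw [SHom.map_ipow_sgn, zero_mul, sg_zero, Int.cast_one, one_smul]

lemma blackId_tensorTo {p r s : ZMod 2} {A B X Y X' Y' : List (Option QObj)} (h : p + r = s)
    (hA : A = X ++ X') (hB : B = Y ++ Y') {f : SHom p (tens (labW M) X) (tens (labW M) Y)}
    {f' : SHom p (tens (labW N) X) (tens (labW N) Y)}
    {e : SHom r (tens (labW M) X') (tens (labW M) Y')}
    {e' : SHom r (tens (labW N) X') (tens (labW N) Y')} (hX : X.count none = 0)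
    (hX' : X'.count none = 0) (hY : Y.count none = 0) (hY' : Y'.count none = 0)
    (hf : ∀ w, (blackId M N Y).1 (f.1 w) = f'.1 ((blackId M N X).1 w))
    (he : ∀ w, (blackId M N Y').1 (e.1 w) = e'.1 ((blackId M N X').1 w)) :
    (blackId M N B).1 ∘ₗ (SHom.tensorTo (labW M) h hA hB f e).1 =
      (SHom.tensorTo (labW N) h hA hB f' e').1 ∘ₗ (blackId M N A).1 := by
  refine joinE_ext (labW M) hA fun x y => ?_
  rw [LinearMap.comp_apply, LinearMap.comp_apply, SHom.tensorTo_join, blackId_joinE hB hY hY',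
    blackId_joinE hA hX hX', SHom.tensorTo_join, hf, he, blackId_ipow_sgn]

/-- An expression between black words does not see the red label: either only black generators
matter, or an intermediate word contains red letters and both values vanish. -/
lemma blackId_eval {p : ZMod 2} {X Y : List wSig.O} (t : Term K wSig p X Y) :
    X.count none = 0 → Y.count none = 0 → ∀ w : (tens (labW M) X).carrier,
      (blackId M N Y).1 ((SHom.eval (gensW M) t).1 w) =
        (SHom.eval (gensW N) t).1 ((blackId M N X).1 w) := by
  induction t with
  | id X => exact fun _ _ _ => rfl
  | gen g =>
    intro hX _ w
    rcases g with g | _ | _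
    · exact blackId_black g w
    · exact absurd hX one_ne_zero
    · exact absurd hX one_ne_zero
  | @comp p r s X Y Z hs f g hf hg =>
    intro hX hZ w
    change (blackId M N Z).1 ((SHom.eval (gensW M) f).1 ((SHom.eval (gensW M) g).1 w)) =
      (SHom.eval (gensW N) f).1 ((SHom.eval (gensW N) g).1 ((blackId M N X).1 w))
    by_cases hY : Y.count none = 0
    · rw [hf hY hZ, hg hX hY]
    · have h : X.count none ≠ Y.count none := by rw [hX]; exact fun h => hY h.symm
      rw [eval_zero_of_count g h, eval_zero_of_count g h]
      exact ((congrArg _ (map_zero (SHom.eval (gensW M) f).1)).trans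
        (map_zero (blackId M N Z).1)).trans (map_zero (SHom.eval (gensW N) f).1).symm
  | tensor hs hA hB f g hf hg =>
    intro hX hY w
    rw [hA, List.count_append, Nat.add_eq_zero_iff] at hX
    rw [hB, List.count_append, Nat.add_eq_zero_iff] at hY
    exact LinearMap.congr_fun (blackId_tensorTo hs hA hB hX.1 hX.2 hY.1 hY.2 (hf hX.1 hY.1)
      (hg hX.2 hY.2)) w
  | zero => exact fun _ _ _ => map_zero (blackId M N _).1
  | add f g hf hg =>
    intro hX hY w
    exact (map_add (blackId M N _).1 _ _).trans (congrArg₂ (· + ·) (hf hX hY w) (hg hX hY w))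
  | smul c f hf =>
    intro hX hY w
    exact (map_smul (blackId M N _).1 c _).trans (congrArg (c • ·) (hf hX hY w))

lemma redHom_joinE_left {r : ZMod 2} (g : SHom r M N) {A X Y : List (Option QObj)}
    (hA : A = X ++ Y) (hX : X.count none = 1) (hY : Y.count none = 0)
    (x : (tens (labW M) X).carrier) (y : (tens (labW M) Y).carrier) :
    (redHom g A).1 (joinE (labW M) hA (x ⊗ₜ[K] y)) =
      joinE (labW N) hA ((redHom g X).1 x ⊗ₜ[K] (blackId M N Y).1 y) := by
  subst hA
  exact redHom_join_left g X Y hX hY x y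

lemma redHom_joinE_right {r : ZMod 2} (g : SHom r M N) {A X Y : List (Option QObj)}
    (hA : A = X ++ Y) (hX : X.count none = 0) (hY : Y.count none = 1)
    (x : (tens (labW M) X).carrier) (y : (tens (labW M) Y).carrier) :
    (redHom g A).1 (joinE (labW M) hA (x ⊗ₜ[K] y)) =
      joinE (labW N) hA ((blackId M N X).1 (ipow (tens (labW M) X).sgn r x) ⊗ₜ[K]
        (redHom g Y).1 y) := by
  subst hA
  exact redHom_join_right g X Y hX hY x y

lemma sg_zero_mul_smul {P : Type} [AddCommGroup P] [Module K P] (r : ZMod 2) (x : P) :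
    (sg (0 * r) : K) • x = x := by
  rw [zero_mul, sg_zero, Int.cast_one, one_smul]

lemma redHom_posRed {r : ZMod 2} (g : SHom r M N) (w : (M.tensor (SMod.fund q n)).carrier) :
    (redHom g [W.up, W.red]).1 (M.T w) = N.T ((redHom g [W.red, W.up]).1 w) :=
  (LinearMap.congr_fun (T_natural g) w).symm

/-- Naturality of an isomorphism passes to its inverse. -/
lemma redHom_negRed {r : ZMod 2} (g : SHom r M N) (w : ((SMod.fund q n).tensor M).carrier) :
    (redHom g [W.red, W.up]).1 (M.Tinv w) = N.Tinv ((redHom g [W.up, W.red]).1 w) := by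
  refine Eq.trans (LinearMap.congr_fun N.Tinv_T _).symm (congrArg N.Tinv ?_)
  refine (redHom_posRed g (M.Tinv w)).symm.trans ?_
  exact congrArg (redHom g [W.up, W.red]).1 (LinearMap.congr_fun M.T_Tinv w)

section Tensor

variable {r p p' s : ZMod 2} (g : SHom r M N) {A B X Y X' Y' : List (Option QObj)} (h : p + p' = s)
    (hA : A = X ++ X') (hB : B = Y ++ Y') {f : SHom p (tens (labW M) X) (tens (labW M) Y)}
    {f' : SHom p (tens (labW N) X) (tens (labW N) Y)}
    {e : SHom p' (tens (labW M) X') (tens (labW M) Y')}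
    {e' : SHom p' (tens (labW N) X') (tens (labW N) Y')}

/-- The factor (-1)^{pr} comes from f, and (-1)^{p'r} from interchanging g with the involution which
e applies to the first factor. -/
lemma redHom_tensorTo_left (hX : X.count none = 1)
    (hX' : X'.count none = 0) (hY : Y.count none = 1) (hY' : Y'.count none = 0)
    (hf : ∀ w, (redHom g Y).1 (f.1 w) = (sg (p * r) : K) • f'.1 ((redHom g X).1 w))
    (he : ∀ w, (blackId M N Y').1 (e.1 w) = e'.1 ((blackId M N X').1 w)) :
    (redHom g B).1 ∘ₗ (SHom.tensorTo (labW M) h hA hB f e).1 =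
      (sg (s * r) : K) • (SHom.tensorTo (labW N) h hA hB f' e').1 ∘ₗ (redHom g A).1 := by
  refine joinE_ext (labW M) hA fun x y => ?_
  rw [LinearMap.smul_apply, LinearMap.comp_apply, LinearMap.comp_apply, SHom.tensorTo_join,
    redHom_joinE_left g hB hY hY', redHom_joinE_left g hA hX hX', SHom.tensorTo_join, hf, he,
    SHom.map_ipow_sgn, map_smul, smul_smul, ← TensorProduct.smul_tmul', map_smul, ← h, add_mul,
    sgK_add, mul_comm r p']

/-- Now (-1)^{p'r} comes from e, and (-1)^{pr} from moving f through the involution which g applies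
to the black factor. -/
lemma redHom_tensorTo_right (hX : X.count none = 0)
    (hX' : X'.count none = 1) (hY : Y.count none = 0) (hY' : Y'.count none = 1)
    (hf : ∀ w, (blackId M N Y).1 (f.1 w) = f'.1 ((blackId M N X).1 w))
    (he : ∀ w, (redHom g Y').1 (e.1 w) = (sg (p' * r) : K) • e'.1 ((redHom g X').1 w)) :
    (redHom g B).1 ∘ₗ (SHom.tensorTo (labW M) h hA hB f e).1 =
      (sg (s * r) : K) • (SHom.tensorTo (labW N) h hA hB f' e').1 ∘ₗ (redHom g A).1 := by
  refine joinE_ext (labW M) hA fun x y => ?_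
  have h4 : ∀ x : (tens (labW M) X).carrier,
      ipow (tens (labW M) X).sgn p' (ipow (tens (labW M) X).sgn r x) =
        ipow (tens (labW M) X).sgn r (ipow (tens (labW M) X).sgn p' x) := fun x => by
    rw [← Module.End.mul_apply, ← Module.End.mul_apply, ipow_add (tens (labW M) X).sgn_sgn,
      ipow_add (tens (labW M) X).sgn_sgn, add_comm]
  have h5 : ∀ x : (tens (labW M) X).carrier, ipow (tens (labW M) Y).sgn r (f.1 x) =
      (sg (p * r) : K) • f.1 (ipow (tens (labW M) X).sgn r x) := fun x => by
    rw [SHom.map_ipow_sgn f r, smul_smul, sgK_mul_self, one_smul]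
  rw [LinearMap.smul_apply, LinearMap.comp_apply, LinearMap.comp_apply, SHom.tensorTo_join,
    redHom_joinE_right g hB hY hY', redHom_joinE_right g hA hX hX', SHom.tensorTo_join, h5,
    map_smul, hf, he, ← blackId_ipow_sgn, h4, TensorProduct.tmul_smul, ← TensorProduct.smul_tmul',
    smul_smul, map_smul, ← h, add_mul, sgK_add, mul_comm]

end Tensor

/-- The values of an expression between words with one red letter are supernatural in the red
label. -/
lemma redHom_eval {r : ZMod 2} (g : SHom r M N) {p : ZMod 2} {X Y : List wSig.O}
    (t : Term K wSig p X Y) :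
    X.count none = 1 → Y.count none = 1 → ∀ w : (tens (labW M) X).carrier,
      (redHom g Y).1 ((SHom.eval (gensW M) t).1 w) =
        (sg (p * r) : K) • (SHom.eval (gensW N) t).1 ((redHom g X).1 w) := by
  induction t with
  | id X => exact fun _ _ w => (sg_zero_mul_smul (K := K) r ((redHom g X).1 w)).symm
  | gen γ =>
    intro hX _ w
    rcases γ with γ | _ | _
    · cases γ <;> exact absurd hX zero_ne_one
    · exact (redHom_posRed g w).trans (sg_zero_mul_smul (K := K) r _).symm
    · exact (redHom_negRed g w).trans (sg_zero_mul_smul (K := K) r _).symm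
  | @comp p p' s X Y Z hs f e hf he =>
    intro hX hZ w
    change (redHom g Z).1 ((SHom.eval (gensW M) f).1 ((SHom.eval (gensW M) e).1 w)) =
      (sg (s * r) : K) • (SHom.eval (gensW N) f).1 ((SHom.eval (gensW N) e).1 ((redHom g X).1 w))
    by_cases hY : Y.count none = 1
    · rw [hf hY hZ, he hX hY, map_smul, smul_smul, ← sgK_add, ← add_mul, hs]
    · have h : X.count none ≠ Y.count none := by rw [hX]; exact fun h => hY h.symm
      rw [eval_zero_of_count e h, eval_zero_of_count e h]
      refine ((congrArg _ (map_zero (SHom.eval (gensW M) f).1)).trans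
        (map_zero (redHom g Z).1)).trans ?_
      exact ((congrArg ((sg (s * r) : K) • ·) (map_zero (SHom.eval (gensW N) f).1)).trans
        (smul_zero (sg (s * r) : K))).symm
  | @tensor p p' s X Y X' Y' A B hs hA hB f e hf he =>
    intro hX hY w
    have hX2 := hX
    have hY2 := hY
    rw [hA, List.count_append] at hX2
    rw [hB, List.count_append] at hY2
    by_cases hXY : X.count none = Y.count none
    swap
    -- If the red letter is in one factor of the source and in the other factor of the target, the
    -- tensor product vanishes and there is nothing to compare.
    · have hz : ∀ P : SMod q n, SHom.tensorTo (labW P) hs hA hB (SHom.eval (gensW P) f)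
          (SHom.eval (gensW P) e) = 0 := fun P => by
        refine Subtype.ext (joinE_ext (labW P) hA fun x y => ?_)
        rw [SHom.tensorTo_join, eval_zero_of_count f hXY]
        exact (congrArg _ (TensorProduct.zero_tmul _ _)).trans (map_zero _)
      rw [SHom.eval, SHom.eval, hz, hz]
      exact (map_zero (redHom g B).1).trans (smul_zero (sg (s * r) : K)).symm
    by_cases hX1 : X.count none = 1
    · have hX' : X'.count none = 0 := by omega
      have hY1 : Y.count none = 1 := by omega
      have hY' : Y'.count none = 0 := by omega
      exact LinearMap.congr_fun (redHom_tensorTo_left g hs hA hB hX1 hX' hY1 hY' (hf hX1 hY1)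
        (blackId_eval e hX' hY')) w
    · have hX0 : X.count none = 0 := by omega
      have hX' : X'.count none = 1 := by omega
      have hY0 : Y.count none = 0 := by omega
      have hY' : Y'.count none = 1 := by omega
      exact LinearMap.congr_fun (redHom_tensorTo_right g hs hA hB hX0 hX' hY0 hY'
        (blackId_eval f hX0 hY0) (he hX' hY')) w
  | zero => exact fun _ _ _ => (map_zero (redHom g _).1).trans (smul_zero _).symm
  | add f e hf he =>
    intro hX hY w
    refine (map_add (redHom g _).1 _ _).trans ?_
    refine (congrArg₂ (· + ·) (hf hX hY w) (he hX hY w)).trans ?_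
    exact (smul_add _ _ _).symm
  | smul c f hf =>
    intro hX hY w
    refine (map_smul (redHom g _).1 c _).trans ((congrArg (c • ·) (hf hX hY w)).trans ?_)
    exact smul_comm _ _ _

lemma comp_redHom_eval {r s : ZMod 2} (g : SHom r M N) {p : ZMod 2} {X Y : List wSig.O}
    (t : Term K wSig p X Y) (hX : X.count none = 1) (hY : Y.count none = 1) (h : r + p = s)
    (h' : p + r = s) : SHom.comp h (redHom g Y) (SHom.eval (gensW M) t) =
      sg (p * r) • SHom.comp h' (SHom.eval (gensW N) t) (redHom g X) := by
  rw [← Int.cast_smul_eq_zsmul K]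
  exact Subtype.ext (LinearMap.ext fun w => redHom_eval g t hX hY w)

variable (q n) in
/-- The endofunctor attached to a word with one red letter. -/
def redEnd (X : (W1cat (zz q)).Obj) : (SEnd (UqCat q n)).Obj := redObj q n X

/-- The supernatural transformation attached to a morphism between words with one red letter. -/
def redMap (p : ZMod 2) (X Y : (W1cat (zz q)).Obj) :
    (W1cat (zz q)).Hom p X Y →ₗ[K] (SEnd (UqCat q n)).Hom p (redEnd q n X) (redEnd q n Y) where
  toFun f := ⟨fun M => (incarnationW M).map p X.1 Y.1 f, by
    intro r s h h' M N g
    revert f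
    refine (Wcat (zz q)).ind fun t => ?_
    exact comp_redHom_eval g t X.2 Y.2 h h'⟩
  map_add' f g := Subtype.ext (funext fun M => map_add ((incarnationW M).map p X.1 Y.1) f g)
  map_smul' c f := Subtype.ext (funext fun M => map_smul ((incarnationW M).map p X.1 Y.1) c f)

variable (q n) in
/-- The superfunctor from words with one red letter to endofunctors. -/
def redFunctor : Superfunctor (W1cat (zz q)) (SEnd (UqCat q n)) where
  obj := redEnd q n
  map := redMap
  map_id X := Subtype.ext (funext fun M => (incarnationW M).map_id X.1)
  map_comp h f g := Subtype.ext (funext fun M => (incarnationW M).map_comp h f g)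

/-- Uniqueness is immediate, since objects and components are prescribed; existence amounts to the
supernaturality proved in `comp_redHom_eval`. -/
lemma existsUnique_redFunctor : ∃! R : Superfunctor (W1cat (zz q)) (SEnd (UqCat q n)),
    IsRedFunctor (fun M => incarnationW M) R := by
  refine ⟨redFunctor q n, ⟨fun _ => rfl, fun _ _ _ _ _ => HEq.rfl⟩, ?_⟩
  rintro ⟨o, m, hi, hc⟩ ⟨hobj, hmap⟩
  -- Once the object maps are identified, the heterogeneous equality of components becomes an
  -- equality.
  obtain rfl : o = redEnd q n := funext hobj
  have hm : m = redMap := by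
    refine funext fun p => funext fun X => funext fun Y => LinearMap.ext fun f => ?_
    exact Subtype.ext (funext fun M => eq_of_heq (hmap p X Y f M))
  subst hm
  rfl

end RedNatural

end Isomeric

end

/-! ### The theorem over ℂ(q) -/

theorem mainTheorem12 (n : ℕ) :
    (∀ M : SMod qq n,
      ∃ (T : SHom 0 (M.tensor (SMod.fund qq n)) ((SMod.fund qq n).tensor M))
        (T' : SHom 0 ((SMod.fund qq n).tensor M) (M.tensor (SMod.fund qq n))),
        T.1 = M.T ∧ SHom.comp (add_zero 0) T' T = SHom.one _ ∧
          SHom.comp (add_zero 0) T T' = SHom.one _) ∧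
    (∀ (p : ZMod 2) (M N : SMod qq n) (f : SHom p M N),
      N.T ∘ₗ (SHom.tensor (add_zero p) f (SHom.one (SMod.fund qq n))).1 =
        (SHom.tensor (zero_add p) (SHom.one (SMod.fund qq n)) f).1 ∘ₗ M.T) ∧
    ∃ F : MonFun (Qcat (zz qq)) (labQ qq n),
      (IsIncarnation F ∧ ∀ F', IsIncarnation F' → F' = F) ∧
      ∃ G : ∀ M : SMod qq n, MonFun (Wcat (zz qq)) (labW M),
        (∀ M, IsExtension F M (G M) ∧ ∀ G', IsExtension F M G' → G' = G M) ∧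
        (∀ M, ((G M).map 0 [W.up, W.red] [W.red, W.up] ((Wcat (zz qq)).cls W.negRed)).1 ∘ₗ M.T =
            LinearMap.id ∧
          M.T ∘ₗ ((G M).map 0 [W.up, W.red] [W.red, W.up] ((Wcat (zz qq)).cls W.negRed)).1 =
            LinearMap.id) ∧
        (∃ S : Uq qq n ≃ₗ[RatFunc ℂ] Uq qq n, (∀ x, S x = Uq.antipode qq n x) ∧
          ∀ M, ((G M).map 0 [W.red, W.dn] [W.dn, W.red] ((Wcat (zz qq)).cls W.posDownRed)).1 =
            M.flip (SMod.fund qq n).dual ∘ₗ M.LDual (fun i j => S.symm (uu qq i j))) ∧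
        (∀ M, ((G M).map 0 [W.dn, W.red] [W.red, W.dn] ((Wcat (zz qq)).cls W.negDownRed)).1 =
            M.LDual (uu qq) ∘ₗ (SMod.fund qq n).dual.flip M) ∧
        ∃! R : Superfunctor (W1cat (zz qq)) (SEnd (UqCat qq n)), IsRedFunctor G R := by
  refine ⟨fun M => ⟨SHom.T M, SHom.symmOf M.Tequiv (SHom.T M) rfl, rfl,
    Subtype.ext M.Tinv_T, Subtype.ext M.T_Tinv⟩, fun p M N f => T_natural f,
    incarnation qq n, ⟨isIncarnation, fun F' hF => hF.eq⟩, fun M => incarnationW M,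
    fun M => ⟨isExtension M, fun G' hG => hG.eq⟩, fun M => ⟨M.Tinv_T, M.T_Tinv⟩,
    ⟨Uq.antipodeEquiv qq n, fun x => rfl, fun M => ?_⟩, fun M => ?_, existsUnique_redFunctor⟩
  · exact (eval_posDownRed M).trans M.dualCrossInv_formula
  · exact (eval_negDownRed M).trans M.dualCross_formula
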